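/- \textbf{The language OML.} Fix record names $T$, each with an arity, labels $\ell$, and a label environment $\Lambda$ that assigns to some pairs $(T,\ell)$ a closed scheme $\forall\bar\alpha.\,T\bar\alpha\to\tau$; $\mathrm{dom}\,\Lambda(T)$ is the set of labels of $T$. Types are $\tau ::= \alpha \mid 1 \mid \tau\to\tau \mid \Pi_{i=1}^n\tau_i \mid T\,\bar\tau \mid [\sigma]$ and schemes are $\sigma ::= \forall\bar\alpha.\,\tau$, up to renaming and reordering of binders and removal of useless binders. $\mathfrak g$ ranges over ground types (types without free variables). Terms are $$e ::= x \mid () \mid \lambda x.e \mid e\,e \mid \mathsf{let}\ x=e\ \mathsf{in}\ e \mid (e:\exists\bar\alpha.\tau) \mid (e_1,\dots,e_n) \mid e.j \mid e.j/n \mid [e] \mid [e:\exists\bar\alpha.\sigma] \mid \langle e\rangle \mid \langle e:\exists\bar\alpha.\sigma\rangle \mid \{\overline{\ell=e}\} \mid T.\{\overline{\ell=e}\} \mid e.\ell \mid e.T.\ell \mid \{\!\{\bar e\}\!\},$$ where annotations are closed, record literals have at least one field, and $\{\!\{\bar e\}\!\}$ is a typed hole (of arbitrary type, provided that each $e_i$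 has some type). The implicit constructs are $e.j$, $[e]$, $\langle e\rangle$, $\{\overline{\ell=e}\}$, $e.\ell$; each has an explicit counterpart ($e.j/n$, $[e:\exists\bar\alpha.\sigma]$, $\langle e:\exists\bar\alpha.\sigma\rangle$, $T.\{\overline{\ell=e}\}$, $e.T.\ell$). $E$ ranges over one-hole term contexts. A shape $\nu\bar\gamma.\tau$ is a type $\tau$ with holes $\bar\gamma=\mathrm{fv}(\tau)$; it is non-trivial if $\tau$ is not a variable. The principal shape of a non-variable type $\tau$ is the most general non-trivial shape of which $\tau$ is an instance; $\mathrm{shape}(\tau)$ is its canonical representative (holes listed in order of occurrence). \textbf{Typing.} $\Gamma\vdash e:\sigma$ is the declarative ML system (with generalization and instantiation rules) with the usual rules for the explicit constructs, for typed holes, and for record literals and field projections whose set of labels, resp. label, determines the record name uniquely in $\Lambda$ (these are typed like their explicit counterparts), extended with contextual rules for the implicit constructs $e^i$: $\Gamma\vdash E[e^i]:\tau$ holds if $\Gamma\vdash E[e^x]:\tau$, where $e^x$ is the explicit counterpart of $e^i$ that is determined by a canonical principal shape $s$ (a tuple, polytype or record shape), and the unicity condition holds: for elimination forms $e.j$,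 $\langle e\rangle$, $e.\ell$, for all $\Gamma',\tau',\mathfrak g$, if $\Gamma'\vdash\lfloor E[\{\!\{(e:\mathfrak g)\}\!\}]\rfloor:\tau'$ then $\mathrm{shape}(\mathfrak g)=s$; for introduction forms $[e]$, $\{\overline{\ell=e}\}$ with subterms $\bar e$, for all $\Gamma',\tau',\mathfrak g$, if $\Gamma'\vdash\lfloor E[(\{\!\{\bar e\}\!\}:\mathfrak g)]\rfloor:\tau'$ then $\mathrm{shape}(\mathfrak g)=s$. Here the erasure $\lfloor\cdot\rfloor$ replaces all remaining implicit constructs by typed holes around their subterms (except records and projections whose labels determine the record name), and the antecedents use the system without contextual rules. $e$ is typable if $\emptyset\vdash e:\sigma$ for some $\sigma$. The canonical judgment $\Vdash e:\tau$ holds if $e$ can be turned into an explicit term $e'$ (or one whose remaining implicit constructs are records and projections that are determined by their labels) by finitely many applications of the contextual rules to the whole program, and $e'$ has type $\tau$, in the empty context, in the syntax-directed ML system (instantiation at variables, generalization at let). \textbf{Constraints.} $C ::= \mathsf{true}\mid\mathsf{false}\mid C\wedge C\mid \tau=\tau\mid\exists\alpha.C\mid\forall\alpha.C\mid \mathsf{let}\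 x=\lambda\alpha.C\ \mathsf{in}\ C\mid x\,\tau\mid \mathsf{match}\ \tau\ \mathsf{with}\ \overline{p\to C}$, where branches may mention record and scheme variables bound by the patterns $p$. Satisfaction $\varphi\vdash C$, with $\varphi$ mapping type variables to ground types and term variables to sets of ground types, is the usual one on all but the last form (with $\mathsf{let}$ requiring the set denoted by $\lambda\alpha.C$ to be non-empty, and $x\,\tau$ meaning $\varphi(\tau)\in\varphi(x)$), together with the contextual rule: $\varphi\vdash\mathcal C[\mathsf{match}\ \tau\ \mathsf{with}\ \overline{p\to C}]$ holds if, for some canonical principal shape $s$, $\varphi\vdash\mathcal C[D_s]$, where $D_s$ is $\exists\bar\gamma.\ \tau=s\,\bar\gamma\wedge\theta(C_i)$ if $p_i$ matches $s\,\bar\gamma$ with the substitution $\theta$ and $\mathsf{false}$ if no pattern matches, and for all $\varphi',\mathfrak g$, if $\varphi'\vdash\lfloor\mathcal C[\tau=\mathfrak g]\rfloor$ then $\mathrm{shape}(\mathfrak g)=s$; here $\lfloor\cdot\rfloor$ replaces every $\mathsf{match}$ by $\mathsf{true}$. $C$ is satisfiable if $\varphi\vdash C$ for some $\varphi$, and $C$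 entails $C'$ if $\varphi\vdash C$ implies $\varphi\vdash C'$ for all $\varphi$. A substitution $\theta$ (idempotent, with finite domain) unifies $C$ if $\exists\bar\beta.\bigwedge_{\alpha\in\mathrm{dom}\,\theta}\alpha=\theta(\alpha)$, where $\bar\beta$ are the free variables of the range of $\theta$, entails $C$. \textbf{Constraint generation.} $\llbracket e:\tau\rrbracket$ is defined by recursion on $e$, all generated type variables being fresh. Write $\sigma\le\tau$ for $\exists\bar\alpha.\tau'=\tau$ and $x\le\sigma$ for $\forall\bar\alpha.x\,\tau'$ and $\llbracket e:\sigma\rrbracket$ for $\forall\bar\alpha.\llbracket e:\tau'\rrbracket$, if $\sigma=\forall\bar\alpha.\tau'$; $\ell/T\le\tau_1\to\tau_2$ for $\exists\bar\alpha.\tau_1=T\bar\alpha\wedge\tau_2=\tau$ if $\Lambda(T,\ell)=\forall\bar\alpha.T\bar\alpha\to\tau$ and for $\mathsf{false}$ if it is undefined; and $\mathrm{dom}\,T=\bar\ell$ for $\mathsf{true}$ or $\mathsf{false}$. Then \begin{align*} \llbracket x:\tau\rrbracket &= x\,\tau, \qquad \llbracket ():\tau\rrbracket = (\tau=1),\\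 \llbracket \lambda x.e:\tau\rrbracket &= \exists\alpha\beta.\,(\mathsf{let}\ x=\lambda\alpha'.\,\alpha'=\alpha\ \mathsf{in}\ \llbracket e:\beta\rrbracket)\wedge\tau=\alpha\to\beta,\\ \llbracket e_1\,e_2:\tau\rrbracket &= \exists\alpha\beta.\,\llbracket e_1:\beta\rrbracket\wedge\llbracket e_2:\alpha\rrbracket\wedge\beta=\alpha\to\tau,\\ \llbracket \mathsf{let}\ x=e_1\ \mathsf{in}\ e_2:\tau\rrbracket &= \mathsf{let}\ x=\lambda\alpha.\llbracket e_1:\alpha\rrbracket\ \mathsf{in}\ \llbracket e_2:\tau\rrbracket,\\ \llbracket (e:\exists\bar\alpha.\tau'):\tau\rrbracket &= \exists\bar\alpha.\,\llbracket e:\tau'\rrbracket\wedge\tau=\tau',\\ \llbracket (e_1,\dots,e_n):\tau\rrbracket &= \exists\bar\alpha.\,\tau=\Pi\bar\alpha\wedge\textstyle\bigwedge_i\llbracket e_i:\alpha_i\rrbracket,\\ \llbracket e.j/n:\tau\rrbracket &= \exists\alpha\bar\alpha.\,\llbracket e:\alpha\rrbracket\wedge\alpha=\Pi_{i=1}^n\alpha_i\wedge\tau=\alpha_j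 \quad(\mathsf{false}\text{ if }j>n),\\ \llbracket e.j:\tau\rrbracket &= \exists\alpha.\,\llbracket e:\alpha\rrbracket\wedge\mathsf{match}\ \alpha\ \mathsf{with}\ (\Pi\,\beta\,j\to\tau=\beta),\\ \llbracket [e:\exists\bar\alpha.\sigma]:\tau\rrbracket &= \exists\bar\alpha.\,\llbracket e:\sigma\rrbracket\wedge\tau=[\sigma],\\ \llbracket [e]:\tau\rrbracket &= \mathsf{let}\ x=\lambda\alpha.\llbracket e:\alpha\rrbracket\ \mathsf{in}\ \mathsf{match}\ \tau\ \mathsf{with}\ ([s]\to x\le s),\\ \llbracket \langle e:\exists\bar\alpha.\sigma\rangle:\tau\rrbracket &= \exists\bar\alpha\beta.\,\llbracket e:\beta\rrbracket\wedge\beta=[\sigma]\wedge\sigma\le\tau,\\ \llbracket \langle e\rangle:\tau\rrbracket &= \exists\alpha.\,\llbracket e:\alpha\rrbracket\wedge\mathsf{match}\ \alpha\ \mathsf{with}\ ([s]\to s\le\tau),\\ \llbracket e.T.\ell:\tau\rrbracket &= \exists\alpha.\,\llbracket e:\alpha\rrbracket\wedge\ell/T\le\alpha\to\tau,\\ \llbracket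 e.\ell:\tau\rrbracket &= \exists\alpha.\,\llbracket e:\alpha\rrbracket\wedge\mathsf{match}\ \alpha\ \mathsf{with}\ (t\,\_\to\ell/t\le\alpha\to\tau),\\ \llbracket T.\{\overline{\ell=e}\}:\tau\rrbracket &= \exists\bar\alpha.\,\textstyle\bigwedge_i\llbracket e_i:\alpha_i\rrbracket\wedge\mathrm{dom}\,T=\bar\ell\wedge\bigwedge_i\ell_i/T\le\tau\to\alpha_i,\\ \llbracket \{\overline{\ell=e}\}:\tau\rrbracket &= \exists\bar\alpha.\,\textstyle\bigwedge_i\llbracket e_i:\alpha_i\rrbracket\wedge\mathsf{match}\ \tau\ \mathsf{with}\ (t\,\_\to\mathrm{dom}\,t=\bar\ell\wedge\bigwedge_i\ell_i/t\le\tau\to\alpha_i),\\ \llbracket \{\!\{\bar e\}\!\}:\tau\rrbracket &= \exists\bar\alpha.\,\textstyle\bigwedge_i\llbracket e_i:\alpha_i\rrbracket, \end{align*} except that $e.\ell$ and $\{\overline{\ell=e}\}$ are treated like $e.T.\ell$ and $T.\{\overline{\ell=e}\}$ if $\ell$, resp. $\bar\ell$, determines $T$ uniquely in $\Lambda$. \textbf{Theorem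 (constraint generation is sound and complete).} Let $e$ be an OML term without free term variables. Then (i) $e$ is typable if and only if the constraint $\exists\alpha.\llbracket e:\alpha\rrbracket$ is satisfiable; (ii) for every substitution $\theta$ and type variable $\alpha$, $\Vdash e:\theta(\alpha)$ if and only if $\theta$ unifies $\llbracket e:\alpha\rrbracket$. -/

import Mathlib

noncomputable section

namespace OML

/-! ## Types and type schemes -/

/-- The names of the language: record names (each with its number of type parameters) and labels. -/
structure Sig where
  Rec : Type
  Lab : Type
  arity : Rec → ℕ

/-- Type constructors: unit, arrow, `n`-ary product, nominal record. -/
inductive Con (S : Sig) : Type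
  | unit : Con S
  | arr : Con S
  | prod (n : ℕ) : Con S
  | rcd (T : S.Rec) : Con S

def Con.arity {S : Sig} : Con S → ℕ
  | .unit => 0
  | .arr => 2
  | .prod n => n
  | .rcd T => S.arity T

/-- Raw types. `fvar a` is the type variable `a`. `poly n b` is the polytype `[∀ᾱ. b]` that binds
`n` variables at once; in its body `bvar k i` is the `i`-th variable bound by the `k`-th enclosing
`poly` (counted from the inside, starting with 0). -/
inductive PreTy (S : Sig) : Type
  | fvar (a : ℕ) : PreTy S
  | bvar (k i : ℕ) : PreTy S
  | con (c : Con S) (ts : Fin c.arity → PreTy S) : PreTy S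
  | poly (n : ℕ) (b : PreTy S) : PreTy S

namespace PreTy

variable {S : Sig}

/-- The free type variables, with repetitions, from left to right. -/
def fvs : PreTy S → List ℕ
  | .fvar a => [a]
  | .bvar _ _ => []
  | .con _ ts => (List.ofFn fun i => (ts i).fvs).flatten
  | .poly _ b => b.fvs

/-- The occurrences, from left to right, of variables bound by the binder that is `k` levels up. -/
def occ : ℕ → PreTy S → List ℕ
  | _, .fvar _ => []
  | k, .bvar j i => if j = k then [i] else []
  | k, .con _ ts => (List.ofFn fun i => (ts i).occ k).flatten
  | k, .poly _ b => b.occ (k + 1)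

end PreTy

/-- A list of numbers is numbered by first occurrence: it starts with `0`, and every new number is
the successor of the largest one that precedes it. -/
def FirstOcc (l : List ℕ) : Prop :=
  ∀ i a : ℕ, l[i]? = some (a + 1) → ∃ j < i, l[j]? = some a

/-- `l` mentions exactly the numbers `0, …, n-1`, numbered by first occurrence. -/
def CanonicalOcc (n : ℕ) (l : List ℕ) : Prop :=
  (∀ i, i ∈ l ↔ i < n) ∧ FirstOcc l

namespace PreTy

variable {S : Sig}

/-- Well-formedness under `d` enclosing binders: every bound variable refers to one of them, and
every `poly` inside binds exactly the variables that its body uses, numbered by first occurrence.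
So each class of types up to renaming and reordering of binders and removal of useless binders
has exactly one well-formed representative. -/
def LC : ℕ → PreTy S → Prop
  | _, .fvar _ => True
  | d, .bvar k _ => k < d
  | d, .con _ ts => ∀ i, (ts i).LC d
  | d, .poly n b => b.LC (d + 1) ∧ CanonicalOcc n (b.occ 0)

/-- Substitution of (locally closed) types for the free variables. -/
def subst (θ : ℕ → PreTy S) : PreTy S → PreTy S
  | .fvar a => θ a
  | .bvar k i => .bvar k i
  | .con c ts => .con c fun i => (ts i).subst θ
  | .poly n b => .poly n (b.subst θ)

/-- Replace the variables of the binder `k` levels up by (locally closed) types. -/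
def openAt (u : ℕ → PreTy S) : ℕ → PreTy S → PreTy S
  | _, .fvar a => .fvar a
  | k, .bvar j i => if j = k then u i else .bvar j i
  | k, .con c ts => .con c fun i => (ts i).openAt u k
  | k, .poly n b => .poly n (b.openAt u (k + 1))

/-- Replace each free variable `a ∈ B` by the variable number `f a` of the binder `k` levels up. -/
def closeAt (B : Finset ℕ) (f : ℕ → ℕ) : ℕ → PreTy S → PreTy S
  | k, .fvar a => if a ∈ B then .bvar k (f a) else .fvar a
  | _, .bvar j i => .bvar j i
  | k, .con c ts => .con c fun i => (ts i).closeAt B f k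
  | k, .poly n b => .poly n (b.closeAt B f (k + 1))

theorem LC.mono {t : PreTy S} {d d' : ℕ} (h : t.LC d) (hd : d ≤ d') : t.LC d' := by
  induction t generalizing d d' with
  | fvar a => trivial
  | bvar k i => exact lt_of_lt_of_le h hd
  | con c ts ih => exact fun i => ih i (h i) hd
  | poly n b ih => exact ⟨ih h.1 (by omega), h.2⟩

theorem LC.occ_eq_nil {t : PreTy S} {d k : ℕ} (h : t.LC d) (hk : d ≤ k) : t.occ k = [] := by
  induction t generalizing d k with
  | fvar a => rfl
  | bvar j i => simp only [LC] at h; simp only [occ]; rw [if_neg (by omega)]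
  | con c ts ih =>
    simp only [occ, List.flatten_eq_nil_iff, List.mem_ofFn]
    rintro l ⟨i, rfl⟩
    exact ih i (h i) hk
  | poly n b ih => exact ih h.1 (by omega)

theorem occ_subst {θ : ℕ → PreTy S} (hθ : ∀ a, (θ a).LC 0) (t : PreTy S) (k : ℕ) :
    (t.subst θ).occ k = t.occ k := by
  induction t generalizing k with
  | fvar a => exact (hθ a).occ_eq_nil (Nat.zero_le _)
  | bvar j i => rfl
  | con c ts ih => simp only [subst, occ, ih]
  | poly n b ih => exact ih _

theorem LC.subst {θ : ℕ → PreTy S} (hθ : ∀ a, (θ a).LC 0) {t : PreTy S} {d : ℕ} (h : t.LC d) :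
    (t.subst θ).LC d := by
  induction t generalizing d with
  | fvar a => exact (hθ a).mono (Nat.zero_le _)
  | bvar j i => exact h
  | con c ts ih => exact fun i => ih i (h i)
  | poly n b ih => exact ⟨ih h.1, by rw [occ_subst hθ]; exact h.2⟩

theorem occ_openAt {u : ℕ → PreTy S} (hu : ∀ i, (u i).LC 0) (t : PreTy S) (d k : ℕ) (hk : k < d) :
    (t.openAt u d).occ k = t.occ k := by
  induction t generalizing d k with
  | fvar a => rfl
  | bvar j i =>
    simp only [openAt]
    split
    · rw [(hu i).occ_eq_nil (Nat.zero_le _)]; simp only [occ]; rw [if_neg (by omega)]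
    · rfl
  | con c ts ih => simp only [openAt, occ, ih _ _ _ hk]
  | poly n b ih => exact ih _ _ (by omega)

theorem LC.openAt {u : ℕ → PreTy S} (hu : ∀ i, (u i).LC 0) {t : PreTy S} {d : ℕ}
    (h : t.LC (d + 1)) : (t.openAt u d).LC d := by
  induction t generalizing d with
  | fvar a => trivial
  | bvar j i =>
    simp only [PreTy.openAt]
    split
    · exact (hu i).mono (Nat.zero_le _)
    · simp only [LC] at h ⊢; omega
  | con c ts ih => exact fun i => ih i (h i)
  | poly n b ih => exact ⟨ih h.1, by rw [occ_openAt hu _ _ _ (by omega)]; exact h.2⟩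

theorem occ_closeAt_lt (B : Finset ℕ) (f : ℕ → ℕ) (t : PreTy S) (d k : ℕ) (hk : k < d) :
    (t.closeAt B f d).occ k = t.occ k := by
  induction t generalizing d k with
  | fvar a =>
    simp only [closeAt]
    split
    · simp only [occ]; rw [if_neg (by omega)]
    · rfl
  | bvar j i => rfl
  | con c ts ih => simp only [closeAt, occ, ih _ _ _ hk]
  | poly n b ih => exact ih _ _ (by omega)

theorem occ_closeAt (B : Finset ℕ) (f : ℕ → ℕ) (t : PreTy S) (d : ℕ) (h : t.LC d) :
    (t.closeAt B f d).occ d = (t.fvs.filter (· ∈ B)).map f := by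
  induction t generalizing d with
  | fvar a =>
    simp only [closeAt, fvs]
    split <;> rename_i ha <;> simp [occ, ha]
  | bvar j i =>
    simp only [LC] at h
    simp only [closeAt, occ, fvs]; rw [if_neg (by omega)]; rfl
  | con c ts ih =>
    simp only [closeAt, occ, fvs, List.filter_flatten, List.map_flatten, List.map_map]
    congr 1
    rw [List.map_ofFn]
    congr 1
    funext i
    exact ih i d (h i)
  | poly n b ih => exact ih _ h.1

theorem LC.closeAt (B : Finset ℕ) (f : ℕ → ℕ) {t : PreTy S} {d : ℕ} (h : t.LC d) :
    (t.closeAt B f d).LC (d + 1) := by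
  induction t generalizing d with
  | fvar a =>
    simp only [PreTy.closeAt]
    split
    · exact Nat.lt_succ_self d
    · trivial
  | bvar j i => exact Nat.lt_succ_of_lt h
  | con c ts ih => exact fun i => ih i (h i)
  | poly n b ih => exact ⟨ih h.1, by rw [occ_closeAt_lt _ _ _ _ _ (by omega)]; exact h.2⟩

theorem fvs_subst_eq_nil {θ : ℕ → PreTy S} (hθ : ∀ a, (θ a).fvs = []) (t : PreTy S) :
    (t.subst θ).fvs = [] := by
  induction t with
  | fvar a => exact hθ a
  | bvar j i => rfl
  | con c ts ih =>
    simp only [subst, fvs, List.flatten_eq_nil_iff, List.mem_ofFn]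
    rintro l ⟨i, rfl⟩
    exact ih i
  | poly n b ih => exact ih

end PreTy

/-- The number of distinct entries of `l` before the first occurrence of `a`. -/
def rank (l : List ℕ) (a : ℕ) : ℕ := (l.take (l.idxOf a)).toFinset.card

theorem canonicalOcc_rank (l : List ℕ) : CanonicalOcc l.toFinset.card (l.map (rank l)) := by
  -- an index where the number of distinct entries steps up from `c`
  have key : ∀ c q, q ≤ l.length → c < (l.take q).toFinset.card →
      ∃ j < q, ∃ b, l[j]? = some b ∧ rank l b = c := by
    intro c q
    induction q with
    | zero => intro _ h; simp at h
    | succ q ih =>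
      intro hq h
      by_cases hc : c < (l.take q).toFinset.card
      · obtain ⟨j, hj, b, hb⟩ := ih (by omega) hc
        exact ⟨j, by omega, b, hb⟩
      · have hql : q < l.length := by omega
        have htake : l.take (q + 1) = l.take q ++ [l[q]] := by
          simp
        rw [htake, List.toFinset_append] at h
        have hnew : l[q] ∉ l.take q := by
          intro hmem
          have : (l.take q).toFinset ∪ [l[q]].toFinset = (l.take q).toFinset := by
            apply Finset.union_eq_left.2
            intro x hx
            simp only [List.toFinset_cons, List.toFinset_nil, insert_empty_eq,
              Finset.mem_singleton] at hx
            subst hx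
            exact List.mem_toFinset.2 hmem
          rw [this] at h
          exact hc h
        have hle : ((l.take q).toFinset ∪ [l[q]].toFinset).card ≤
            (l.take q).toFinset.card + 1 := by
          refine (Finset.card_union_le _ _).trans ?_
          simp
        refine ⟨q, by omega, l[q], by simp, ?_⟩
        have hidx : l.idxOf l[q] = q := by
          have h1 : l.idxOf l[q] ≤ q := by
            by_contra hlt
            have := List.not_of_lt_findIdx (p := (· == l[q])) (xs := l) (i := q)
              (by simpa [List.idxOf] using Nat.lt_of_not_le hlt)
            simp at this
          by_contra hne
          have hlt : l.idxOf l[q] < q := by omega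
          apply hnew
          have h2 : l[l.idxOf l[q]]'(by omega) = l[q] := List.getElem_idxOf (by omega)
          rw [List.mem_take_iff_getElem]
          exact ⟨l.idxOf l[q], by omega, h2⟩
        unfold rank
        rw [hidx]
        omega
  constructor
  · intro i
    constructor
    · intro hi
      obtain ⟨a, ha, rfl⟩ := List.mem_map.1 hi
      have hlt : l.idxOf a < l.length := List.idxOf_lt_length_of_mem ha
      refine Finset.card_lt_card ⟨?_, ?_⟩
      · intro x hx
        exact List.mem_toFinset.2 (List.mem_of_mem_take (List.mem_toFinset.1 hx))
      · intro hsub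
        have hmem := List.mem_toFinset.1 (hsub (List.mem_toFinset.2 ha))
        obtain ⟨j, hj, hja⟩ := List.mem_take_iff_getElem.1 hmem
        have := List.not_of_lt_findIdx (p := (· == a)) (xs := l) (i := j)
          (by have : j < l.idxOf a := by omega
              simpa [List.idxOf] using this)
        simp [hja] at this
    · intro hi
      obtain ⟨j, _, b, hb, hr⟩ := key i l.length le_rfl (by simpa using hi)
      exact List.mem_map.2 ⟨b, List.mem_of_getElem? hb, hr⟩
  · intro i c hic
    rw [List.getElem?_map, Option.map_eq_some_iff] at hic
    obtain ⟨a, ha, hac⟩ := hic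
    have hmem : a ∈ l := List.mem_of_getElem? ha
    have hlt : l.idxOf a < l.length := List.idxOf_lt_length_of_mem hmem
    obtain ⟨j, hj, b, hb, hr⟩ := key c (l.idxOf a) hlt.le (by
      unfold rank at hac; omega)
    refine ⟨j, ?_, by rw [List.getElem?_map, hb]; simp [hr]⟩
    have hle : l.idxOf a ≤ i := by
      by_contra hlt'
      have := List.not_of_lt_findIdx (p := (· == a)) (xs := l) (i := i)
        (by simpa [List.idxOf] using Nat.lt_of_not_le hlt')
      obtain ⟨hi, hia⟩ := List.getElem?_eq_some_iff.1 ha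
      simp [hia] at this
    omega

/-- Types. -/
def Ty (S : Sig) : Type := {t : PreTy S // t.LC 0}

namespace Ty

variable {S : Sig}

def fvs (t : Ty S) : List ℕ := t.1.fvs

def var (a : ℕ) : Ty S := ⟨.fvar a, trivial⟩

/-- The constructor `c` applied to types. -/
def con (c : Con S) (ts : Fin c.arity → Ty S) : Ty S :=
  ⟨.con c fun i => (ts i).1, fun i => (ts i).2⟩

def unit : Ty S := con .unit Fin.elim0

/-- `a → b`. -/
def arr (a b : Ty S) : Ty S := con .arr ![a, b]

def prod {n : ℕ} (ts : Fin n → Ty S) : Ty S := con (.prod n) ts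

def rcd (T : S.Rec) (ts : Fin (S.arity T) → Ty S) : Ty S := con (.rcd T) ts

def subst (θ : ℕ → Ty S) (t : Ty S) : Ty S :=
  ⟨t.1.subst fun a => (θ a).1, t.2.subst fun a => (θ a).2⟩

/-- Renaming of the variable `a` to `a + n`, used to enter the scope of `n` more binders. -/
def shift (n : ℕ) (t : Ty S) : Ty S := t.subst fun a => var (a + n)

end Ty

/-- Type schemes `∀ᾱ. τ`, where `ᾱ` are `n` variables; a type scheme is what a `poly` boxes. -/
structure Scheme (S : Sig) where
  n : ℕ
  body : PreTy S
  lc : (PreTy.poly n body).LC 0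

/-- The polytype `[σ]`. -/
def Ty.poly {S : Sig} (σ : Scheme S) : Ty S := ⟨.poly σ.n σ.body, σ.lc⟩

namespace Scheme

variable {S : Sig}

def fvs (σ : Scheme S) : List ℕ := σ.body.fvs

/-- A type as a scheme without binders. -/
def mono (t : Ty S) : Scheme S where
  n := 0
  body := t.1
  lc := ⟨t.2.mono (Nat.zero_le _), by
    rw [t.2.occ_eq_nil le_rfl]
    exact ⟨by simp, by intro i a h; simp at h⟩⟩

/-- Capture-avoiding substitution. -/
def subst (θ : ℕ → Ty S) (σ : Scheme S) : Scheme S where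
  n := σ.n
  body := σ.body.subst fun a => (θ a).1
  lc := PreTy.LC.subst (fun a => (θ a).2) σ.lc

/-- `τ[ᾱ := u]` for `σ = ∀ᾱ. τ`. -/
def inst (u : ℕ → Ty S) (σ : Scheme S) : Ty S :=
  ⟨σ.body.openAt (fun i => (u i).1) 0, PreTy.LC.openAt (fun i => (u i).2) σ.lc.1⟩

/-- `∀B. t`. -/
def gen (B : Finset ℕ) (t : Ty S) : Scheme S where
  n := (t.fvs.filter (· ∈ B)).toFinset.card
  body := t.1.closeAt B (rank (t.fvs.filter (· ∈ B))) 0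
  lc := ⟨t.2.closeAt _ _, by
    rw [PreTy.occ_closeAt _ _ _ _ t.2]; exact canonicalOcc_rank _⟩

/-- `∀α. σ`: the binders of `σ` are first given fresh names `N, N+1, …`. -/
def all (α : ℕ) (σ : Scheme S) : Scheme S :=
  let N := (σ.fvs.foldr max α) + 1
  gen (insert α ((Finset.range σ.n).image (N + ·))) (σ.inst fun i => Ty.var (N + i))

/-- The body of `σ` in the scope of `σ.n` more binders, whose variables `0, …, σ.n-1` stand for
the bound variables of `σ`. -/
def unbind (σ : Scheme S) : Ty S := (σ.subst fun a => Ty.var (a + σ.n)).inst Ty.var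

end Scheme

/-- Ground types. -/
def Ground (S : Sig) : Type := {t : Ty S // t.fvs = []}

/-! ## Shapes -/

/-- `νγ̄. τ` where `γ̄`, the variables `0, …, n-1`, are exactly the free variables of `τ`. -/
structure Shape (S : Sig) where
  n : ℕ
  ty : Ty S
  closed : ∀ i, i ∈ ty.fvs ↔ i < n

/-- Type annotations `∃ᾱ. τ`, where `ᾱ` are likewise exactly the free variables of `τ`. -/
abbrev TyAnn (S : Sig) := Shape S

/-- Scheme annotations `∃ᾱ. σ`, where `ᾱ` are exactly the free variables of `σ`. -/
structure SchAnn (S : Sig) where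
  n : ℕ
  sch : Scheme S
  closed : ∀ i, i ∈ sch.fvs ↔ i < n

/-- A ground type as an annotation without bound variables. -/
def Ground.ann {S : Sig} (g : Ground S) : TyAnn S where
  n := 0
  ty := g.1
  closed := by intro i; rw [g.2]; simp

namespace Shape

variable {S : Sig}

/-- `νγ̄. Π γ̄`. -/
def prod (S : Sig) (n : ℕ) : Shape S where
  n := n
  ty := Ty.prod fun i : Fin n => Ty.var i
  closed := by
    intro i
    show i ∈ (List.ofFn fun j : Fin n => [(j : ℕ)]).flatten ↔ i < n
    simp only [List.mem_flatten, List.mem_ofFn]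
    constructor
    · rintro ⟨l, ⟨j, rfl⟩, hi⟩
      rw [List.mem_singleton] at hi
      subst hi
      exact j.2
    · intro hi
      exact ⟨[i], ⟨⟨i, hi⟩, rfl⟩, by simp⟩

/-- `νγ̄. T γ̄`. -/
def rcd (T : S.Rec) : Shape S where
  n := S.arity T
  ty := Ty.rcd T fun i => Ty.var i
  closed := (Shape.prod S (S.arity T)).closed

/-- `νγ̄. [σ]`. -/
def poly (a : SchAnn S) : Shape S where
  n := a.n
  ty := Ty.poly a.sch
  closed := a.closed

/-- The trivial shape is `νγ. γ`. -/
def NonTrivial (s : Shape S) : Prop := ∀ a, s.ty ≠ Ty.var a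

/-- The instantiation order `s ⪯ s'`. -/
def le (s s' : Shape S) : Prop := ∃ θ : ℕ → Ty S, s'.ty = s.ty.subst θ

/-- `s` is a shape of `t`. -/
def IsShapeOf (s : Shape S) (t : Ty S) : Prop := ∃ θ : ℕ → Ty S, t = s.ty.subst θ

/-- `s` is a principal shape of `t`. -/
def IsPrincipal (s : Shape S) (t : Ty S) : Prop :=
  s.NonTrivial ∧ s.IsShapeOf t ∧ ∀ s' : Shape S, s'.NonTrivial → s'.IsShapeOf t → s.le s'

/-- `shape t = s`: the canonical principal shape, whose variables are numbered in the order in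
which they occur. -/
def IsCanonicalOf (s : Shape S) (t : Ty S) : Prop := s.IsPrincipal t ∧ FirstOcc s.ty.fvs

/-- The set of canonical principal shapes. -/
def Canonical (s : Shape S) : Prop := ∃ t, s.IsCanonicalOf t

end Shape

/-! ## Label environments -/

/-- The global label environment: `field T ℓ = some τ` means that the label `ℓ` of the record
type `T` has the scheme `∀ᾱ. T ᾱ → τ`, where `ᾱ` are the variables `0, …, arity T - 1`. -/
structure LabelEnv (S : Sig) where
  field : S.Rec → S.Lab → Option (Ty S)
  closed : ∀ T l t, field T l = some t → ∀ a ∈ t.fvs, a < S.arity T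

namespace LabelEnv

variable {S : Sig}

/-- The set of labels of `T`. -/
def dom (L : LabelEnv S) (T : S.Rec) : Set S.Lab := {l | ∃ t, L.field T l = some t}

/-- The label `l` belongs to the record type `T` only. -/
def LabUni (L : LabelEnv S) (l : S.Lab) (T : S.Rec) : Prop :=
  l ∈ L.dom T ∧ ∀ T', l ∈ L.dom T' → T = T'

/-- `T` is the only record type whose set of labels is `ls`. -/
def LabsUni (L : LabelEnv S) (ls : Set S.Lab) (T : S.Rec) : Prop :=
  L.dom T = ls ∧ ∀ T', L.dom T' = ls → T = T'

/-- `a → b` is an instance of the scheme of the label `l` of `T`. -/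
def LabInst (L : LabelEnv S) (l : S.Lab) (T : S.Rec) (a b : Ty S) : Prop :=
  ∃ t, L.field T l = some t ∧ ∃ θ : ℕ → Ty S, a = Ty.rcd T (fun i => θ i) ∧ b = t.subst θ

end LabelEnv

/-! ## Terms -/

/-- Terms. Tuple components are numbered from 0, and record literals have at least one field. -/
inductive Term (S : Sig) : Type
  | var (x : ℕ) : Term S
  | unit : Term S
  | lam (x : ℕ) (e : Term S) : Term S
  | app (e₁ e₂ : Term S) : Term S
  | letE (x : ℕ) (e₁ e₂ : Term S) : Term S
  /-- `(e : ∃ᾱ. τ)` -/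
  | annot (e : Term S) (a : TyAnn S) : Term S
  | tuple {n : ℕ} (es : Fin n → Term S) : Term S
  /-- implicit projection `e.j` -/
  | proj (e : Term S) (j : ℕ) : Term S
  /-- explicit projection `e.j` from an `n`-tuple -/
  | projX (e : Term S) (n j : ℕ) : Term S
  /-- implicit boxing `[e]` -/
  | box (e : Term S) : Term S
  /-- explicit boxing `[e : ∃ᾱ. σ]` -/
  | boxX (e : Term S) (a : SchAnn S) : Term S
  /-- implicit unboxing `⟨e⟩` -/
  | unbox (e : Term S) : Term S
  /-- explicit unboxing `⟨e : ∃ᾱ. σ⟩` -/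
  | unboxX (e : Term S) (a : SchAnn S) : Term S
  /-- overloaded record literal `{ℓ₁ = e₁; …}` -/
  | record {n : ℕ} (ls : Fin (n + 1) → S.Lab) (es : Fin (n + 1) → Term S) : Term S
  /-- explicit record literal `T.{ℓ₁ = e₁; …}` -/
  | recordX (T : S.Rec) {n : ℕ} (ls : Fin (n + 1) → S.Lab) (es : Fin (n + 1) → Term S) : Term S
  /-- overloaded field projection `e.ℓ` -/
  | field (e : Term S) (l : S.Lab) : Term S
  /-- explicit field projection `e.T.ℓ` -/
  | fieldX (e : Term S) (T : S.Rec) (l : S.Lab) : Term S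
  /-- typed hole carrying subterms -/
  | hole {n : ℕ} (es : Fin n → Term S) : Term S

namespace Term

variable {S : Sig}

/-- Free term variables. -/
def fv : Term S → Set ℕ
  | .var x => {x}
  | .unit => ∅
  | .lam x e => e.fv \ {x}
  | .app e₁ e₂ => e₁.fv ∪ e₂.fv
  | .letE x e₁ e₂ => e₁.fv ∪ (e₂.fv \ {x})
  | .annot e _ => e.fv
  | .tuple es => ⋃ i, (es i).fv
  | .proj e _ => e.fv
  | .projX e _ _ => e.fv
  | .box e => e.fv
  | .boxX e _ => e.fv
  | .unbox e => e.fv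
  | .unboxX e _ => e.fv
  | .record _ es => ⋃ i, (es i).fv
  | .recordX _ _ es => ⋃ i, (es i).fv
  | .field e _ => e.fv
  | .fieldX e _ _ => e.fv
  | .hole es => ⋃ i, (es i).fv

def Closed (e : Term S) : Prop := e.fv = ∅

open Classical in
/-- Erasure: implicit constructs become typed holes around their subterms, except for labels and
closed sets of labels that determine the record type. -/
def erase (L : LabelEnv S) : Term S → Term S
  | .var x => .var x
  | .unit => .unit
  | .lam x e => .lam x (e.erase L)
  | .app e₁ e₂ => .app (e₁.erase L) (e₂.erase L)
  | .letE x e₁ e₂ => .letE x (e₁.erase L) (e₂.erase L)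
  | .annot e a => .annot (e.erase L) a
  | .tuple es => .tuple fun i => (es i).erase L
  | .proj e _ => .hole fun _ : Fin 1 => e.erase L
  | .projX e n j => .projX (e.erase L) n j
  | .box e => .hole fun _ : Fin 1 => e.erase L
  | .boxX e a => .boxX (e.erase L) a
  | .unbox e => .hole fun _ : Fin 1 => e.erase L
  | .unboxX e a => .unboxX (e.erase L) a
  | .record ls es =>
      if ∃ T, L.LabsUni (Set.range ls) T then .record ls fun i => (es i).erase L
      else .hole fun i => (es i).erase L
  | .recordX T ls es => .recordX T ls fun i => (es i).erase L
  | .field e l =>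
      if ∃ T, L.LabUni l T then .field (e.erase L) l else .hole fun _ : Fin 1 => e.erase L
  | .fieldX e T l => .fieldX (e.erase L) T l
  | .hole es => .hole fun i => (es i).erase L

end Term

/-- One-hole term contexts. In the `n`-ary cases the hole is in component `j`, and the family `es`
gives the other components (its value at `j` is not used). -/
inductive ECtx (S : Sig) : Type
  | hole : ECtx S
  | lam (x : ℕ) (E : ECtx S) : ECtx S
  | appL (E : ECtx S) (e : Term S) : ECtx S
  | appR (e : Term S) (E : ECtx S) : ECtx S
  | letL (x : ℕ) (E : ECtx S) (e : Term S) : ECtx S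
  | letR (x : ℕ) (e : Term S) (E : ECtx S) : ECtx S
  | annot (E : ECtx S) (a : TyAnn S) : ECtx S
  | tuple {n : ℕ} (j : Fin n) (E : ECtx S) (es : Fin n → Term S) : ECtx S
  | proj (E : ECtx S) (j : ℕ) : ECtx S
  | projX (E : ECtx S) (n j : ℕ) : ECtx S
  | box (E : ECtx S) : ECtx S
  | boxX (E : ECtx S) (a : SchAnn S) : ECtx S
  | unbox (E : ECtx S) : ECtx S
  | unboxX (E : ECtx S) (a : SchAnn S) : ECtx S
  | record {n : ℕ} (ls : Fin (n + 1) → S.Lab) (j : Fin (n + 1)) (E : ECtx S)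
      (es : Fin (n + 1) → Term S) : ECtx S
  | recordX (T : S.Rec) {n : ℕ} (ls : Fin (n + 1) → S.Lab) (j : Fin (n + 1)) (E : ECtx S)
      (es : Fin (n + 1) → Term S) : ECtx S
  | field (E : ECtx S) (l : S.Lab) : ECtx S
  | fieldX (E : ECtx S) (T : S.Rec) (l : S.Lab) : ECtx S
  | typedHole {n : ℕ} (j : Fin n) (E : ECtx S) (es : Fin n → Term S) : ECtx S

/-- `E[e]`; the hole may capture term variables of `e`. -/
def ECtx.plug {S : Sig} (e : Term S) : ECtx S → Term S
  | .hole => e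
  | .lam x E => .lam x (E.plug e)
  | .appL E e' => .app (E.plug e) e'
  | .appR e' E => .app e' (E.plug e)
  | .letL x E e' => .letE x (E.plug e) e'
  | .letR x e' E => .letE x e' (E.plug e)
  | .annot E a => .annot (E.plug e) a
  | .tuple j E es => .tuple (Function.update es j (E.plug e))
  | .proj E j => .proj (E.plug e) j
  | .projX E n j => .projX (E.plug e) n j
  | .box E => .box (E.plug e)
  | .boxX E a => .boxX (E.plug e) a
  | .unbox E => .unbox (E.plug e)
  | .unboxX E a => .unboxX (E.plug e) a
  | .record ls j E es => .record ls (Function.update es j (E.plug e))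
  | .recordX T ls j E es => .recordX T ls (Function.update es j (E.plug e))
  | .field E l => .field (E.plug e) l
  | .fieldX E T l => .fieldX (E.plug e) T l
  | .typedHole j E es => .hole (Function.update es j (E.plug e))

/-! ## Typing -/

/-- Typing contexts, the innermost binding first. -/
abbrev TyCtx (S : Sig) := List (ℕ × Scheme S)

/-- `α` is not free in `Γ`. -/
def TyCtx.Fresh {S : Sig} (α : ℕ) (Γ : TyCtx S) : Prop := ∀ p ∈ Γ, α ∉ p.2.fvs

/-- The typing rules, relative to the unicity conditions that guard the contextual rules for the
implicit constructs: `KE E e s` (for elimination forms) says that the shape of the type of the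
subterm `e` of `E` is known to be `s`; `KI E es s` (for introduction forms) says that the shape
of the type of the hole of `E` is known to be `s`, given the subterms `es`. -/
inductive TypingWith {S : Sig} (L : LabelEnv S) (KE : ECtx S → Term S → Shape S → Prop)
    (KI : ECtx S → (n : ℕ) → (Fin n → Term S) → Shape S → Prop) :
    TyCtx S → Term S → Scheme S → Prop
  | var {Γ x σ} : Γ.lookup x = some σ → TypingWith L KE KI Γ (.var x) σ
  | lam {Γ x e t₁ t₂} :
      TypingWith L KE KI ((x, .mono t₁) :: Γ) e (.mono t₂) →
      TypingWith L KE KI Γ (.lam x e) (.mono (.arr t₁ t₂))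
  | app {Γ e₁ e₂ t₁ t₂} :
      TypingWith L KE KI Γ e₁ (.mono (.arr t₁ t₂)) → TypingWith L KE KI Γ e₂ (.mono t₁) →
      TypingWith L KE KI Γ (.app e₁ e₂) (.mono t₂)
  | unit {Γ} : TypingWith L KE KI Γ .unit (.mono .unit)
  | gen {Γ e} {σ : Scheme S} (α : ℕ) :
      TypingWith L KE KI Γ e σ → TyCtx.Fresh α Γ → TypingWith L KE KI Γ e (σ.all α)
  | inst {Γ e} {σ : Scheme S} (α : ℕ) (t : Ty S) :
      TypingWith L KE KI Γ e (σ.all α) →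
      TypingWith L KE KI Γ e (σ.subst (Function.update Ty.var α t))
  | letE {Γ x e₁ e₂ σ t} :
      TypingWith L KE KI Γ e₁ σ → TypingWith L KE KI ((x, σ) :: Γ) e₂ (.mono t) →
      TypingWith L KE KI Γ (.letE x e₁ e₂) (.mono t)
  | annot {Γ e} {a : TyAnn S} (θ : ℕ → Ty S) :
      TypingWith L KE KI Γ e (.mono (a.ty.subst θ)) →
      TypingWith L KE KI Γ (.annot e a) (.mono (a.ty.subst θ))
  | tuple {Γ n} {es : Fin n → Term S} {ts : Fin n → Ty S} :
      (∀ i, TypingWith L KE KI Γ (es i) (.mono (ts i))) →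
      TypingWith L KE KI Γ (.tuple es) (.mono (.prod ts))
  | projX {Γ e n} {ts : Fin n → Ty S} (j : Fin n) :
      TypingWith L KE KI Γ e (.mono (.prod ts)) →
      TypingWith L KE KI Γ (.projX e n j) (.mono (ts j))
  | boxX {Γ e} {a : SchAnn S} (θ : ℕ → Ty S) :
      TypingWith L KE KI Γ e (a.sch.subst θ) →
      TypingWith L KE KI Γ (.boxX e a) (.mono (.poly (a.sch.subst θ)))
  | unboxX {Γ e} {a : SchAnn S} (θ : ℕ → Ty S) :
      TypingWith L KE KI Γ e (.mono (.poly (a.sch.subst θ))) →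
      TypingWith L KE KI Γ (.unboxX e a) (a.sch.subst θ)
  | recordX {Γ T n} {ls : Fin (n + 1) → S.Lab} {es : Fin (n + 1) → Term S} {t}
      {ts : Fin (n + 1) → Ty S} :
      L.dom T = Set.range ls → (∀ i, L.LabInst (ls i) T t (ts i)) →
      (∀ i, TypingWith L KE KI Γ (es i) (.mono (ts i))) →
      TypingWith L KE KI Γ (.recordX T ls es) (.mono t)
  | recordClosed {Γ T n} {ls : Fin (n + 1) → S.Lab} {es : Fin (n + 1) → Term S} {t} :
      L.LabsUni (Set.range ls) T → TypingWith L KE KI Γ (.recordX T ls es) (.mono t) →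
      TypingWith L KE KI Γ (.record ls es) (.mono t)
  | fieldX {Γ e T l t₁ t₂} :
      L.LabInst l T t₁ t₂ → TypingWith L KE KI Γ e (.mono t₁) →
      TypingWith L KE KI Γ (.fieldX e T l) (.mono t₂)
  | fieldClosed {Γ e T l t} :
      L.LabUni l T → TypingWith L KE KI Γ (.fieldX e T l) (.mono t) →
      TypingWith L KE KI Γ (.field e l) (.mono t)
  | hole {Γ n} {es : Fin n → Term S} {ts : Fin n → Ty S} (t : Ty S) :
      (∀ i, TypingWith L KE KI Γ (es i) (.mono (ts i))) →
      TypingWith L KE KI Γ (.hole es) (.mono t)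
  | projI {Γ e j t} (E : ECtx S) (n : ℕ) :
      KE E e (Shape.prod S n) → TypingWith L KE KI Γ (E.plug (.projX e n j)) (.mono t) →
      TypingWith L KE KI Γ (E.plug (.proj e j)) (.mono t)
  | boxI {Γ e t} (E : ECtx S) (a : SchAnn S) :
      KI E 1 ![e] (Shape.poly a) → TypingWith L KE KI Γ (E.plug (.boxX e a)) (.mono t) →
      TypingWith L KE KI Γ (E.plug (.box e)) (.mono t)
  | unboxI {Γ e t} (E : ECtx S) (a : SchAnn S) :
      KE E e (Shape.poly a) → TypingWith L KE KI Γ (E.plug (.unboxX e a)) (.mono t) →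
      TypingWith L KE KI Γ (E.plug (.unbox e)) (.mono t)
  | recordI {Γ n} {ls : Fin (n + 1) → S.Lab} {es : Fin (n + 1) → Term S} {t} (E : ECtx S)
      (T : S.Rec) :
      KI E (n + 1) es (Shape.rcd T) →
      TypingWith L KE KI Γ (E.plug (.recordX T ls es)) (.mono t) →
      TypingWith L KE KI Γ (E.plug (.record ls es)) (.mono t)
  | fieldI {Γ e l t} (E : ECtx S) (T : S.Rec) :
      KE E e (Shape.rcd T) → TypingWith L KE KI Γ (E.plug (.fieldX e T l)) (.mono t) →
      TypingWith L KE KI Γ (E.plug (.field e l)) (.mono t)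

/-- The restricted judgment, without the rules for implicit constructs. -/
def RobustTyping {S : Sig} (L : LabelEnv S) : TyCtx S → Term S → Scheme S → Prop :=
  TypingWith L (fun _ _ _ => False) (fun _ _ _ _ => False)

/-- Unicity for elimination forms: in every typing of the erasure of `E[e]`, the type of `e` has
the canonical shape `s`. -/
def KnownElim {S : Sig} (L : LabelEnv S) (E : ECtx S) (e : Term S) (s : Shape S) : Prop :=
  s.Canonical ∧ ∀ (Γ : TyCtx S) (t : Ty S) (g : Ground S),
    RobustTyping L Γ ((E.plug (.hole ![.annot e g.ann])).erase L) (.mono t) → s.IsCanonicalOf g.1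

/-- Unicity for introduction forms: in every typing of the erasure of `E` with the subterms `es`
in its hole, the hole has a type of canonical shape `s`. -/
def KnownIntro {S : Sig} (L : LabelEnv S) (E : ECtx S) (n : ℕ) (es : Fin n → Term S)
    (s : Shape S) : Prop :=
  s.Canonical ∧ ∀ (Γ : TyCtx S) (t : Ty S) (g : Ground S),
    RobustTyping L Γ ((E.plug (.annot (.hole es) g.ann)).erase L) (.mono t) → s.IsCanonicalOf g.1

/-- The typing judgment `Γ ⊢ e : σ`. -/
def Typing {S : Sig} (L : LabelEnv S) : TyCtx S → Term S → Scheme S → Prop :=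
  TypingWith L (KnownElim L) (KnownIntro L)

/-- `e` is typable (in the empty context). -/
def Typable {S : Sig} (L : LabelEnv S) (e : Term S) : Prop := ∃ σ, Typing L [] e σ

/-- The syntax-directed system for simple terms. -/
inductive SDTyping {S : Sig} (L : LabelEnv S) : TyCtx S → Term S → Ty S → Prop
  | var {Γ x σ} (u : ℕ → Ty S) : Γ.lookup x = some σ → SDTyping L Γ (.var x) (σ.inst u)
  | lam {Γ x e t₁ t₂} :
      SDTyping L ((x, .mono t₁) :: Γ) e t₂ → SDTyping L Γ (.lam x e) (.arr t₁ t₂)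
  | app {Γ e₁ e₂ t₁ t₂} :
      SDTyping L Γ e₁ (.arr t₁ t₂) → SDTyping L Γ e₂ t₁ → SDTyping L Γ (.app e₁ e₂) t₂
  | unit {Γ} : SDTyping L Γ .unit .unit
  | letE {Γ x e₁ e₂ t₁ t₂} (B : Finset ℕ) :
      SDTyping L Γ e₁ t₁ → (∀ α ∈ B, TyCtx.Fresh α Γ) →
      SDTyping L ((x, .gen B t₁) :: Γ) e₂ t₂ → SDTyping L Γ (.letE x e₁ e₂) t₂
  | annot {Γ e} {a : TyAnn S} (θ : ℕ → Ty S) :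
      SDTyping L Γ e (a.ty.subst θ) → SDTyping L Γ (.annot e a) (a.ty.subst θ)
  | tuple {Γ n} {es : Fin n → Term S} {ts : Fin n → Ty S} :
      (∀ i, SDTyping L Γ (es i) (ts i)) → SDTyping L Γ (.tuple es) (.prod ts)
  | projX {Γ e n} {ts : Fin n → Ty S} (j : Fin n) :
      SDTyping L Γ e (.prod ts) → SDTyping L Γ (.projX e n j) (ts j)
  | boxX {Γ e t} {a : SchAnn S} (θ : ℕ → Ty S) (B : Finset ℕ) :
      SDTyping L Γ e t → (∀ α ∈ B, TyCtx.Fresh α Γ) → a.sch.subst θ = .gen B t →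
      SDTyping L Γ (.boxX e a) (.poly (a.sch.subst θ))
  | unboxX {Γ e} {a : SchAnn S} (θ u : ℕ → Ty S) :
      SDTyping L Γ e (.poly (a.sch.subst θ)) →
      SDTyping L Γ (.unboxX e a) ((a.sch.subst θ).inst u)
  | recordX {Γ T n} {ls : Fin (n + 1) → S.Lab} {es : Fin (n + 1) → Term S} {t}
      {ts : Fin (n + 1) → Ty S} :
      L.dom T = Set.range ls → (∀ i, L.LabInst (ls i) T t (ts i)) →
      (∀ i, SDTyping L Γ (es i) (ts i)) → SDTyping L Γ (.recordX T ls es) t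
  | recordClosed {Γ T n} {ls : Fin (n + 1) → S.Lab} {es : Fin (n + 1) → Term S} {t} :
      L.LabsUni (Set.range ls) T → SDTyping L Γ (.recordX T ls es) t →
      SDTyping L Γ (.record ls es) t
  | fieldX {Γ e T l t₁ t₂} :
      L.LabInst l T t₁ t₂ → SDTyping L Γ e t₁ → SDTyping L Γ (.fieldX e T l) t₂
  | fieldClosed {Γ e T l t} :
      L.LabUni l T → SDTyping L Γ (.fieldX e T l) t → SDTyping L Γ (.field e l) t
  | hole {Γ n} {es : Fin n → Term S} {ts : Fin n → Ty S} (t : Ty S) :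
      (∀ i, SDTyping L Γ (es i) (ts i)) → SDTyping L Γ (.hole es) t

/-- The canonical typing judgment `⊩ e : τ`: all implicit constructs are elaborated first, and the
resulting simple term is typed by the syntax-directed rules. -/
inductive CanTyping {S : Sig} (L : LabelEnv S) : Term S → Ty S → Prop
  | base {e t} : SDTyping L [] e t → CanTyping L e t
  | projI {e j t} (E : ECtx S) (n : ℕ) :
      KnownElim L E e (Shape.prod S n) → CanTyping L (E.plug (.projX e n j)) t →
      CanTyping L (E.plug (.proj e j)) t
  | boxI {e t} (E : ECtx S) (a : SchAnn S) :
      KnownIntro L E 1 ![e] (Shape.poly a) → CanTyping L (E.plug (.boxX e a)) t →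
      CanTyping L (E.plug (.box e)) t
  | unboxI {e t} (E : ECtx S) (a : SchAnn S) :
      KnownElim L E e (Shape.poly a) → CanTyping L (E.plug (.unboxX e a)) t →
      CanTyping L (E.plug (.unbox e)) t
  | recordI {n} {ls : Fin (n + 1) → S.Lab} {es : Fin (n + 1) → Term S} {t} (E : ECtx S)
      (T : S.Rec) :
      KnownIntro L E (n + 1) es (Shape.rcd T) → CanTyping L (E.plug (.recordX T ls es)) t →
      CanTyping L (E.plug (.record ls es)) t
  | fieldI {e l t} (E : ECtx S) (T : S.Rec) :
      KnownElim L E e (Shape.rcd T) → CanTyping L (E.plug (.fieldX e T l)) t →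
      CanTyping L (E.plug (.field e l)) t

/-! ## Constraints -/

/-- Shape patterns: the wildcard; `Π α j`, which binds a type variable to component `j`; a record
pattern, which binds a record variable; a polytype pattern, which binds a scheme variable. -/
inductive Pat : Type
  | wild : Pat
  | prod (j : ℕ) : Pat
  | rcd (r : ℕ) : Pat
  | poly (k : ℕ) : Pat

/-- Constraints. Type variables are de Bruijn indices: `ex`, `all`, the abstraction `c₁` of `letC`,
and the branches of a `prod` pattern bind the variable `0`. Term variables, record variables and
scheme variables are named. -/
inductive Constr (S : Sig) : Type
  | tt : Constr S
  | ff : Constr S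
  | conj (c₁ c₂ : Constr S) : Constr S
  | unif (a b : Ty S) : Constr S
  | ex (c : Constr S) : Constr S
  | all (c : Constr S) : Constr S
  /-- `let x = λα. c₁ in c₂` -/
  | letC (x : ℕ) (c₁ c₂ : Constr S) : Constr S
  /-- `x τ` -/
  | app (x : ℕ) (t : Ty S) : Constr S
  /-- the suspended constraint `match τ with (pᵢ → cᵢ)ᵢ` -/
  | mtch (t : Ty S) {n : ℕ} (ps : Fin n → Pat) (cs : Fin n → Constr S) : Constr S
  /-- `ℓ/r ≤ a → b` for a record variable `r` -/
  | labLe (l : S.Lab) (r : ℕ) (a b : Ty S) : Constr S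
  /-- `dom r = ls` for a record variable `r` -/
  | domEq (r : ℕ) (ls : Set S.Lab) : Constr S
  /-- `k ≤ τ` for a scheme variable `k` -/
  | schLe (k : ℕ) (t : Ty S) : Constr S
  /-- `x ≤ k` for a scheme variable `k` -/
  | leSch (x : ℕ) (k : ℕ) : Constr S

namespace Constr

variable {S : Sig}

/-- `∃ᾱ. c` with `n` variables. -/
def exN : ℕ → Constr S → Constr S
  | 0, c => c
  | n + 1, c => .ex (exN n c)

/-- `∀ᾱ. c` with `n` variables. -/
def allN : ℕ → Constr S → Constr S
  | 0, c => c
  | n + 1, c => .all (allN n c)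

/-- Conjunction of a list. -/
def conjList (l : List (Constr S)) : Constr S := l.foldr .conj .tt

/-- `⋀ᵢ cᵢ`. -/
def bigConj {n : ℕ} (cs : Fin n → Constr S) : Constr S := conjList (List.ofFn cs)

/-- `ℓ/T ≤ a → b` for a record name `T`. -/
def labInst (L : LabelEnv S) (l : S.Lab) (T : S.Rec) (a b : Ty S) : Constr S :=
  match L.field T l with
  | some t => exN (S.arity T)
      (.conj (.unif (a.shift (S.arity T)) (.rcd T fun i => .var i))
        (.unif (b.shift (S.arity T)) t))
  | none => .ff

open Classical in
/-- `dom T = ls` for a record name `T`. -/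
def domIs (L : LabelEnv S) (T : S.Rec) (ls : Set S.Lab) : Constr S :=
  if L.dom T = ls then .tt else .ff

/-- `σ ≤ τ`. -/
def schemeLe (σ : Scheme S) (t : Ty S) : Constr S := exN σ.n (.unif σ.unbind (t.shift σ.n))

/-- `x ≤ σ`. -/
def leScheme (x : ℕ) (σ : Scheme S) : Constr S := allN σ.n (.app x σ.unbind)

end Constr

/-- Substitutions of types for type variables, record names for record variables, and type schemes
for scheme variables (`none` leaves a variable as it is). -/
structure PatSub (S : Sig) where
  ty : ℕ → Ty S
  rcd : ℕ → Option S.Rec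
  sch : ℕ → Option (Scheme S)

/-- The substitution below a binder of a type variable. -/
def PatSub.up {S : Sig} (θ : PatSub S) : PatSub S where
  ty := fun
    | 0 => .var 0
    | i + 1 => (θ.ty i).shift 1
  rcd := θ.rcd
  sch := fun k => (θ.sch k).map fun σ => σ.subst fun a => .var (a + 1)

/-- The substitution below the binders of a pattern. -/
def PatSub.under {S : Sig} (θ : PatSub S) : Pat → PatSub S
  | .wild => θ
  | .prod _ => θ.up
  | .rcd r => { θ with rcd := Function.update θ.rcd r none }
  | .poly k => { θ with sch := Function.update θ.sch k none }

/-- `θ(c)`. -/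
def Constr.inst {S : Sig} (L : LabelEnv S) : PatSub S → Constr S → Constr S
  | _, .tt => .tt
  | _, .ff => .ff
  | θ, .conj c₁ c₂ => .conj (c₁.inst L θ) (c₂.inst L θ)
  | θ, .unif a b => .unif (a.subst θ.ty) (b.subst θ.ty)
  | θ, .ex c => .ex (c.inst L θ.up)
  | θ, .all c => .all (c.inst L θ.up)
  | θ, .letC x c₁ c₂ => .letC x (c₁.inst L θ.up) (c₂.inst L θ)
  | θ, .app x t => .app x (t.subst θ.ty)
  | θ, .mtch t ps cs => .mtch (t.subst θ.ty) ps fun i => (cs i).inst L (θ.under (ps i))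
  | θ, .labLe l r a b =>
      match θ.rcd r with
      | some T => labInst L l T (a.subst θ.ty) (b.subst θ.ty)
      | none => .labLe l r (a.subst θ.ty) (b.subst θ.ty)
  | θ, .domEq r ls =>
      match θ.rcd r with
      | some T => domIs L T ls
      | none => .domEq r ls
  | θ, .schLe k t =>
      match θ.sch k with
      | some σ => schemeLe σ (t.subst θ.ty)
      | none => .schLe k (t.subst θ.ty)
  | θ, .leSch x k =>
      match θ.sch k with
      | some σ => leScheme x σ
      | none => .leSch x k

/-- `p` matches the shape `s` applied to fresh variables `0, …, s.n-1`, with the substitution `θ`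
for the corresponding branch; `θ` also moves the branch into the scope of the fresh variables. -/
inductive Pat.Matches {S : Sig} : Pat → Shape S → PatSub S → Prop
  | wild (s : Shape S) : Matches .wild s ⟨fun i => .var (i + s.n), fun _ => none, fun _ => none⟩
  | prod (n j : ℕ) : j < n →
      Matches (.prod j) (Shape.prod S n)
        ⟨fun | 0 => .var j | i + 1 => .var (i + n), fun _ => none, fun _ => none⟩
  | rcd (r : ℕ) (T : S.Rec) :
      Matches (.rcd r) (Shape.rcd T)
        ⟨fun i => .var (i + S.arity T), Function.update (fun _ => none) r (some T), fun _ => none⟩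
  | poly (k : ℕ) (a : SchAnn S) :
      Matches (.poly k) (Shape.poly a)
        ⟨fun i => .var (i + a.n), fun _ => none, Function.update (fun _ => none) k (some a.sch)⟩

open Classical in
/-- The discharged match constraint. (When the patterns are disjoint, as they are meant to be, the
branch and its substitution are unique.) -/
def Constr.matched {S : Sig} (L : LabelEnv S) (t : Ty S) (s : Shape S) {n : ℕ} (ps : Fin n → Pat)
    (cs : Fin n → Constr S) : Constr S :=
  if h : ∃ q : Fin n × PatSub S, (ps q.1).Matches s q.2 then
    exN s.n (.conj (.unif (t.shift s.n) s.ty) ((cs h.choose.1).inst L h.choose.2))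
  else .ff

/-- Erasure of suspended match constraints. -/
def Constr.erase {S : Sig} : Constr S → Constr S
  | .conj c₁ c₂ => .conj c₁.erase c₂.erase
  | .ex c => .ex c.erase
  | .all c => .all c.erase
  | .letC x c₁ c₂ => .letC x c₁.erase c₂.erase
  | .mtch _ _ _ => .tt
  | c => c

/-- Constraint contexts. -/
inductive CCtx (S : Sig) : Type
  | hole : CCtx S
  | andL (C : CCtx S) (c : Constr S) : CCtx S
  | andR (c : Constr S) (C : CCtx S) : CCtx S
  | ex (C : CCtx S) : CCtx S
  | all (C : CCtx S) : CCtx S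
  | letL (x : ℕ) (C : CCtx S) (c : Constr S) : CCtx S
  | letR (x : ℕ) (c : Constr S) (C : CCtx S) : CCtx S

/-- `C[c]`; the hole captures variables. -/
def CCtx.plug {S : Sig} (c : Constr S) : CCtx S → Constr S
  | .hole => c
  | .andL C c' => .conj (C.plug c) c'
  | .andR c' C => .conj c' (C.plug c)
  | .ex C => .ex (C.plug c)
  | .all C => .all (C.plug c)
  | .letL x C c' => .letC x (C.plug c) c'
  | .letR x c' C => .letC x c' (C.plug c)

/-- Semantic environments. -/
structure Env (S : Sig) where
  ty : ℕ → Ground S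
  tm : ℕ → Set (Ground S)

namespace Env

variable {S : Sig}

/-- `φ(τ)`. -/
def eval (φ : Env S) (t : Ty S) : Ground S :=
  ⟨t.subst fun a => (φ.ty a).1, PreTy.fvs_subst_eq_nil (fun a => (φ.ty a).2) t.1⟩

/-- `φ[α := g]` for a newly bound type variable. -/
def pushTy (φ : Env S) (g : Ground S) : Env S where
  ty := fun
    | 0 => g
    | i + 1 => φ.ty i
  tm := φ.tm

/-- `φ[x := G]`. -/
def setTm (φ : Env S) (x : ℕ) (G : Set (Ground S)) : Env S where
  ty := φ.ty
  tm := Function.update φ.tm x G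

end Env

/-- Satisfiability `φ ⊢ c`, relative to the unicity condition `K C τ s` that guards the contextual
rule for suspended match constraints. In the rule for `letC`, the set `G` is a nonempty subset of
`{g | φ[α := g] ⊢ c₁}`; by `SatWith.letC_iff_literal` below one can always take the whole set. -/
inductive SatWith {S : Sig} (L : LabelEnv S) (K : CCtx S → Ty S → Shape S → Prop) :
    Env S → Constr S → Prop
  | tt {φ} : SatWith L K φ .tt
  | conj {φ c₁ c₂} : SatWith L K φ c₁ → SatWith L K φ c₂ → SatWith L K φ (.conj c₁ c₂)
  | unif {φ a b} : φ.eval a = φ.eval b → SatWith L K φ (.unif a b)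
  | ex {φ c} (g : Ground S) : SatWith L K (φ.pushTy g) c → SatWith L K φ (.ex c)
  | all {φ c} : (∀ g, SatWith L K (φ.pushTy g) c) → SatWith L K φ (.all c)
  | letC {φ x c₁ c₂} (G : Set (Ground S)) :
      (∀ g ∈ G, SatWith L K (φ.pushTy g) c₁) → G.Nonempty → SatWith L K (φ.setTm x G) c₂ →
      SatWith L K φ (.letC x c₁ c₂)
  | app {φ x t} : φ.eval t ∈ φ.tm x → SatWith L K φ (.app x t)
  | matchCtx {φ t n} {ps : Fin n → Pat} {cs : Fin n → Constr S} (C : CCtx S) (s : Shape S) :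
      K C t s → SatWith L K φ (C.plug (.matched L t s ps cs)) →
      SatWith L K φ (C.plug (.mtch t ps cs))

/-- Satisfiability is monotone in the interpretation of the term variables. -/
theorem SatWith.mono {S : Sig} {L : LabelEnv S} {K : CCtx S → Ty S → Shape S → Prop} {φ : Env S}
    {c : Constr S} (h : SatWith L K φ c) :
    ∀ ψ : Env S, ψ.ty = φ.ty → (∀ x, φ.tm x ⊆ ψ.tm x) → SatWith L K ψ c := by
  have hpush : ∀ (φ ψ : Env S) (g : Ground S), ψ.ty = φ.ty →
      (ψ.pushTy g).ty = (φ.pushTy g).ty := by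
    intro φ ψ g h
    simp only [Env.pushTy, h]
  have heval : ∀ (φ ψ : Env S) (t : Ty S), ψ.ty = φ.ty → ψ.eval t = φ.eval t := by
    intro φ ψ t h
    obtain ⟨_, _⟩ := φ
    obtain ⟨_, _⟩ := ψ
    subst h
    rfl
  induction h with
  | tt => intros; exact .tt
  | conj _ _ ih₁ ih₂ => intro ψ h₁ h₂; exact .conj (ih₁ ψ h₁ h₂) (ih₂ ψ h₁ h₂)
  | unif h => intro ψ h₁ _; exact .unif (by rw [heval _ _ _ h₁, heval _ _ _ h₁]; exact h)
  | ex g _ ih => intro ψ h₁ h₂; exact .ex g (ih _ (hpush _ _ _ h₁) h₂)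
  | all _ ih => intro ψ h₁ h₂; exact .all fun g => ih g _ (hpush _ _ _ h₁) h₂
  | @letC φ x c₁ c₂ G _ hne _ ih₁ ih₂ =>
    intro ψ h₁ h₂
    refine .letC G (fun g hg => ih₁ g hg _ (hpush _ _ _ h₁) h₂) hne (ih₂ _ h₁ fun y => ?_)
    by_cases hy : y = x
    · subst hy; simp [Env.setTm]
    · simpa [Env.setTm, hy] using h₂ y
  | app h => intro ψ h₁ h₂; exact .app (by rw [heval _ _ _ h₁]; exact h₂ _ h)
  | matchCtx C s hK _ ih => intro ψ h₁ h₂; exact .matchCtx C s hK (ih ψ h₁ h₂)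

/-- The premises of the `letC` rule hold for some `G` iff they hold for
`G = {g | φ[α := g] ⊢ c₁}`. -/
theorem SatWith.letC_iff_literal {S : Sig} {L : LabelEnv S}
    {K : CCtx S → Ty S → Shape S → Prop} {φ : Env S} {x : ℕ} {c₁ c₂ : Constr S} :
    (∃ G : Set (Ground S), (∀ g ∈ G, SatWith L K (φ.pushTy g) c₁) ∧ G.Nonempty ∧
      SatWith L K (φ.setTm x G) c₂) ↔
    ∃ G : Set (Ground S), G = {g | SatWith L K (φ.pushTy g) c₁} ∧ G.Nonempty ∧
      SatWith L K (φ.setTm x G) c₂ := by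
  constructor
  · rintro ⟨G, hG, hne, h⟩
    refine ⟨_, rfl, hne.mono hG, h.mono _ rfl fun y => ?_⟩
    by_cases hy : y = x
    · subst hy
      simp only [Env.setTm, Function.update_self]
      exact hG
    · simp [Env.setTm, hy]
  · rintro ⟨G, rfl, hne, h⟩
    exact ⟨_, fun g hg => hg, hne, h⟩

/-- Satisfiability of simple constraints: no contextual rule. -/
def SimpleSat {S : Sig} (L : LabelEnv S) : Env S → Constr S → Prop :=
  SatWith L fun _ _ _ => False

/-- Unicity: in every solution of the erasure of `C`, the type `t` has the canonical shape `s`. -/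
def Known {S : Sig} (L : LabelEnv S) (C : CCtx S) (t : Ty S) (s : Shape S) : Prop :=
  s.Canonical ∧ ∀ (φ : Env S) (g : Ground S),
    SimpleSat L φ (C.plug (.unif t g.1)).erase → s.IsCanonicalOf g.1

/-- The contextual semantics `φ ⊢ c` of constraints. -/
def Sat {S : Sig} (L : LabelEnv S) : Env S → Constr S → Prop := SatWith L (Known L)

/-- `c` has a solution. -/
def Satisfiable {S : Sig} (L : LabelEnv S) (c : Constr S) : Prop := ∃ φ, Sat L φ c

/-- `c₁` entails `c₂`. -/
def Entails {S : Sig} (L : LabelEnv S) (c₁ c₂ : Constr S) : Prop := ∀ φ, Sat L φ c₁ → Sat L φ c₂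

/-! ## Constraint generation -/

open Constr in
/-- Constraint for an explicit record literal, given the constraint generators of its fields. -/
def genRecordX {S : Sig} (L : LabelEnv S) (T : S.Rec) {n : ℕ} (ls : Fin n → S.Lab)
    (gs : Fin n → Ty S → Constr S) (t : Ty S) : Constr S :=
  exN n (.conj (bigConj fun i => gs i (.var i))
    (.conj (domIs L T (Set.range ls))
      (bigConj fun i => labInst L (ls i) T (t.shift n) (.var i))))

/-- Constraint for an explicit field projection, given the constraint generator of the record. -/
def genFieldX {S : Sig} (L : LabelEnv S) (T : S.Rec) (l : S.Lab) (g : Ty S → Constr S) (t : Ty S) :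
    Constr S :=
  .ex (.conj (g (.var 0)) (.labInst L l T (.var 0) (t.shift 1)))

open Classical Constr in
/-- The constraint `⟦e : τ⟧`. Generated type variables are de Bruijn indices, and types are shifted
when they are moved below a binder. -/
def gen {S : Sig} (L : LabelEnv S) : Term S → Ty S → Constr S
  | .var x, t => .app x t
  | .unit, t => .unif t .unit
  | .lam x e, t =>
      .ex (.ex (.conj (.letC x (.unif (.var 0) (.var 2)) (gen L e (.var 0)))
        (.unif (t.shift 2) (.arr (.var 1) (.var 0)))))
  | .app e₁ e₂, t =>
      .ex (.ex (.conj (gen L e₁ (.var 0)) (.conj (gen L e₂ (.var 1))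
        (.unif (.var 0) (.arr (.var 1) (t.shift 2))))))
  | .letE x e₁ e₂, t => .letC x (gen L e₁ (.var 0)) (gen L e₂ t)
  | .annot e a, t => exN a.n (.conj (gen L e a.ty) (.unif (t.shift a.n) a.ty))
  | .tuple (n := n) es, t =>
      exN n (.conj (.unif (t.shift n) (.prod fun i : Fin n => .var i))
        (bigConj fun i => gen L (es i) (.var i)))
  | .proj e j, t =>
      .ex (.conj (gen L e (.var 0))
        (.mtch (.var 0) (fun _ : Fin 1 => .prod j) fun _ => .unif (t.shift 2) (.var 0)))
  | .projX e n j, t =>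
      if j < n then
        .ex (exN n (.conj (gen L e (.var n))
          (.conj (.unif (.var n) (.prod fun i : Fin n => .var i))
            (.unif (t.shift (n + 1)) (.var j)))))
      else .ff
  | .box e, t =>
      .letC 0 (gen L e (.var 0)) (.mtch t (fun _ : Fin 1 => .poly 0) fun _ => .leSch 0 0)
  | .boxX e a, t =>
      exN a.n (.conj (allN a.sch.n (gen L e a.sch.unbind)) (.unif (t.shift a.n) (.poly a.sch)))
  | .unbox e, t =>
      .ex (.conj (gen L e (.var 0))
        (.mtch (.var 0) (fun _ : Fin 1 => .poly 0) fun _ => .schLe 0 (t.shift 1)))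
  | .unboxX e a, t =>
      .ex (exN a.n (.conj (gen L e (.var a.n))
        (.conj (.unif (.var a.n) (.poly a.sch)) (schemeLe a.sch (t.shift (a.n + 1))))))
  | .record (n := n) ls es, t =>
      if h : ∃ T, L.LabsUni (Set.range ls) T then
        genRecordX L h.choose ls (fun i => gen L (es i)) t
      else
        exN (n + 1) (.conj (bigConj fun i => gen L (es i) (.var i))
          (.mtch (t.shift (n + 1)) (fun _ : Fin 1 => .rcd 0) fun _ =>
            .conj (.domEq 0 (Set.range ls))
              (bigConj fun i => .labLe (ls i) 0 (t.shift (n + 1)) (.var i))))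
  | .recordX T ls es, t => genRecordX L T ls (fun i => gen L (es i)) t
  | .field e l, t =>
      if h : ∃ T, L.LabUni l T then genFieldX L h.choose l (gen L e) t
      else
        .ex (.conj (gen L e (.var 0))
          (.mtch (.var 0) (fun _ : Fin 1 => .rcd 0) fun _ => .labLe l 0 (.var 0) (t.shift 1)))
  | .fieldX e T l, t => genFieldX L T l (gen L e) t
  | .hole (n := n) es, _ => exN n (bigConj fun i => gen L (es i) (.var i))

/-! ## Unifiers -/

/-- Idempotent substitutions with finite domain. -/
structure Substitution (S : Sig) where
  toFun : ℕ → Ty S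
  finite : {a | toFun a ≠ Ty.var a}.Finite
  idem : ∀ a, (toFun a).subst toFun = toFun a

namespace Substitution

variable {S : Sig}

/-- The domain, as a list. -/
def dom (θ : Substitution S) : List ℕ := θ.finite.toFinset.toList

/-- The free variables of the range, as a list without repetitions. -/
def rng (θ : Substitution S) : List ℕ := (θ.dom.flatMap fun a => (θ.toFun a).fvs).dedup

/-- The constraint `∃θ`, that is `∃β̄. ⋀ (α = θ(α))`, where `α` ranges over the domain of `θ` and `β̄`
are the free variables of its range (which, `θ` being idempotent, are not in its domain). -/
def toConstr (θ : Substitution S) : Constr S :=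
  .exN θ.rng.length (.conjList (θ.dom.map fun a =>
    .unif (.var (a + θ.rng.length)) ((θ.toFun a).subst fun b => .var (θ.rng.idxOf b))))

end Substitution

/-- `θ` is a unifier of `c`: `∃θ` entails `c`. -/
def IsUnifier {S : Sig} (L : LabelEnv S) (θ : Substitution S) (c : Constr S) : Prop :=
  Entails L θ.toConstr c

end OML

end

/-! Everything is compared through ground types. Given sets of ground types for its term variables,
a term denotes a set of ground types (`tsem`), and a constraint has its ground solutions (`csem`).
In both, a proposition `m` gives the reading of whatever is still implicit or suspended: `True` is
the erasure, where it imposes nothing, and `False` is the simple system, where it is forbidden. A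
term and its generated constraint have the same meaning, at every stage of elaboration (`Tree.sem`).

Declarative typing is sound for this meaning (`TypingWith.sound`). For the converse, types are
recovered from their values. Call a family of ground types irreducible if its members have no common
non-trivial shape. Every family is the value of a type whose variables stand for irreducible
families (`exists_name`), and in only one way (`Ty.subst_eq_of_irred`), so irreducible families
behave like type variables. If the variables of `t` name distinct irreducible families and a simple
term has the value of `t` at every index, then it has type `t` in the syntax-directed system
(`SDTyping.complete`). At `let` and at explicit boxes the index set is enlarged so that the
generalized variables become new irreducible families.

The contextual rules become rewriting steps on whole terms and whole constraints (`TStep`, `CStep`).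
The unicity conditions quantify over all contexts and environments and only concern erasures, so
they depend on the meaning with `m = True` alone. They therefore agree on both sides
(`Tree.known_iff`), and the steps of a term correspond to those of its constraint
(`Tree.cStep_of_tStep`, `Tree.tStep_of_cStep`).

What remains is that contextual satisfaction is a sequence of steps followed by simple satisfaction
(`sat_iff`). The obstacle is that the contextual rule may be used below `∀` and `let`, separately
for each ground type, and that entailment in (ii) yields one elaboration for each environment. So
one needs that elaborations with a solution are unique (`CSteps.unique`), hence that a known shape
is the only one that admits solutions (`Known.eq`). The unicity condition does not say this
directly: it speaks of one fixed ground type, while below a `∀` the matched type may vary. Suppose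
there are solutions with two different shapes. They are merged by a map from families to ground
types that commutes with all type constructors. A family whose members have different canonical
shapes is irreducible, so the value of the map there can be prescribed (`exists_hom`). The merged
solution then gives the matched type an arbitrary ground value (`Tri.transfer`), which contradicts
unicity.

Part (i) then uses completeness for a one-point family, and part (ii) for the family of all ground
valuations, in which each type variable names its own irreducible family. -/

noncomputable section

namespace OML

/-! ### Substitution, opening and closing of raw types -/

namespace PreTy

variable {S : Sig}

theorem mem_fvs_con {c : Con S} {ts : Fin c.arity → PreTy S} {a : ℕ} :
    a ∈ (PreTy.con c ts).fvs ↔ ∃ i, a ∈ (ts i).fvs := by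
  simp only [fvs, List.mem_flatten, List.mem_ofFn]
  constructor
  · rintro ⟨_, ⟨i, rfl⟩, h⟩; exact ⟨i, h⟩
  · rintro ⟨i, h⟩; exact ⟨_, ⟨i, rfl⟩, h⟩

theorem mem_occ_con {c : Con S} {ts : Fin c.arity → PreTy S} {a k : ℕ} :
    a ∈ (PreTy.con c ts).occ k ↔ ∃ i, a ∈ (ts i).occ k := by
  simp only [occ, List.mem_flatten, List.mem_ofFn]
  constructor
  · rintro ⟨_, ⟨i, rfl⟩, h⟩; exact ⟨i, h⟩
  · rintro ⟨i, h⟩; exact ⟨_, ⟨i, rfl⟩, h⟩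

theorem subst_congr {θ θ' : ℕ → PreTy S} {t : PreTy S} (h : ∀ a ∈ t.fvs, θ a = θ' a) :
    t.subst θ = t.subst θ' := by
  induction t with
  | fvar a => exact h a (by simp [fvs])
  | bvar k i => rfl
  | con c ts ih =>
    simp only [subst]; congr 1; funext i
    exact ih i fun a ha => h a (mem_fvs_con.2 ⟨i, ha⟩)
  | poly n b ih => simp only [subst]; rw [ih h]

/-- The image of a free variable can be read off at the positions where it occurs. -/
theorem subst_inj_on {θ θ' : ℕ → PreTy S} {t : PreTy S} (h : t.subst θ = t.subst θ') :
    ∀ a ∈ t.fvs, θ a = θ' a := by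
  induction t with
  | fvar a => intro b hb; simp only [fvs, List.mem_singleton] at hb; subst hb; exact h
  | bvar k i => intro b hb; simp [fvs] at hb
  | con c ts ih =>
    intro a ha
    obtain ⟨i, hi⟩ := mem_fvs_con.1 ha
    simp only [subst, PreTy.con.injEq, heq_eq_eq, true_and] at h
    exact ih i (congrFun h i) a hi
  | poly n b ih =>
    simp only [subst, PreTy.poly.injEq, true_and] at h
    exact ih h

theorem subst_fvar (t : PreTy S) : t.subst .fvar = t := by
  induction t with
  | fvar a => rfl
  | bvar k i => rfl
  | con c ts ih => simp only [subst, ih]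
  | poly n b ih => simp only [subst, ih]

theorem subst_subst (θ θ' : ℕ → PreTy S) (t : PreTy S) :
    (t.subst θ).subst θ' = t.subst fun a => (θ a).subst θ' := by
  induction t with
  | fvar a => rfl
  | bvar k i => rfl
  | con c ts ih => simp only [subst, ih]
  | poly n b ih => simp only [subst, ih]

theorem fvs_subst (θ : ℕ → PreTy S) (t : PreTy S) :
    (t.subst θ).fvs = t.fvs.flatMap fun a => (θ a).fvs := by
  induction t with
  | fvar a => simp [subst, fvs]
  | bvar k i => rfl
  | con c ts ih =>
    simp only [subst, fvs, ih, List.flatMap, List.map_flatten, List.flatten_flatten, List.map_ofFn]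
    rfl
  | poly n b ih => exact ih

theorem openAt_of_LC {u : ℕ → PreTy S} {t : PreTy S} {d k : ℕ} (h : t.LC d) (hk : d ≤ k) :
    t.openAt u k = t := by
  induction t generalizing d k with
  | fvar a => rfl
  | bvar j i => simp only [LC] at h; simp only [openAt]; rw [if_neg (by omega)]
  | con c ts ih => simp only [openAt]; congr 1; funext i; exact ih i (h i) hk
  | poly n b ih => simp only [openAt]; rw [ih h.1 (by omega)]

theorem subst_openAt {θ : ℕ → PreTy S} (hθ : ∀ a, (θ a).LC 0) (u : ℕ → PreTy S) (t : PreTy S)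
    (k : ℕ) : (t.openAt u k).subst θ = (t.subst θ).openAt (fun i => (u i).subst θ) k := by
  induction t generalizing k with
  | fvar a => exact (openAt_of_LC (hθ a) (Nat.zero_le _)).symm
  | bvar j i => simp only [openAt, subst]; split <;> rfl
  | con c ts ih => simp only [openAt, subst, ih]
  | poly n b ih => simp only [openAt, subst, ih]

theorem openAt_closeAt (B : Finset ℕ) (f : ℕ → ℕ) (u : ℕ → PreTy S) {t : PreTy S} {k : ℕ}
    (h : t.LC k) : (t.closeAt B f k).openAt u k =
      t.subst fun a => if a ∈ B then u (f a) else .fvar a := by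
  induction t generalizing k with
  | fvar a => simp only [closeAt, subst]; split <;> simp [openAt]
  | bvar j i =>
    simp only [LC] at h; simp only [closeAt, openAt, subst]; rw [if_neg (by omega)]
  | con c ts ih => simp only [closeAt, openAt, subst]; congr 1; funext i; exact ih i (h i)
  | poly n b ih => simp only [closeAt, openAt, subst]; rw [ih h.1]

theorem openAt_congr {u u' : ℕ → PreTy S} {t : PreTy S} {k : ℕ} (h : ∀ i ∈ t.occ k, u i = u' i) :
    t.openAt u k = t.openAt u' k := by
  induction t generalizing k with
  | fvar a => rfl
  | bvar j i =>
    simp only [openAt]; split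
    · rename_i hj; exact h i (by simp [occ, hj])
    · rfl
  | con c ts ih =>
    simp only [openAt]; congr 1; funext i
    exact ih i fun a ha => h a (mem_occ_con.2 ⟨i, ha⟩)
  | poly n b ih => simp only [openAt]; rw [ih h]

/-- Closing after opening with fresh distinct names. -/
theorem closeAt_openAt {B : Finset ℕ} {f : ℕ → ℕ} {r : ℕ → ℕ} {t : PreTy S} {k : ℕ}
    (ho : ∀ i ∈ t.occ k, r i ∈ B ∧ f (r i) = i) (hf : ∀ a ∈ t.fvs, a ∉ B) :
    (t.openAt (fun i => .fvar (r i)) k).closeAt B f k = t := by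
  induction t generalizing k with
  | fvar a => simp only [openAt, closeAt]; rw [if_neg (hf a (by simp [fvs]))]
  | bvar j i =>
    simp only [openAt]; split
    · rename_i hj
      obtain ⟨h1, h2⟩ := ho i (by simp [occ, hj])
      simp only [closeAt]; rw [if_pos h1, h2, hj]
    · rfl
  | con c ts ih =>
    simp only [openAt, closeAt]; congr 1; funext i
    exact ih i (fun a ha => ho a (mem_occ_con.2 ⟨i, ha⟩)) fun a ha => hf a (mem_fvs_con.2 ⟨i, ha⟩)
  | poly n b ih => simp only [openAt, closeAt]; rw [ih ho hf]

/-- The closed variables must be renamed to closed variables with the same number, and the images of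
the others must contain nothing to close. Both renaming of bound variables and capture-avoiding
substitution are of this form. -/
theorem closeAt_subst {B : Finset ℕ} {f : ℕ → ℕ} {B' : Finset ℕ} {f' : ℕ → ℕ}
    {θ : ℕ → PreTy S} {θ' : ℕ → PreTy S} {t : PreTy S} {k : ℕ}
    (hB : ∀ a ∈ t.fvs, a ∈ B → ∃ b, θ a = .fvar b ∧ b ∈ B' ∧ f' b = f a)
    (hn : ∀ a ∈ t.fvs, a ∉ B → θ a = θ' a ∧ ∀ k, (θ a).closeAt B' f' k = θ a) :
    (t.subst θ).closeAt B' f' k = (t.closeAt B f k).subst θ' := by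
  induction t generalizing k with
  | fvar a =>
    by_cases ha : a ∈ B
    · obtain ⟨b, h1, h2, h3⟩ := hB a (by simp [fvs]) ha
      simp [subst, closeAt, ha, h1, h2, h3]
    · obtain ⟨h1, h2⟩ := hn a (by simp [fvs]) ha
      simp only [subst, closeAt]
      rw [if_neg ha, h2]; exact h1
  | bvar j i => rfl
  | con c ts ih =>
    simp only [subst, closeAt]; congr 1; funext i
    exact ih i (fun a ha => hB a (mem_fvs_con.2 ⟨i, ha⟩)) fun a ha => hn a (mem_fvs_con.2 ⟨i, ha⟩)
  | poly n b ih => simp only [subst, closeAt]; rw [ih hB hn]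

theorem closeAt_of_disjoint {B : Finset ℕ} {f : ℕ → ℕ} {t : PreTy S} {k : ℕ}
    (h : ∀ a ∈ t.fvs, a ∉ B) : t.closeAt B f k = t := by
  induction t generalizing k with
  | fvar a => simp only [closeAt]; rw [if_neg (h a (by simp [fvs]))]
  | bvar j i => rfl
  | con c ts ih =>
    simp only [closeAt]; congr 1; funext i
    exact ih i fun a ha => h a (mem_fvs_con.2 ⟨i, ha⟩)
  | poly n b ih => simp only [closeAt]; rw [ih h]

theorem fvs_closeAt (B : Finset ℕ) (f : ℕ → ℕ) (t : PreTy S) (k : ℕ) :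
    (t.closeAt B f k).fvs = t.fvs.filter (· ∉ B) := by
  induction t generalizing k with
  | fvar a => simp only [closeAt, fvs]; split <;> rename_i h <;> simp [fvs, h]
  | bvar j i => rfl
  | con c ts ih =>
    simp only [closeAt, fvs, ih, List.filter_flatten, List.map_ofFn]; rfl
  | poly n b ih => exact ih _

theorem mem_fvs_openAt {u : ℕ → PreTy S} {t : PreTy S} {k a : ℕ} (h : a ∈ (t.openAt u k).fvs) :
    a ∈ t.fvs ∨ ∃ i ∈ t.occ k, a ∈ (u i).fvs := by
  induction t generalizing k with
  | fvar b => exact .inl h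
  | bvar j i =>
    simp only [openAt] at h
    split at h
    · rename_i hj; exact .inr ⟨i, by simp [occ, hj], h⟩
    · simp [fvs] at h
  | con c ts ih =>
    simp only [openAt] at h
    obtain ⟨i, hi⟩ := mem_fvs_con.1 h
    rcases ih i hi with h | ⟨j, hj, hj'⟩
    · exact .inl (mem_fvs_con.2 ⟨i, h⟩)
    · exact .inr ⟨j, mem_occ_con.2 ⟨i, hj⟩, hj'⟩
  | poly n b ih => exact ih h

/-- Locally closed images contribute no bound variables, so neither the scoping nor the order of
occurrences can be repaired by a substitution. -/
theorem LC.of_subst {θ : ℕ → PreTy S} (hθ : ∀ a, (θ a).LC 0) {t : PreTy S} {d : ℕ}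
    (h : (t.subst θ).LC d) : t.LC d := by
  induction t generalizing d with
  | fvar a => trivial
  | bvar j i => exact h
  | con c ts ih => exact fun i => ih i (h i)
  | poly n b ih => exact ⟨ih h.1, by have := h.2; rwa [occ_subst hθ] at this⟩

end PreTy

/-! ### Ranks and numbering by first occurrence -/

theorem mem_take_idxOf {l : List ℕ} {a b : ℕ} (ha : a ∈ l) (hb : b ∈ l) (hab : a ≠ b) :
    a ∈ l.take (l.idxOf b) ∨ b ∈ l.take (l.idxOf a) := by
  have h1 := List.idxOf_lt_length_of_mem ha
  have h2 := List.idxOf_lt_length_of_mem hb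
  have e1 : l[l.idxOf a] = a := List.getElem_idxOf h1
  have e2 : l[l.idxOf b] = b := List.getElem_idxOf h2
  rcases lt_trichotomy (l.idxOf a) (l.idxOf b) with h | h | h
  · left; rw [List.mem_take_iff_getElem]; exact ⟨l.idxOf a, by omega, e1⟩
  · exact absurd (by rw [← e1, ← e2]; simp only [h]) hab
  · right; rw [List.mem_take_iff_getElem]; exact ⟨l.idxOf b, by omega, e2⟩

theorem rank_lt_of_mem_take {l : List ℕ} {a b : ℕ} (h : a ∈ l.take (l.idxOf b)) :
    rank l a < rank l b := by
  obtain ⟨j, hj, hja⟩ := List.mem_take_iff_getElem.1 h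
  have hle : l.idxOf a ≤ j := by
    by_contra hlt
    have := List.not_of_lt_findIdx (p := (· == a)) (xs := l) (i := j)
      (by simpa [List.idxOf] using hlt)
    simp [hja] at this
  unfold rank
  apply Finset.card_lt_card
  refine ⟨?_, ?_⟩
  · intro x hx
    rw [List.mem_toFinset] at hx ⊢
    exact List.mem_of_mem_take (i := l.idxOf a) (by
      rw [List.take_take, min_eq_left (by omega)]; exact hx)
  · intro hsub
    have := hsub (List.mem_toFinset.2 h)
    rw [List.mem_toFinset] at this
    obtain ⟨i, hi, hia⟩ := List.mem_take_iff_getElem.1 this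
    have := List.not_of_lt_findIdx (p := (· == a)) (xs := l) (i := i)
      (by have : i < l.idxOf a := by omega
          simpa [List.idxOf] using this)
    simp [hia] at this

/-- Of two different entries one occurs first, and it is counted in the rank of the other, so the
ranks differ. -/
theorem rank_injOn {l : List ℕ} {a b : ℕ} (ha : a ∈ l) (hb : b ∈ l) (h : rank l a = rank l b) :
    a = b := by
  by_contra hab
  rcases mem_take_idxOf ha hb hab with h' | h' <;> have := rank_lt_of_mem_take h' <;> omega

theorem idxOf_map {l : List ℕ} {r : ℕ → ℕ} {a : ℕ} (hr : ∀ b ∈ l, r b = r a → b = a) :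
    (l.map r).idxOf (r a) = l.idxOf a := by
  induction l with
  | nil => rfl
  | cons b l ih =>
    by_cases hb : b = a
    · subst hb; simp
    · have : r b ≠ r a := fun h => hb (hr b (by simp) h)
      rw [List.map_cons, List.idxOf_cons_ne _ this, List.idxOf_cons_ne _ hb,
        ih fun c hc => hr c (by simp [hc])]

/-- A rank depends only on which entries of the list coincide. This is why generalization does not
depend on the names of the generalized variables. -/
theorem rank_map {l : List ℕ} {r : ℕ → ℕ} {a : ℕ} (ha : a ∈ l)
    (hr : ∀ b ∈ l, ∀ c ∈ l, r b = r c → b = c) : rank (l.map r) (r a) = rank l a := by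
  unfold rank
  rw [idxOf_map fun b hb => hr b hb a ha, ← List.map_take]
  have : (List.map r (l.take (l.idxOf a))).toFinset = ((l.take (l.idxOf a)).toFinset).image r := by
    ext x; simp [-List.map_take]
  rw [this, Finset.card_image_of_injOn]
  intro b hb c hc h
  rw [Finset.mem_coe, List.mem_toFinset] at hb hc
  exact hr b (List.mem_of_mem_take hb) c (List.mem_of_mem_take hc) h

/-- Following predecessors backwards through the list reaches every smaller number. -/
theorem FirstOcc.mem_take {l : List ℕ} (h : FirstOcc l) {i a : ℕ} (hi : l[i]? = some a) {b : ℕ}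
    (hb : b < a) : b ∈ l.take i := by
  induction a generalizing i with
  | zero => omega
  | succ a ih =>
    obtain ⟨j, hj, hja⟩ := h i a hi
    obtain ⟨hj1, hj2⟩ := List.getElem?_eq_some_iff.1 hja
    obtain ⟨hi1, hi2⟩ := List.getElem?_eq_some_iff.1 hi
    rcases Nat.lt_succ_iff_lt_or_eq.1 hb with hb | rfl
    · have := ih hja hb
      exact List.mem_of_mem_take (i := j) (by rwa [List.take_take, min_eq_left hj.le])
    · exact List.mem_take_iff_getElem.2 ⟨j, by omega, hj2⟩

/-- In a list numbered by first occurrence, every number is its own rank. -/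
theorem FirstOcc.rank_eq {l : List ℕ} (h : FirstOcc l) {a : ℕ} (ha : a ∈ l) : rank l a = a := by
  have hlt := List.idxOf_lt_length_of_mem ha
  have ea : l[l.idxOf a] = a := List.getElem_idxOf hlt
  -- Every smaller number occurs before the first `a`, and a larger number there would require an
  -- even earlier `a`.
  have hsub : (l.take (l.idxOf a)).toFinset = Finset.range a := by
    ext b
    rw [List.mem_toFinset, Finset.mem_range]
    constructor
    · intro hb
      by_contra hba
      have hne : b ≠ a := by
        rintro rfl
        obtain ⟨i, hi, hib⟩ := List.mem_take_iff_getElem.1 hb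
        have := List.not_of_lt_findIdx (p := (· == b)) (xs := l) (i := i)
          (by have : i < l.idxOf b := by omega
              simpa [List.idxOf] using this)
        simp [hib] at this
      obtain ⟨i, hi, hib⟩ := List.mem_take_iff_getElem.1 hb
      have := h.mem_take (List.getElem?_eq_some_iff.2 ⟨by omega, hib⟩) (b := a) (by omega)
      obtain ⟨j, hj, hja⟩ := List.mem_take_iff_getElem.1 this
      have := List.not_of_lt_findIdx (p := (· == a)) (xs := l) (i := j)
        (by have : j < l.idxOf a := by omega
            simpa [List.idxOf] using this)
      simp [hja] at this
    · intro hb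
      exact h.mem_take (List.getElem?_eq_some_iff.2 ⟨hlt, ea⟩) hb
  unfold rank
  rw [hsub, Finset.card_range]

/-! ### Well-formed types and their substitutions -/

namespace Ty

variable {S : Sig}

theorem ext {t t' : Ty S} (h : t.1 = t'.1) : t = t' := Subtype.ext h

theorem subst_congr {θ θ' : ℕ → Ty S} {t : Ty S} (h : ∀ a ∈ t.fvs, θ a = θ' a) :
    t.subst θ = t.subst θ' :=
  Ty.ext (PreTy.subst_congr fun a ha => congrArg Subtype.val (h a ha))

theorem subst_inj_on {θ θ' : ℕ → Ty S} {t : Ty S} (h : t.subst θ = t.subst θ') :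
    ∀ a ∈ t.fvs, θ a = θ' a :=
  fun a ha => Ty.ext (PreTy.subst_inj_on (congrArg Subtype.val h) a ha)

theorem subst_var (t : Ty S) : t.subst var = t := Ty.ext (PreTy.subst_fvar t.1)

theorem subst_subst (θ θ' : ℕ → Ty S) (t : Ty S) :
    (t.subst θ).subst θ' = t.subst fun a => (θ a).subst θ' :=
  Ty.ext (PreTy.subst_subst _ _ t.1)

theorem var_subst (θ : ℕ → Ty S) (a : ℕ) : (var a).subst θ = θ a := rfl

theorem fvs_var (a : ℕ) : (var a : Ty S).fvs = [a] := rfl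

theorem var_inj {a b : ℕ} (h : (var a : Ty S) = var b) : a = b := by
  have := congrArg Ty.fvs h
  simpa [fvs_var] using this

theorem fvs_subst (θ : ℕ → Ty S) (t : Ty S) :
    (t.subst θ).fvs = t.fvs.flatMap fun a => (θ a).fvs := PreTy.fvs_subst _ t.1

theorem mem_fvs_subst {θ : ℕ → Ty S} {t : Ty S} {b : ℕ} :
    b ∈ (t.subst θ).fvs ↔ ∃ a ∈ t.fvs, b ∈ (θ a).fvs := by
  rw [fvs_subst, List.mem_flatMap]

theorem mem_fvs_con {c : Con S} {ts : Fin c.arity → Ty S} {a : ℕ} :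
    a ∈ (con c ts).fvs ↔ ∃ i, a ∈ (ts i).fvs := PreTy.mem_fvs_con

theorem con_subst (θ : ℕ → Ty S) (c : Con S) (ts : Fin c.arity → Ty S) :
    (con c ts).subst θ = con c fun i => (ts i).subst θ := rfl

theorem unit_subst (θ : ℕ → Ty S) : (unit : Ty S).subst θ = unit := by
  exact (con_subst _ _ _).trans (congrArg (con .unit) (funext fun i => i.elim0))

theorem arr_subst (θ : ℕ → Ty S) (a b : Ty S) :
    (arr a b).subst θ = arr (a.subst θ) (b.subst θ) := by
  refine (con_subst _ _ _).trans (congrArg (con .arr) (funext fun i => ?_))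
  match i with
  | ⟨0, _⟩ => rfl
  | ⟨1, _⟩ => rfl

theorem prod_subst {n : ℕ} (θ : ℕ → Ty S) (ts : Fin n → Ty S) :
    (prod ts).subst θ = prod fun i => (ts i).subst θ := rfl

theorem rcd_subst (θ : ℕ → Ty S) (T : S.Rec) (ts : Fin (S.arity T) → Ty S) :
    (rcd T ts).subst θ = rcd T fun i => (ts i).subst θ := rfl

theorem mem_fvs_arr {a b : Ty S} {x : ℕ} : x ∈ (arr a b).fvs ↔ x ∈ a.fvs ∨ x ∈ b.fvs := by
  refine Iff.trans mem_fvs_con ?_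
  constructor
  · rintro ⟨⟨i, hi⟩, h⟩
    match i, hi with
    | 0, _ => exact .inl h
    | 1, _ => exact .inr h
  · rintro (h | h)
    · exact ⟨(0 : Fin 2), h⟩
    · exact ⟨(1 : Fin 2), h⟩

theorem poly_subst (θ : ℕ → Ty S) (σ : Scheme S) : (poly σ).subst θ = poly (σ.subst θ) := rfl

end Ty

/-! ### Type schemes: instantiation and generalization -/

namespace Scheme

variable {S : Sig}

theorem ext' {σ σ' : Scheme S} (h₁ : σ.n = σ'.n) (h₂ : σ.body = σ'.body) : σ = σ' := by
  cases σ; cases σ'; simp only at h₁ h₂; subst h₁; subst h₂; rfl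

theorem poly_inj {σ σ' : Scheme S} (h : Ty.poly σ = Ty.poly σ') : σ = σ' := by
  have := congrArg Subtype.val h
  simp only [Ty.poly, PreTy.poly.injEq] at this
  exact ext' this.1 this.2

theorem subst_congr {θ θ' : ℕ → Ty S} {σ : Scheme S} (h : ∀ a ∈ σ.fvs, θ a = θ' a) :
    σ.subst θ = σ.subst θ' :=
  ext' rfl (PreTy.subst_congr fun a ha => congrArg Subtype.val (h a ha))

theorem subst_subst (θ θ' : ℕ → Ty S) (σ : Scheme S) :
    (σ.subst θ).subst θ' = σ.subst fun a => (θ a).subst θ' :=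
  ext' rfl (PreTy.subst_subst _ _ σ.body)

theorem mem_occ {σ : Scheme S} {i : ℕ} : i ∈ σ.body.occ 0 ↔ i < σ.n := σ.lc.2.1 i

theorem inst_congr {u u' : ℕ → Ty S} {σ : Scheme S} (h : ∀ i < σ.n, u i = u' i) :
    σ.inst u = σ.inst u' :=
  Ty.ext (PreTy.openAt_congr fun i hi => congrArg Subtype.val (h i (mem_occ.1 hi)))

theorem inst_subst (θ u : ℕ → Ty S) (σ : Scheme S) :
    (σ.inst u).subst θ = (σ.subst θ).inst fun i => (u i).subst θ :=
  Ty.ext (PreTy.subst_openAt (fun a => (θ a).2) _ σ.body 0)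

/-- Opening undoes closing; `rank` is the number under which a generalized variable was bound. -/
theorem gen_inst (B : Finset ℕ) (t : Ty S) (u : ℕ → Ty S) :
    (gen B t).inst u = t.subst fun a =>
      if a ∈ B then u (rank (t.fvs.filter (· ∈ B)) a) else Ty.var a := by
  refine Ty.ext ((PreTy.openAt_closeAt _ _ _ t.2).trans (PreTy.subst_congr fun a _ => ?_))
  by_cases h : a ∈ B
  · simp only [if_pos h]
  · simp only [if_neg h]; rfl

theorem mono_inst (t : Ty S) (u : ℕ → Ty S) : (mono t).inst u = t :=
  Ty.ext (PreTy.openAt_of_LC t.2 le_rfl)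

theorem mono_subst (t : Ty S) (θ : ℕ → Ty S) : (mono t).subst θ = mono (t.subst θ) := rfl

theorem fvs_gen (B : Finset ℕ) (t : Ty S) : (gen B t).fvs = t.fvs.filter (· ∉ B) :=
  PreTy.fvs_closeAt _ _ _ _

theorem mem_fvs_gen {B : Finset ℕ} {t : Ty S} {a : ℕ} :
    a ∈ (gen B t).fvs ↔ a ∈ t.fvs ∧ a ∉ B := by
  rw [fvs_gen, List.mem_filter]; simp

theorem fvs_subst (θ : ℕ → Ty S) (σ : Scheme S) :
    (σ.subst θ).fvs = σ.fvs.flatMap fun a => (θ a).fvs := PreTy.fvs_subst _ _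

theorem mem_fvs_inst {u : ℕ → Ty S} {σ : Scheme S} {a : ℕ} (h : a ∈ (σ.inst u).fvs) :
    a ∈ σ.fvs ∨ ∃ i < σ.n, a ∈ (u i).fvs := by
  rcases PreTy.mem_fvs_openAt h with h | ⟨i, hi, h⟩
  · exact .inl h
  · exact .inr ⟨i, mem_occ.1 hi, h⟩

theorem gen_empty (t : Ty S) : gen ∅ t = mono t :=
  ext' (by simp [gen, mono]) (PreTy.closeAt_of_disjoint (by simp))

/-- Renaming of the generalized variables. -/
theorem gen_rename {B B' : Finset ℕ} {t : Ty S} {r : ℕ → ℕ}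
    (hinj : ∀ a ∈ t.fvs, ∀ b ∈ t.fvs, r a = r b → a = b)
    (hB : ∀ a ∈ t.fvs, r a ∈ B' ↔ a ∈ B) (hid : ∀ a ∈ t.fvs, a ∉ B → r a = a) :
    gen B' (t.subst fun a => Ty.var (r a)) = gen B t := by
  have hfv : (t.subst fun a => Ty.var (r a)).fvs = t.fvs.map r := by
    rw [Ty.fvs_subst, List.map_eq_flatMap]; rfl
  -- The generalized occurrences are renamed injectively, so neither their count nor their ranks
  -- change.
  have hfilter : (t.subst fun a => Ty.var (r a)).fvs.filter (· ∈ B') =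
      (t.fvs.filter (· ∈ B)).map r := by
    rw [hfv, List.filter_map]
    congr 1
    apply List.filter_congr
    intro a ha
    simp [hB a ha]
  have hinj' : ∀ b ∈ t.fvs.filter (· ∈ B), ∀ c ∈ t.fvs.filter (· ∈ B), r b = r c → b = c :=
    fun b hb c hc => hinj b (List.mem_of_mem_filter hb) c (List.mem_of_mem_filter hc)
  apply ext'
  · simp only [gen]
    rw [hfilter]
    have : ((t.fvs.filter (· ∈ B)).map r).toFinset = (t.fvs.filter (· ∈ B)).toFinset.image r := by
      ext x; simp
    rw [this, Finset.card_image_of_injOn]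
    intro b hb c hc
    exact hinj' b (by simpa using hb) c (by simpa using hc)
  · show (t.subst _).1.closeAt _ _ 0 = t.1.closeAt _ _ 0
    rw [hfilter]
    refine (PreTy.closeAt_subst (B := B) (f := rank (t.fvs.filter (· ∈ B))) (θ' := .fvar)
      ?_ ?_).trans (PreTy.subst_fvar _)
    · intro a ha haB
      exact ⟨r a, rfl, (hB a ha).2 haB, rank_map (by simp [haB]; exact ha) hinj'⟩
    · intro a ha haB
      have e : ((fun a => (Ty.var (r a) : Ty S)) a) = Ty.var a := congrArg Ty.var (hid a ha haB)
      simp only [e]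
      refine ⟨rfl, fun k => ?_⟩
      have : a ∉ B' := by
        have := hB a ha
        rw [hid a ha haB] at this
        exact fun h => haB (this.1 h)
      show PreTy.closeAt _ _ _ (.fvar a) = _
      simp only [PreTy.closeAt]; rw [if_neg this]; rfl

/-- Substitution commutes with generalization when the generalized variables are fresh. -/
theorem gen_subst {B : Finset ℕ} {t : Ty S} {θ : ℕ → Ty S} (hB : ∀ a ∈ B, θ a = Ty.var a)
    (hn : ∀ a, a ∉ B → ∀ b ∈ (θ a).fvs, b ∉ B) :
    (gen B t).subst θ = gen B (t.subst θ) := by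
  -- Variables in `B` are fixed and no other image introduces one, so the sequence of generalized
  -- occurrences, and with it the numbering, is unchanged.
  have hfilter : (t.subst θ).fvs.filter (· ∈ B) = t.fvs.filter (· ∈ B) := by
    rw [Ty.fvs_subst]
    induction t.fvs with
    | nil => rfl
    | cons a l ih =>
      rw [List.flatMap_cons, List.filter_append, ih]
      by_cases ha : a ∈ B
      · rw [hB a ha, Ty.fvs_var]; simp [ha]
      · have : (θ a).fvs.filter (· ∈ B) = [] := by
          rw [List.filter_eq_nil_iff]; intro b hb; simpa using hn a ha b hb
        rw [this]; simp [ha]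
  apply ext'
  · simp only [gen, subst]
    rw [hfilter]
  · show _ = (t.subst θ).1.closeAt _ _ 0
    rw [hfilter]
    refine (PreTy.closeAt_subst ?_ ?_).symm
    · intro a _ haB
      exact ⟨a, by rw [hB a haB]; rfl, haB, rfl⟩
    · intro a _ haB
      exact ⟨rfl, fun k => PreTy.closeAt_of_disjoint (hn a haB)⟩

/-- Every scheme is a generalization of its instance at fresh names. -/
theorem gen_inst_fresh {σ : Scheme S} {N : ℕ} (hN : ∀ a ∈ σ.fvs, a < N) :
    gen ((Finset.range σ.n).image (N + ·)) (σ.inst fun i => Ty.var (N + i)) = σ := by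
  set B := (Finset.range σ.n).image (N + ·) with hBdef
  have hBmem : ∀ a, a ∈ B ↔ ∃ i < σ.n, N + i = a := by intro a; simp [hBdef]
  have hfB : ∀ a ∈ σ.fvs, a ∉ B := by
    intro a ha h
    obtain ⟨i, _, rfl⟩ := (hBmem a).1 h
    have := hN _ ha; omega
  have hfilter : (σ.inst fun i => Ty.var (N + i)).fvs.filter (· ∈ B) =
      (σ.body.occ 0).map (N + ·) := by
    have key : ∀ (b : PreTy S) (k : ℕ), (∀ i ∈ b.occ k, i < σ.n) → (∀ a ∈ b.fvs, a ∉ B) →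
        (b.openAt (fun i => .fvar (N + i)) k).fvs.filter (· ∈ B) = (b.occ k).map (N + ·) := by
      intro b
      induction b with
      | fvar a => intro k _ h; simp [PreTy.openAt, PreTy.fvs, PreTy.occ, h a (by simp [PreTy.fvs])]
      | bvar j i =>
        intro k h _
        by_cases hj : j = k
        · have := (hBmem (N + i)).2 ⟨i, h i (by simp [PreTy.occ, hj]), rfl⟩
          simp [PreTy.openAt, hj, PreTy.fvs, PreTy.occ, this]
        · simp [PreTy.openAt, hj, PreTy.fvs, PreTy.occ]
      | con c ts ih =>
        intro k h h'
        simp only [PreTy.openAt, PreTy.fvs, PreTy.occ, List.filter_flatten, List.map_flatten,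
          List.map_ofFn]
        congr 2; funext i
        exact ih i k (fun a ha => h a (PreTy.mem_occ_con.2 ⟨i, ha⟩))
          fun a ha => h' a (PreTy.mem_fvs_con.2 ⟨i, ha⟩)
      | poly n b ih => intro k h h'; exact ih (k + 1) h h'
    exact key σ.body 0 (fun i hi => mem_occ.1 hi) hfB
  -- The body is already numbered by first occurrence, so ranking the fresh names gives back the
  -- original numbers.
  have hrank : ∀ i ∈ σ.body.occ 0, rank ((σ.body.occ 0).map (N + ·)) (N + i) = i := by
    intro i hi
    rw [rank_map (r := (N + ·)) hi (by intro b _ c _ h; simpa using h), σ.lc.2.2.rank_eq hi]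
  apply ext'
  · simp only [gen]
    rw [hfilter]
    have : ((σ.body.occ 0).map (N + ·)).toFinset = B := by
      ext x; rw [hBmem]; simp [mem_occ]
    rw [this, hBdef, Finset.card_image_of_injective _ (add_right_injective N), Finset.card_range]
  · show (σ.inst _).1.closeAt _ _ 0 = _
    rw [hfilter]
    exact PreTy.closeAt_openAt (r := (N + ·))
      (fun i hi => ⟨(hBmem _).2 ⟨i, mem_occ.1 hi, rfl⟩, hrank i hi⟩) hfB

theorem le_foldr_max (l : List ℕ) (α : ℕ) : α ≤ l.foldr max α ∧ ∀ a ∈ l, a ≤ l.foldr max α := by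
  induction l with
  | nil => simp
  | cons b l ih =>
    simp only [List.foldr_cons, List.mem_cons]
    refine ⟨le_max_of_le_right ih.1, ?_⟩
    rintro a (rfl | h)
    · exact le_max_left _ _
    · exact le_max_of_le_right (ih.2 a h)

theorem all_eq (α : ℕ) (σ : Scheme S) : ∃ N, α < N ∧ (∀ a ∈ σ.fvs, a < N) ∧
    all α σ = gen (insert α ((Finset.range σ.n).image (N + ·))) (σ.inst fun i => Ty.var (N + i)) :=
  ⟨(σ.fvs.foldr max α) + 1, by have := (le_foldr_max σ.fvs α).1; omega,
    fun a ha => by have := (le_foldr_max σ.fvs α).2 a ha; omega, rfl⟩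

/-- Opening `gen B t` at fresh names only renames the variables in `B`, and generalization is blind
to that. Repeated one-variable generalization can thus be handled as generalization over a finite
set. -/
theorem all_gen (α : ℕ) (B : Finset ℕ) (t : Ty S) : all α (gen B t) = gen (insert α B) t := by
  obtain ⟨N, hα, hN, h⟩ := all_eq α (gen B t)
  rw [h, gen_inst]
  set l := t.fvs.filter (· ∈ B) with hl
  -- A generalized variable goes to `N` plus its rank, while the other free variables stay below
  -- `N`; this gives injectivity.
  set r : ℕ → ℕ := fun a => if a ∈ B then N + rank l a else a with hr
  have hlt : ∀ a ∈ t.fvs, a ∈ B → rank l a < (gen B t).n := by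
    intro a ha haB
    have := (canonicalOcc_rank l).1 (rank l a)
    exact this.1 (List.mem_map.2 ⟨a, by simp [hl, ha, haB], rfl⟩)
  have hlN : ∀ a ∈ t.fvs, a ∉ B → a < N := fun a ha haB => hN a (mem_fvs_gen.2 ⟨ha, haB⟩)
  have e : (fun a => if a ∈ B then (Ty.var (N + rank l a) : Ty S) else Ty.var a) =
      fun a => Ty.var (r a) := by
    funext a; simp only [hr]; split <;> rfl
  rw [e]
  apply gen_rename
  · intro a ha b hb hab
    simp only [hr] at hab
    split at hab <;> split at hab
    · rename_i h1 h2
      exact rank_injOn (l := l) (by simp [hl, h1, ha]) (by simp [hl, h2, hb]) (by omega)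
    · rename_i h1 h2; have := hlN b hb h2; omega
    · rename_i h1 h2; have := hlN a ha h1; omega
    · exact hab
  · intro a ha
    simp only [hr, Finset.mem_insert, Finset.mem_image, Finset.mem_range]
    split
    · rename_i h1
      simp only [h1, or_true, iff_true]
      exact .inr ⟨_, hlt a ha h1, rfl⟩
    · rename_i h1
      have := hlN a ha h1
      simp only [h1, or_false]
      constructor
      · rintro (h | ⟨i, _, h⟩)
        · exact h
        · omega
      · exact .inl
  · intro a ha haB
    have : a ∉ B := fun h => haB (Finset.mem_insert_of_mem h)
    simp [hr, this]

/-- Every scheme generalizes a type, away from a given bound on the names. -/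
theorem exists_eq_gen (σ : Scheme S) (M : ℕ) :
    ∃ N, M ≤ N ∧ (∀ a ∈ σ.fvs, a < N) ∧
      gen ((Finset.range σ.n).image (N + ·)) (σ.inst fun i => Ty.var (N + i)) = σ := by
  have h := le_foldr_max σ.fvs M
  have hN : ∀ a ∈ σ.fvs, a < σ.fvs.foldr max M + 1 := fun a ha => by
    have := h.2 a ha; omega
  exact ⟨σ.fvs.foldr max M + 1, by omega, hN, gen_inst_fresh hN⟩

end Scheme

end OML

namespace OML

variable {S : Sig}

/-! ## Ground valuations -/

theorem Ground.ext {g h : Ground S} (e : g.1 = h.1) : g = h := Subtype.ext e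

/-- A ground valuation as a substitution. -/
def gt (v : ℕ → Ground S) : ℕ → Ty S := fun a => (v a).1

/-- The ground unit type. -/
def Ground.unit : Ground S := ⟨Ty.unit, by
  rw [List.eq_nil_iff_forall_not_mem]
  intro a h
  obtain ⟨i, _⟩ := PreTy.mem_fvs_con.1 h
  exact i.elim0⟩

instance : Inhabited (Ground S) := ⟨Ground.unit⟩

/-- The value of a type under a ground valuation. -/
def Ty.ev (v : ℕ → Ground S) (t : Ty S) : Ground S :=
  ⟨t.subst (gt v), PreTy.fvs_subst_eq_nil (fun a => (v a).2) t.1⟩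

theorem Ty.ev_val (v : ℕ → Ground S) (t : Ty S) : (t.ev v).1 = t.subst (gt v) := rfl

theorem Ty.ev_var (v : ℕ → Ground S) (a : ℕ) : (Ty.var a).ev v = v a := rfl

theorem Ty.ev_congr {v v' : ℕ → Ground S} {t : Ty S} (h : ∀ a ∈ t.fvs, v a = v' a) :
    t.ev v = t.ev v' :=
  Ground.ext (Ty.subst_congr fun a ha => congrArg Subtype.val (h a ha))

theorem Ty.ev_subst (v : ℕ → Ground S) (θ : ℕ → Ty S) (t : Ty S) :
    (t.subst θ).ev v = t.ev fun a => (θ a).ev v :=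
  Ground.ext (Ty.subst_subst _ _ _)

theorem Ty.subst_of_closed {t : Ty S} (h : t.fvs = []) (θ : ℕ → Ty S) : t.subst θ = t :=
  (Ty.subst_congr (θ' := Ty.var) (by rw [h]; simp)).trans (Ty.subst_var t)

theorem Ty.ev_ground (v : ℕ → Ground S) (g : Ground S) : g.1.ev v = g :=
  Ground.ext (Ty.subst_of_closed g.2 _)

/-- The ground instances of a scheme. -/
def Scheme.ginst (v : ℕ → Ground S) (σ : Scheme S) : Set (Ground S) :=
  {g | ∃ u : ℕ → Ground S, g.1 = (σ.subst (gt v)).inst (gt u)}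

namespace Scheme

theorem ginst_mono {v : ℕ → Ground S} {t : Ty S} {g : Ground S} :
    g ∈ (mono t).ginst v ↔ g = t.ev v := by
  constructor
  · rintro ⟨u, h⟩
    exact Ground.ext (h.trans (by rw [mono_subst, mono_inst]; rfl))
  · rintro rfl
    exact ⟨fun _ => default, by rw [mono_subst, mono_inst]; rfl⟩

theorem ginst_subst {v : ℕ → Ground S} {θ : ℕ → Ty S} {σ : Scheme S} :
    (σ.subst θ).ginst v = σ.ginst fun a => (θ a).ev v := by
  unfold ginst
  rw [subst_subst]
  rfl

theorem ginst_congr {v v' : ℕ → Ground S} {σ : Scheme S} (h : ∀ a ∈ σ.fvs, v a = v' a) :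
    σ.ginst v = σ.ginst v' := by
  unfold ginst
  rw [subst_congr (θ := gt v) (θ' := gt v') fun a ha => congrArg Subtype.val (h a ha)]

theorem gt_subst (u : ℕ → Ground S) (θ : ℕ → Ty S) (i : ℕ) : (gt u i).subst θ = gt u i :=
  Ty.subst_of_closed (u i).2 θ

theorem subst_inst_gt (v u : ℕ → Ground S) (σ : Scheme S) :
    (σ.inst (gt u)).subst (gt v) = (σ.subst (gt v)).inst (gt u) := by
  rw [inst_subst]; congr 1; funext i; exact gt_subst u _ i

/-- Instantiating a generalization amounts to revaluing the variables in `B`. This uses that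
distinct variables of `B` in `t` have distinct ranks. -/
theorem ginst_gen {v : ℕ → Ground S} {B : Finset ℕ} {t : Ty S} {g : Ground S} :
    g ∈ (gen B t).ginst v ↔ ∃ v' : ℕ → Ground S, (∀ a, a ∉ B → v' a = v a) ∧ g = t.ev v' := by
  constructor
  · rintro ⟨u, h⟩
    rw [← subst_inst_gt, gen_inst, Ty.subst_subst] at h
    refine ⟨fun a => if a ∈ B then u (rank (t.fvs.filter (· ∈ B)) a) else v a,
      fun a ha => if_neg ha, Ground.ext (h.trans (Ty.subst_congr fun a _ => ?_))⟩
    by_cases ha : a ∈ B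
    · simp only [gt, if_pos ha]; exact gt_subst u _ _
    · simp only [gt, if_neg ha]; rfl
  · rintro ⟨v', hv, rfl⟩
    set l := t.fvs.filter (· ∈ B) with hl
    classical
    -- The bound variable number `k` gets the new value of the variable of rank `k`; the default is
    -- for numbers that are not ranks.
    refine ⟨fun k => if h : ∃ a ∈ l, rank l a = k then v' h.choose else default, ?_⟩
    rw [← subst_inst_gt, gen_inst, Ty.subst_subst]
    refine Ty.subst_congr fun a ha => ?_
    by_cases haB : a ∈ B
    · have hal : a ∈ l := by simp [hl, ha, haB]
      have hex : ∃ b ∈ l, rank l b = rank l a := ⟨a, hal, rfl⟩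
      simp only [if_pos haB]
      rw [gt_subst]
      simp only [gt, ← hl, dif_pos hex]
      rw [rank_injOn hex.choose_spec.1 hal hex.choose_spec.2]
    · simp only [if_neg haB, gt, hv a haB]; rfl

/-- Writing the scheme as a generalization over fresh names turns one more quantifier into one more
element of `B`. -/
theorem ginst_all {v : ℕ → Ground S} {α : ℕ} {σ : Scheme S} {g : Ground S} :
    g ∈ (all α σ).ginst v ↔ ∃ h, g ∈ σ.ginst (Function.update v α h) := by
  obtain ⟨N, _, _, hσ⟩ := exists_eq_gen σ 0
  rw [← hσ, all_gen]
  simp only [ginst_gen]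
  constructor
  · rintro ⟨v', hv, rfl⟩
    refine ⟨v' α, v', fun a ha => ?_, rfl⟩
    by_cases h : a = α
    · subst h; simp
    · rw [Function.update_of_ne h]; exact hv a (by simp only [Finset.mem_insert, not_or]; exact ⟨h, ha⟩)
  · rintro ⟨h, v', hv, rfl⟩
    refine ⟨v', fun a ha => ?_, rfl⟩
    simp only [Finset.mem_insert, not_or] at ha
    rw [hv a ha.2, Function.update_of_ne ha.1]

theorem fvs_subst_inst_gt (v u : ℕ → Ground S) (σ : Scheme S) :
    ((σ.subst (gt v)).inst (gt u)).fvs = [] := by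
  rw [List.eq_nil_iff_forall_not_mem]
  intro a h
  rcases mem_fvs_inst h with h | ⟨i, _, h⟩
  · rw [fvs_subst, List.mem_flatMap] at h
    obtain ⟨b, _, hb⟩ := h
    simp only [gt] at hb
    rw [(v b).2] at hb
    simp at hb
  · simp only [gt] at h
    rw [(u i).2] at h
    simp at h

/-- The meaning of `let` demands a nonempty set, and ground types exist to instantiate with. -/
theorem ginst_nonempty (v : ℕ → Ground S) (σ : Scheme S) : (σ.ginst v).Nonempty :=
  ⟨⟨_, fvs_subst_inst_gt v (fun _ => default) σ⟩, fun _ => default, rfl⟩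

end Scheme

/-! ## From the syntax-directed to the declarative system -/

section Declarative

variable {L : LabelEnv S} {KE : ECtx S → Term S → Shape S → Prop}
  {KI : ECtx S → (n : ℕ) → (Fin n → Term S) → Shape S → Prop}

theorem TypingWith.gen_finset {Γ : TyCtx S} {e : Term S} {t : Ty S}
    (h : TypingWith L KE KI Γ e (.mono t)) {B : Finset ℕ} (hB : ∀ α ∈ B, TyCtx.Fresh α Γ) :
    TypingWith L KE KI Γ e (.gen B t) := by
  induction B using Finset.induction_on with
  | empty => rw [Scheme.gen_empty]; exact h
  | insert α B _ ih =>
    rw [← Scheme.all_gen]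
    exact .gen α (ih fun β hβ => hB β (Finset.mem_insert_of_mem hβ)) (hB α (Finset.mem_insert_self _ _))

/-- The instantiation rule substitutes one variable at a time. This equals the simultaneous
substitution because the images avoid `B`. -/
theorem TypingWith.inst_gen {Γ : TyCtx S} {e : Term S} {B : Finset ℕ} {θ : ℕ → Ty S} :
    ∀ {t : Ty S}, TypingWith L KE KI Γ e (.gen B t) →
      (∀ α ∈ B, ∀ b ∈ (θ α).fvs, b ∉ B) →
      TypingWith L KE KI Γ e (.mono (t.subst fun a => if a ∈ B then θ a else Ty.var a)) := by
  induction B using Finset.induction_on with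
  | empty => intro t h _; simpa [Scheme.gen_empty, Ty.subst_var] using h
  | insert α B hα ih =>
    intro t h hθ
    rw [← Scheme.all_gen] at h
    have h1 := h.inst α (θ α)
    rw [Scheme.gen_subst] at h1
    · have h2 := ih h1 fun β hβ b hb h => hθ β (Finset.mem_insert_of_mem hβ) b hb
        (Finset.mem_insert_of_mem h)
      rw [Ty.subst_subst] at h2
      convert h2 using 3
      funext a
      by_cases ha : a = α
      · subst ha
        simp only [Finset.mem_insert_self, if_true, Function.update_self]
        refine ((Ty.subst_congr fun b hb => ?_).trans (Ty.subst_var _)).symm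
        rw [if_neg fun h => hθ a (Finset.mem_insert_self _ _) b hb (Finset.mem_insert_of_mem h)]
      · rw [Function.update_of_ne ha, Ty.var_subst]
        simp [Finset.mem_insert, ha]
    · intro a ha
      exact Function.update_of_ne (fun h : a = α => hα (by rw [← h]; exact ha)) _ _
    · intro a ha b hb
      by_cases h : a = α
      · subst h
        rw [Function.update_self] at hb
        exact fun h => hθ a (Finset.mem_insert_self _ _) b hb (Finset.mem_insert_of_mem h)
      · rw [Function.update_of_ne h, Ty.fvs_var, List.mem_singleton] at hb
        subst hb; exact ha

/-- The bound variables are first named beyond all variables of `u`, which is the side condition of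
`inst_gen`. -/
theorem TypingWith.inst_mono {Γ : TyCtx S} {e : Term S} {σ : Scheme S}
    (h : TypingWith L KE KI Γ e σ) (u : ℕ → Ty S) : TypingWith L KE KI Γ e (.mono (σ.inst u)) := by
  obtain ⟨M, hM⟩ : ∃ M, ∀ j < σ.n, ∀ a ∈ (u j).fvs, a < M := by
    refine ⟨(Finset.range σ.n).sup fun j => (u j).fvs.foldr max 0 + 1, fun j hj a ha => ?_⟩
    have h1 := Finset.le_sup (f := fun j => (u j).fvs.foldr max 0 + 1) (Finset.mem_range.2 hj)
    have h2 := (Scheme.le_foldr_max (u j).fvs 0).2 a ha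
    omega
  obtain ⟨N, hN, hfv, hσ⟩ := Scheme.exists_eq_gen σ M
  rw [← hσ] at h
  have h1 := h.inst_gen (θ := fun a => u (a - N)) (by
    intro α hα b hb hb'
    simp only [Finset.mem_image, Finset.mem_range] at hα hb'
    obtain ⟨i, hi, rfl⟩ := hα
    obtain ⟨j, hj, rfl⟩ := hb'
    have := hM _ (by simpa using hi) _ hb
    omega)
  rw [Scheme.inst_subst] at h1
  have e1 : σ.subst (fun a => if a ∈ (Finset.range σ.n).image (N + ·) then u (a - N) else Ty.var a)
      = σ := by
    refine (Scheme.subst_congr (θ' := Ty.var) fun a ha => ?_).trans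
      (Scheme.ext' rfl (PreTy.subst_fvar _))
    have := hfv a ha
    rw [if_neg]
    simp only [Finset.mem_image, Finset.mem_range, not_exists, not_and]
    intro x _; omega
  rw [e1] at h1
  convert h1 using 2
  refine Scheme.inst_congr fun i hi => ?_
  rw [Ty.var_subst, if_pos (Finset.mem_image.2 ⟨i, Finset.mem_range.2 hi, rfl⟩)]
  simp

theorem SDTyping.typingWith {Γ : TyCtx S} {e : Term S} {t : Ty S} (h : SDTyping L Γ e t) :
    TypingWith L KE KI Γ e (.mono t) := by
  induction h with
  | var u h => exact (TypingWith.var h).inst_mono u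
  | lam _ ih => exact .lam ih
  | app _ _ ih₁ ih₂ => exact .app ih₁ ih₂
  | unit => exact .unit
  | letE B _ hB _ ih₁ ih₂ => exact .letE (ih₁.gen_finset hB) ih₂
  | annot θ _ ih => exact .annot θ ih
  | tuple _ ih => exact .tuple ih
  | projX j _ ih => exact .projX j ih
  | boxX θ B _ hB he ih => exact .boxX θ (he ▸ ih.gen_finset hB)
  | unboxX θ u _ ih => exact (TypingWith.unboxX θ ih).inst_mono u
  | recordX h₁ h₂ _ ih => exact .recordX h₁ h₂ ih
  | recordClosed h _ ih => exact .recordClosed h ih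
  | fieldX h _ ih => exact .fieldX h ih
  | fieldClosed h _ ih => exact .fieldClosed h ih
  | hole t _ ih => exact .hole t ih

end Declarative

/-! ## Ground semantics of terms -/

/-- The ground types of a term, given sets of ground types for the term variables. The
proposition `m` tells whether the implicit constructs are read as typed holes or are untypable. -/
def tsem (m : Prop) (L : LabelEnv S) : Term S → (ℕ → Set (Ground S)) → Ground S → Prop
  | .var x, ρ, g => g ∈ ρ x
  | .unit, _, g => g.1 = .unit
  | .lam x e, ρ, g => ∃ t₁ t₂ : Ground S,
      g.1 = .arr t₁.1 t₂.1 ∧ tsem m L e (Function.update ρ x {t₁}) t₂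
  | .app e₁ e₂, ρ, g => ∃ t h : Ground S,
      tsem m L e₁ ρ h ∧ h.1 = .arr t.1 g.1 ∧ tsem m L e₂ ρ t
  -- Any nonempty set of values may be bound, as in the rule for `letC`; since the meaning is
  -- monotone this is no more liberal than binding all values.
  | .letE x e₁ e₂, ρ, g => ∃ G : Set (Ground S), (∀ h ∈ G, tsem m L e₁ ρ h) ∧ G.Nonempty ∧
      tsem m L e₂ (Function.update ρ x G) g
  | .annot e a, ρ, g => ∃ u : ℕ → Ground S, tsem m L e ρ (a.ty.ev u) ∧ g = a.ty.ev u
  | .tuple (n := n) es, ρ, g => ∃ gs : Fin n → Ground S,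
      g.1 = .prod (fun i => (gs i).1) ∧ ∀ i, tsem m L (es i) ρ (gs i)
  | .proj e _, ρ, _ => m ∧ ∃ h, tsem m L e ρ h
  | .projX e n j, ρ, g => ∃ (gs : Fin n → Ground S) (h : Ground S), tsem m L e ρ h ∧
      h.1 = .prod (fun i => (gs i).1) ∧ ∃ hj : j < n, g = gs ⟨j, hj⟩
  | .box e, ρ, _ => m ∧ ∃ h, tsem m L e ρ h
  | .boxX e a, ρ, g => ∃ u : ℕ → Ground S, (∀ h ∈ a.sch.ginst u, tsem m L e ρ h) ∧
      g.1 = .poly (a.sch.subst (gt u))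
  | .unbox e, ρ, _ => m ∧ ∃ h, tsem m L e ρ h
  | .unboxX e a, ρ, g => ∃ (u : ℕ → Ground S) (h : Ground S), tsem m L e ρ h ∧
      h.1 = .poly (a.sch.subst (gt u)) ∧ g ∈ a.sch.ginst u
  | .record (n := n) ls es, ρ, g =>
      (∃ T, L.LabsUni (Set.range ls) T ∧ L.dom T = Set.range ls ∧ ∃ gs : Fin (n + 1) → Ground S,
        (∀ i, L.LabInst (ls i) T g.1 (gs i).1) ∧ ∀ i, tsem m L (es i) ρ (gs i)) ∨
      ((¬ ∃ T, L.LabsUni (Set.range ls) T) ∧ m ∧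
        ∃ gs : Fin (n + 1) → Ground S, ∀ i, tsem m L (es i) ρ (gs i))
  | .recordX T (n := n) ls es, ρ, g => L.dom T = Set.range ls ∧ ∃ gs : Fin (n + 1) → Ground S,
      (∀ i, L.LabInst (ls i) T g.1 (gs i).1) ∧ ∀ i, tsem m L (es i) ρ (gs i)
  | .field e l, ρ, g =>
      (∃ T, L.LabUni l T ∧ ∃ h : Ground S, tsem m L e ρ h ∧ L.LabInst l T h.1 g.1) ∨
      ((¬ ∃ T, L.LabUni l T) ∧ m ∧ ∃ h, tsem m L e ρ h)
  | .fieldX e T l, ρ, g => ∃ h : Ground S, tsem m L e ρ h ∧ L.LabInst l T h.1 g.1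
  | .hole (n := n) es, ρ, _ => ∃ gs : Fin n → Ground S, ∀ i, tsem m L (es i) ρ (gs i)

theorem update_subset {ρ ρ' : ℕ → Set (Ground S)} {x : ℕ} {s : Set ℕ}
    (h : ∀ y ∈ s \ {x}, ρ y ⊆ ρ' y) (G : Set (Ground S)) :
    ∀ y ∈ s, Function.update ρ x G y ⊆ Function.update ρ' x G y := by
  intro y hy
  by_cases hyx : y = x
  · subst hyx; simp
  · simp only [Function.update_of_ne hyx]; exact h y ⟨hy, hyx⟩

/-- The semantics is monotone in the values of the free term variables. -/
theorem tsem_mono {m : Prop} {L : LabelEnv S} {e : Term S} {ρ ρ' : ℕ → Set (Ground S)}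
    {g : Ground S} (h : ∀ x ∈ e.fv, ρ x ⊆ ρ' x) (hg : tsem m L e ρ g) : tsem m L e ρ' g := by
  induction e generalizing ρ ρ' g with
  | var x => exact h x rfl hg
  | unit => exact hg
  | lam x e ih =>
    obtain ⟨t₁, t₂, h1, h2⟩ := hg
    exact ⟨t₁, t₂, h1, ih (update_subset h _) h2⟩
  | app e₁ e₂ ih₁ ih₂ =>
    obtain ⟨t, k, h1, h2, h3⟩ := hg
    exact ⟨t, k, ih₁ (fun x hx => h x (.inl hx)) h1, h2, ih₂ (fun x hx => h x (.inr hx)) h3⟩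
  | letE x e₁ e₂ ih₁ ih₂ =>
    obtain ⟨G, h1, h2, h3⟩ := hg
    exact ⟨G, fun k hk => ih₁ (fun x hx => h x (.inl hx)) (h1 k hk), h2,
      ih₂ (update_subset (fun x hx => h x (.inr hx)) G) h3⟩
  | annot e a ih => obtain ⟨u, h1, h2⟩ := hg; exact ⟨u, ih h h1, h2⟩
  | tuple es ih =>
    obtain ⟨gs, h1, h2⟩ := hg
    exact ⟨gs, h1, fun i => ih i (fun x hx => h x (Set.mem_iUnion.2 ⟨i, hx⟩)) (h2 i)⟩
  | proj e j ih => exact ⟨hg.1, hg.2.imp fun k => ih h⟩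
  | projX e n j ih => obtain ⟨gs, k, h1, h2⟩ := hg; exact ⟨gs, k, ih h h1, h2⟩
  | box e ih => exact ⟨hg.1, hg.2.imp fun k => ih h⟩
  | boxX e a ih => obtain ⟨u, h1, h2⟩ := hg; exact ⟨u, fun k hk => ih h (h1 k hk), h2⟩
  | unbox e ih => exact ⟨hg.1, hg.2.imp fun k => ih h⟩
  | unboxX e a ih => obtain ⟨u, k, h1, h2⟩ := hg; exact ⟨u, k, ih h h1, h2⟩
  | record ls es ih =>
    rcases hg with ⟨T, h1, h2, gs, h3, h4⟩ | ⟨h1, h2, gs, h3⟩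
    · exact .inl ⟨T, h1, h2, gs, h3,
        fun i => ih i (fun x hx => h x (Set.mem_iUnion.2 ⟨i, hx⟩)) (h4 i)⟩
    · exact .inr ⟨h1, h2, gs, fun i => ih i (fun x hx => h x (Set.mem_iUnion.2 ⟨i, hx⟩)) (h3 i)⟩
  | recordX T ls es ih =>
    obtain ⟨h2, gs, h3, h4⟩ := hg
    exact ⟨h2, gs, h3, fun i => ih i (fun x hx => h x (Set.mem_iUnion.2 ⟨i, hx⟩)) (h4 i)⟩
  | field e l ih =>
    rcases hg with ⟨T, h1, k, h2, h3⟩ | ⟨h1, h2, k, h3⟩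
    · exact .inl ⟨T, h1, k, ih h h2, h3⟩
    · exact .inr ⟨h1, h2, k, ih h h3⟩
  | fieldX e T l ih => obtain ⟨k, h1, h2⟩ := hg; exact ⟨k, ih h h1, h2⟩
  | hole es ih =>
    obtain ⟨gs, h2⟩ := hg
    exact ⟨gs, fun i => ih i (fun x hx => h x (Set.mem_iUnion.2 ⟨i, hx⟩)) (h2 i)⟩

theorem tsem_closed {m : Prop} {L : LabelEnv S} {e : Term S} (he : e.Closed)
    (ρ ρ' : ℕ → Set (Ground S)) {g : Ground S} (hg : tsem m L e ρ g) : tsem m L e ρ' g :=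
  tsem_mono (fun x hx => by rw [he] at hx; exact hx.elim) hg

/-- Reading implicit constructs as holes is the same as erasing them. -/
theorem tsem_erase {L : LabelEnv S} {e : Term S} {ρ : ℕ → Set (Ground S)} {g : Ground S} :
    tsem False L (e.erase L) ρ g ↔ tsem True L e ρ g := by
  have hole1 : ∀ {P : Ground S → Prop}, (∃ gs : Fin 1 → Ground S, ∀ i, P (gs i)) ↔
      (True ∧ ∃ h, P h) := by
    intro P
    exact ⟨fun ⟨gs, h⟩ => ⟨trivial, gs 0, h 0⟩, fun ⟨_, g, h⟩ => ⟨fun _ => g, fun _ => h⟩⟩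
  induction e generalizing ρ g with
  | var x => rfl
  | unit => rfl
  | lam x e ih => simp only [Term.erase, tsem, ih]
  | app e₁ e₂ ih₁ ih₂ => simp only [Term.erase, tsem, ih₁, ih₂]
  | letE x e₁ e₂ ih₁ ih₂ => simp only [Term.erase, tsem, ih₁, ih₂]
  | annot e a ih => simp only [Term.erase, tsem, ih]
  | tuple es ih => simp only [Term.erase, tsem, ih]
  | proj e j ih => simp only [Term.erase, tsem, ih]; exact hole1 (P := fun h => tsem True L e ρ h)
  | projX e n j ih => simp only [Term.erase, tsem, ih]
  | box e ih => simp only [Term.erase, tsem, ih]; exact hole1 (P := fun h => tsem True L e ρ h)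
  | boxX e a ih => simp only [Term.erase, tsem, ih]
  | unbox e ih => simp only [Term.erase, tsem, ih]; exact hole1 (P := fun h => tsem True L e ρ h)
  | unboxX e a ih => simp only [Term.erase, tsem, ih]
  | record ls es ih =>
    by_cases h : ∃ T, L.LabsUni (Set.range ls) T
    · rw [Term.erase, if_pos h]
      simp only [tsem, ih]
      simp only [h, not_true_eq_false, false_and, or_false]
    · have h' : ∀ T, ¬ L.LabsUni (Set.range ls) T := fun T hT => h ⟨T, hT⟩
      simp only [Term.erase, if_neg h, tsem, ih]
      simp [h']
  | recordX T ls es ih => simp only [Term.erase, tsem, ih]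
  | field e l ih =>
    by_cases h : ∃ T, L.LabUni l T
    · rw [Term.erase, if_pos h]
      simp only [tsem, ih]
      simp only [h, not_true_eq_false, false_and, or_false]
    · have h' : ∀ T, ¬ L.LabUni l T := fun T hT => h ⟨T, hT⟩
      simp only [Term.erase, if_neg h, tsem, ih]
      refine (hole1 (P := fun h => tsem True L e ρ h)).trans ?_
      simp [h']
  | fieldX e T l ih => simp only [Term.erase, tsem, ih]
  | hole es ih => simp only [Term.erase, tsem, ih]

/-- The proposition `m` only occurs as a positive conjunct. -/
theorem tsem_weaken {m : Prop} {L : LabelEnv S} {e : Term S} {ρ : ℕ → Set (Ground S)}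
    {g : Ground S} (hg : tsem False L e ρ g) : tsem m L e ρ g := by
  induction e generalizing ρ g with
  | var x => exact hg
  | unit => exact hg
  | lam x e ih => obtain ⟨t₁, t₂, h1, h2⟩ := hg; exact ⟨t₁, t₂, h1, ih h2⟩
  | app e₁ e₂ ih₁ ih₂ => obtain ⟨t, k, h1, h2, h3⟩ := hg; exact ⟨t, k, ih₁ h1, h2, ih₂ h3⟩
  | letE x e₁ e₂ ih₁ ih₂ =>
    obtain ⟨G, h1, h2, h3⟩ := hg; exact ⟨G, fun k hk => ih₁ (h1 k hk), h2, ih₂ h3⟩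
  | annot e a ih => obtain ⟨u, h1, h2⟩ := hg; exact ⟨u, ih h1, h2⟩
  | tuple es ih => obtain ⟨gs, h1, h2⟩ := hg; exact ⟨gs, h1, fun i => ih i (h2 i)⟩
  | proj e j ih => exact hg.1.elim
  | projX e n j ih => obtain ⟨gs, k, h1, h2⟩ := hg; exact ⟨gs, k, ih h1, h2⟩
  | box e ih => exact hg.1.elim
  | boxX e a ih => obtain ⟨u, h1, h2⟩ := hg; exact ⟨u, fun k hk => ih (h1 k hk), h2⟩
  | unbox e ih => exact hg.1.elim
  | unboxX e a ih => obtain ⟨u, k, h1, h2⟩ := hg; exact ⟨u, k, ih h1, h2⟩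
  | record ls es ih =>
    rcases hg with ⟨T, h1, h2, gs, h3, h4⟩ | ⟨h1, h2, gs, h3⟩
    · exact .inl ⟨T, h1, h2, gs, h3, fun i => ih i (h4 i)⟩
    · exact h2.elim
  | recordX T ls es ih => obtain ⟨h2, gs, h3, h4⟩ := hg; exact ⟨h2, gs, h3, fun i => ih i (h4 i)⟩
  | field e l ih =>
    rcases hg with ⟨T, h1, k, h2, h3⟩ | ⟨h1, h2, k, h3⟩
    · exact .inl ⟨T, h1, k, ih h2, h3⟩
    · exact h2.elim
  | fieldX e T l ih => obtain ⟨k, h1, h2⟩ := hg; exact ⟨k, ih h1, h2⟩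
  | hole es ih => obtain ⟨gs, h2⟩ := hg; exact ⟨gs, fun i => ih i (h2 i)⟩

/-! ## Soundness -/

/-- The sets of ground types that a typing context assigns to the term variables. -/
def ctxSem (Γ : TyCtx S) (v : ℕ → Ground S) (x : ℕ) : Set (Ground S) :=
  {g | ∃ σ, Γ.lookup x = some σ ∧ g ∈ σ.ginst v}

theorem ctxSem_cons (Γ : TyCtx S) (v : ℕ → Ground S) (x : ℕ) (σ : Scheme S) :
    ctxSem ((x, σ) :: Γ) v = Function.update (ctxSem Γ v) x (σ.ginst v) := by
  funext y
  by_cases h : y = x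
  · subst h
    simp [ctxSem, List.lookup]
  · have : (y == x) = false := by simpa using h
    rw [Function.update_of_ne h]
    simp [ctxSem, List.lookup, this]

theorem mem_of_lookup {Γ : TyCtx S} {x : ℕ} {σ : Scheme S} (h : Γ.lookup x = some σ) :
    (x, σ) ∈ Γ := by
  induction Γ with
  | nil => simp at h
  | cons p Γ ih =>
    obtain ⟨y, τ⟩ := p
    by_cases hxy : x = y
    · subst hxy
      simp [List.lookup] at h
      simp [h]
    · have : (x == y) = false := by simpa using hxy
      simp [List.lookup, this] at h
      exact List.mem_cons_of_mem _ (ih h)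

theorem ctxSem_congr {Γ : TyCtx S} {v v' : ℕ → Ground S}
    (h : ∀ p ∈ Γ, ∀ a ∈ p.2.fvs, v a = v' a) : ctxSem Γ v = ctxSem Γ v' := by
  funext x
  ext g
  constructor
  · rintro ⟨σ, h1, h2⟩
    exact ⟨σ, h1, by rwa [← Scheme.ginst_congr (h _ (mem_of_lookup h1))]⟩
  · rintro ⟨σ, h1, h2⟩
    exact ⟨σ, h1, by rwa [Scheme.ginst_congr (h _ (mem_of_lookup h1))]⟩

theorem LabelEnv.LabInst.subst {L : LabelEnv S} {l : S.Lab} {T : S.Rec} {a b : Ty S}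
    (h : L.LabInst l T a b) (θ : ℕ → Ty S) : L.LabInst l T (a.subst θ) (b.subst θ) := by
  obtain ⟨t, h1, η, rfl, rfl⟩ := h
  exact ⟨t, h1, fun i => (η i).subst θ, Ty.rcd_subst _ _ _, Ty.subst_subst _ _ _⟩

theorem ginst_mono_eq (t : Ty S) (v : ℕ → Ground S) : (Scheme.mono t).ginst v = {t.ev v} := by
  ext g; exact Scheme.ginst_mono

/-- The context is valued together with the type. Generalizing over a variable that is fresh for the
context lets its value vary without changing the context, and instantiating selects a value
(`Scheme.ginst_all`). -/
theorem TypingWith.sound {L : LabelEnv S} {Γ : TyCtx S} {e : Term S} {σ : Scheme S}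
    (h : RobustTyping L Γ e σ) :
    ∀ v : ℕ → Ground S, ∀ g ∈ σ.ginst v, tsem False L e (ctxSem Γ v) g := by
  unfold RobustTyping at h
  induction h with
  | var h => exact fun v g hg => ⟨_, h, hg⟩
  | @lam Γ x e t₁ t₂ _ ih =>
    intro v g hg
    rw [Scheme.ginst_mono] at hg
    subst hg
    refine ⟨t₁.ev v, t₂.ev v, Ty.arr_subst _ _ _, ?_⟩
    have := ih v (t₂.ev v) (Scheme.ginst_mono.2 rfl)
    rwa [ctxSem_cons, ginst_mono_eq] at this
  | @app Γ e₁ e₂ t₁ t₂ _ _ ih₁ ih₂ =>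
    intro v g hg
    rw [Scheme.ginst_mono] at hg
    subst hg
    exact ⟨t₁.ev v, _, ih₁ v _ (Scheme.ginst_mono.2 rfl), Ty.arr_subst _ _ _,
      ih₂ v _ (Scheme.ginst_mono.2 rfl)⟩
  | unit =>
    intro v g hg
    rw [Scheme.ginst_mono] at hg
    subst hg
    exact Ty.unit_subst _
  | @gen Γ e σ α _ hα ih =>
    intro v g hg
    obtain ⟨k, hk⟩ := Scheme.ginst_all.1 hg
    have := ih _ g hk
    rwa [ctxSem_congr] at this
    intro p hp a ha
    exact Function.update_of_ne (by rintro rfl; exact hα p hp ha) _ _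
  | @inst Γ e σ α t _ ih =>
    intro v g hg
    refine ih v g (Scheme.ginst_all.2 ⟨t.ev v, ?_⟩)
    rw [Scheme.ginst_subst] at hg
    convert hg using 2
    funext a
    by_cases h : a = α
    · subst h; simp
    · rw [Function.update_of_ne h, Function.update_of_ne h]; rfl
  | @letE Γ x e₁ e₂ σ t _ _ ih₁ ih₂ =>
    intro v g hg
    -- The set bound to `x` is that of all ground instances of its scheme.
    refine ⟨σ.ginst v, ih₁ v, Scheme.ginst_nonempty v σ, ?_⟩
    have := ih₂ v g hg
    rwa [ctxSem_cons] at this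
  | @annot Γ e a θ _ ih =>
    intro v g hg
    have := ih v g hg
    rw [Scheme.ginst_mono, Ty.ev_subst] at hg
    subst hg
    exact ⟨_, this, rfl⟩
  | @tuple Γ n es ts _ ih =>
    intro v g hg
    rw [Scheme.ginst_mono] at hg
    subst hg
    exact ⟨fun i => (ts i).ev v, Ty.prod_subst _ _, fun i => ih i v _ (Scheme.ginst_mono.2 rfl)⟩
  | @projX Γ e n ts j _ ih =>
    intro v g hg
    rw [Scheme.ginst_mono] at hg
    subst hg
    exact ⟨fun i => (ts i).ev v, _, ih v _ (Scheme.ginst_mono.2 rfl), Ty.prod_subst _ _, j.2, rfl⟩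
  | @boxX Γ e a θ _ ih =>
    intro v g hg
    rw [Scheme.ginst_mono] at hg
    subst hg
    refine ⟨fun i => (θ i).ev v, fun k hk => ih v k (by rwa [Scheme.ginst_subst]), ?_⟩
    rw [Ty.ev_val, Ty.poly_subst, Scheme.subst_subst]; rfl
  | @unboxX Γ e a θ _ ih =>
    intro v g hg
    rw [Scheme.ginst_subst] at hg
    refine ⟨_, _, ih v _ (Scheme.ginst_mono.2 rfl), ?_, hg⟩
    rw [Ty.ev_val, Ty.poly_subst, Scheme.subst_subst]; rfl
  | @recordX Γ T n ls es t ts h₁ h₂ _ ih =>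
    intro v g hg
    rw [Scheme.ginst_mono] at hg
    subst hg
    exact ⟨h₁, fun i => (ts i).ev v, fun i => (h₂ i).subst _,
      fun i => ih i v _ (Scheme.ginst_mono.2 rfl)⟩
  | @recordClosed Γ T n ls es t h₁ _ ih =>
    intro v g hg
    exact .inl ⟨T, h₁, ih v g hg⟩
  | @fieldX Γ e T l t₁ t₂ h _ ih =>
    intro v g hg
    rw [Scheme.ginst_mono] at hg
    subst hg
    exact ⟨t₁.ev v, ih v _ (Scheme.ginst_mono.2 rfl), h.subst _⟩
  | @fieldClosed Γ e T l t h _ ih =>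
    intro v g hg
    exact .inl ⟨T, h, ih v g hg⟩
  | @hole Γ n es ts t _ ih =>
    intro v g _
    exact ⟨fun i => (ts i).ev v, fun i => ih i v _ (Scheme.ginst_mono.2 rfl)⟩
  | projI _ _ h => exact h.elim
  | boxI _ _ h => exact h.elim
  | unboxI _ _ h => exact h.elim
  | recordI _ _ h => exact h.elim
  | fieldI _ _ h => exact h.elim

end OML

namespace OML

variable {S : Sig}

/-! ## Families of ground types -/

/-- The number of nodes. -/
def PreTy.size : PreTy S → ℕ
  | .fvar _ => 1
  | .bvar _ _ => 1
  | .con _ ts => 1 + ∑ i, (ts i).size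
  | .poly _ b => 1 + b.size

theorem PreTy.size_le_subst {θ : ℕ → PreTy S} {t : PreTy S} {a : ℕ} (h : a ∈ t.fvs) :
    (θ a).size ≤ (t.subst θ).size := by
  induction t with
  | fvar b => simp only [fvs, List.mem_singleton] at h; subst h; exact le_rfl
  | bvar k i => simp [fvs] at h
  | con c ts ih =>
    obtain ⟨i, hi⟩ := mem_fvs_con.1 h
    have h1 := ih i hi
    have h2 := Finset.single_le_sum (f := fun i => ((ts i).subst θ).size) (fun _ _ => Nat.zero_le _)
      (Finset.mem_univ i)
    simp only [subst, size]
    exact (h1.trans h2).trans (Nat.le_add_left _ _)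
  | poly n b ih => simp only [subst, size]; have := ih h; omega

/-- The measure for decomposing families: the components below a non-trivial form are strictly
smaller. -/
theorem Ty.size_lt_subst {θ : ℕ → Ty S} {t : Ty S} {a : ℕ} (h : a ∈ t.fvs)
    (hv : ∀ b, t ≠ Ty.var b) : (θ a).1.size < (t.subst θ).1.size := by
  obtain ⟨t, ht⟩ := t
  cases t with
  | fvar b => exact (hv b rfl).elim
  | bvar k i => simp only [PreTy.LC] at ht; omega
  | con c ts =>
    obtain ⟨i, hi⟩ := PreTy.mem_fvs_con.1 h
    have h1 := PreTy.size_le_subst (θ := fun a => (θ a).1) hi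
    have h2 := Finset.single_le_sum (f := fun i => ((ts i).subst fun a => (θ a).1).size)
      (fun _ _ => Nat.zero_le _) (Finset.mem_univ i)
    show (θ a).1.size < 1 + _
    exact Nat.lt_of_lt_of_le (Nat.lt_succ_of_le (h1.trans h2)) (by rw [Nat.add_comm])
  | poly n b =>
    have h1 := PreTy.size_le_subst (θ := fun a => (θ a).1) (t := b) h
    show (θ a).1.size < 1 + (b.subst fun a => (θ a).1).size
    omega

/-- A family of ground types is irreducible if its members have no common non-trivial shape. -/
def Irred {I : Type} (f : I → Ground S) : Prop :=
  ∀ (t : Ty S) (w : I → ℕ → Ground S), (∀ i, t.ev (w i) = f i) → ∃ a, t = Ty.var a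

/-- A common form of the pulled-back family is one of the original family, by way of a section of
`π`. -/
theorem Irred.comp {I J : Type} {f : I → Ground S} (h : Irred f) {π : J → I}
    (hπ : Function.Surjective π) : Irred (f ∘ π) := by
  intro t w hw
  refine h t (fun i => w (hπ i).choose) fun i => ?_
  rw [hw, Function.comp, (hπ i).choose_spec]

/-- A family that takes the values `1` and `1 → 1` is irreducible. -/
theorem irred_of_surjective {I : Type} {f : I → Ground S} (hf : Function.Surjective f) :
    Irred f := by
  intro t w hw
  obtain ⟨i, hi⟩ := hf Ground.unit
  obtain ⟨j, hj⟩ := hf ((Ty.arr (Ty.var 0) (Ty.var 0)).ev fun _ => Ground.unit)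
  have h1 := congrArg (fun g : Ground S => g.1.1) ((hw i).trans hi)
  have h2 := congrArg (fun g : Ground S => g.1.1) ((hw j).trans hj)
  obtain ⟨t, ht⟩ := t
  cases t with
  | fvar a => exact ⟨a, rfl⟩
  | bvar k i => simp only [PreTy.LC] at ht; omega
  | con c ts =>
    have e1 : PreTy.con c (fun i => (ts i).subst _) = PreTy.con .unit _ := h1
    have e2 : PreTy.con c (fun i => (ts i).subst _) = PreTy.con .arr _ := h2
    injection e1 with e1
    injection e2 with e2
    rw [e1] at e2
    cases e2
  | poly n b =>
    have e1 : PreTy.poly n _ = PreTy.con .unit _ := h1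
    cases e1

/-- Uniqueness of the description of a family. The two types are compared node by node. Where one
has a variable, irreducibility forces a variable on the other side too, and the two name the same
family. So both types are the same tree up to names, and `θ` and `θ'` agree on corresponding names.
-/
theorem PreTy.subst_eq_of_irred {I : Type} [Nonempty I] {v v' : I → ℕ → Ground S}
    {θ θ' : ℕ → PreTy S} : ∀ {t t' : PreTy S},
    (∀ a ∈ t.fvs, Irred fun i => v i a) → (∀ a ∈ t'.fvs, Irred fun i => v' i a) →
    (∀ a ∈ t.fvs, ∀ b ∈ t'.fvs, (∀ i, v i a = v' i b) → θ a = θ' b) →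
    (∀ i, t.subst (fun a => (v i a).1.1) = t'.subst fun a => (v' i a).1.1) →
    t.subst θ = t'.subst θ' := by
  -- A type facing a variable is a common form of an irreducible family, hence itself a variable. An
  -- instance shows that it is well formed.
  have key : ∀ (v v' : I → ℕ → Ground S) (a : ℕ) (t' : PreTy S), (Irred fun i => v i a) →
      (∀ i, (v i a).1.1 = t'.subst fun a => (v' i a).1.1) → ∃ b, t' = .fvar b := by
    intro v v' a t' ha h
    have hLC : t'.LC 0 := by
      obtain ⟨i⟩ := ‹Nonempty I›
      exact PreTy.LC.of_subst (fun a => (v' i a).1.2) (h i ▸ (v i a).1.2)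
    obtain ⟨b, hb⟩ := ha ⟨t', hLC⟩ v' fun i => Ground.ext (Ty.ext (h i).symm)
    exact ⟨b, congrArg Subtype.val hb⟩
  intro t
  induction t with
  | fvar a =>
    intro t' h1 h2 h3 h4
    obtain ⟨b, rfl⟩ := key v v' a t' (h1 a (by simp [fvs])) h4
    exact h3 a (by simp [fvs]) b (by simp [fvs]) fun i => Ground.ext (Ty.ext (h4 i))
  | bvar k j =>
    intro t' h1 h2 h3 h4
    cases t' with
    | fvar b =>
      obtain ⟨c, hc⟩ := key v' v b _ (h2 b (by simp [fvs])) fun i => (h4 i).symm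
      cases hc
    | bvar k' j' => obtain ⟨i⟩ := ‹Nonempty I›; have := h4 i; cases this; rfl
    | con c ts => obtain ⟨i⟩ := ‹Nonempty I›; have := h4 i; cases this
    | poly n b => obtain ⟨i⟩ := ‹Nonempty I›; have := h4 i; cases this
  | con c ts ih =>
    intro t' h1 h2 h3 h4
    cases t' with
    | fvar b =>
      obtain ⟨c, hc⟩ := key v' v b _ (h2 b (by simp [fvs])) fun i => (h4 i).symm
      cases hc
    | bvar k' j' => obtain ⟨i⟩ := ‹Nonempty I›; have := h4 i; cases this
    | con c' ts' =>
      have hc : c = c' := by obtain ⟨i⟩ := ‹Nonempty I›; have := h4 i; injection this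
      subst hc
      simp only [subst]
      congr 1
      funext k
      refine ih k (fun a ha => h1 a (mem_fvs_con.2 ⟨k, ha⟩))
        (fun a ha => h2 a (mem_fvs_con.2 ⟨k, ha⟩))
        (fun a ha b hb => h3 a (mem_fvs_con.2 ⟨k, ha⟩) b (mem_fvs_con.2 ⟨k, hb⟩)) fun i => ?_
      have := h4 i
      simp only [subst, PreTy.con.injEq, heq_eq_eq, true_and] at this
      exact congrFun this k
    | poly n b => obtain ⟨i⟩ := ‹Nonempty I›; have := h4 i; cases this
  | poly n b ih =>
    intro t' h1 h2 h3 h4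
    cases t' with
    | fvar b =>
      obtain ⟨c, hc⟩ := key v' v b _ (h2 b (by simp [fvs])) fun i => (h4 i).symm
      cases hc
    | bvar k' j' => obtain ⟨i⟩ := ‹Nonempty I›; have := h4 i; cases this
    | con c' ts' => obtain ⟨i⟩ := ‹Nonempty I›; have := h4 i; cases this
    | poly n' b' =>
      have hn : n = n' := by
        obtain ⟨i⟩ := ‹Nonempty I›
        have := h4 i
        simp only [subst, PreTy.poly.injEq] at this
        exact this.1
      subst hn
      simp only [subst]
      rw [ih (t' := b') h1 h2 h3 fun i => by
        have := h4 i
        simp only [subst, PreTy.poly.injEq, true_and] at this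
        exact this]

theorem Ty.subst_eq_of_irred {I : Type} [Nonempty I] {v v' : I → ℕ → Ground S}
    {θ θ' : ℕ → Ty S} {t t' : Ty S}
    (h₁ : ∀ a ∈ t.fvs, Irred fun i => v i a) (h₂ : ∀ a ∈ t'.fvs, Irred fun i => v' i a)
    (h₃ : ∀ a ∈ t.fvs, ∀ b ∈ t'.fvs, (∀ i, v i a = v' i b) → θ a = θ' b)
    (h₄ : ∀ i, t.ev (v i) = t'.ev (v' i)) : t.subst θ = t'.subst θ' :=
  Ty.ext (PreTy.subst_eq_of_irred h₁ h₂
    (fun a ha b hb h => congrArg Subtype.val (h₃ a ha b hb h))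
    fun i => congrArg (fun g : Ground S => g.1.1) (h₄ i))

/-- The variables in `A` name distinct irreducible families. -/
structure Faithful {I : Type} (A : Finset ℕ) (v : I → ℕ → Ground S) : Prop where
  irred : ∀ a ∈ A, Irred fun i => v i a
  inj : ∀ a ∈ A, ∀ b ∈ A, (∀ i, v i a = v i b) → a = b

/-- Over faithful names a type is determined by its family of values: uniqueness of descriptions,
with identity substitutions. -/
theorem Faithful.eq {I : Type} [Nonempty I] {A : Finset ℕ} {v : I → ℕ → Ground S}
    (h : Faithful A v) {t t' : Ty S} (ht : ∀ a ∈ t.fvs, a ∈ A) (ht' : ∀ a ∈ t'.fvs, a ∈ A)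
    (he : ∀ i, t.ev (v i) = t'.ev (v i)) : t = t' := by
  have := Ty.subst_eq_of_irred (θ := Ty.var) (θ' := Ty.var) (fun a ha => h.irred a (ht a ha))
    (fun a ha => h.irred a (ht' a ha))
    (fun a ha b hb hab => congrArg Ty.var (h.inj a (ht a ha) b (ht' b hb) hab)) he
  rwa [Ty.subst_var, Ty.subst_var] at this

theorem Faithful.comp {I J : Type} {A : Finset ℕ} {v : I → ℕ → Ground S} (h : Faithful A v)
    {π : J → I} (hπ : Function.Surjective π) : Faithful A fun j => v (π j) where
  irred := fun a ha => (h.irred a ha).comp hπ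
  inj := fun a ha b hb hab => h.inj a ha b hb fun i => by
    obtain ⟨j, rfl⟩ := hπ i; exact hab j

/-- `(A', v')` extends `(A, v)`. -/
structure NameExt {I : Type} (A : Finset ℕ) (v : I → ℕ → Ground S) (A' : Finset ℕ)
    (v' : I → ℕ → Ground S) : Prop where
  subset : A ⊆ A'
  agree : ∀ i, ∀ a ∈ A, v' i a = v i a
  faithful : Faithful A' v'

theorem NameExt.trans {I : Type} {A A' A'' : Finset ℕ} {v v' v'' : I → ℕ → Ground S}
    (h : NameExt A v A' v') (h' : NameExt A' v' A'' v'') : NameExt A v A'' v'' where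
  subset := h.subset.trans h'.subset
  agree := fun i a ha => (h'.agree i a (h.subset ha)).trans (h.agree i a ha)
  faithful := h'.faithful

theorem NameExt.ev {I : Type} {A A' : Finset ℕ} {v v' : I → ℕ → Ground S}
    (h : NameExt A v A' v') {t : Ty S} (ht : ∀ a ∈ t.fvs, a ∈ A) (i : I) :
    t.ev (v' i) = t.ev (v i) :=
  Ty.ev_congr fun a ha => h.agree i a (ht a ha)

/-- The families are described one after the other; descriptions found earlier survive because an
extension keeps the old names and their values. -/
theorem name_list {I : Type} {A : Finset ℕ} {v : I → ℕ → Ground S} (hA : Faithful A v)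
    (F : ℕ → I → Ground S) (l : List ℕ)
    (hl : ∀ k ∈ l, ∀ (A : Finset ℕ) (v : I → ℕ → Ground S), Faithful A v →
      ∃ (A' : Finset ℕ) (v' : I → ℕ → Ground S) (t : Ty S), NameExt A v A' v' ∧
        (∀ a ∈ t.fvs, a ∈ A') ∧ ∀ i, t.ev (v' i) = F k i) :
    ∃ (A' : Finset ℕ) (v' : I → ℕ → Ground S) (θ : ℕ → Ty S), NameExt A v A' v' ∧
      ∀ k ∈ l, (∀ a ∈ (θ k).fvs, a ∈ A') ∧ ∀ i, (θ k).ev (v' i) = F k i := by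
  induction l with
  | nil => exact ⟨A, v, Ty.var, ⟨subset_rfl, fun _ _ _ => rfl, hA⟩, by simp⟩
  | cons k l ih =>
    obtain ⟨A₁, v₁, θ, h1, h2⟩ := ih fun k hk => hl k (List.mem_cons_of_mem _ hk)
    obtain ⟨A₂, v₂, t, h3, h4, h5⟩ := hl k List.mem_cons_self A₁ v₁ h1.faithful
    refine ⟨A₂, v₂, Function.update θ k t, h1.trans h3, fun j hj => ?_⟩
    by_cases hjk : j = k
    · subst hjk; simp only [Function.update_self]; exact ⟨h4, h5⟩
    · rw [Function.update_of_ne hjk]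
      obtain ⟨h6, h7⟩ := h2 j ((List.mem_cons.1 hj).resolve_left hjk)
      exact ⟨fun a ha => h3.subset (h6 a ha), fun i => (h3.ev h6 i).trans (h7 i)⟩

/-- Every family of ground types is described by a type over irreducible families. -/
theorem exists_name {I : Type} [Nonempty I] (f : I → Ground S) (A : Finset ℕ)
    (v : I → ℕ → Ground S) (hA : Faithful A v) :
    ∃ (A' : Finset ℕ) (v' : I → ℕ → Ground S) (t : Ty S), NameExt A v A' v' ∧
      (∀ a ∈ t.fvs, a ∈ A') ∧ ∀ i, t.ev (v' i) = f i := by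
  obtain ⟨i₀⟩ := ‹Nonempty I›
  induction hs : (f i₀).1.1.size using Nat.strong_induction_on generalizing f A v with
  -- The measure is the size of the member at one fixed index.
  | _ n ih =>
    by_cases hf : Irred f
    -- An irreducible family is described by a variable. A name that it already has is reused, so
    -- that distinct names keep naming distinct families.
    · by_cases hex : ∃ a ∈ A, ∀ i, v i a = f i
      · obtain ⟨a, ha, hv⟩ := hex
        refine ⟨A, v, Ty.var a, ⟨subset_rfl, fun _ _ _ => rfl, hA⟩, ?_, hv⟩
        intro b hb
        rw [Ty.fvs_var, List.mem_singleton] at hb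
        subst hb; exact ha
      · obtain ⟨c, hc⟩ := Infinite.exists_notMem_finset A
        have hne : ∀ a ∈ A, a ≠ c := fun a ha h => hc (h ▸ ha)
        have hupd : ∀ a ∈ A, ∀ i, Function.update (v i) c (f i) a = v i a :=
          fun a ha i => Function.update_of_ne (hne a ha) _ _
        refine ⟨insert c A, fun i => Function.update (v i) c (f i), Ty.var c,
          ⟨Finset.subset_insert _ _, fun i a ha => hupd a ha i, ?_, ?_⟩, ?_, ?_⟩
        · intro a ha
          rcases Finset.mem_insert.1 ha with rfl | ha
          · simpa using hf
          · have := hA.irred a ha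
            simpa only [hupd a ha] using this
        · intro a ha b hb hab
          rcases Finset.mem_insert.1 ha with ha' | ha' <;> rcases Finset.mem_insert.1 hb with hb' | hb'
          · rw [ha', hb']
          · subst ha'
            simp only [Function.update_self, hupd b hb'] at hab
            exact (hex ⟨b, hb', fun i => (hab i).symm⟩).elim
          · subst hb'
            simp only [Function.update_self, hupd a ha'] at hab
            exact (hex ⟨a, ha', hab⟩).elim
          · simp only [hupd a ha', hupd b hb'] at hab
            exact hA.inj a ha' b hb' hab
        · intro b hb
          rw [Ty.fvs_var, List.mem_singleton] at hb
          subst hb; exact Finset.mem_insert_self _ _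
        · intro i; rw [Ty.ev_var]; exact Function.update_self _ _ _
    -- A reducible family has a common non-trivial form `t`; the families of its components have
    -- smaller members and are described by induction.
    · simp only [Irred, not_forall, not_exists] at hf
      obtain ⟨t, w, hw, ht⟩ := hf
      obtain ⟨A', v', θ, h1, h2⟩ := name_list hA (fun a i => w i a) t.fvs (by
        intro a ha A v hA
        refine ih _ ?_ (fun i => w i a) A v hA rfl
        rw [← hs, ← hw i₀]
        exact Ty.size_lt_subst (θ := gt (w i₀)) ha ht)
      refine ⟨A', v', t.subst θ, h1, ?_, fun i => ?_⟩
      · intro b hb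
        obtain ⟨a, ha, hb⟩ := Ty.mem_fvs_subst.1 hb
        exact (h2 a ha).1 b hb
      · rw [Ty.ev_subst, ← hw i]
        exact Ty.ev_congr fun a ha => (h2 a ha).2 i

theorem exists_names {I : Type} [Nonempty I] (F : ℕ → I → Ground S) (n : ℕ) {A : Finset ℕ}
    {v : I → ℕ → Ground S} (hA : Faithful A v) :
    ∃ (A' : Finset ℕ) (v' : I → ℕ → Ground S) (θ : ℕ → Ty S), NameExt A v A' v' ∧
      ∀ k < n, (∀ a ∈ (θ k).fvs, a ∈ A') ∧ ∀ i, (θ k).ev (v' i) = F k i := by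
  obtain ⟨A', v', θ, h1, h2⟩ := name_list hA F (List.range n)
    fun k _ A v hA => exists_name (F k) A v hA
  exact ⟨A', v', θ, h1, fun k hk => h2 k (List.mem_range.2 hk)⟩

/-! ## Completeness of the syntax-directed system for the ground semantics -/

/-- The parameters of a ground record type are ground, and the type of a field mentions nothing but
these parameters. -/
theorem LabelEnv.LabInst.ground {L : LabelEnv S} {l : S.Lab} {T : S.Rec} {a b : Ground S}
    (h : L.LabInst l T a.1 b.1) : ∃ t, L.field T l = some t ∧ ∃ u : ℕ → Ground S,
      a.1 = Ty.rcd T (fun i => gt u i) ∧ b.1 = t.subst (gt u) := by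
  obtain ⟨t, h1, θ, h2, h3⟩ := h
  have hc : ∀ i < S.arity T, (θ i).fvs = [] := by
    intro i hi
    rw [List.eq_nil_iff_forall_not_mem]
    intro x hx
    have : x ∈ a.1.fvs := by rw [h2]; exact Ty.mem_fvs_con.2 ⟨⟨i, hi⟩, hx⟩
    rw [a.2] at this
    simp at this
  have hu : ∀ i, ∃ g : Ground S, i < S.arity T → g.1 = θ i := fun i => by
    by_cases hi : i < S.arity T
    · exact ⟨⟨θ i, hc i hi⟩, fun _ => rfl⟩
    · exact ⟨default, fun h => (hi h).elim⟩
  choose u hu using hu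
  refine ⟨t, h1, u, ?_, ?_⟩
  · rw [h2]; congr 1; funext i; exact (hu i i.2).symm
  · rw [h3]; exact Ty.subst_congr fun i hi => (hu i (L.closed T l t h1 i hi)).symm

/-- The label has the same scheme at every index, and the parameters at the various indices form
families, which are described over an extension of the names. -/
theorem Faithful.labInst {L : LabelEnv S} {I : Type} [Nonempty I] {A : Finset ℕ}
    {v : I → ℕ → Ground S} (hA : Faithful A v) {l : S.Lab} {T : S.Rec} {a b : Ty S}
    (ha : ∀ x ∈ a.fvs, x ∈ A) (hb : ∀ x ∈ b.fvs, x ∈ A)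
    (h : ∀ i, L.LabInst l T (a.ev (v i)).1 (b.ev (v i)).1) : L.LabInst l T a b := by
  choose t h1 u h2 h3 using fun i => (h i).ground
  obtain ⟨i₀⟩ := id ‹Nonempty I›
  have ht : ∀ i, t i = t i₀ := fun i => by
    have := (h1 i).symm.trans (h1 i₀)
    simpa using this
  obtain ⟨A', v', θ, h4, h5⟩ := exists_names (fun k i => u i k) (S.arity T) hA
  have hlt : ∀ x ∈ (t i₀).fvs, x < S.arity T := L.closed T l _ (h1 i₀)
  refine ⟨t i₀, h1 i₀, θ, ?_, ?_⟩
  · refine h4.faithful.eq (fun x hx => h4.subset (ha x hx)) ?_ fun i => Ground.ext ?_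
    · intro x hx
      obtain ⟨k, hk⟩ := Ty.mem_fvs_con.1 hx
      exact (h5 k k.2).1 x hk
    · rw [h4.ev ha, h2 i, Ty.ev_val, Ty.rcd_subst]
      congr 1; funext k
      exact (congrArg Subtype.val ((h5 k k.2).2 i)).symm
  · refine h4.faithful.eq (fun x hx => h4.subset (hb x hx)) ?_ fun i => Ground.ext ?_
    · intro x hx
      obtain ⟨k, hk, hx⟩ := Ty.mem_fvs_subst.1 hx
      exact (h5 k (hlt k hk)).1 x hx
    · rw [h4.ev hb, h3 i, Ty.ev_subst, ht i, Ty.ev_val]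
      exact Ty.subst_congr fun k hk => (congrArg Subtype.val ((h5 k (hlt k hk)).2 i)).symm

/-- A term that has all values of the type `t`, for a faithful family of valuations, has type `t`. -/
theorem SDTyping.complete {L : LabelEnv S} {e : Term S} : ∀ {I : Type} [Nonempty I]
    {A : Finset ℕ} {v : I → ℕ → Ground S} {Γ : TyCtx S} {t : Ty S}, Faithful A v →
    (∀ p ∈ Γ, ∀ a ∈ p.2.fvs, a ∈ A) → (∀ a ∈ t.fvs, a ∈ A) →
    (∀ i, tsem False L e (ctxSem Γ (v i)) (t.ev (v i))) → SDTyping L Γ e t := by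
  -- New names do not change the meaning of the context, whose free variables are old names.
  have hctx : ∀ {I : Type} {A : Finset ℕ} {v : I → ℕ → Ground S} {A' : Finset ℕ}
      {v' : I → ℕ → Ground S} {Γ : TyCtx S}, NameExt A v A' v' → (∀ p ∈ Γ, ∀ a ∈ p.2.fvs, a ∈ A) →
      ∀ i, ctxSem Γ (v' i) = ctxSem Γ (v i) := fun h hΓ i =>
    ctxSem_congr fun p hp a ha => h.agree i a (hΓ p hp a ha)
  -- Shared by explicit record literals and by those whose labels determine the record name.
  have hrec : ∀ {I : Type} [Nonempty I] {A : Finset ℕ} {v : I → ℕ → Ground S} {Γ : TyCtx S}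
      {t : Ty S} {T : S.Rec} {n : ℕ} {ls : Fin (n + 1) → S.Lab} {es : Fin (n + 1) → Term S},
      (∀ k, ∀ {A : Finset ℕ} {v : I → ℕ → Ground S} {Γ : TyCtx S} {t : Ty S}, Faithful A v →
        (∀ p ∈ Γ, ∀ a ∈ p.2.fvs, a ∈ A) → (∀ a ∈ t.fvs, a ∈ A) →
        (∀ i, tsem False L (es k) (ctxSem Γ (v i)) (t.ev (v i))) → SDTyping L Γ (es k) t) →
      Faithful A v → (∀ p ∈ Γ, ∀ a ∈ p.2.fvs, a ∈ A) → (∀ a ∈ t.fvs, a ∈ A) →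
      (∀ i, tsem False L (.recordX T ls es) (ctxSem Γ (v i)) (t.ev (v i))) →
      SDTyping L Γ (.recordX T ls es) t := by
    intro I _ A v Γ t T n ls es ih hA hΓ ht h
    obtain ⟨i₀⟩ := id ‹Nonempty I›
    choose h1 gs h2 h3 using h
    obtain ⟨A', v', θ, h4, h5⟩ := exists_names
      (fun k i => if hk : k < n + 1 then gs i ⟨k, hk⟩ else default) (n + 1) hA
    have h6 : ∀ (k : Fin (n + 1)) i, (θ k).ev (v' i) = gs i k := fun k i => by
      rw [(h5 k k.2).2 i, dif_pos k.2]
    refine .recordX (ts := fun k => θ k) (h1 i₀) (fun k => ?_) fun k => ?_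
    · refine h4.faithful.labInst (fun x hx => h4.subset (ht x hx)) (h5 k k.2).1 fun i => ?_
      rw [h6, h4.ev ht]; exact h2 i k
    · refine ih k h4.faithful (fun p hp a ha => h4.subset (hΓ p hp a ha)) (h5 k k.2).1 fun i => ?_
      rw [h6, hctx h4 hΓ]; exact h3 i k
  have hfld : ∀ {I : Type} [Nonempty I] {A : Finset ℕ} {v : I → ℕ → Ground S} {Γ : TyCtx S}
      {t : Ty S} {T : S.Rec} {l : S.Lab} {e : Term S},
      (∀ {A : Finset ℕ} {v : I → ℕ → Ground S} {Γ : TyCtx S} {t : Ty S}, Faithful A v →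
        (∀ p ∈ Γ, ∀ a ∈ p.2.fvs, a ∈ A) → (∀ a ∈ t.fvs, a ∈ A) →
        (∀ i, tsem False L e (ctxSem Γ (v i)) (t.ev (v i))) → SDTyping L Γ e t) →
      Faithful A v → (∀ p ∈ Γ, ∀ a ∈ p.2.fvs, a ∈ A) → (∀ a ∈ t.fvs, a ∈ A) →
      (∀ i, tsem False L (.fieldX e T l) (ctxSem Γ (v i)) (t.ev (v i))) →
      SDTyping L Γ (.fieldX e T l) t := by
    intro I _ A v Γ t T l e ih hA hΓ ht h
    choose k h1 h2 using h
    obtain ⟨A', v', t', h4, h5, h6⟩ := exists_name k A v hA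
    refine .fieldX (t₁ := t') (h4.faithful.labInst h5 (fun x hx => h4.subset (ht x hx)) fun i => ?_)
      (ih h4.faithful (fun p hp a ha => h4.subset (hΓ p hp a ha)) h5 fun i => ?_)
    · rw [h6, h4.ev ht]; exact h2 i
    · rw [h6, hctx h4 hΓ]; exact h1 i
  induction e with
  | var x =>
    intro I _ A v Γ t hA hΓ ht h
    obtain ⟨i₀⟩ := id ‹Nonempty I›
    choose σ h1 u h2 using h
    have hσ : ∀ i, σ i = σ i₀ := fun i => by
      have := (h1 i).symm.trans (h1 i₀)
      simpa using this
    have hfv := hΓ _ (mem_of_lookup (h1 i₀))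
    obtain ⟨A', v', θ, h4, h5⟩ := exists_names (fun k i => u i k) (σ i₀).n hA
    have : t = (σ i₀).inst θ := by
      refine h4.faithful.eq (fun x hx => h4.subset (ht x hx)) ?_ fun i => Ground.ext ?_
      · intro x hx
        rcases Scheme.mem_fvs_inst hx with hx | ⟨k, hk, hx⟩
        · exact h4.subset (hfv x hx)
        · exact (h5 k hk).1 x hx
      · rw [h4.ev ht, h2 i, hσ i, Ty.ev_val, Scheme.inst_subst]
        rw [Scheme.subst_congr (θ := gt (v' i)) (θ' := gt (v i)) fun a ha =>
          congrArg Subtype.val (h4.agree i a (hfv a ha))]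
        exact Scheme.inst_congr fun k hk => (congrArg Subtype.val ((h5 k hk).2 i)).symm
    rw [this]
    exact .var θ (h1 i₀)
  | unit =>
    intro I _ A v Γ t hA hΓ ht h
    have hu : ∀ a ∈ (Ty.unit : Ty S).fvs, a ∈ A := by
      intro a ha
      have := (Ground.unit : Ground S).2 ▸ (show a ∈ (Ground.unit : Ground S).1.fvs from ha)
      simp at this
    have : t = Ty.unit := hA.eq ht hu fun i => Ground.ext ((h i).trans (Ty.unit_subst _).symm)
    rw [this]
    exact .unit
  | lam x e ih =>
    intro I _ A v Γ t hA hΓ ht h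
    choose g₁ g₂ h1 h2 using h
    obtain ⟨A₁, v₁, t₁, n1, s1, e1⟩ := exists_name g₁ A v hA
    obtain ⟨A₂, v₂, t₂, n2, s2, e2⟩ := exists_name g₂ A₁ v₁ n1.faithful
    have n := n1.trans n2
    have : t = Ty.arr t₁ t₂ := by
      refine n.faithful.eq (fun x hx => n.subset (ht x hx)) ?_ fun i => Ground.ext ?_
      · intro x hx
        rcases Ty.mem_fvs_arr.1 hx with hx | hx
        · exact n2.subset (s1 x hx)
        · exact s2 x hx
      · rw [n.ev ht, h1 i, Ty.ev_val, Ty.arr_subst, ← Ty.ev_val, ← Ty.ev_val, e2, n2.ev s1, e1]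
    rw [this]
    refine .lam (ih n.faithful ?_ s2 fun i => ?_)
    · intro p hp a ha
      rcases List.mem_cons.1 hp with rfl | hp
      · exact n2.subset (s1 a ha)
      · exact n.subset (hΓ p hp a ha)
    · rw [ctxSem_cons, ginst_mono_eq, hctx n hΓ, n2.ev s1, e1, e2]
      exact h2 i
  | app e₁ e₂ ih₁ ih₂ =>
    intro I _ A v Γ t hA hΓ ht h
    choose g₁ g₂ h1 h2 h3 using h
    obtain ⟨A₁, v₁, t₁, n, s1, e1⟩ := exists_name g₁ A v hA
    have hΓ' : ∀ p ∈ Γ, ∀ a ∈ p.2.fvs, a ∈ A₁ := fun p hp a ha => n.subset (hΓ p hp a ha)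
    refine .app (t₁ := t₁) (ih₁ n.faithful hΓ' ?_ fun i => ?_) (ih₂ n.faithful hΓ' s1 fun i => ?_)
    · intro x hx
      rcases Ty.mem_fvs_arr.1 hx with hx | hx
      · exact s1 x hx
      · exact n.subset (ht x hx)
    · rw [hctx n hΓ]
      convert h1 i
      refine Ground.ext ?_
      rw [Ty.ev_val, Ty.arr_subst, ← Ty.ev_val, ← Ty.ev_val, e1, n.ev ht, h2]
    · rw [hctx n hΓ, e1]; exact h3 i
  | letE x e₁ e₂ ih₁ ih₂ =>
    intro I _ A v Γ t hA hΓ ht h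
    choose G h1 h2 h3 using h
    -- One index for each value that `x` takes at each old index. Over `J` these values form a
    -- single family, so one type `t₁` describes them all.
    let J := Σ i, {g // g ∈ G i}
    have hπ : Function.Surjective (fun j : J => j.1) := fun i => by
      obtain ⟨g, hg⟩ := h2 i; exact ⟨⟨i, g, hg⟩, rfl⟩
    have : Nonempty J := by
      obtain ⟨i₀⟩ := id ‹Nonempty I›
      obtain ⟨j, _⟩ := hπ i₀
      exact ⟨j⟩
    obtain ⟨A', v', t₁, n, s1, e1⟩ := exists_name (fun j : J => j.2.1) A _ (hA.comp hπ)
    have ty1 : SDTyping L Γ e₁ t₁ := by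
      refine ih₁ n.faithful (fun p hp a ha => n.subset (hΓ p hp a ha)) s1 fun j => ?_
      rw [hctx n hΓ, e1]
      exact h1 j.1 _ j.2.2
    -- The names introduced to describe this family are generalized; they are fresh because the free
    -- variables of `Γ` are in `A`.
    refine .letE (A' \ A) ty1 (fun α hα p hp hp' => (Finset.mem_sdiff.1 hα).2 (hΓ p hp α hp'))
      (ih₂ hA ?_ ht fun i => ?_)
    · intro p hp a ha
      rcases List.mem_cons.1 hp with rfl | hp
      · obtain ⟨ha1, ha2⟩ := Scheme.mem_fvs_gen.1 ha
        by_contra haA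
        exact ha2 (Finset.mem_sdiff.2 ⟨s1 a ha1, haA⟩)
      · exact hΓ p hp a ha
    · refine tsem_mono ?_ (h3 i)
      intro y _
      rw [ctxSem_cons]
      by_cases hy : y = x
      · subst hy
        simp only [Function.update_self]
        intro g hg
        -- Each `g ∈ G i` is an instance of the generalization: it is the value of `t₁` at the index
        -- `(i, g)`.
        refine Scheme.ginst_gen.2 ⟨fun a => if a ∈ A' \ A then v' ⟨i, g, hg⟩ a else v i a,
          fun a ha => if_neg ha, ?_⟩
        refine (e1 ⟨i, g, hg⟩).symm.trans ?_
        refine Ty.ev_congr fun a ha => ?_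
        by_cases haA : a ∈ A
        · rw [if_neg fun h => (Finset.mem_sdiff.1 h).2 haA]
          exact n.agree ⟨i, g, hg⟩ a haA
        · rw [if_pos (Finset.mem_sdiff.2 ⟨s1 a ha, haA⟩)]
      · simp only [Function.update_of_ne hy]; exact subset_rfl
  | annot e a ih =>
    intro I _ A v Γ t hA hΓ ht h
    choose u h1 h2 using h
    obtain ⟨A', v', θ, n, h5⟩ := exists_names (fun k i => u i k) a.n hA
    have hs : ∀ x ∈ (a.ty.subst θ).fvs, x ∈ A' := by
      intro x hx
      obtain ⟨k, hk, hx⟩ := Ty.mem_fvs_subst.1 hx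
      exact (h5 k ((a.closed k).1 hk)).1 x hx
    have he : ∀ i, (a.ty.subst θ).ev (v' i) = a.ty.ev (u i) := fun i => by
      rw [Ty.ev_subst]; exact Ty.ev_congr fun k hk => (h5 k ((a.closed k).1 hk)).2 i
    have : t = a.ty.subst θ :=
      n.faithful.eq (fun x hx => n.subset (ht x hx)) hs fun i => by rw [n.ev ht, he, h2]
    rw [this]
    refine .annot θ (ih n.faithful (fun p hp a ha => n.subset (hΓ p hp a ha)) hs fun i => ?_)
    rw [he, hctx n hΓ]; exact h1 i
  | tuple es ih =>
    rename_i n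
    intro I _ A v Γ t hA hΓ ht h
    choose gs h1 h2 using h
    obtain ⟨A', v', θ, h4, h5⟩ := exists_names
      (fun k i => if hk : k < n then gs i ⟨k, hk⟩ else default) n hA
    have h6 : ∀ (k : Fin n) i, (θ k).ev (v' i) = gs i k := fun k i => by
      rw [(h5 k k.2).2 i, dif_pos k.2]
    have : t = Ty.prod fun k : Fin n => θ k := by
      refine h4.faithful.eq (fun x hx => h4.subset (ht x hx)) ?_ fun i => Ground.ext ?_
      · intro x hx
        obtain ⟨k, hk⟩ := Ty.mem_fvs_con.1 hx
        exact (h5 k k.2).1 x hk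
      · rw [h4.ev ht, h1 i, Ty.ev_val, Ty.prod_subst]
        congr 1; funext k
        exact (congrArg Subtype.val (h6 k i)).symm
    rw [this]
    refine .tuple fun k => ih k h4.faithful (fun p hp a ha => h4.subset (hΓ p hp a ha)) (h5 k k.2).1
      fun i => ?_
    rw [h6, hctx h4 hΓ]; exact h2 i k
  | proj e j ih =>
    intro I _ A v Γ t hA hΓ ht h
    obtain ⟨i₀⟩ := ‹Nonempty I›
    exact (h i₀).1.elim
  | projX e n j ih =>
    intro I _ A v Γ t hA hΓ ht h
    obtain ⟨i₀⟩ := id ‹Nonempty I›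
    choose gs k h1 h2 hj h3 using h
    obtain ⟨A', v', θ, h4, h5⟩ := exists_names
      (fun k i => if hk : k < n then gs i ⟨k, hk⟩ else default) n hA
    have h6 : ∀ (k : Fin n) i, (θ k).ev (v' i) = gs i k := fun k i => by
      rw [(h5 k k.2).2 i, dif_pos k.2]
    have : t = θ j := by
      refine h4.faithful.eq (fun x hx => h4.subset (ht x hx)) (h5 j (hj i₀)).1 fun i => ?_
      rw [h4.ev ht, h3 i, ← h6 ⟨j, hj i⟩ i]
    rw [this]
    refine SDTyping.projX (ts := fun k : Fin n => θ k) ⟨j, hj i₀⟩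
      (ih h4.faithful (fun p hp a ha => h4.subset (hΓ p hp a ha)) ?_ fun i => ?_)
    · intro x hx
      obtain ⟨k, hk⟩ := Ty.mem_fvs_con.1 hx
      exact (h5 k k.2).1 x hk
    · rw [hctx h4 hΓ]
      convert h1 i
      refine Ground.ext ?_
      rw [h2, Ty.ev_val, Ty.prod_subst]
      congr 1; funext k
      exact congrArg Subtype.val (h6 k i)
  | box e ih =>
    intro I _ A v Γ t hA hΓ ht h
    obtain ⟨i₀⟩ := ‹Nonempty I›
    exact (h i₀).1.elim
  | boxX e a ih =>
    intro I _ A v Γ t hA hΓ ht h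
    obtain ⟨i₀⟩ := id ‹Nonempty I›
    choose u h1 h2 using h
    obtain ⟨A', v', θ, n, h5⟩ := exists_names (fun k i => u i k) a.n hA
    set σ := a.sch.subst θ with hσ
    have hs : ∀ x ∈ σ.fvs, x ∈ A' := by
      intro x hx
      rw [hσ, Scheme.fvs_subst, List.mem_flatMap] at hx
      obtain ⟨k, hk, hx⟩ := hx
      exact (h5 k ((a.closed k).1 hk)).1 x hx
    have hginst : ∀ i, σ.ginst (v' i) = a.sch.ginst (u i) := fun i => by
      rw [hσ, Scheme.ginst_subst]
      exact Scheme.ginst_congr fun k hk => (h5 k ((a.closed k).1 hk)).2 i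
    have : t = Ty.poly σ := by
      refine n.faithful.eq (fun x hx => n.subset (ht x hx)) hs fun i => Ground.ext ?_
      rw [n.ev ht, h2, Ty.ev_val, Ty.poly_subst, hσ, Scheme.subst_subst]
      congr 1
      exact Scheme.subst_congr fun k hk =>
        (congrArg Subtype.val ((h5 k ((a.closed k).1 hk)).2 i)).symm
    rw [this]
    obtain ⟨N, hN, -, hgen⟩ := Scheme.exists_eq_gen σ (A'.sup id + 1)
    have hNA : ∀ a ∈ A', a < N := fun a ha => by
      have := Finset.le_sup (f := id) ha
      simp only [id] at this; omega
    set B := (Finset.range σ.n).image (N + ·) with hB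
    have hBmem : ∀ a, a ∈ B ↔ ∃ k < σ.n, N + k = a := by intro a; simp [hB]
    -- The bound variables of `σ` are opened at names from `N` on. The index set is multiplied by
    -- all valuations of these names, so that they become independent irreducible families.
    let w : I × (ℕ → Ground S) → ℕ → Ground S := fun p a => if a < N then v' p.1 a else p.2 (a - N)
    have hw1 : ∀ p, ∀ a ∈ A', w p a = v' p.1 a := fun p a ha => if_pos (hNA a ha)
    have hw2 : ∀ p k, w p (N + k) = p.2 k := fun p k => by simp [w]
    have hfst : Function.Surjective (Prod.fst : I × (ℕ → Ground S) → I) :=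
      fun i => ⟨(i, fun _ => default), rfl⟩
    have hF : Faithful (A' ∪ B) w := by
      have hcomp := n.faithful.comp hfst
      constructor
      · intro a ha
        rcases Finset.mem_union.1 ha with ha | ha
        · have := hcomp.irred a ha
          simpa only [hw1 _ a ha] using this
        · obtain ⟨k, _, rfl⟩ := (hBmem a).1 ha
          simp only [hw2]
          exact irred_of_surjective fun g => ⟨(i₀, fun _ => g), rfl⟩
      · intro a ha b hb hab
        -- A new name varies while an old one stays fixed when only the second component of the
        -- index changes.
        have hmix : ∀ a ∈ A', ∀ k, ¬ ∀ p, w p a = w p (N + k) := by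
          intro a ha k hk
          simp only [hw1 _ a ha, hw2] at hk
          have e1 := hk (i₀, fun _ => Ground.unit)
          have e2 := hk (i₀, fun _ => (Ty.arr (Ty.var 0) (Ty.var 0)).ev fun _ => Ground.unit)
          have e3 := congrArg (fun g : Ground S => g.1.1) (e1.symm.trans e2)
          have e4 : PreTy.con .unit _ = PreTy.con .arr _ := e3
          injection e4 with e4
          cases e4
        rcases Finset.mem_union.1 ha with ha | ha <;> rcases Finset.mem_union.1 hb with hb | hb
        · simp only [hw1 _ a ha, hw1 _ b hb] at hab
          exact hcomp.inj a ha b hb hab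
        · obtain ⟨k, _, rfl⟩ := (hBmem b).1 hb
          exact (hmix a ha k hab).elim
        · obtain ⟨k, _, rfl⟩ := (hBmem a).1 ha
          exact (hmix b hb k fun p => (hab p).symm).elim
        · obtain ⟨k, _, rfl⟩ := (hBmem a).1 ha
          obtain ⟨l, _, rfl⟩ := (hBmem b).1 hb
          simp only [hw2] at hab
          by_contra hkl
          have hkl : k ≠ l := fun h => hkl (by rw [h])
          -- Two new names are told apart by a valuation that sends one to an arrow type and the
          -- other to unit.
          have e1 := hab (i₀, Function.update (fun _ => Ground.unit) k
            ((Ty.arr (Ty.var 0) (Ty.var 0)).ev fun _ => Ground.unit))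
          simp only [Function.update_self, Function.update_of_ne hkl.symm] at e1
          have e3 := congrArg (fun g : Ground S => g.1.1) e1
          have e4 : PreTy.con .arr _ = PreTy.con .unit _ := e3
          injection e4 with e4
          cases e4
    have : Nonempty (I × (ℕ → Ground S)) := ⟨(i₀, fun _ => default)⟩
    refine .boxX θ B (t := σ.inst fun i => Ty.var (N + i))
      (ih hF (fun p hp a ha => Finset.mem_union_left _ (n.subset (hΓ p hp a ha))) ?_ fun p => ?_)
      ?_ hgen.symm
    · intro x hx
      rcases Scheme.mem_fvs_inst hx with hx | ⟨k, hk, hx⟩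
      · exact Finset.mem_union_left _ (hs x hx)
      · rw [Ty.fvs_var, List.mem_singleton] at hx
        exact Finset.mem_union_right _ ((hBmem x).2 ⟨k, hk, hx.symm⟩)
    · have e1 : ctxSem Γ (w p) = ctxSem Γ (v p.1) := by
        rw [← hctx n hΓ p.1]
        exact ctxSem_congr fun q hq a ha => hw1 p a (n.subset (hΓ q hq a ha))
      rw [e1]
      refine h1 p.1 _ ?_
      rw [← hginst]
      refine ⟨p.2, ?_⟩
      rw [Ty.ev_val, Scheme.inst_subst]
      rw [Scheme.subst_congr (θ := gt (w p)) (θ' := gt (v' p.1)) fun a ha =>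
        congrArg Subtype.val (hw1 p a (hs a ha))]
      refine Scheme.inst_congr fun k _ => congrArg Subtype.val (hw2 p k)
    · intro α hα p hp hp'
      obtain ⟨k, _, rfl⟩ := (hBmem α).1 hα
      have := hNA _ (n.subset (hΓ p hp _ hp'))
      omega
  | unbox e ih =>
    intro I _ A v Γ t hA hΓ ht h
    obtain ⟨i₀⟩ := ‹Nonempty I›
    exact (h i₀).1.elim
  | unboxX e a ih =>
    intro I _ A v Γ t hA hΓ ht h
    choose u k h1 h2 w h3 using h
    obtain ⟨A₁, v₁, θ, n1, h5⟩ := exists_names (fun k i => u i k) a.n hA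
    obtain ⟨A₂, v₂, η, n2, h6⟩ := exists_names (fun k i => w i k) a.sch.n n1.faithful
    have n := n1.trans n2
    have hs : ∀ x ∈ (a.sch.subst θ).fvs, x ∈ A₁ := by
      intro x hx
      rw [Scheme.fvs_subst, List.mem_flatMap] at hx
      obtain ⟨k, hk, hx⟩ := hx
      exact (h5 k ((a.closed k).1 hk)).1 x hx
    have hsub : ∀ i, (a.sch.subst θ).subst (gt (v₂ i)) = a.sch.subst (gt (u i)) := fun i => by
      rw [Scheme.subst_subst]
      refine Scheme.subst_congr fun k hk => congrArg Subtype.val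
        ((n2.ev (h5 k ((a.closed k).1 hk)).1 i).trans ((h5 k ((a.closed k).1 hk)).2 i))
    have : t = (a.sch.subst θ).inst η := by
      refine n.faithful.eq (fun x hx => n.subset (ht x hx)) ?_ fun i => Ground.ext ?_
      · intro x hx
        rcases Scheme.mem_fvs_inst hx with hx | ⟨k, hk, hx⟩
        · exact n2.subset (hs x hx)
        · exact (h6 k hk).1 x hx
      · rw [n.ev ht, h3 i, Ty.ev_val, Scheme.inst_subst, hsub]
        exact Scheme.inst_congr fun k hk => (congrArg Subtype.val ((h6 k hk).2 i)).symm
    rw [this]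
    refine .unboxX θ η (ih n.faithful (fun p hp a ha => n.subset (hΓ p hp a ha))
      (fun x hx => n2.subset (hs x hx)) fun i => ?_)
    rw [hctx n hΓ]
    convert h1 i
    refine Ground.ext ?_
    rw [h2, Ty.ev_val, Ty.poly_subst, hsub]
  | record ls es ih =>
    intro I _ A v Γ t hA hΓ ht h
    obtain ⟨i₀⟩ := id ‹Nonempty I›
    rcases h i₀ with ⟨T, hT, _⟩ | ⟨_, h, _⟩
    · refine .recordClosed hT (hrec (fun k => ih k) hA hΓ ht fun i => ?_)
      rcases h i with ⟨T', hT', h⟩ | ⟨_, h, _⟩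
      · obtain rfl := hT.2 T' hT'.1
        exact h
      · exact h.elim
    · exact h.elim
  | recordX T ls es ih =>
    intro I _ A v Γ t hA hΓ ht h
    exact hrec (fun k => ih k) hA hΓ ht h
  | field e l ih =>
    intro I _ A v Γ t hA hΓ ht h
    obtain ⟨i₀⟩ := id ‹Nonempty I›
    rcases h i₀ with ⟨T, hT, _⟩ | ⟨_, h, _⟩
    · refine .fieldClosed hT (hfld ih hA hΓ ht fun i => ?_)
      rcases h i with ⟨T', hT', h⟩ | ⟨_, h, _⟩
      · obtain rfl := hT.2 T' hT'.1
        exact h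
      · exact h.elim
    · exact h.elim
  | fieldX e T l ih =>
    intro I _ A v Γ t hA hΓ ht h
    exact hfld ih hA hΓ ht h
  | hole es ih =>
    rename_i n
    intro I _ A v Γ t hA hΓ ht h
    choose gs h2 using h
    obtain ⟨A', v', θ, h4, h5⟩ := exists_names
      (fun k i => if hk : k < n then gs i ⟨k, hk⟩ else default) n hA
    refine .hole (ts := fun k => θ k) t fun k => ih k h4.faithful
      (fun p hp a ha => h4.subset (hΓ p hp a ha)) (h5 k k.2).1 fun i => ?_
    rw [(h5 k k.2).2 i, dif_pos k.2, hctx h4 hΓ]; exact h2 i k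

end OML

namespace OML

variable {S : Sig}

/-! ## Ground semantics of constraints -/

/-- The solutions of a constraint whose suspended constraints all have the truth value `m`. -/
def csem (m : Prop) : Constr S → Env S → Prop
  | .tt, _ => True
  | .ff, _ => False
  | .conj c₁ c₂, φ => csem m c₁ φ ∧ csem m c₂ φ
  | .unif a b, φ => a.ev φ.ty = b.ev φ.ty
  | .ex c, φ => ∃ g, csem m c (φ.pushTy g)
  | .all c, φ => ∀ g, csem m c (φ.pushTy g)
  | .letC x c₁ c₂, φ => ∃ G : Set (Ground S), (∀ g ∈ G, csem m c₁ (φ.pushTy g)) ∧ G.Nonempty ∧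
      csem m c₂ (φ.setTm x G)
  | .app x t, φ => t.ev φ.ty ∈ φ.tm x
  | .mtch _ _ _, _ => m
  -- A constraint on an unresolved record or scheme variable has no satisfaction rule.
  | .labLe _ _ _ _, _ => False
  | .domEq _ _, _ => False
  | .schLe _ _, _ => False
  | .leSch _ _, _ => False

theorem SatWith.of_csem {L : LabelEnv S} {K : CCtx S → Ty S → Shape S → Prop} {c : Constr S} :
    ∀ {φ : Env S}, csem False c φ → SatWith L K φ c := by
  induction c with
  | tt => exact fun _ => .tt
  | ff => exact fun h => h.elim
  | conj c₁ c₂ ih₁ ih₂ => exact fun h => .conj (ih₁ h.1) (ih₂ h.2)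
  | unif a b => exact fun h => .unif h
  | ex c ih => exact fun ⟨g, h⟩ => .ex g (ih h)
  | all c ih => exact fun h => .all fun g => ih (h g)
  | letC x c₁ c₂ ih₁ ih₂ => exact fun ⟨G, h1, h2, h3⟩ => .letC G (fun g hg => ih₁ (h1 g hg)) h2 (ih₂ h3)
  | app x t => exact fun h => .app h
  | _ => exact fun h => h.elim

theorem simpleSat_iff {L : LabelEnv S} {c : Constr S} {φ : Env S} :
    SimpleSat L φ c ↔ csem False c φ := by
  constructor
  · intro h
    unfold SimpleSat at h
    induction h with
    | tt => trivial
    | conj _ _ ih₁ ih₂ => exact ⟨ih₁, ih₂⟩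
    | unif h => exact h
    | ex g _ ih => exact ⟨g, ih⟩
    | all _ ih => exact ih
    | letC G _ hG _ ih₁ ih₂ => exact ⟨G, ih₁, hG, ih₂⟩
    | app h => exact h
    | matchCtx _ _ h => exact h.elim
  · exact SatWith.of_csem

theorem csem_erase {c : Constr S} : ∀ {φ : Env S}, csem False c.erase φ ↔ csem True c φ := by
  induction c with
  | conj c₁ c₂ ih₁ ih₂ => intro φ; simp only [Constr.erase, csem, ih₁, ih₂]
  | ex c ih => intro φ; simp only [Constr.erase, csem, ih]
  | all c ih => intro φ; simp only [Constr.erase, csem, ih]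
  | letC x c₁ c₂ ih₁ ih₂ => intro φ; simp only [Constr.erase, csem, ih₁, ih₂]
  | _ => intro φ; rfl

theorem simpleSat_erase_iff {L : LabelEnv S} {c : Constr S} {φ : Env S} :
    SimpleSat L φ c.erase ↔ csem True c φ := simpleSat_iff.trans csem_erase

theorem csem_weaken {m : Prop} {c : Constr S} : ∀ {φ : Env S}, csem False c φ → csem m c φ := by
  induction c with
  | conj c₁ c₂ ih₁ ih₂ => exact fun h => ⟨ih₁ h.1, ih₂ h.2⟩
  | ex c ih => exact fun ⟨g, h⟩ => ⟨g, ih h⟩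
  | all c ih => exact fun h g => ih (h g)
  | letC x c₁ c₂ ih₁ ih₂ => exact fun ⟨G, h1, h2, h3⟩ => ⟨G, fun g hg => ih₁ (h1 g hg), h2, ih₂ h3⟩
  | mtch => exact fun h => h.elim
  | _ => exact fun h => h

/-- The environment in the scope of `n` more binders. -/
def Env.pushN (φ : Env S) (n : ℕ) (u : ℕ → Ground S) : Env S where
  ty := fun i => if i < n then u i else φ.ty (i - n)
  tm := φ.tm

/-- The outermost of `n + 1` binders has the largest index, `n`. -/
theorem Env.pushTy_pushN (φ : Env S) (n : ℕ) (g : Ground S) (u : ℕ → Ground S) :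
    (φ.pushTy g).pushN n u = φ.pushN (n + 1) (Function.update u n g) := by
  simp only [pushN, pushTy, Env.mk.injEq, and_true]
  funext i
  rcases lt_trichotomy i n with h | h | h
  · rw [if_pos h, if_pos (by omega), Function.update_of_ne (by omega)]
  · subst h; simp
  · rw [if_neg (by omega), if_neg (by omega)]
    obtain ⟨k, rfl⟩ := Nat.exists_eq_add_of_lt h
    rw [show n + k + 1 - n = k + 1 by omega, show n + k + 1 - (n + 1) = k by omega]

theorem Env.pushN_zero (φ : Env S) (u : ℕ → Ground S) : φ.pushN 0 u = φ := by simp [pushN]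

theorem csem_exN {m : Prop} {n : ℕ} {c : Constr S} {φ : Env S} :
    csem m (.exN n c) φ ↔ ∃ u, csem m c (φ.pushN n u) := by
  induction n generalizing φ with
  | zero => simp [Constr.exN, Env.pushN_zero]
  | succ n ih =>
    simp only [Constr.exN, csem, ih, Env.pushTy_pushN]
    exact ⟨fun ⟨g, u, h⟩ => ⟨_, h⟩, fun ⟨u, h⟩ => ⟨u n, u, by rwa [Function.update_eq_self]⟩⟩

theorem csem_allN {m : Prop} {n : ℕ} {c : Constr S} {φ : Env S} :
    csem m (.allN n c) φ ↔ ∀ u, csem m c (φ.pushN n u) := by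
  induction n generalizing φ with
  | zero => simp [Constr.allN, Env.pushN_zero]
  | succ n ih =>
    simp only [Constr.allN, csem, ih, Env.pushTy_pushN]
    refine ⟨fun h u => ?_, fun h g u => h _⟩
    have := h (u n) u
    rwa [Function.update_eq_self] at this

theorem csem_conjList {m : Prop} {l : List (Constr S)} {φ : Env S} :
    csem m (.conjList l) φ ↔ ∀ c ∈ l, csem m c φ := by
  induction l with
  | nil => simp [Constr.conjList, csem]
  | cons c l ih =>
    have : Constr.conjList (c :: l) = .conj c (.conjList l) := rfl
    rw [this, csem, ih]; simp

theorem csem_bigConj {m : Prop} {n : ℕ} {cs : Fin n → Constr S} {φ : Env S} :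
    csem m (.bigConj cs) φ ↔ ∀ i, csem m (cs i) φ := by
  rw [Constr.bigConj, csem_conjList]
  simp [List.mem_ofFn]

theorem ev_shift_pushN (φ : Env S) (n : ℕ) (u : ℕ → Ground S) (t : Ty S) :
    (t.shift n).ev (φ.pushN n u).ty = t.ev φ.ty := by
  rw [Ty.shift, Ty.ev_subst]
  refine Ty.ev_congr fun a _ => ?_
  rw [Ty.ev_var]; simp [Env.pushN]

theorem ev_shift_one (φ : Env S) (g : Ground S) (t : Ty S) :
    (t.shift 1).ev (φ.pushTy g).ty = t.ev φ.ty := by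
  rw [Ty.shift, Ty.ev_subst]
  exact Ty.ev_congr fun a _ => rfl

theorem ev_shift_two (φ : Env S) (g h : Ground S) (t : Ty S) :
    (t.shift 2).ev ((φ.pushTy g).pushTy h).ty = t.ev φ.ty := by
  rw [Ty.shift, Ty.ev_subst]
  exact Ty.ev_congr fun a _ => rfl

theorem ev_shift_succ (φ : Env S) (g : Ground S) (n : ℕ) (u : ℕ → Ground S) (t : Ty S) :
    (t.shift (n + 1)).ev ((φ.pushTy g).pushN n u).ty = t.ev φ.ty := by
  rw [Env.pushTy_pushN, ev_shift_pushN]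

theorem pushN_lt (φ : Env S) {n i : ℕ} (u : ℕ → Ground S) (h : i < n) :
    (φ.pushN n u).ty i = u i := if_pos h

theorem pushN_self (φ : Env S) (n : ℕ) (u : ℕ → Ground S) : (φ.pushN n u).ty n = φ.ty 0 := by
  simp [Env.pushN]

theorem ev_pushN_closed (φ : Env S) {n : ℕ} (u : ℕ → Ground S) {t : Ty S}
    (h : ∀ i ∈ t.fvs, i < n) : t.ev (φ.pushN n u).ty = t.ev u :=
  Ty.ev_congr fun a ha => pushN_lt φ u (h a ha)

theorem Scheme.ginst_pushN (φ : Env S) {n : ℕ} (u : ℕ → Ground S) {σ : Scheme S}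
    (h : ∀ i ∈ σ.fvs, i < n) : σ.ginst (φ.pushN n u).ty = σ.ginst u :=
  Scheme.ginst_congr fun a ha => pushN_lt φ u (h a ha)

theorem Scheme.ev_unbind (σ : Scheme S) (φ : Env S) (u : ℕ → Ground S) :
    (σ.unbind.ev (φ.pushN σ.n u).ty).1 = (σ.subst (gt φ.ty)).inst (gt u) := by
  rw [Ty.ev_val, Scheme.unbind, Scheme.inst_subst, Scheme.subst_subst]
  have e : σ.subst (fun a => (Ty.var (a + σ.n)).subst (gt (φ.pushN σ.n u).ty)) =
      σ.subst (gt φ.ty) :=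
    Scheme.subst_congr fun a _ => by rw [Ty.var_subst]; simp [gt, Env.pushN]
  rw [e]
  exact Scheme.inst_congr fun i hi => congrArg Subtype.val (pushN_lt φ u hi)

theorem csem_schemeLe {m : Prop} {σ : Scheme S} {t : Ty S} {φ : Env S} :
    csem m (.schemeLe σ t) φ ↔ t.ev φ.ty ∈ σ.ginst φ.ty := by
  simp only [Constr.schemeLe, csem_exN, csem, ev_shift_pushN, Scheme.ginst, Set.mem_ofPred_eq]
  refine exists_congr fun u => ?_
  rw [← Scheme.ev_unbind]
  exact ⟨fun h => congrArg Subtype.val h.symm, fun h => (Ground.ext h).symm⟩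

theorem csem_allN_unbind {m : Prop} {σ : Scheme S} {c : Constr S} {φ : Env S}
    {P : Ground S → Prop} (h : ∀ u, csem m c (φ.pushN σ.n u) ↔ P (σ.unbind.ev (φ.pushN σ.n u).ty)) :
    csem m (.allN σ.n c) φ ↔ ∀ g ∈ σ.ginst φ.ty, P g := by
  simp only [csem_allN, h]
  constructor
  · rintro h g ⟨u, hu⟩
    have := h u
    rwa [show σ.unbind.ev (φ.pushN σ.n u).ty = g from
      Ground.ext ((Scheme.ev_unbind σ φ u).trans hu.symm)] at this
  · intro h u
    exact h _ ⟨u, Scheme.ev_unbind σ φ u⟩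

theorem csem_leScheme {m : Prop} {σ : Scheme S} {x : ℕ} {φ : Env S} :
    csem m (.leScheme x σ) φ ↔ ∀ g ∈ σ.ginst φ.ty, g ∈ φ.tm x :=
  csem_allN_unbind (P := fun g => g ∈ φ.tm x) fun _ => Iff.rfl

theorem csem_labInst {m : Prop} {L : LabelEnv S} {l : S.Lab} {T : S.Rec} {a b : Ty S} {φ : Env S} :
    csem m (.labInst L l T a b) φ ↔ L.LabInst l T (a.ev φ.ty).1 (b.ev φ.ty).1 := by
  unfold Constr.labInst
  cases hf : L.field T l with
  | none =>
    simp only [csem, false_iff]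
    rintro ⟨t, h, _⟩
    rw [hf] at h; cases h
  | some t =>
    simp only [csem_exN, csem, ev_shift_pushN]
    have e1 : ∀ u : ℕ → Ground S, (Ty.rcd T fun i => Ty.var i).ev (φ.pushN (S.arity T) u).ty =
        (Ty.rcd T fun i => Ty.var i).ev u := fun u => ev_pushN_closed φ u (by
      intro i hi
      obtain ⟨k, hk⟩ := Ty.mem_fvs_con.1 hi
      rw [Ty.fvs_var, List.mem_singleton] at hk
      subst hk; exact k.2)
    have e2 : ∀ u : ℕ → Ground S, t.ev (φ.pushN (S.arity T) u).ty = t.ev u := fun u =>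
      ev_pushN_closed φ u (L.closed T l t hf)
    simp only [e1, e2]
    constructor
    · rintro ⟨u, h1, h2⟩
      exact ⟨t, hf, gt u, by rw [h1]; exact Ty.rcd_subst _ _ _, by rw [h2]; rfl⟩
    · intro h
      obtain ⟨t', h1, u, h2, h3⟩ := h.ground
      rw [hf] at h1
      cases h1
      exact ⟨u, Ground.ext (h2.trans (Ty.rcd_subst (gt u) T
        fun i : Fin (S.arity T) => Ty.var (i : ℕ)).symm), Ground.ext h3⟩

theorem csem_domIs {m : Prop} {L : LabelEnv S} {T : S.Rec} {ls : Set S.Lab} {φ : Env S} :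
    csem m (.domIs L T ls) φ ↔ L.dom T = ls := by
  unfold Constr.domIs
  split <;> rename_i h <;> simp [csem, h]

/-! ## Contexts -/

def ECtx.comp (E : ECtx S) (F : ECtx S) : ECtx S :=
  match E with
  | .hole => F
  | .lam x E => .lam x (E.comp F)
  | .appL E e => .appL (E.comp F) e
  | .appR e E => .appR e (E.comp F)
  | .letL x E e => .letL x (E.comp F) e
  | .letR x e E => .letR x e (E.comp F)
  | .annot E a => .annot (E.comp F) a
  | .tuple j E es => .tuple j (E.comp F) es
  | .proj E j => .proj (E.comp F) j
  | .projX E n j => .projX (E.comp F) n j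
  | .box E => .box (E.comp F)
  | .boxX E a => .boxX (E.comp F) a
  | .unbox E => .unbox (E.comp F)
  | .unboxX E a => .unboxX (E.comp F) a
  | .record ls j E es => .record ls j (E.comp F) es
  | .recordX T ls j E es => .recordX T ls j (E.comp F) es
  | .field E l => .field (E.comp F) l
  | .fieldX E T l => .fieldX (E.comp F) T l
  | .typedHole j E es => .typedHole j (E.comp F) es

theorem ECtx.plug_comp (E F : ECtx S) (e : Term S) : (E.comp F).plug e = E.plug (F.plug e) := by
  induction E with
  | hole => rfl
  | _ => simp_all [ECtx.comp, ECtx.plug]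

theorem ECtx.fv_plug {e e' : Term S} (h : e.fv = e'.fv) (E : ECtx S) :
    (E.plug e).fv = (E.plug e').fv := by
  have upd : ∀ {n : ℕ} (es : Fin n → Term S) (j : Fin n) (a b : Term S), a.fv = b.fv →
      ∀ i, (Function.update es j a i).fv = (Function.update es j b i).fv := by
    intro n es j a b hab i
    by_cases hi : i = j
    · subst hi; simpa using hab
    · rw [Function.update_of_ne hi, Function.update_of_ne hi]
  induction E with
  | hole => exact h
  | tuple j E es ih => simp only [plug, Term.fv]; exact Set.iUnion_congr (upd es j _ _ ih)
  | record ls j E es ih => simp only [plug, Term.fv]; exact Set.iUnion_congr (upd es j _ _ ih)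
  | recordX T ls j E es ih => simp only [plug, Term.fv]; exact Set.iUnion_congr (upd es j _ _ ih)
  | typedHole j E es ih => simp only [plug, Term.fv]; exact Set.iUnion_congr (upd es j _ _ ih)
  | _ => simp_all [plug, Term.fv]

def CCtx.comp (C : CCtx S) (D : CCtx S) : CCtx S :=
  match C with
  | .hole => D
  | .andL C c => .andL (C.comp D) c
  | .andR c C => .andR c (C.comp D)
  | .ex C => .ex (C.comp D)
  | .all C => .all (C.comp D)
  | .letL x C c => .letL x (C.comp D) c
  | .letR x c C => .letR x c (C.comp D)

theorem CCtx.plug_comp (C D : CCtx S) (c : Constr S) : (C.comp D).plug c = C.plug (D.plug c) := by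
  induction C with
  | hole => rfl
  | _ => simp_all [CCtx.comp, CCtx.plug]

/-- No suspended constraint, except in branches. -/
def NoMatch : Constr S → Prop
  | .conj c₁ c₂ => NoMatch c₁ ∧ NoMatch c₂
  | .ex c => NoMatch c
  | .all c => NoMatch c
  | .letC _ c₁ c₂ => NoMatch c₁ ∧ NoMatch c₂
  | .mtch _ _ _ => False
  | _ => True

/-- Constraint contexts never have their hole inside a branch, so `NoMatch` sees whatever is plugged
in. -/
theorem NoMatch.plug_ne {n : ℕ} {t : Ty S} {ps : Fin n → Pat} {cs : Fin n → Constr S}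
    {C : CCtx S} : ¬ NoMatch (C.plug (.mtch t ps cs)) := by
  induction C with
  | hole => exact id
  | andL C c ih => exact fun h => ih h.1
  | andR c C ih => exact fun h => ih h.2
  | ex C ih => exact ih
  | all C ih => exact ih
  | letL x C c ih => exact fun h => ih h.1
  | letR x c C ih => exact fun h => ih h.2

theorem NoMatch.exN {n : ℕ} {c : Constr S} (h : NoMatch c) : NoMatch (.exN n c) := by
  induction n with
  | zero => exact h
  | succ n ih => exact ih

theorem NoMatch.allN {n : ℕ} {c : Constr S} (h : NoMatch c) : NoMatch (.allN n c) := by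
  induction n with
  | zero => exact h
  | succ n ih => exact ih

theorem NoMatch.conjList {l : List (Constr S)} (h : ∀ c ∈ l, NoMatch c) :
    NoMatch (.conjList l) := by
  induction l with
  | nil => trivial
  | cons c l ih =>
    exact ⟨h c List.mem_cons_self, ih fun d hd => h d (List.mem_cons_of_mem c hd)⟩

theorem NoMatch.bigConj {n : ℕ} {cs : Fin n → Constr S} (h : ∀ i, NoMatch (cs i)) :
    NoMatch (.bigConj cs) := by
  refine NoMatch.conjList fun c hc => ?_
  obtain ⟨i, rfl⟩ := List.mem_ofFn.1 hc
  exact h i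

theorem NoMatch.labInst {L : LabelEnv S} {l : S.Lab} {T : S.Rec} {a b : Ty S} :
    NoMatch (.labInst L l T a b) := by
  unfold Constr.labInst
  split
  · exact NoMatch.exN ⟨trivial, trivial⟩
  · trivial

theorem NoMatch.domIs {L : LabelEnv S} {T : S.Rec} {ls : Set S.Lab} : NoMatch (.domIs L T ls) := by
  unfold Constr.domIs
  split <;> trivial

/-! ## Implicit constructs and their explicit counterparts -/

/-- Implicit constructs. -/
inductive Imp (S : Sig) : Type
  | proj (j : ℕ)
  | box
  | unbox
  | record (n : ℕ) (ls : Fin (n + 1) → S.Lab)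
  | field (l : S.Lab)

/-- Explicit counterparts of implicit constructs. -/
inductive Exp (S : Sig) : Type
  | proj (n j : ℕ)
  | box (a : SchAnn S)
  | unbox (a : SchAnn S)
  | record (T : S.Rec) (n : ℕ) (ls : Fin (n + 1) → S.Lab)
  | field (T : S.Rec) (l : S.Lab)

namespace Imp

/-- The number of subterms. -/
def ar : Imp S → ℕ
  | .record n _ => n + 1
  | _ => 1

def mk : (k : Imp S) → (Fin k.ar → Term S) → Term S
  | .proj j, es => .proj (es (0 : Fin 1)) j
  | .box, es => .box (es (0 : Fin 1))
  | .unbox, es => .unbox (es (0 : Fin 1))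
  | .record _ ls, es => .record ls es
  | .field l, es => .field (es (0 : Fin 1)) l

/-- The observation of the type `g` in place of an implicit construct. -/
def obs (g : Ground S) : (k : Imp S) → (Fin k.ar → Term S) → Term S
  | .proj _, es => .hole ![.annot (es (0 : Fin 1)) g.ann]
  | .box, es => .annot (.hole ![es (0 : Fin 1)]) g.ann
  | .unbox, es => .hole ![.annot (es (0 : Fin 1)) g.ann]
  | .record _ _, es => .annot (.hole es) g.ann
  | .field _, es => .hole ![.annot (es (0 : Fin 1)) g.ann]

/-- The labels do not determine the record type. -/
def Open (L : LabelEnv S) : Imp S → Prop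
  | .record _ ls => ¬ ∃ T, L.LabsUni (Set.range ls) T
  | .field l => ¬ ∃ T, L.LabUni l T
  | _ => True

/-- The type that is matched. -/
def scrut : Imp S → Ty S → Ty S
  | .box, t => t
  | .record n _, t => t.shift (n + 1)
  | _, _ => .var 0

def pat : Imp S → Pat
  | .proj j => .prod j
  | .box => .poly 0
  | .unbox => .poly 0
  | .record _ _ => .rcd 0
  | .field _ => .rcd 0

/-- The branch of the suspended constraint. -/
def branch : Imp S → Ty S → Constr S
  | .proj _, t => .unif (t.shift 2) (.var 0)
  | .box, _ => .leSch 0 0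
  | .unbox, t => .schLe 0 (t.shift 1)
  | .record n ls, t => .conj (.domEq 0 (Set.range ls))
      (.bigConj fun i => .labLe (ls i) 0 (t.shift (n + 1)) (.var i))
  | .field l, t => .labLe l 0 (.var 0) (t.shift 1)

/-- The suspended constraint. -/
def susp (k : Imp S) (t : Ty S) : Constr S :=
  .mtch (k.scrut t) (fun _ : Fin 1 => k.pat) fun _ => k.branch t

end Imp

namespace Exp

def imp : Exp S → Imp S
  | .proj _ j => .proj j
  | .box _ => .box
  | .unbox _ => .unbox
  | .record _ n ls => .record n ls
  | .field _ l => .field l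

def shape : Exp S → Shape S
  | .proj n _ => .prod S n
  | .box a => .poly a
  | .unbox a => .poly a
  | .record T _ _ => .rcd T
  | .field T _ => .rcd T

def mk : (x : Exp S) → (Fin x.imp.ar → Term S) → Term S
  | .proj n j, es => .projX (es (0 : Fin 1)) n j
  | .box a, es => .boxX (es (0 : Fin 1)) a
  | .unbox a, es => .unboxX (es (0 : Fin 1)) a
  | .record T _ ls, es => .recordX T ls es
  | .field T l, es => .fieldX (es (0 : Fin 1)) T l

/-- The discharged suspended constraint. -/
def disch (L : LabelEnv S) (x : Exp S) (t : Ty S) : Constr S :=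
  .matched L (x.imp.scrut t) x.shape (fun _ : Fin 1 => x.imp.pat) fun _ => x.imp.branch t

end Exp

theorem Shape.prod_inj {n n' : ℕ} (h : Shape.prod S n = Shape.prod S n') : n = n' :=
  congrArg Shape.n h

theorem Shape.rcd_inj {T T' : S.Rec} (h : Shape.rcd T = Shape.rcd T') : T = T' := by
  have := congrArg (fun s : Shape S => s.ty.1) h
  have e : PreTy.con (Con.rcd T) _ = PreTy.con (Con.rcd T') _ := this
  injection e with e
  injection e

theorem Shape.poly_inj {a a' : SchAnn S} (h : Shape.poly a = Shape.poly a') : a = a' := by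
  have h1 : a.n = a'.n := congrArg Shape.n h
  have h2 : a.sch = a'.sch := Scheme.poly_inj (congrArg Shape.ty h)
  cases a; cases a'; simp only at h1 h2; subst h1; subst h2; rfl

theorem Pat.Matches.prod_iff {j n : ℕ} {θ : PatSub S} : (Pat.prod j).Matches (Shape.prod S n) θ ↔
    j < n ∧ θ = ⟨fun | 0 => .var j | i + 1 => .var (i + n), fun _ => none, fun _ => none⟩ := by
  constructor
  · intro h
    generalize hs : Shape.prod S n = s at h
    cases h with
    | prod n' _ hj => obtain rfl := Shape.prod_inj hs; exact ⟨hj, rfl⟩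
  · rintro ⟨h, rfl⟩; exact .prod n j h

theorem Pat.Matches.rcd_iff {r : ℕ} {T : S.Rec} {θ : PatSub S} :
    (Pat.rcd r).Matches (Shape.rcd T) θ ↔ θ = ⟨fun i => .var (i + S.arity T),
      Function.update (fun _ => none) r (some T), fun _ => none⟩ := by
  constructor
  · intro h
    generalize hs : Shape.rcd T = s at h
    cases h with
    | rcd _ T' => obtain rfl := Shape.rcd_inj hs; rfl
  · rintro rfl; exact .rcd r T

theorem Pat.Matches.poly_iff {k : ℕ} {a : SchAnn S} {θ : PatSub S} :
    (Pat.poly k).Matches (Shape.poly a) θ ↔ θ = ⟨fun i => .var (i + a.n),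
      fun _ => none, Function.update (fun _ => none) k (some a.sch)⟩ := by
  constructor
  · intro h
    generalize hs : Shape.poly a = s at h
    cases h with
    | poly _ a' => obtain rfl := Shape.poly_inj hs; rfl
  · rintro rfl; exact .poly k a

/-- The definition chooses a matching substitution; it plays no role here because there is only one.
-/
theorem matched_eq {L : LabelEnv S} {t : Ty S} {s : Shape S} {p : Pat} {c : Constr S}
    {θ : PatSub S} (h : ∀ θ', p.Matches s θ' ↔ θ' = θ) :
    Constr.matched L t s (fun _ : Fin 1 => p) (fun _ => c) =
      .exN s.n (.conj (.unif (t.shift s.n) s.ty) (c.inst L θ)) := by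
  unfold Constr.matched
  have hex : ∃ q : Fin 1 × PatSub S, p.Matches s q.2 := ⟨(0, θ), (h θ).2 rfl⟩
  rw [dif_pos hex, (h _).1 hex.choose_spec]

theorem matched_eq_ff {L : LabelEnv S} {t : Ty S} {s : Shape S} {p : Pat} {c : Constr S}
    (h : ∀ θ', ¬ p.Matches s θ') :
    Constr.matched L t s (fun _ : Fin 1 => p) (fun _ => c) = .ff := by
  unfold Constr.matched
  rw [dif_neg]
  rintro ⟨q, hq⟩
  exact h _ hq

theorem Constr.inst_bigConj {L : LabelEnv S} {n : ℕ} {cs : Fin n → Constr S} {θ : PatSub S} :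
    (bigConj cs).inst L θ = bigConj fun i => (cs i).inst L θ := by
  have key : ∀ l : List (Constr S), (conjList l).inst L θ = conjList (l.map (inst L θ)) := by
    intro l
    induction l with
    | nil => rfl
    | cons c l ih =>
      show Constr.conj _ ((conjList l).inst L θ) = _
      rw [ih]; rfl
  rw [bigConj, key, List.map_ofFn]; rfl

/-- In the branch, index 0 is the pattern variable and index 1 the matched type. Matching sends the
former to component `j` and moves all others past the `n` new variables. -/
theorem Exp.disch_proj {L : LabelEnv S} {n j : ℕ} {t : Ty S} :
    (Exp.proj n j).disch L t = if j < n then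
      .exN n (.conj (.unif ((Ty.var 0).shift n) (.prod fun i : Fin n => .var i))
        (.unif ((t.shift 1).shift n) (.var j))) else .ff := by
  split
  · rename_i hj
    refine (matched_eq fun θ' => Pat.Matches.prod_iff.trans (and_iff_right hj)).trans ?_
    simp only [Imp.branch, Exp.imp, Constr.inst]
    congr 3
    simp only [Ty.shift, Ty.subst_subst]
    rfl
  · rename_i hj
    exact matched_eq_ff fun θ' h => hj (Pat.Matches.prod_iff.1 h).1

theorem Exp.disch_box {L : LabelEnv S} {a : SchAnn S} {t : Ty S} :
    (Exp.box a).disch L t =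
      .exN a.n (.conj (.unif (t.shift a.n) (.poly a.sch)) (.leScheme 0 a.sch)) := by
  refine (matched_eq fun θ' => Pat.Matches.poly_iff).trans ?_
  simp only [Imp.branch, Exp.imp, Constr.inst, Function.update_self]
  rfl

theorem Exp.disch_unbox {L : LabelEnv S} {a : SchAnn S} {t : Ty S} :
    (Exp.unbox a).disch L t =
      .exN a.n (.conj (.unif ((Ty.var 0).shift a.n) (.poly a.sch))
        (.schemeLe a.sch ((t.shift 1).shift a.n))) := by
  refine (matched_eq fun θ' => Pat.Matches.poly_iff).trans ?_
  simp only [Imp.branch, Exp.imp, Constr.inst, Function.update_self]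
  rfl

theorem Exp.disch_record {L : LabelEnv S} {T : S.Rec} {n : ℕ} {ls : Fin (n + 1) → S.Lab} {t : Ty S} :
    (Exp.record T n ls).disch L t =
      .exN (S.arity T) (.conj (.unif ((t.shift (n + 1)).shift (S.arity T)) (.rcd T fun i => .var i))
        (.conj (.domIs L T (Set.range ls)) (.bigConj fun i : Fin (n + 1) =>
          .labInst L (ls i) T ((t.shift (n + 1)).shift (S.arity T))
            ((Ty.var i).shift (S.arity T))))) := by
  refine (matched_eq fun θ' => Pat.Matches.rcd_iff).trans ?_
  simp only [Imp.branch, Exp.imp, Constr.inst, Constr.inst_bigConj, Function.update_self]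
  rfl

theorem Exp.disch_field {L : LabelEnv S} {T : S.Rec} {l : S.Lab} {t : Ty S} :
    (Exp.field T l).disch L t =
      .exN (S.arity T) (.conj (.unif ((Ty.var 0).shift (S.arity T)) (.rcd T fun i => .var i))
        (.labInst L l T ((Ty.var 0).shift (S.arity T)) ((t.shift 1).shift (S.arity T)))) := by
  refine (matched_eq fun θ' => Pat.Matches.rcd_iff).trans ?_
  simp only [Imp.branch, Exp.imp, Constr.inst, Function.update_self]
  rfl

theorem Exp.noMatch_disch {L : LabelEnv S} {x : Exp S} {t : Ty S} : NoMatch (x.disch L t) := by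
  cases x with
  | proj n j => rw [disch_proj]; split; exacts [NoMatch.exN ⟨trivial, trivial⟩, trivial]
  | box a => rw [disch_box]; exact NoMatch.exN ⟨trivial, NoMatch.allN trivial⟩
  | unbox a => rw [disch_unbox]; exact NoMatch.exN ⟨trivial, NoMatch.exN trivial⟩
  | record T n ls =>
    rw [disch_record]
    exact NoMatch.exN ⟨trivial, NoMatch.domIs, NoMatch.bigConj fun _ => NoMatch.labInst⟩
  | field T l => rw [disch_field]; exact NoMatch.exN ⟨trivial, NoMatch.labInst⟩

/-- A discharged constraint with a solution is not `ff`, so the pattern matched, and the pattern of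
each construct only matches shapes that belong to an explicit counterpart. -/
theorem Imp.exists_exp {L : LabelEnv S} {k : Imp S} {t t' : Ty S} {s : Shape S} {m : Prop}
    {φ : Env S} (h : csem m (.matched L t' s (fun _ : Fin 1 => k.pat) fun _ => k.branch t) φ) :
    ∃ x : Exp S, x.imp = k ∧ x.shape = s := by
  by_cases hex : ∃ θ, k.pat.Matches s θ
  · obtain ⟨θ, hθ⟩ := hex
    cases k with
    | proj j => cases hθ with | prod n _ _ => exact ⟨.proj n j, rfl, rfl⟩
    | box => cases hθ with | poly _ a => exact ⟨.box a, rfl, rfl⟩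
    | unbox => cases hθ with | poly _ a => exact ⟨.unbox a, rfl, rfl⟩
    | record n ls => cases hθ with | rcd _ T => exact ⟨.record T n ls, rfl, rfl⟩
    | field l => cases hθ with | rcd _ T => exact ⟨.field T l, rfl, rfl⟩
  · rw [matched_eq_ff fun θ hθ => hex ⟨θ, hθ⟩] at h
    exact h.elim

end OML

namespace OML

variable {S : Sig}

/-! ## Constraints with several holes -/

/-- Constraints with holes named by `ι`. -/
inductive MC (S : Sig) (ι : Type) : Type
  | leaf (c : Constr S)
  | hole (i : ι)
  | conj (M N : MC S ι)
  | ex (M : MC S ι)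
  | all (M : MC S ι)
  | letC (x : ℕ) (M N : MC S ι)

namespace MC

variable {ι : Type}

def fill (f : ι → Constr S) : MC S ι → Constr S
  | .leaf c => c
  | .hole i => f i
  | .conj M N => .conj (M.fill f) (N.fill f)
  | .ex M => .ex (M.fill f)
  | .all M => .all (M.fill f)
  | .letC x M N => .letC x (M.fill f) (N.fill f)

def exN : ℕ → MC S ι → MC S ι
  | 0, M => M
  | n + 1, M => .ex (exN n M)

def allN : ℕ → MC S ι → MC S ι
  | 0, M => M
  | n + 1, M => .all (allN n M)

def bigConj {n : ℕ} (Ms : Fin n → MC S ι) : MC S ι := (List.ofFn Ms).foldr .conj (.leaf .tt)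

theorem fill_exN (f : ι → Constr S) (n : ℕ) (M : MC S ι) :
    (exN n M).fill f = Constr.exN n (M.fill f) := by
  induction n with
  | zero => rfl
  | succ n ih => exact congrArg Constr.ex ih

theorem fill_allN (f : ι → Constr S) (n : ℕ) (M : MC S ι) :
    (allN n M).fill f = Constr.allN n (M.fill f) := by
  induction n with
  | zero => rfl
  | succ n ih => exact congrArg Constr.all ih

theorem fill_bigConj (f : ι → Constr S) {n : ℕ} (Ms : Fin n → MC S ι) :
    (bigConj Ms).fill f = Constr.bigConj fun i => (Ms i).fill f := by
  have key : ∀ l : List (MC S ι), (l.foldr MC.conj (MC.leaf .tt)).fill f =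
      Constr.conjList (l.map (fill f)) := by
    intro l
    induction l with
    | nil => rfl
    | cons M l ih => exact congrArg _ ih
  rw [bigConj, key, List.map_ofFn]; rfl

/-- No suspended constraint in the leaves. -/
def Leaves : MC S ι → Prop
  | .leaf c => NoMatch c
  | .hole _ => True
  | .conj M N => M.Leaves ∧ N.Leaves
  | .ex M => M.Leaves
  | .all M => M.Leaves
  | .letC _ M N => M.Leaves ∧ N.Leaves

theorem leaves_exN {n : ℕ} {M : MC S ι} : (exN n M).Leaves ↔ M.Leaves := by
  induction n with
  | zero => rfl
  | succ n ih => exact ih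

theorem leaves_allN {n : ℕ} {M : MC S ι} : (allN n M).Leaves ↔ M.Leaves := by
  induction n with
  | zero => rfl
  | succ n ih => exact ih

theorem leaves_bigConj {n : ℕ} {Ms : Fin n → MC S ι} (h : ∀ i, (Ms i).Leaves) :
    (bigConj Ms).Leaves := by
  have key : ∀ l : List (MC S ι), (∀ M ∈ l, M.Leaves) → (l.foldr MC.conj (MC.leaf .tt)).Leaves := by
    intro l
    induction l with
    | nil => exact fun _ => trivial
    | cons M l ih => exact fun h => ⟨h M (by simp), ih fun N hN => h N (by simp [hN])⟩
  refine key _ fun M hM => ?_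
  obtain ⟨i, rfl⟩ := List.mem_ofFn.1 hM
  exact h i

variable [DecidableEq ι]

/-- The number of holes with name `j`. -/
def cnt (j : ι) : MC S ι → ℕ
  | .leaf _ => 0
  | .hole i => if i = j then 1 else 0
  | .conj M N => M.cnt j + N.cnt j
  | .ex M => M.cnt j
  | .all M => M.cnt j
  | .letC _ M N => M.cnt j + N.cnt j

theorem cnt_exN {j : ι} {n : ℕ} {M : MC S ι} : (exN n M).cnt j = M.cnt j := by
  induction n with
  | zero => rfl
  | succ n ih => exact ih

theorem cnt_allN {j : ι} {n : ℕ} {M : MC S ι} : (allN n M).cnt j = M.cnt j := by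
  induction n with
  | zero => rfl
  | succ n ih => exact ih

theorem cnt_bigConj {j : ι} {n : ℕ} {Ms : Fin n → MC S ι} :
    (bigConj Ms).cnt j = ∑ i, (Ms i).cnt j := by
  have key : ∀ l : List (MC S ι), (l.foldr MC.conj (MC.leaf .tt)).cnt j = (l.map (cnt j)).sum := by
    intro l
    induction l with
    | nil => rfl
    | cons M l ih => simp only [List.foldr_cons, cnt, List.map_cons, List.sum_cons, ih]
  rw [bigConj, key, List.map_ofFn, List.sum_ofFn]; rfl

theorem fill_update_of_cnt {f : ι → Constr S} {j : ι} (c : Constr S) {M : MC S ι}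
    (h : M.cnt j = 0) : M.fill (Function.update f j c) = M.fill f := by
  induction M with
  | leaf => rfl
  | hole i =>
    have : i ≠ j := by rintro rfl; simp [cnt] at h
    exact Function.update_of_ne this _ _
  | conj M N ih₁ ih₂ =>
    simp only [cnt, Nat.add_eq_zero_iff] at h; simp only [fill, ih₁ h.1, ih₂ h.2]
  | letC x M N ih₁ ih₂ =>
    simp only [cnt, Nat.add_eq_zero_iff] at h; simp only [fill, ih₁ h.1, ih₂ h.2]
  | ex M ih => exact congrArg _ (ih h)
  | all M ih => exact congrArg _ (ih h)

/-- Filling all holes but one gives a context. -/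
theorem exists_ctx (f : ι → Constr S) {j : ι} {M : MC S ι} (h : M.cnt j = 1) :
    ∃ C : CCtx S, ∀ c, M.fill (Function.update f j c) = C.plug c := by
  induction M with
  | leaf => cases h
  | hole i =>
    obtain rfl : i = j := by by_contra hij; simp [cnt, hij] at h
    exact ⟨.hole, fun c => Function.update_self _ _ _⟩
  | conj M N ih₁ ih₂ =>
    simp only [cnt] at h
    rcases (by omega : M.cnt j = 1 ∧ N.cnt j = 0 ∨ M.cnt j = 0 ∧ N.cnt j = 1) with ⟨h1, h2⟩ | ⟨h1, h2⟩
    · obtain ⟨C, hC⟩ := ih₁ h1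
      exact ⟨.andL C (N.fill f), fun c => by simp only [fill, hC, fill_update_of_cnt c h2, CCtx.plug]⟩
    · obtain ⟨C, hC⟩ := ih₂ h2
      exact ⟨.andR (M.fill f) C, fun c => by simp only [fill, hC, fill_update_of_cnt c h1, CCtx.plug]⟩
  | letC x M N ih₁ ih₂ =>
    simp only [cnt] at h
    rcases (by omega : M.cnt j = 1 ∧ N.cnt j = 0 ∨ M.cnt j = 0 ∧ N.cnt j = 1) with ⟨h1, h2⟩ | ⟨h1, h2⟩
    · obtain ⟨C, hC⟩ := ih₁ h1
      exact ⟨.letL x C (N.fill f), fun c => by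
        simp only [fill, hC, fill_update_of_cnt c h2, CCtx.plug]⟩
    · obtain ⟨C, hC⟩ := ih₂ h2
      exact ⟨.letR x (M.fill f) C, fun c => by
        simp only [fill, hC, fill_update_of_cnt c h1, CCtx.plug]⟩
  | ex M ih => obtain ⟨C, hC⟩ := ih h; exact ⟨.ex C, fun c => congrArg _ (hC c)⟩
  | all M ih => obtain ⟨C, hC⟩ := ih h; exact ⟨.all C, fun c => congrArg _ (hC c)⟩

/-- A suspended constraint of a filled constraint is inside one of the fillers. -/
theorem inv {f : ι → Constr S} {M : MC S ι} (hl : M.Leaves) (hM : ∀ j, M.cnt j ≤ 1)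
    {n : ℕ} {t : Ty S} {ps : Fin n → Pat} {cs : Fin n → Constr S} {C : CCtx S}
    (h : M.fill f = C.plug (.mtch t ps cs)) :
    ∃ (j : ι) (C₁ C₂ : CCtx S), M.cnt j = 1 ∧ C = C₁.comp C₂ ∧ f j = C₂.plug (.mtch t ps cs) ∧
      ∀ c, C₁.plug c = M.fill (Function.update f j c) := by
  induction M generalizing C with
  | leaf c =>
    refine (NoMatch.plug_ne (C := C) (t := t) (ps := ps) (cs := cs) ?_).elim
    rw [← h]; exact hl
  | hole i =>
    exact ⟨i, .hole, C, by simp [cnt], rfl, h, fun c => (Function.update_self i c f).symm⟩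
  | conj M N ih₁ ih₂ =>
    have hM₁ : ∀ j, M.cnt j ≤ 1 := fun j => (Nat.le_add_right _ _).trans (hM j)
    have hM₂ : ∀ j, N.cnt j ≤ 1 := fun j => (Nat.le_add_left _ _).trans (hM j)
    cases C with
    | andL C c =>
      simp only [fill, CCtx.plug, Constr.conj.injEq] at h
      obtain ⟨j, C₁, C₂, h1, rfl, h2, h3⟩ := ih₁ hl.1 hM₁ h.1
      have h0 : N.cnt j = 0 := by have := hM j; simp only [cnt] at this; omega
      exact ⟨j, .andL C₁ c, C₂, by simp only [cnt]; omega, rfl, h2, fun d => by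
        simp only [CCtx.plug, fill, h3, fill_update_of_cnt d h0, h.2]⟩
    | andR c C =>
      simp only [fill, CCtx.plug, Constr.conj.injEq] at h
      obtain ⟨j, C₁, C₂, h1, rfl, h2, h3⟩ := ih₂ hl.2 hM₂ h.2
      have h0 : M.cnt j = 0 := by have := hM j; simp only [cnt] at this; omega
      exact ⟨j, .andR c C₁, C₂, by simp only [cnt]; omega, rfl, h2, fun d => by
        simp only [CCtx.plug, fill, h3, fill_update_of_cnt d h0, h.1]⟩
    | _ => simp [fill, CCtx.plug] at h
  | letC x M N ih₁ ih₂ =>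
    have hM₁ : ∀ j, M.cnt j ≤ 1 := fun j => (Nat.le_add_right _ _).trans (hM j)
    have hM₂ : ∀ j, N.cnt j ≤ 1 := fun j => (Nat.le_add_left _ _).trans (hM j)
    cases C with
    | letL y C c =>
      simp only [fill, CCtx.plug, Constr.letC.injEq] at h
      obtain ⟨j, C₁, C₂, h1, rfl, h2, h3⟩ := ih₁ hl.1 hM₁ h.2.1
      have h0 : N.cnt j = 0 := by have := hM j; simp only [cnt] at this; omega
      exact ⟨j, .letL y C₁ c, C₂, by simp only [cnt]; omega, rfl, h2, fun d => by
        simp only [CCtx.plug, fill, h3, fill_update_of_cnt d h0, h.2.2, h.1]⟩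
    | letR y c C =>
      simp only [fill, CCtx.plug, Constr.letC.injEq] at h
      obtain ⟨j, C₁, C₂, h1, rfl, h2, h3⟩ := ih₂ hl.2 hM₂ h.2.2
      have h0 : M.cnt j = 0 := by have := hM j; simp only [cnt] at this; omega
      exact ⟨j, .letR y c C₁, C₂, by simp only [cnt]; omega, rfl, h2, fun d => by
        simp only [CCtx.plug, fill, h3, fill_update_of_cnt d h0, h.2.1, h.1]⟩
    | _ => simp [fill, CCtx.plug] at h
  | ex M ih =>
    cases C with
    | ex C =>
      simp only [fill, CCtx.plug, Constr.ex.injEq] at h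
      obtain ⟨j, C₁, C₂, h1, rfl, h2, h3⟩ := ih hl hM h
      exact ⟨j, .ex C₁, C₂, h1, rfl, h2, fun d => congrArg _ (h3 d)⟩
    | _ => simp [fill, CCtx.plug] at h
  | all M ih =>
    cases C with
    | all C =>
      simp only [fill, CCtx.plug, Constr.all.injEq] at h
      obtain ⟨j, C₁, C₂, h1, rfl, h2, h3⟩ := ih hl hM h
      exact ⟨j, .all C₁, C₂, h1, rfl, h2, fun d => congrArg _ (h3 d)⟩
    | _ => simp [fill, CCtx.plug] at h

end MC

/-! ## Partially elaborated terms -/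

/-- The constraint around the suspended constraint of an implicit construct. -/
def Imp.mc : (k : Imp S) → MC S (Option (Fin k.ar))
  | .box => .letC 0 (.hole (some (0 : Fin 1))) (.hole none)
  | .record n _ => .exN (n + 1) (.conj
      (.bigConj fun i : Fin (n + 1) => .hole (some (i : Fin (n + 1)))) (.hole none))
  | .proj _ => .ex (.conj (.hole (some (0 : Fin 1))) (.hole none))
  | .unbox => .ex (.conj (.hole (some (0 : Fin 1))) (.hole none))
  | .field _ => .ex (.conj (.hole (some (0 : Fin 1))) (.hole none))

/-- The constructors of partially elaborated terms. -/
inductive Op (L : LabelEnv S) : Type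
  | var (x : ℕ)
  | unit
  | lam (x : ℕ)
  | app
  | letE (x : ℕ)
  | annot (a : TyAnn S)
  | tuple (n : ℕ)
  | projX (n j : ℕ) (h : j < n)
  -- The generated constraint is `ff` whatever the subterm is. The subterm is stored as a plain term
  -- and is not an argument.
  | projBad (e : Term S) (n j : ℕ) (h : ¬ j < n)
  | boxX (a : SchAnn S)
  | unboxX (a : SchAnn S)
  | recordX (T : S.Rec) (n : ℕ) (ls : Fin (n + 1) → S.Lab)
  | recordC (T : S.Rec) (n : ℕ) (ls : Fin (n + 1) → S.Lab) (h : L.LabsUni (Set.range ls) T)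
  | fieldX (T : S.Rec) (l : S.Lab)
  | fieldC (T : S.Rec) (l : S.Lab) (h : L.LabUni l T)
  | hole (n : ℕ)
  | imp (k : Imp S) (h : k.Open L)
  -- Kept apart from the explicit constructs: discharging a suspended constraint gives an equivalent
  -- constraint, but not literally the one generated for the explicit term.
  | exp (x : Exp S)

namespace Op

variable {L : LabelEnv S}

def ar : Op L → ℕ
  | .var _ => 0
  | .unit => 0
  | .lam _ => 1
  | .app => 2
  | .letE _ => 2
  | .annot _ => 1
  | .tuple n => n
  | .projX _ _ _ => 1
  | .projBad _ _ _ _ => 0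
  | .boxX _ => 1
  | .unboxX _ => 1
  | .recordX _ n _ => n + 1
  | .recordC _ n _ _ => n + 1
  | .fieldX _ _ => 1
  | .fieldC _ _ _ => 1
  | .hole n => n
  | .imp k _ => k.ar
  | .exp x => x.imp.ar

def mk : (o : Op L) → (Fin o.ar → Term S) → Term S
  | .var x, _ => .var x
  | .unit, _ => .unit
  | .lam x, es => .lam x (es (0 : Fin 1))
  | .app, es => .app (es (0 : Fin 2)) (es (1 : Fin 2))
  | .letE x, es => .letE x (es (0 : Fin 2)) (es (1 : Fin 2))
  | .annot a, es => .annot (es (0 : Fin 1)) a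
  | .tuple _, es => .tuple es
  | .projX n j _, es => .projX (es (0 : Fin 1)) n j
  | .projBad e n j _, _ => .projX e n j
  | .boxX a, es => .boxX (es (0 : Fin 1)) a
  | .unboxX a, es => .unboxX (es (0 : Fin 1)) a
  | .recordX T _ ls, es => .recordX T ls es
  | .recordC _ _ ls _, es => .record ls es
  | .fieldX T l, es => .fieldX (es (0 : Fin 1)) T l
  | .fieldC _ l _, es => .field (es (0 : Fin 1)) l
  | .hole _, es => .hole es
  | .imp k _, es => k.mk es
  | .exp x, es => x.mk es

/-- The type of a subterm. -/
def ty : (o : Op L) → Ty S → Fin o.ar → Ty S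
  | .lam _, _, _ => .var 0
  | .letE _, t, i => if i.1 = 0 then .var 0 else t
  | .annot a, _, _ => a.ty
  | .projX n _ _, _, _ => .var n
  | .boxX a, _, _ => a.sch.unbind
  | .unboxX a, _, _ => .var a.n
  | _, _, i => .var i

/-- The constraint, with a hole for each subterm and a hole for the (discharged) suspended
constraint. -/
def mc : (o : Op L) → Ty S → MC S (Option (Fin o.ar))
  | .var x, t => .leaf (.app x t)
  | .unit, t => .leaf (.unif t .unit)
  | .lam x, t => .ex (.ex (.conj
      (.letC x (.leaf (.unif (.var 0) (.var 2))) (.hole (some (0 : Fin 1))))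
      (.leaf (.unif (t.shift 2) (.arr (.var 1) (.var 0))))))
  | .app, t => .ex (.ex (.conj (.hole (some (0 : Fin 2))) (.conj (.hole (some (1 : Fin 2)))
      (.leaf (.unif (.var 0) (.arr (.var 1) (t.shift 2)))))))
  | .letE x, _ => .letC x (.hole (some (0 : Fin 2))) (.hole (some (1 : Fin 2)))
  | .annot a, t => .exN a.n (.conj (.hole (some (0 : Fin 1))) (.leaf (.unif (t.shift a.n) a.ty)))
  | .tuple n, t => .exN n (.conj (.leaf (.unif (t.shift n) (.prod fun i : Fin n => .var i)))
      (.bigConj fun i : Fin n => .hole (some (i : Fin n))))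
  | .projX n j _, t => .ex (.exN n (.conj (.hole (some (0 : Fin 1)))
      (.leaf (.conj (.unif (.var n) (.prod fun i : Fin n => .var i))
        (.unif (t.shift (n + 1)) (.var j))))))
  | .projBad _ _ _ _, _ => .leaf .ff
  | .boxX a, t => .exN a.n (.conj (.allN a.sch.n (.hole (some (0 : Fin 1))))
      (.leaf (.unif (t.shift a.n) (.poly a.sch))))
  | .unboxX a, t => .ex (.exN a.n (.conj (.hole (some (0 : Fin 1)))
      (.leaf (.conj (.unif (.var a.n) (.poly a.sch)) (.schemeLe a.sch (t.shift (a.n + 1)))))))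
  | .recordX T n ls, t => .exN (n + 1) (.conj
      (.bigConj fun i : Fin (n + 1) => .hole (some (i : Fin (n + 1))))
      (.leaf (.conj (.domIs L T (Set.range ls))
        (.bigConj fun i => .labInst L (ls i) T (t.shift (n + 1)) (.var i)))))
  | .recordC T n ls _, t => .exN (n + 1) (.conj
      (.bigConj fun i : Fin (n + 1) => .hole (some (i : Fin (n + 1))))
      (.leaf (.conj (.domIs L T (Set.range ls))
        (.bigConj fun i => .labInst L (ls i) T (t.shift (n + 1)) (.var i)))))
  | .fieldX T l, t => .ex (.conj (.hole (some (0 : Fin 1)))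
      (.leaf (.labInst L l T (.var 0) (t.shift 1))))
  | .fieldC T l _, t => .ex (.conj (.hole (some (0 : Fin 1)))
      (.leaf (.labInst L l T (.var 0) (t.shift 1))))
  | .hole n, _ => .exN n (.bigConj fun i : Fin n => .hole (some (i : Fin n)))
  | .imp k _, _ => k.mc
  | .exp x, _ => x.imp.mc

/-- The (discharged) suspended constraint. -/
def slot : Op L → Ty S → Constr S
  | .imp k _, t => k.susp t
  | .exp x, t => x.disch L t
  | _, _ => .tt

/-- The constraint, given the constraints of the subterms. -/
def con (o : Op L) (t : Ty S) (cs : Fin o.ar → Constr S) : Constr S :=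
  (o.mc t).fill fun i => i.elim (o.slot t) cs

theorem leaves (o : Op L) (t : Ty S) : (o.mc t).Leaves := by
  have hk : ∀ k : Imp S, k.mc.Leaves := by
    intro k
    cases k with
    | record n ls => exact MC.leaves_exN.2 ⟨MC.leaves_bigConj fun _ => trivial, trivial⟩
    | _ => exact ⟨trivial, trivial⟩
  have hr : ∀ (T : S.Rec) (n : ℕ) (ls : Fin (n + 1) → S.Lab), NoMatch (.conj (.domIs L T (Set.range ls))
      (.bigConj fun i => .labInst L (ls i) T (t.shift (n + 1)) (.var i))) := fun T n ls =>
    ⟨NoMatch.domIs, NoMatch.bigConj fun _ => NoMatch.labInst⟩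
  cases o with
  | imp k h => exact hk k
  | exp x => exact hk _
  | lam x => exact ⟨⟨trivial, trivial⟩, trivial⟩
  | app => exact ⟨trivial, trivial, trivial⟩
  | letE x => exact ⟨trivial, trivial⟩
  | annot a => exact MC.leaves_exN.2 ⟨trivial, trivial⟩
  | tuple n => exact MC.leaves_exN.2 ⟨trivial, MC.leaves_bigConj fun _ => trivial⟩
  | projX n j h => exact MC.leaves_exN.2 ⟨trivial, trivial, trivial⟩
  | boxX a => exact MC.leaves_exN.2 ⟨MC.leaves_allN.2 trivial, trivial⟩
  | unboxX a => exact MC.leaves_exN.2 ⟨trivial, trivial, NoMatch.exN trivial⟩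
  | recordX T n ls => exact MC.leaves_exN.2 ⟨MC.leaves_bigConj fun _ => trivial, hr _ _ _⟩
  | recordC T n ls h => exact MC.leaves_exN.2 ⟨MC.leaves_bigConj fun _ => trivial, hr _ _ _⟩
  | fieldX T l => exact ⟨trivial, NoMatch.labInst⟩
  | fieldC T l h => exact ⟨trivial, NoMatch.labInst⟩
  | hole n => exact MC.leaves_exN.2 (MC.leaves_bigConj fun _ => trivial)
  | _ => trivial

theorem _root_.OML.Imp.cnt_mc (k : Imp S) (j : Option (Fin k.ar)) : k.mc.cnt j = 1 := by
  have h1 : ∀ j : Option (Fin 1), (if some (0 : Fin 1) = j then 1 else 0) +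
      (if none = j then 1 else 0) = 1 := by
    rintro (_ | i)
    · rfl
    · obtain rfl := Subsingleton.elim i 0; rfl
  cases k with
  | record n ls =>
    simp only [Imp.mc, MC.cnt_exN, MC.cnt, MC.cnt_bigConj]
    cases j with
    | none => simp
    | some i => simp [Imp.ar] at i ⊢
  | _ => exact h1 j

/-- The constraint of each subterm is used exactly once, so a one-hole context of a tree gives a
one-hole constraint context. -/
theorem cnt_some (o : Op L) (t : Ty S) (i : Fin o.ar) : (o.mc t).cnt (some i) = 1 := by
  have h1 : ∀ i : Fin 1, (if some (0 : Fin 1) = some i then 1 else 0) = 1 := by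
    intro i; obtain rfl := Subsingleton.elim i 0; rfl
  have h2 : ∀ i : Fin 2, (if some (0 : Fin 2) = some i then 1 else 0) +
      (if some (1 : Fin 2) = some i then 1 else 0) = 1 := by decide
  have h3 : ∀ {n : ℕ} (i : Fin n),
      (MC.bigConj fun j : Fin n => (MC.hole (some j) : MC S (Option (Fin n)))).cnt (some i) = 1 := by
    intro n i; rw [MC.cnt_bigConj]; simp [MC.cnt]
  cases o with
  | imp k h => exact k.cnt_mc _
  | exp x => exact x.imp.cnt_mc _
  | var x => exact i.elim0
  | unit => exact i.elim0
  | projBad => exact i.elim0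
  | lam x => exact (congrArg (· + 0) (Nat.zero_add _)).trans (h1 i)
  | app => exact h2 i
  | letE x => exact h2 i
  | annot a => exact MC.cnt_exN.trans (h1 i)
  | tuple n => exact MC.cnt_exN.trans ((Nat.zero_add _).trans (h3 i))
  | projX n j h => exact MC.cnt_exN.trans (h1 i)
  | boxX a => exact MC.cnt_exN.trans ((congrArg (· + 0) MC.cnt_allN).trans (h1 i))
  | unboxX a => exact MC.cnt_exN.trans (h1 i)
  | recordX T n ls => exact MC.cnt_exN.trans (h3 i)
  | recordC T n ls h => exact MC.cnt_exN.trans (h3 i)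
  | fieldX T l => exact h1 i
  | fieldC T l h => exact h1 i
  | hole n => exact MC.cnt_exN.trans (h3 i)

theorem cnt_none (o : Op L) (t : Ty S) : (o.mc t).cnt none ≤ 1 := by
  cases o with
  | imp k h => exact (k.cnt_mc _).le
  | exp x => exact (x.imp.cnt_mc _).le
  | _ => simp [mc, MC.cnt, MC.cnt_exN, MC.cnt_allN, MC.cnt_bigConj]

end Op

end OML

namespace OML

variable {S : Sig}

/-! ### Terms and generated constraints have the same ground meaning -/

theorem eq_ev_iff {g : Ground S} {t : Ty S} {v : ℕ → Ground S} :
    g = t.ev v ↔ g.1 = t.subst (gt v) := ⟨fun h => congrArg Subtype.val h, fun h => Ground.ext h⟩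

theorem eq_ev_unit {g : Ground S} {v : ℕ → Ground S} : g = Ty.unit.ev v ↔ g.1 = .unit :=
  eq_ev_iff.trans (by rw [Ty.unit_subst])

theorem eq_ev_arr {g : Ground S} {a b : Ty S} {v : ℕ → Ground S} :
    g = (Ty.arr a b).ev v ↔ g.1 = .arr (a.ev v).1 (b.ev v).1 :=
  eq_ev_iff.trans (by rw [Ty.arr_subst]; rfl)

theorem eq_ev_prod {g : Ground S} {n : ℕ} {φ : Env S} {u : ℕ → Ground S} :
    g = (Ty.prod fun i : Fin n => Ty.var i).ev (φ.pushN n u).ty ↔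
      g.1 = .prod fun i : Fin n => (u i).1 := by
  have : (fun i : Fin n => gt (φ.pushN n u).ty i) = fun i : Fin n => (u i).1 :=
    funext fun i => congrArg Subtype.val (pushN_lt φ u i.2)
  exact eq_ev_iff.trans (by rw [Ty.prod_subst]; simp only [Ty.var_subst, this])

theorem eq_ev_rcd {g : Ground S} {T : S.Rec} {φ : Env S} {u : ℕ → Ground S} :
    g = (Ty.rcd T fun i : Fin (S.arity T) => Ty.var i).ev (φ.pushN (S.arity T) u).ty ↔
      g.1 = .rcd T fun i : Fin (S.arity T) => (u i).1 := by
  have : (fun i : Fin (S.arity T) => gt (φ.pushN (S.arity T) u).ty i) =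
      fun i : Fin (S.arity T) => (u i).1 :=
    funext fun i => congrArg Subtype.val (pushN_lt φ u i.2)
  exact eq_ev_iff.trans (by rw [Ty.rcd_subst]; simp only [Ty.var_subst, this])

theorem eq_ev_poly {g : Ground S} {a : SchAnn S} {φ : Env S} {u : ℕ → Ground S} :
    g = (Ty.poly a.sch).ev (φ.pushN a.n u).ty ↔ g.1 = .poly (a.sch.subst (gt u)) := by
  rw [ev_pushN_closed φ u (t := Ty.poly a.sch) fun i hi => (a.closed i).1 hi]
  exact eq_ev_iff

theorem exists_fin_fun {n : ℕ} {P : (Fin n → Ground S) → Prop} :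
    (∃ gs, P gs) ↔ ∃ u : ℕ → Ground S, P fun i => u i := by
  constructor
  · rintro ⟨gs, h⟩
    refine ⟨fun i => if hi : i < n then gs ⟨i, hi⟩ else default, ?_⟩
    convert h using 1
    funext i; simp
  · rintro ⟨u, h⟩; exact ⟨_, h⟩

theorem update_subset_self {ρ : ℕ → Set (Ground S)} {x : ℕ} {G G' : Set (Ground S)} (h : G ⊆ G')
    (y : ℕ) : Function.update ρ x G y ⊆ Function.update ρ x G' y := by
  by_cases hy : y = x
  · subst hy; simpa using h
  · simp [Function.update_of_ne hy]

theorem LabelEnv.LabInst.exists_rcd {L : LabelEnv S} {l : S.Lab} {T : S.Rec} {a : Ground S} {b : Ty S}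
    (h : L.LabInst l T a.1 b) : ∃ u : ℕ → Ground S, a.1 = .rcd T fun i => (u i).1 := by
  obtain ⟨t, _, θ, h2, _⟩ := h
  refine ⟨fun i => (θ i).ev fun _ => default, ?_⟩
  have := Ty.subst_of_closed a.2 (gt fun _ => default)
  rw [h2] at this ⊢
  exact this.symm

namespace Op

variable {L : LabelEnv S}

theorem sem_record {m : Prop} {T : S.Rec} {n : ℕ} {ls : Fin (n + 1) → S.Lab} {t : Ty S}
    {cs : Fin (n + 1) → Constr S} {ts : Fin (n + 1) → Term S} {φ : Env S}
    (h : ∀ i φ, csem m (cs i) φ ↔ tsem m L (ts i) φ.tm ((Ty.var i).ev φ.ty)) :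
    csem m ((recordX (L := L) T n ls).con t cs) φ ↔ L.dom T = Set.range ls ∧
      ∃ gs : Fin (n + 1) → Ground S, (∀ i, L.LabInst (ls i) T (t.ev φ.ty).1 (gs i).1) ∧
        ∀ i, tsem m L (ts i) φ.tm (gs i) := by
  rw [exists_fin_fun]
  simp only [con, mc, MC.fill_exN, MC.fill, MC.fill_bigConj, csem_exN, csem, csem_bigConj,
    Option.elim, h, csem_domIs, csem_labInst, ev_shift_pushN, Ty.ev_var]
  have e : ∀ (u : ℕ → Ground S) (i : Fin (n + 1)), (φ.pushN (n + 1) u).ty i = u i :=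
    fun u i => pushN_lt φ u i.2
  simp only [e]
  constructor
  · rintro ⟨u, h1, h2, h3⟩; exact ⟨h2, u, h3, h1⟩
  · rintro ⟨h2, u, h3, h1⟩; exact ⟨u, h1, h2, h3⟩

theorem sem_field {m : Prop} {T : S.Rec} {l : S.Lab} {t : Ty S}
    {cs : Fin 1 → Constr S} {ts : Fin 1 → Term S} {φ : Env S}
    (h : ∀ φ, csem m (cs 0) φ ↔ tsem m L (ts 0) φ.tm ((Ty.var 0).ev φ.ty)) :
    csem m ((fieldX (L := L) T l).con t cs) φ ↔
      ∃ g : Ground S, tsem m L (ts 0) φ.tm g ∧ L.LabInst l T g.1 (t.ev φ.ty).1 := by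
  simp only [con, mc, MC.fill, csem, Option.elim, csem_labInst, ev_shift_one]
  exact exists_congr fun g => and_congr (h _) Iff.rfl

/-- The surroundings of the slot are the same whether it holds a suspended constraint, a discharged
one or an observation. The environments `ψ` that reach the slot are described once, for all three
uses. -/
theorem _root_.OML.Imp.sem_mc {m : Prop} {k : Imp S} {cs : Option (Fin k.ar) → Constr S}
    {ts : Fin k.ar → Term S} {φ : Env S}
    (h : ∀ i φ, csem m (cs (some i)) φ ↔ tsem m L (ts i) φ.tm ((Ty.var i).ev φ.ty)) :
    csem m (k.mc.fill cs) φ ↔ ∃ ψ : Env S, csem m (cs none) ψ ∧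
      match k, ts with
      | .box, ts => ∃ G : Set (Ground S), (∀ g ∈ G, tsem m L (ts (0 : Fin 1)) φ.tm g) ∧ G.Nonempty ∧
          ψ = φ.setTm 0 G
      | .record n _, ts => ∃ u, ψ = φ.pushN (n + 1) u ∧
          ∀ i : Fin (n + 1), tsem m L (ts i) φ.tm (u i)
      | .proj _, ts => ∃ g, tsem m L (ts (0 : Fin 1)) φ.tm g ∧ ψ = φ.pushTy g
      | .unbox, ts => ∃ g, tsem m L (ts (0 : Fin 1)) φ.tm g ∧ ψ = φ.pushTy g
      | .field _, ts => ∃ g, tsem m L (ts (0 : Fin 1)) φ.tm g ∧ ψ = φ.pushTy g := by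
  have key : ∀ {c c' : Constr S} {e : Term S}, (∀ φ, csem m c φ ↔ tsem m L e φ.tm (φ.ty 0)) →
      ((∃ g, csem m c (φ.pushTy g) ∧ csem m c' (φ.pushTy g)) ↔ ∃ ψ, csem m c' ψ ∧
        ∃ g, tsem m L e φ.tm g ∧ ψ = φ.pushTy g) := by
    intro c c' e hc
    constructor
    · rintro ⟨g, h1, h2⟩; exact ⟨_, h2, g, (hc _).1 h1, rfl⟩
    · rintro ⟨_, h2, g, h1, rfl⟩; exact ⟨g, (hc _).2 h1, h2⟩
  cases k with
  | box =>
    constructor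
    · rintro ⟨G, h1, h2, h3⟩; exact ⟨_, h3, G, fun g hg => (h (0 : Fin 1) _).1 (h1 g hg), h2, rfl⟩
    · rintro ⟨_, h3, G, h1, h2, rfl⟩; exact ⟨G, fun g hg => (h (0 : Fin 1) _).2 (h1 g hg), h2, h3⟩
  | record n ls =>
    simp only [Imp.mc, MC.fill_exN, csem_exN, MC.fill, MC.fill_bigConj, csem, csem_bigConj]
    have h' : ∀ u, (∀ i : Fin (n + 1), csem m (cs (some i)) (φ.pushN (n + 1) u)) ↔
        ∀ i : Fin (n + 1), tsem m L (ts i) φ.tm (u i) := fun u => forall_congr' fun i => by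
      rw [h i, Ty.ev_var, pushN_lt φ u i.2]; rfl
    constructor
    · rintro ⟨u, h1, h2⟩; exact ⟨_, h2, u, rfl, (h' u).1 h1⟩
    · rintro ⟨_, h2, u, rfl, h1⟩; exact ⟨u, (h' u).2 h1, h2⟩
  | proj j => exact key (h (0 : Fin 1))
  | unbox => exact key (h (0 : Fin 1))
  | field l => exact key (h (0 : Fin 1))

end Op

/-- The observation of a type has the same meaning for constraints and for terms. -/
theorem Imp.sem_obs {L : LabelEnv S} {m : Prop} {k : Imp S} {cs : Option (Fin k.ar) → Constr S}
    {ts : Fin k.ar → Term S} {φ : Env S} {t : Ty S} {g : Ground S}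
    (h : ∀ i φ, csem m (cs (some i)) φ ↔ tsem m L (ts i) φ.tm ((Ty.var i).ev φ.ty))
    (h0 : cs none = .unif (k.scrut t) g.1) :
    csem m (k.mc.fill cs) φ ↔ tsem m L (k.obs g ts) φ.tm (t.ev φ.ty) := by
  rw [Imp.sem_mc (L := L) h, h0]
  simp only [csem, Ty.ev_ground]
  have h1 : ∀ {P : Ground S → Prop}, (∃ gs : Fin 1 → Ground S, ∀ i, P (gs i)) ↔ ∃ h, P h := by
    intro P
    exact ⟨fun ⟨gs, h⟩ => ⟨gs 0, h 0⟩, fun ⟨g, h⟩ => ⟨fun _ => g, fun _ => h⟩⟩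
  have key : ∀ e : Term S, (∃ ψ : Env S, (Ty.var 0).ev ψ.ty = g ∧
      ∃ h, tsem m L e φ.tm h ∧ ψ = φ.pushTy h) ↔
      tsem m L (.hole ![.annot e g.ann]) φ.tm (t.ev φ.ty) := by
    intro e
    simp only [tsem, Ground.ann]
    constructor
    · rintro ⟨_, h2, g', h3, rfl⟩
      obtain rfl : g' = g := h2
      exact ⟨fun _ => g', fun i => by
        obtain rfl := Subsingleton.elim i 0
        exact ⟨fun _ => default, by rwa [Ty.ev_ground], (Ty.ev_ground _ _).symm⟩⟩
    · rintro ⟨gs, h2⟩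
      obtain ⟨u, h3, h4⟩ := h2 0
      rw [Ty.ev_ground] at h3
      exact ⟨_, rfl, g, h3, rfl⟩
  cases k with
  | proj j => exact key _
  | unbox => exact key _
  | field l => exact key _
  | box =>
    simp only [Imp.scrut, Imp.obs, tsem, Ground.ann, Ty.ev_ground]
    constructor
    · rintro ⟨_, h2, G, h3, ⟨h, hh⟩, rfl⟩
      exact ⟨fun _ => default, ⟨fun _ => h, fun i => by
        obtain rfl := Subsingleton.elim i 0; exact h3 h hh⟩, h2⟩
    · rintro ⟨_, ⟨gs, h2⟩, h3⟩
      exact ⟨φ.setTm 0 {gs 0}, h3, {gs 0}, by rintro _ rfl; exact h2 0, ⟨_, rfl⟩, rfl⟩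
  | record n ls =>
    simp only [Imp.scrut, Imp.obs, tsem, Ground.ann, Ty.ev_ground]
    constructor
    · rintro ⟨_, h2, u, rfl, h3⟩
      rw [ev_shift_pushN] at h2
      exact ⟨fun _ => default, ⟨fun i => u i, h3⟩, h2⟩
    · rintro ⟨_, ⟨gs, h2⟩, h3⟩
      obtain ⟨u, hu⟩ := (exists_fin_fun (P := fun gs => ∀ i, tsem m L (ts i) φ.tm (gs i))).1 ⟨gs, h2⟩
      exact ⟨_, by rw [ev_shift_pushN]; exact h3, u, rfl, hu⟩

/-- A discharged suspended constraint has the meaning of the explicit construct. -/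
theorem Exp.sem {L : LabelEnv S} {m : Prop} {x : Exp S} {cs : Option (Fin x.imp.ar) → Constr S}
    {ts : Fin x.imp.ar → Term S} {φ : Env S} {t : Ty S}
    (h : ∀ i φ, csem m (cs (some i)) φ ↔ tsem m L (ts i) φ.tm ((Ty.var i).ev φ.ty))
    (h0 : cs none = x.disch L t) :
    csem m (x.imp.mc.fill cs) φ ↔ tsem m L (x.mk ts) φ.tm (t.ev φ.ty) := by
  rw [Imp.sem_mc (L := L) h, h0]
  cases x with
  | proj n j =>
    rw [Exp.disch_proj]
    simp only [Exp.imp, Exp.mk, tsem]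
    by_cases hj : j < n
    · simp only [if_pos hj, csem_exN, csem, ev_shift_pushN, eq_ev_prod]
      constructor
      · rintro ⟨_, ⟨u, h1, h2⟩, g, h3, rfl⟩
        refine ⟨fun i => u i, g, h3, h1, hj, ?_⟩
        rw [ev_shift_one, Ty.ev_var, pushN_lt _ u hj] at h2
        exact h2
      · rintro ⟨gs, g, h3, h1, hj, h2⟩
        obtain ⟨u, h4, h5⟩ := (exists_fin_fun (P := fun gs => g.1 = Ty.prod (fun i => (gs i).1) ∧
          t.ev φ.ty = gs ⟨j, hj⟩)).1 ⟨gs, h1, h2⟩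
        refine ⟨φ.pushTy g, ⟨u, h4, ?_⟩, g, h3, rfl⟩
        rw [ev_shift_one, Ty.ev_var, pushN_lt _ u hj]
        exact h5
    · simp only [if_neg hj, csem, false_and, exists_false, false_iff]
      rintro ⟨_, _, _, _, h, _⟩
      exact hj h
  | box a =>
    rw [Exp.disch_box]
    simp only [Exp.imp, Exp.mk, tsem, csem_exN, csem, csem_leScheme, ev_shift_pushN, eq_ev_poly]
    have e : ∀ (ψ : Env S) u, a.sch.ginst (ψ.pushN a.n u).ty = a.sch.ginst u := fun ψ u =>
      Scheme.ginst_pushN ψ u fun i hi => (a.closed i).1 hi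
    simp only [e]
    constructor
    · rintro ⟨_, ⟨u, h1, h2⟩, G, h3, h4, rfl⟩
      exact ⟨u, fun g hg => h3 g (by simpa [Env.pushN, Env.setTm] using h2 g hg), h1⟩
    · rintro ⟨u, h1, h2⟩
      -- The `let` can bind exactly the ground instances of the boxed scheme, a nonempty set.
      exact ⟨φ.setTm 0 (a.sch.ginst u), ⟨u, h2, fun g hg => by simpa [Env.pushN, Env.setTm] using hg⟩, a.sch.ginst u, h1,
        Scheme.ginst_nonempty _ _, rfl⟩
  | unbox a =>
    rw [Exp.disch_unbox]
    simp only [Exp.imp, Exp.mk, tsem, csem_exN, csem, csem_schemeLe, ev_shift_pushN, eq_ev_poly]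
    have e : ∀ (ψ : Env S) u, a.sch.ginst (ψ.pushN a.n u).ty = a.sch.ginst u := fun ψ u =>
      Scheme.ginst_pushN ψ u fun i hi => (a.closed i).1 hi
    simp only [e]
    constructor
    · rintro ⟨_, ⟨u, h1, h2⟩, g, h3, rfl⟩
      rw [ev_shift_one] at h2
      exact ⟨u, g, h3, h1, h2⟩
    · rintro ⟨u, g, h3, h1, h2⟩
      exact ⟨φ.pushTy g, ⟨u, h1, by rwa [ev_shift_one]⟩, g, h3, rfl⟩
  | record T n ls =>
    rw [Exp.disch_record]
    simp only [Exp.imp, Exp.mk, tsem, csem_exN, csem, csem_bigConj, csem_domIs, csem_labInst,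
      ev_shift_pushN, eq_ev_rcd]
    constructor
    · rintro ⟨_, ⟨v, h1, h2, h3⟩, u, rfl, h4⟩
      refine ⟨h2, fun i => u i, fun i => ?_, h4⟩
      have := h3 i
      rwa [ev_shift_pushN, Ty.ev_var, pushN_lt _ u i.2] at this
    · rintro ⟨h2, gs, h3, h4⟩
      obtain ⟨u, h3, h4⟩ := (exists_fin_fun (P := fun gs =>
        (∀ i, L.LabInst (ls i) T (t.ev φ.ty).1 (gs i).1) ∧ ∀ i, tsem m L (ts i) φ.tm (gs i))).1
        ⟨gs, h3, h4⟩
      -- That the type is a record type follows from any label instance; a literal has at least one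
      -- field.
      obtain ⟨v, hv⟩ := (h3 0).exists_rcd
      refine ⟨_, ⟨v, by rw [ev_shift_pushN]; exact hv, h2, fun i => ?_⟩, u, rfl, h4⟩
      rw [ev_shift_pushN, Ty.ev_var, pushN_lt _ u i.2]
      exact h3 i
  | field T l =>
    rw [Exp.disch_field]
    simp only [Exp.imp, Exp.mk, tsem, csem_exN, csem, csem_labInst, ev_shift_pushN, eq_ev_rcd]
    constructor
    · rintro ⟨_, ⟨v, h1, h2⟩, g, h3, rfl⟩
      rw [ev_shift_one] at h2
      exact ⟨g, h3, h2⟩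
    · rintro ⟨g, h3, h2⟩
      obtain ⟨v, hv⟩ := h2.exists_rcd
      exact ⟨φ.pushTy g, ⟨v, hv, by rw [ev_shift_one]; exact h2⟩, g, h3, rfl⟩

/-- A suspended constraint counts as `m`, like an implicit construct. Openness excludes records and
projections that their labels determine, which are read as explicit. -/
theorem Imp.sem_susp {L : LabelEnv S} {m : Prop} {k : Imp S} (hk : k.Open L)
    {cs : Option (Fin k.ar) → Constr S}
    {ts : Fin k.ar → Term S} {φ : Env S} {t : Ty S}
    (h : ∀ i φ, csem m (cs (some i)) φ ↔ tsem m L (ts i) φ.tm ((Ty.var i).ev φ.ty))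
    (h0 : cs none = k.susp t) :
    csem m (k.mc.fill cs) φ ↔ tsem m L (k.mk ts) φ.tm (t.ev φ.ty) := by
  rw [Imp.sem_mc (L := L) h, h0]
  have key : ∀ e : Term S, (∃ ψ : Env S, m ∧ ∃ h, tsem m L e φ.tm h ∧ ψ = φ.pushTy h) ↔
      m ∧ ∃ h, tsem m L e φ.tm h := by
    intro e
    exact ⟨fun ⟨_, hm, h, h1, _⟩ => ⟨hm, h, h1⟩, fun ⟨hm, h, h1⟩ => ⟨_, hm, h, h1, rfl⟩⟩
  cases k with
  | proj j => exact key _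
  | unbox => exact key _
  | field l =>
    have hk' : ¬ ∃ T, L.LabUni l T := hk
    refine (key (ts (0 : Fin 1))).trans ?_
    simp only [Imp.mk, tsem]
    constructor
    · exact fun h => .inr ⟨hk', h⟩
    · rintro (⟨T, hT, _⟩ | ⟨_, h⟩)
      · exact (hk' ⟨T, hT⟩).elim
      · exact h
  | box =>
    simp only [Imp.mk, tsem, Imp.susp, csem]
    constructor
    · rintro ⟨_, hm, G, h1, ⟨g, hg⟩, _⟩; exact ⟨hm, g, h1 g hg⟩
    · rintro ⟨hm, g, hg⟩; exact ⟨_, hm, {g}, by rintro _ rfl; exact hg, ⟨g, rfl⟩, rfl⟩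
  | record n ls =>
    have hk' : ¬ ∃ T, L.LabsUni (Set.range ls) T := hk
    simp only [Imp.mk, tsem, Imp.susp, csem]
    constructor
    · rintro ⟨_, hm, u, _, h1⟩
      exact .inr ⟨hk', hm, fun i => u i, h1⟩
    · rintro (⟨T, hT, _⟩ | ⟨_, hm, h1⟩)
      · exact (hk' ⟨T, hT⟩).elim
      · obtain ⟨u, h1⟩ := (exists_fin_fun (n := n + 1)
          (P := fun gs => ∀ i : Fin (n + 1), tsem m L (ts i) φ.tm (gs i))).1 h1
        exact ⟨_, hm, u, rfl, h1⟩

/-- The induction step of the agreement between terms and constraints, for one construct at a time.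
-/
theorem Op.sem {L : LabelEnv S} {m : Prop} (o : Op L) {t : Ty S} {cs : Fin o.ar → Constr S}
    {ts : Fin o.ar → Term S} {φ : Env S}
    (h : ∀ i φ, csem m (cs i) φ ↔ tsem m L (ts i) φ.tm ((o.ty t i).ev φ.ty)) :
    csem m (o.con t cs) φ ↔ tsem m L (o.mk ts) φ.tm (t.ev φ.ty) := by
  cases o with
  | var x => rfl
  | unit => exact eq_ev_unit
  | projBad e n j hj =>
    refine ⟨fun h => h.elim, ?_⟩
    rintro ⟨_, _, _, _, h, _⟩
    exact hj h
  | imp k hk => exact Imp.sem_susp hk h rfl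
  | exp x => exact Exp.sem h rfl
  | recordX T n ls => exact Op.sem_record h
  | recordC T n ls hT =>
    refine (Op.sem_record (cs := cs) h).trans ?_
    constructor
    · rintro ⟨h1, h2⟩; exact .inl ⟨T, hT, h1, h2⟩
    · rintro (⟨T', hT', h1, h2⟩ | ⟨hn, _⟩)
      · obtain rfl := hT.2 T' h1; exact ⟨h1, h2⟩
      · exact (hn ⟨T, hT⟩).elim
  | fieldX T l => exact Op.sem_field (h (0 : Fin 1))
  | fieldC T l hT =>
    refine (Op.sem_field (cs := cs) (h (0 : Fin 1))).trans ?_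
    constructor
    · exact fun h => .inl ⟨T, hT, h⟩
    · rintro (⟨T', hT', h⟩ | ⟨hn, _⟩)
      · obtain rfl := hT.2 T' hT'.1; exact h
      · exact (hn ⟨T, hT⟩).elim
  | lam x =>
    have h0 := h (0 : Fin 1)
    constructor
    · rintro ⟨g₁, g₂, ⟨G, h1, _, h2⟩, h3⟩
      -- The constraint binds `x` to some nonempty subset of `{g₁}`; monotonicity replaces it by the
      -- singleton.
      refine ⟨g₁, g₂, eq_ev_arr.1 ((ev_shift_two φ g₁ g₂ t).symm.trans h3), tsem_mono (fun y _ => update_subset_self ?_ y) ((h0 _).1 h2)⟩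
      exact fun g hg => h1 g hg
    · rintro ⟨g₁, g₂, h1, h2⟩
      exact ⟨g₁, g₂, ⟨{g₁}, fun g hg => hg, ⟨g₁, rfl⟩, (h0 _).2 h2⟩,
        (ev_shift_two _ _ _ _).trans (eq_ev_arr.2 h1)⟩
  | app =>
    have h0 := h (0 : Fin 2)
    have h1 := h (1 : Fin 2)
    constructor
    · rintro ⟨g₁, g₂, h2, h3, h4⟩
      have h4 := eq_ev_arr.1 h4
      rw [ev_shift_two] at h4
      exact ⟨g₁, g₂, (h0 _).1 h2, h4, (h1 _).1 h3⟩
    · rintro ⟨g₁, g₂, h2, h4, h3⟩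
      refine ⟨g₁, g₂, (h0 _).2 h2, (h1 _).2 h3, eq_ev_arr.2 ?_⟩
      rw [ev_shift_two]; exact h4
  | letE x =>
    have h0 := h (0 : Fin 2)
    have h1 := h (1 : Fin 2)
    constructor
    · rintro ⟨G, h2, h3, h4⟩
      exact ⟨G, fun g hg => (h0 _).1 (h2 g hg), h3, (h1 _).1 h4⟩
    · rintro ⟨G, h2, h3, h4⟩
      exact ⟨G, fun g hg => (h0 _).2 (h2 g hg), h3, (h1 _).2 h4⟩
  | annot a =>
    have h0 := h (0 : Fin 1)
    rw [con, mc, MC.fill_exN]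
    refine csem_exN.trans (exists_congr fun u => ?_)
    have e : a.ty.ev (φ.pushN a.n u).ty = a.ty.ev u :=
      ev_pushN_closed φ u fun i hi => (a.closed i).1 hi
    refine and_congr ((h0 _).trans (by rw [← e]; rfl)) ?_
    show (t.shift a.n).ev _ = a.ty.ev _ ↔ _
    rw [ev_shift_pushN, e]
  | tuple n =>
    simp only [con, mc, MC.fill_exN, csem_exN, MC.fill, MC.fill_bigConj, csem, csem_bigConj,
      ev_shift_pushN, eq_ev_prod, mk, tsem, Option.elim]
    refine Iff.trans (exists_congr fun u => and_congr_right fun _ => forall_congr' fun i => ?_)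
      (exists_fin_fun (P := fun gs => (t.ev φ.ty).1 = .prod (fun i : Fin n => (gs i).1) ∧
        ∀ i : Fin n, tsem m L (ts i) φ.tm (gs i))).symm
    refine (h i _).trans ?_
    simp only [ty, Ty.ev_var]
    rw [pushN_lt φ u i.2]; rfl
  | hole n =>
    simp only [con, mc, MC.fill_exN, csem_exN, MC.fill, MC.fill_bigConj, csem_bigConj,
      mk, tsem, Option.elim]
    refine Iff.trans (exists_congr fun u => forall_congr' fun i => ?_)
      (exists_fin_fun (P := fun gs => ∀ i : Fin n, tsem m L (ts i) φ.tm (gs i))).symm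
    refine (h i _).trans ?_
    simp only [ty, Ty.ev_var]
    rw [pushN_lt φ u i.2]; rfl
  | projX n j hj =>
    have h0 := h (0 : Fin 1)
    simp only [con, mc, MC.fill_exN, csem_exN, MC.fill, csem, ev_shift_succ, Ty.ev_var,
      mk, tsem, Option.elim]
    simp only [pushN_self, pushN_lt _ _ hj, eq_ev_prod]
    constructor
    · rintro ⟨g, u, h1, h2, h3⟩
      refine ⟨fun i => u i, g, ?_, h2, hj, h3⟩
      have := (h0 _).1 h1
      simp only [ty, Ty.ev_var, pushN_self] at this
      exact this
    · rintro ⟨gs, g, h1, h2, _, h3⟩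
      obtain ⟨u, h4, h5⟩ := (exists_fin_fun (P := fun gs => g.1 = Ty.prod (fun i => (gs i).1) ∧
          t.ev φ.ty = gs ⟨j, hj⟩)).1 ⟨gs, h2, h3⟩
      refine ⟨g, u, (h0 _).2 ?_, h4, h5⟩
      simp only [ty, Ty.ev_var, pushN_self]
      exact h1
  | boxX a =>
    have h0 := h (0 : Fin 1)
    simp only [con, mc, MC.fill_exN, csem_exN, MC.fill, MC.fill_allN, csem, ev_shift_pushN,
      eq_ev_poly, mk, tsem, Option.elim]
    refine exists_congr fun u => and_congr ?_ Iff.rfl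
    refine (csem_allN_unbind (φ := φ.pushN a.n u) (P := fun g => tsem m L (ts (0 : Fin 1)) φ.tm g)
      fun u' => h0 _).trans ?_
    rw [Scheme.ginst_pushN φ u fun i hi => (a.closed i).1 hi]
  | unboxX a =>
    have h0 := h (0 : Fin 1)
    simp only [con, mc, MC.fill_exN, csem_exN, MC.fill, csem, ev_shift_succ, Ty.ev_var,
      mk, tsem, Option.elim, csem_schemeLe, eq_ev_poly, pushN_self]
    have e : ∀ (ψ : Env S) u, a.sch.ginst (ψ.pushN a.n u).ty = a.sch.ginst u := fun ψ u =>
      Scheme.ginst_pushN ψ u fun i hi => (a.closed i).1 hi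
    simp only [e]
    constructor
    · rintro ⟨g, u, h1, h2, h3⟩
      have := (h0 _).1 h1
      simp only [ty, Ty.ev_var, pushN_self] at this
      exact ⟨u, g, this, h2, h3⟩
    · rintro ⟨u, g, h1, h2, h3⟩
      refine ⟨g, u, (h0 _).2 ?_, h2, h3⟩
      simp only [ty, Ty.ev_var, pushN_self]
      exact h1

end OML

namespace OML

variable {S : Sig} {L : LabelEnv S}

/-! ### Contexts of terms, of partially elaborated terms and of their constraints -/

namespace Op

/-- The third alternative is a hole in the operand of an out-of-range projection. Such a subterm is
not a subtree, but then the whole term is meaningless whatever fills the hole. -/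
theorem inv_mk (o : Op L) {es : Fin o.ar → Term S} {E : ECtx S} {e₀ : Term S}
    (h : o.mk es = E.plug e₀) : E = .hole ∨ (∃ (i : Fin o.ar) (E' : ECtx S), es i = E'.plug e₀ ∧
      ∀ e, E.plug e = o.mk (Function.update es i (E'.plug e))) ∨
      ∀ e ρ g, ¬ tsem True L (E.plug e) ρ g := by
  have un : ∀ (es : Fin 1 → Term S) (e : Term S), Function.update es 0 e 0 = e :=
    fun es e => Function.update_self _ _ _
  have fam : ∀ {n : ℕ} {es es' : Fin n → Term S} {j : Fin n} {E' : ECtx S},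
      es = Function.update es' j (E'.plug e₀) → es j = E'.plug e₀ ∧
        ∀ e, Function.update es' j (E'.plug e) = Function.update es j (E'.plug e) := by
    rintro n es es' j E' rfl
    exact ⟨Function.update_self _ _ _, fun e => (Function.update_idem _ _ _).symm⟩
  cases o with
  | var x => cases E with
    | hole => exact .inl rfl
    | _ => cases h
  | unit => cases E with
    | hole => exact .inl rfl
    | _ => cases h
  | lam x => cases E with
    | hole => exact .inl rfl
    | lam y E' => injection h with h1 h2; subst h1; exact .inr (.inl
        ⟨(0 : Fin 1), E', h2, fun e => congrArg (Term.lam x) (un es _).symm⟩)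
    | _ => cases h
  | app => cases E with
    | hole => exact .inl rfl
    | appL E' e => injection h with h1 h2; subst h2; exact .inr (.inl ⟨(0 : Fin 2), E', h1, fun _ => rfl⟩)
    | appR e E' => injection h with h1 h2; subst h1; exact .inr (.inl ⟨(1 : Fin 2), E', h2, fun _ => rfl⟩)
    | _ => cases h
  | letE x => cases E with
    | hole => exact .inl rfl
    | letL y E' e =>
      injection h with h0 h1 h2; subst h0; subst h2
      exact .inr (.inl ⟨(0 : Fin 2), E', h1, fun _ => rfl⟩)
    | letR y e E' =>
      injection h with h0 h1 h2; subst h0; subst h1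
      exact .inr (.inl ⟨(1 : Fin 2), E', h2, fun _ => rfl⟩)
    | _ => cases h
  | annot a => cases E with
    | hole => exact .inl rfl
    | annot E' b => injection h with h1 h2; subst h2; exact .inr (.inl
        ⟨(0 : Fin 1), E', h1, fun e => congrArg (Term.annot · a) (un es _).symm⟩)
    | _ => cases h
  | tuple n => cases E with
    | hole => exact .inl rfl
    | tuple j E' es' =>
      injection h with h1 h2; subst h1
      obtain ⟨h3, h4⟩ := fam (eq_of_heq h2)
      exact .inr (.inl ⟨j, E', h3, fun e => congrArg Term.tuple (h4 e)⟩)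
    | _ => cases h
  | hole n => cases E with
    | hole => exact .inl rfl
    | typedHole j E' es' =>
      injection h with h1 h2; subst h1
      obtain ⟨h3, h4⟩ := fam (eq_of_heq h2)
      exact .inr (.inl ⟨j, E', h3, fun e => congrArg Term.hole (h4 e)⟩)
    | _ => cases h
  | projX n j hj => cases E with
    | hole => exact .inl rfl
    | projX E' n' j' =>
      injection h with h1 h2 h3; subst h2; subst h3
      exact .inr (.inl
        ⟨(0 : Fin 1), E', h1, fun e => congrArg (Term.projX · n j) (un es _).symm⟩)
    | _ => cases h
  | projBad e' n j hj => cases E with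
    | hole => exact .inl rfl
    | projX E' n' j' =>
      injection h with h1 h2 h3; subst h2; subst h3
      refine .inr (.inr ?_)
      rintro e ρ g ⟨_, _, _, _, h, _⟩
      exact hj h
    | _ => cases h
  | boxX a => cases E with
    | hole => exact .inl rfl
    | boxX E' b => injection h with h1 h2; subst h2; exact .inr (.inl
        ⟨(0 : Fin 1), E', h1, fun e => congrArg (Term.boxX · a) (un es _).symm⟩)
    | _ => cases h
  | unboxX a => cases E with
    | hole => exact .inl rfl
    | unboxX E' b => injection h with h1 h2; subst h2; exact .inr (.inl
        ⟨(0 : Fin 1), E', h1, fun e => congrArg (Term.unboxX · a) (un es _).symm⟩)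
    | _ => cases h
  | recordX T n ls => cases E with
    | hole => exact .inl rfl
    | recordX T' ls' j E' es' =>
      injection h with h0 h1 h2 h3; subst h0; subst h1; obtain rfl := eq_of_heq h2
      obtain ⟨h4, h5⟩ := fam (eq_of_heq h3)
      exact .inr (.inl ⟨j, E', h4, fun e => congrArg (Term.recordX T ls) (h5 e)⟩)
    | _ => cases h
  | recordC T n ls hT => cases E with
    | hole => exact .inl rfl
    | record ls' j E' es' =>
      injection h with h1 h2 h3; subst h1; obtain rfl := eq_of_heq h2
      obtain ⟨h4, h5⟩ := fam (eq_of_heq h3)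
      exact .inr (.inl ⟨j, E', h4, fun e => congrArg (Term.record ls) (h5 e)⟩)
    | _ => cases h
  | fieldX T l => cases E with
    | hole => exact .inl rfl
    | fieldX E' T' l' =>
      injection h with h1 h2 h3; subst h2; subst h3
      exact .inr (.inl
        ⟨(0 : Fin 1), E', h1, fun e => congrArg (Term.fieldX · T l) (un es _).symm⟩)
    | _ => cases h
  | fieldC T l hT => cases E with
    | hole => exact .inl rfl
    | field E' l' =>
      injection h with h1 h3; subst h3
      exact .inr (.inl
        ⟨(0 : Fin 1), E', h1, fun e => congrArg (Term.field · l) (un es _).symm⟩)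
    | _ => cases h
  | imp k hk => cases k with
    | proj j => cases E with
      | hole => exact .inl rfl
      | proj E' j' => injection h with h1 h2; subst h2; exact .inr (.inl
        ⟨(0 : Fin 1), E', h1, fun e => congrArg (Term.proj · j) (un es _).symm⟩)
      | _ => cases h
    | box => cases E with
      | hole => exact .inl rfl
      | box E' => injection h with h1; exact .inr (.inl
        ⟨(0 : Fin 1), E', h1, fun e => congrArg (Term.box) (un es _).symm⟩)
      | _ => cases h
    | unbox => cases E with
      | hole => exact .inl rfl
      | unbox E' => injection h with h1; exact .inr (.inl
        ⟨(0 : Fin 1), E', h1, fun e => congrArg (Term.unbox) (un es _).symm⟩)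
      | _ => cases h
    | record n ls => cases E with
      | hole => exact .inl rfl
      | record ls' j E' es' =>
        injection h with h1 h2 h3; subst h1; obtain rfl := eq_of_heq h2
        obtain ⟨h4, h5⟩ := fam (eq_of_heq h3)
        exact .inr (.inl ⟨j, E', h4, fun e => congrArg (Term.record ls) (h5 e)⟩)
      | _ => cases h
    | field l => cases E with
      | hole => exact .inl rfl
      | field E' l' =>
        injection h with h1 h3; subst h3
        exact .inr (.inl
        ⟨(0 : Fin 1), E', h1, fun e => congrArg (Term.field · l) (un es _).symm⟩)
      | _ => cases h
  | exp x => cases x with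
    | proj n j => cases E with
      | hole => exact .inl rfl
      | projX E' n' j' =>
        injection h with h1 h2 h3; subst h2; subst h3
        exact .inr (.inl
        ⟨(0 : Fin 1), E', h1, fun e => congrArg (Term.projX · n j) (un es _).symm⟩)
      | _ => cases h
    | box a => cases E with
      | hole => exact .inl rfl
      | boxX E' b => injection h with h1 h2; subst h2; exact .inr (.inl
        ⟨(0 : Fin 1), E', h1, fun e => congrArg (Term.boxX · a) (un es _).symm⟩)
      | _ => cases h
    | unbox a => cases E with
      | hole => exact .inl rfl
      | unboxX E' b => injection h with h1 h2; subst h2; exact .inr (.inl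
        ⟨(0 : Fin 1), E', h1, fun e => congrArg (Term.unboxX · a) (un es _).symm⟩)
      | _ => cases h
    | record T n ls => cases E with
      | hole => exact .inl rfl
      | recordX T' ls' j E' es' =>
        injection h with h0 h1 h2 h3; subst h0; subst h1; obtain rfl := eq_of_heq h2
        obtain ⟨h4, h5⟩ := fam (eq_of_heq h3)
        exact .inr (.inl ⟨j, E', h4, fun e => congrArg (Term.recordX T ls) (h5 e)⟩)
      | _ => cases h
    | field T l => cases E with
      | hole => exact .inl rfl
      | fieldX E' T' l' =>
        injection h with h1 h2 h3; subst h2; subst h3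
        exact .inr (.inl
        ⟨(0 : Fin 1), E', h1, fun e => congrArg (Term.fieldX · T l) (un es _).symm⟩)
      | _ => cases h

theorem exists_frame (o : Op L) (es : Fin o.ar → Term S) (i : Fin o.ar) :
    ∃ E : ECtx S, ∀ e, E.plug e = o.mk (Function.update es i e) := by
  have un : ∀ (es : Fin 1 → Term S) (i : Fin 1) (e : Term S), Function.update es i e 0 = e := by
    intro es i e; obtain rfl := Subsingleton.elim i 0; exact Function.update_self _ _ _
  cases o with
  | var x => exact i.elim0
  | unit => exact i.elim0
  | projBad => exact i.elim0
  | lam x => exact ⟨.lam x .hole, fun e => congrArg (Term.lam x) (un es i e).symm⟩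
  | app =>
    revert i
    refine Fin.forall_fin_two.2 ⟨⟨.appL .hole (es (1 : Fin 2)), fun e => rfl⟩,
      ⟨.appR (es (0 : Fin 2)) .hole, fun e => rfl⟩⟩
  | letE x =>
    revert i
    refine Fin.forall_fin_two.2 ⟨⟨.letL x .hole (es (1 : Fin 2)), fun e => rfl⟩,
      ⟨.letR x (es (0 : Fin 2)) .hole, fun e => rfl⟩⟩
  | annot a => exact ⟨.annot .hole a, fun e => congrArg (Term.annot · a) (un es i e).symm⟩
  | tuple n => exact ⟨.tuple i .hole es, fun e => rfl⟩
  | hole n => exact ⟨.typedHole i .hole es, fun e => rfl⟩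
  | projX n j h => exact ⟨.projX .hole n j, fun e => congrArg (Term.projX · n j) (un es i e).symm⟩
  | boxX a => exact ⟨.boxX .hole a, fun e => congrArg (Term.boxX · a) (un es i e).symm⟩
  | unboxX a => exact ⟨.unboxX .hole a, fun e => congrArg (Term.unboxX · a) (un es i e).symm⟩
  | recordX T n ls => exact ⟨.recordX T ls i .hole es, fun e => rfl⟩
  | recordC T n ls h => exact ⟨.record ls i .hole es, fun e => rfl⟩
  | fieldX T l => exact ⟨.fieldX .hole T l, fun e => congrArg (Term.fieldX · T l) (un es i e).symm⟩
  | fieldC T l h => exact ⟨.field .hole l, fun e => congrArg (Term.field · l) (un es i e).symm⟩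
  | imp k h => cases k with
    | proj j => exact ⟨.proj .hole j, fun e => congrArg (Term.proj · j) (un es i e).symm⟩
    | box => exact ⟨.box .hole, fun e => congrArg Term.box (un es i e).symm⟩
    | unbox => exact ⟨.unbox .hole, fun e => congrArg Term.unbox (un es i e).symm⟩
    | record n ls => exact ⟨.record ls i .hole es, fun e => rfl⟩
    | field l => exact ⟨.field .hole l, fun e => congrArg (Term.field · l) (un es i e).symm⟩
  | exp x => cases x with
    | proj n j => exact ⟨.projX .hole n j, fun e => congrArg (Term.projX · n j) (un es i e).symm⟩
    | box a => exact ⟨.boxX .hole a, fun e => congrArg (Term.boxX · a) (un es i e).symm⟩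
    | unbox a => exact ⟨.unboxX .hole a, fun e => congrArg (Term.unboxX · a) (un es i e).symm⟩
    | record T n ls => exact ⟨.recordX T ls i .hole es, fun e => rfl⟩
    | field T l => exact ⟨.fieldX .hole T l, fun e => congrArg (Term.fieldX · T l) (un es i e).symm⟩

/-- The subterms of a term with a meaning have a meaning. -/
theorem sub_nonempty (o : Op L) {es : Fin o.ar → Term S} {ρ : ℕ → Set (Ground S)} {g : Ground S}
    (h : tsem True L (o.mk es) ρ g) (i : Fin o.ar) : ∃ ρ' g', tsem True L (es i) ρ' g' := by
  have un : ∀ {es : Fin 1 → Term S} (i : Fin 1) {ρ g}, tsem True L (es 0) ρ g →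
      ∃ ρ' g', tsem True L (es i) ρ' g' := by
    intro es i ρ g h; obtain rfl := Subsingleton.elim i 0; exact ⟨_, _, h⟩
  cases o with
  | var x => exact i.elim0
  | unit => exact i.elim0
  | projBad => exact i.elim0
  | lam x => obtain ⟨_, _, _, h⟩ := h; exact un i h
  | app =>
    obtain ⟨_, _, h1, _, h2⟩ := h
    revert i
    exact Fin.forall_fin_two.2 ⟨⟨_, _, h1⟩, ⟨_, _, h2⟩⟩
  | letE x =>
    obtain ⟨_, h1, ⟨_, h3⟩, h2⟩ := h
    revert i
    exact Fin.forall_fin_two.2 ⟨⟨_, _, h1 _ h3⟩, ⟨_, _, h2⟩⟩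
  | annot a => obtain ⟨_, h, _⟩ := h; exact un i h
  | tuple n => obtain ⟨_, _, h⟩ := h; exact ⟨_, _, h i⟩
  | hole n => obtain ⟨_, h⟩ := h; exact ⟨_, _, h i⟩
  | projX n j hj => obtain ⟨_, _, h, _⟩ := h; exact un i h
  | boxX a => obtain ⟨_, h, _⟩ := h; exact un i (h _ (Scheme.ginst_nonempty _ _).choose_spec)
  | unboxX a => obtain ⟨_, _, h, _⟩ := h; exact un i h
  | recordX T n ls => obtain ⟨_, _, _, h⟩ := h; exact ⟨_, _, h i⟩
  | recordC T n ls hT =>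
    rcases h with ⟨_, _, _, _, _, h⟩ | ⟨_, _, _, h⟩
    · exact ⟨_, _, h i⟩
    · exact ⟨_, _, h i⟩
  | fieldX T l => obtain ⟨_, h, _⟩ := h; exact un i h
  | fieldC T l hT =>
    rcases h with ⟨_, _, _, h, _⟩ | ⟨_, _, _, h⟩
    · exact un i h
    · exact un i h
  | imp k hk => cases k with
    | proj j => obtain ⟨_, _, h⟩ := h; exact un i h
    | box => obtain ⟨_, _, h⟩ := h; exact un i h
    | unbox => obtain ⟨_, _, h⟩ := h; exact un i h
    | record n ls =>
      rcases h with ⟨_, _, _, _, _, h⟩ | ⟨_, _, _, h⟩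
      · exact ⟨_, _, h i⟩
      · exact ⟨_, _, h i⟩
    | field l =>
      rcases h with ⟨_, _, _, h, _⟩ | ⟨_, _, _, h⟩
      · exact un i h
      · exact un i h
  | exp x => cases x with
    | proj n j => obtain ⟨_, _, h, _⟩ := h; exact un i h
    | box a => obtain ⟨_, h, _⟩ := h; exact un i (h _ (Scheme.ginst_nonempty _ _).choose_spec)
    | unbox a => obtain ⟨_, _, h, _⟩ := h; exact un i h
    | record T n ls => obtain ⟨_, _, _, h⟩ := h; exact ⟨_, _, h i⟩
    | field T l => obtain ⟨_, h, _⟩ := h; exact un i h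

end Op

theorem Imp.fill_record {n : ℕ} {ls : Fin (n + 1) → S.Lab} (f : Option (Fin (n + 1)) → Constr S) :
    (Imp.record n ls).mc.fill f =
      .exN (n + 1) (.conj (.bigConj fun i : Fin (n + 1) => f (some i)) (f none)) :=
  (MC.fill_exN f _ _).trans
    (congrArg (fun c => Constr.exN (n + 1) (.conj c (f none))) (MC.fill_bigConj f _))

/-- Partially elaborated terms. -/
inductive Tree (L : LabelEnv S) : Type
  | node (o : Op L) (es : Fin o.ar → Tree L)

namespace Tree

def term : Tree L → Term S
  | .node o es => o.mk fun i => (es i).term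

def con : Tree L → Ty S → Constr S
  | .node o es, t => o.con t fun i => (es i).con (o.ty t i)

/-- Valid at every stage of elaboration and for both readings of what is left implicit; all
comparisons of unicity and of satisfaction rest on it. -/
theorem sem {m : Prop} (a : Tree L) : ∀ {t : Ty S} {φ : Env S},
    csem m (a.con t) φ ↔ tsem m L a.term φ.tm (t.ev φ.ty) := by
  induction a with
  | node o es ih => intro t φ; exact o.sem fun i φ => ih i

/-- The constraints agree literally, and not only in meaning, so steps of the generated constraint
can be traced back to nodes of the tree. -/
theorem exists_tree (e : Term S) : ∃ a : Tree L, a.term = e ∧ ∀ t, a.con t = gen L e t := by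
  induction e with
  | var x => exact ⟨.node (.var x) Fin.elim0, rfl, fun t => rfl⟩
  | unit => exact ⟨.node .unit Fin.elim0, rfl, fun t => rfl⟩
  | lam x e ih =>
    obtain ⟨a, rfl, h⟩ := ih
    exact ⟨.node (.lam x) fun _ => a, rfl, fun t => by simp only [gen, ← h]; rfl⟩
  | app e₁ e₂ ih₁ ih₂ =>
    obtain ⟨a, rfl, h⟩ := ih₁
    obtain ⟨b, rfl, h'⟩ := ih₂
    exact ⟨.node .app ![a, b], rfl, fun t => by simp only [gen, ← h, ← h']; rfl⟩
  | letE x e₁ e₂ ih₁ ih₂ =>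
    obtain ⟨a, rfl, h⟩ := ih₁
    obtain ⟨b, rfl, h'⟩ := ih₂
    exact ⟨.node (.letE x) ![a, b], rfl, fun t => by simp only [gen, ← h, ← h']; rfl⟩
  | annot e a ih =>
    obtain ⟨b, rfl, h⟩ := ih
    refine ⟨.node (.annot a) fun _ => b, rfl, fun t => ?_⟩
    simp only [gen, ← h, con, Op.con, Op.mc, MC.fill_exN, MC.fill, Op.ty, Option.elim]
  | tuple es ih =>
    choose as h h' using ih
    obtain rfl : (fun i => (as i).term) = es := funext h
    refine ⟨.node (.tuple _) as, rfl, fun t => ?_⟩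
    simp only [gen, ← h', con, Op.con, Op.mc, MC.fill_exN, MC.fill, MC.fill_bigConj, Op.ty, Option.elim]
  | proj e j ih =>
    obtain ⟨b, rfl, h⟩ := ih
    exact ⟨.node (.imp (.proj j) trivial) fun _ => b, rfl, fun t => by simp only [gen, ← h]; rfl⟩
  | projX e n j ih =>
    obtain ⟨b, rfl, h⟩ := ih
    by_cases hj : j < n
    · refine ⟨.node (.projX n j hj) fun _ => b, rfl, fun t => ?_⟩
      simp only [gen, ← h, con, Op.con, Op.mc, MC.fill_exN, MC.fill, Op.ty, Option.elim, if_pos hj]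
    · refine ⟨.node (.projBad _ n j hj) Fin.elim0, rfl, fun t => ?_⟩
      simp only [gen, con, Op.con, Op.mc, MC.fill, if_neg hj]
  | box e ih =>
    obtain ⟨b, rfl, h⟩ := ih
    exact ⟨.node (.imp .box trivial) fun _ => b, rfl, fun t => by simp only [gen, ← h]; rfl⟩
  | boxX e a ih =>
    obtain ⟨b, rfl, h⟩ := ih
    refine ⟨.node (.boxX a) fun _ => b, rfl, fun t => ?_⟩
    simp only [gen, ← h, con, Op.con, Op.mc, MC.fill_exN, MC.fill_allN, MC.fill, Op.ty, Option.elim]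
  | unbox e ih =>
    obtain ⟨b, rfl, h⟩ := ih
    exact ⟨.node (.imp .unbox trivial) fun _ => b, rfl, fun t => by simp only [gen, ← h]; rfl⟩
  | unboxX e a ih =>
    obtain ⟨b, rfl, h⟩ := ih
    refine ⟨.node (.unboxX a) fun _ => b, rfl, fun t => ?_⟩
    simp only [gen, ← h, con, Op.con, Op.mc, MC.fill_exN, MC.fill, Op.ty, Option.elim]
  | @record n ls es ih =>
    choose as h h' using ih
    obtain rfl : (fun i => (as i).term) = es := funext h
    by_cases hT : ∃ T, L.LabsUni (Set.range ls) T
    · refine ⟨.node (.recordC hT.choose n ls hT.choose_spec) as, rfl, fun t => ?_⟩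
      simp only [gen, ← h', con, Op.con, Op.mc, MC.fill_exN, MC.fill, MC.fill_bigConj, Op.ty,
        Option.elim, dif_pos hT, genRecordX]
    · refine ⟨.node (.imp (.record n ls) hT) as, rfl, fun t => ?_⟩
      simp only [gen, ← h', dif_neg hT]
      exact Imp.fill_record _
  | @recordX T n ls es ih =>
    choose as h h' using ih
    obtain rfl : (fun i => (as i).term) = es := funext h
    refine ⟨.node (.recordX T n ls) as, rfl, fun t => ?_⟩
    simp only [gen, ← h', con, Op.con, Op.mc, MC.fill_exN, MC.fill, MC.fill_bigConj, Op.ty,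
      Option.elim, genRecordX]
  | field e l ih =>
    obtain ⟨b, rfl, h⟩ := ih
    by_cases hT : ∃ T, L.LabUni l T
    · refine ⟨.node (.fieldC hT.choose l hT.choose_spec) fun _ => b, rfl, fun t => ?_⟩
      simp only [gen, dif_pos hT, genFieldX, ← h]
      rfl
    · refine ⟨.node (.imp (.field l) hT) fun _ => b, rfl, fun t => ?_⟩
      simp only [gen, dif_neg hT, ← h]
      rfl
  | fieldX e T l ih =>
    obtain ⟨b, rfl, h⟩ := ih
    refine ⟨.node (.fieldX T l) fun _ => b, rfl, fun t => ?_⟩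
    simp only [gen, genFieldX, ← h]
    rfl
  | hole es ih =>
    choose as h h' using ih
    obtain rfl : (fun i => (as i).term) = es := funext h
    refine ⟨.node (.hole _) as, rfl, fun t => ?_⟩
    simp only [gen, ← h', con, Op.con, Op.mc, MC.fill_exN, MC.fill, MC.fill_bigConj, Op.ty, Option.elim]

/-- One-hole contexts of partially elaborated terms. -/
inductive IsCtx : (Tree L → Tree L) → Prop
  | hole : IsCtx fun b => b
  | node (o : Op L) (i : Fin o.ar) (es : Fin o.ar → Tree L) {F : Tree L → Tree L} :
      IsCtx F → IsCtx fun b => .node o (Function.update es i (F b))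

theorem exists_cctx_node (o : Op L) (i : Fin o.ar) (es : Fin o.ar → Tree L) (t : Ty S) :
    ∃ C : CCtx S, ∀ b : Tree L,
      (node o (Function.update es i b)).con t = C.plug (b.con (o.ty t i)) := by
  obtain ⟨C, hC⟩ := MC.exists_ctx
    (fun j : Option (Fin o.ar) => j.elim (o.slot t) fun i => (es i).con (o.ty t i)) (o.cnt_some t i)
  refine ⟨C, fun b => ?_⟩
  rw [← hC, con, Op.con]
  congr 1
  funext j
  cases j with
  | none => rfl
  | some j =>
    by_cases hj : j = i
    · subst hj; simp
    · rw [Function.update_of_ne (by simpa using hj)]; simp [Function.update_of_ne hj]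

theorem IsCtx.exists_cctx {F : Tree L → Tree L} (hF : IsCtx F) :
    ∀ t : Ty S, ∃ (C : CCtx S) (t' : Ty S), ∀ b, (F b).con t = C.plug (b.con t') := by
  induction hF with
  | hole => exact fun t => ⟨.hole, t, fun b => rfl⟩
  | node o i es _ ih =>
    intro t
    obtain ⟨C, hC⟩ := exists_cctx_node o i es t
    obtain ⟨C', t', hC'⟩ := ih (o.ty t i)
    exact ⟨C.comp C', t', fun b => by rw [hC, hC', CCtx.plug_comp]⟩

theorem _root_.OML.Imp.exists_cctx (k : Imp S) (cs : Fin k.ar → Constr S) :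
    ∃ D : CCtx S, ∀ c, k.mc.fill (fun i => i.elim c cs) = D.plug c := by
  obtain ⟨C, hC⟩ := MC.exists_ctx (fun j : Option (Fin k.ar) => j.elim .tt cs) (k.cnt_mc none)
  refine ⟨C, fun c => ?_⟩
  rw [← hC]
  congr 1
  funext j
  cases j with
  | none => simp
  | some j => simp

/-- Leaves and discharged constraints contain no suspended constraint that a context could reach. So
a context around one ends in the slot of an implicit node, and splits into a part around this node
and a part inside it. -/
theorem inv_con (a : Tree L) : ∀ {t : Ty S} {C : CCtx S} {n : ℕ} {t' : Ty S} {ps : Fin n → Pat}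
    {cs : Fin n → Constr S}, a.con t = C.plug (.mtch t' ps cs) →
    ∃ (F : Tree L → Tree L) (k : Imp S) (h : k.Open L) (as : Fin k.ar → Tree L) (t'' : Ty S)
      (C₁ : CCtx S), IsCtx F ∧ a = F (.node (.imp k h) as) ∧
      (∀ b, (F b).con t = C₁.plug (b.con t'')) ∧ Constr.mtch t' ps cs = k.susp t'' ∧
      ∀ c, C.plug c = C₁.plug (k.mc.fill fun i => i.elim c fun i => (as i).con (.var i)) := by
  induction a with
  | node o es ih =>
    intro t C n t' ps cs h
    obtain ⟨j, C₁, C₂, h1, rfl, h2, h3⟩ := MC.inv (o.leaves t) (fun j => by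
      cases j with
      | none => exact o.cnt_none t
      | some i => exact (o.cnt_some t i).le) h
    cases j with
    | none =>
      have h2 : o.slot t = C₂.plug (.mtch t' ps cs) := h2
      cases o with
      | imp k hk =>
        have h2 : k.susp t = C₂.plug (.mtch t' ps cs) := h2
        cases C₂ with
        | hole =>
          refine ⟨_, k, hk, es, t, .hole, .hole, rfl, fun b => rfl, h2.symm, fun c => ?_⟩
          rw [CCtx.plug_comp]
          refine (h3 c).trans ?_
          simp only [CCtx.plug, Op.mc]
          congr 1
          funext j
          cases j with
          | none => exact Function.update_self _ _ _
          | some j => simp; rfl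
        | _ => cases h2
      | exp x =>
        have h2 : x.disch L t = C₂.plug (.mtch t' ps cs) := h2
        exact (NoMatch.plug_ne (h2 ▸ Exp.noMatch_disch)).elim
      | _ => exact (NoMatch.plug_ne (C := C₂) (t := t') (ps := ps) (cs := cs) (h2 ▸ trivial)).elim
    | some i =>
      obtain ⟨F, k, hk, as, t'', C₃, hF, h4, h5, h6, h7⟩ := ih i (C := C₂) h2
      have h8 : ∀ b, (node o (Function.update es i b)).con t = C₁.plug (b.con (o.ty t i)) := by
        intro b
        rw [h3, con, Op.con]
        congr 1
        funext j
        cases j with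
        | none => simp
        | some j =>
          by_cases hj : j = i
          · subst hj; simp
          · rw [Function.update_of_ne (by simpa using hj)]; simp [Function.update_of_ne hj]
      refine ⟨_, k, hk, as, t'', C₁.comp C₃, .node o i es hF, ?_, fun b => ?_, h6, fun c => ?_⟩
      · rw [← h4, Function.update_eq_self]
      · rw [h8, h5, CCtx.plug_comp]
      · rw [CCtx.plug_comp, CCtx.plug_comp, h7]

/-- Requiring that some filling has a meaning excludes holes in the operand of an out-of-range
projection, the only ones that are invisible in the tree. -/
theorem inv_term (a : Tree L) : ∀ {E : ECtx S} {e₀ : Term S}, a.term = E.plug e₀ →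
    (∃ e ρ g, tsem True L (E.plug e) ρ g) → ∃ (F : Tree L → Tree L) (b : Tree L), IsCtx F ∧
      a = F b ∧ b.term = e₀ ∧ ∀ b', (F b').term = E.plug b'.term := by
  induction a with
  | node o es ih =>
    intro E e₀ h hne
    rcases o.inv_mk h with rfl | ⟨i, E', h1, h2⟩ | h1
    · exact ⟨_, _, .hole, rfl, h, fun b' => rfl⟩
    · obtain ⟨e, ρ, g, hg⟩ := hne
      rw [h2] at hg
      obtain ⟨ρ', g', hg'⟩ := o.sub_nonempty hg i
      rw [Function.update_self] at hg'
      obtain ⟨F, b, hF, h3, h4, h5⟩ := ih i h1 ⟨_, _, _, hg'⟩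
      refine ⟨_, b, .node o i es hF, ?_, h4, fun b' => ?_⟩
      · rw [← h3, Function.update_eq_self]
      · rw [h2, ← h5, term]
        congr 1
        funext j
        by_cases hj : j = i
        · subst hj; simp
        · simp [Function.update_of_ne hj]
    · obtain ⟨e, ρ, g, hg⟩ := hne
      exact (h1 e ρ g hg).elim

theorem IsCtx.exists_ectx {F : Tree L → Tree L} (hF : IsCtx F) :
    ∃ E : ECtx S, ∀ b, (F b).term = E.plug b.term := by
  induction hF with
  | hole => exact ⟨.hole, fun b => rfl⟩
  | @node o i es F _ ih =>
    obtain ⟨E, hE⟩ := o.exists_frame (fun j => (es j).term) i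
    obtain ⟨E', hE'⟩ := ih
    refine ⟨E.comp E', fun b => ?_⟩
    rw [ECtx.plug_comp, hE, ← hE', term]
    congr 1
    funext j
    by_cases hj : j = i
    · subst hj; simp
    · simp [Function.update_of_ne hj]

theorem IsCtx.sub_nonempty {F : Tree L → Tree L} (hF : IsCtx F) {b : Tree L} :
    ∀ {ρ : ℕ → Set (Ground S)} {g : Ground S}, tsem True L (F b).term ρ g →
      ∃ ρ' g', tsem True L b.term ρ' g' := by
  induction hF with
  | hole => exact fun h => ⟨_, _, h⟩
  | @node o i es F _ ih =>
    intro ρ g h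
    obtain ⟨ρ', g', h⟩ := o.sub_nonempty h i
    simp only [Function.update_self] at h
    exact ih h

end Tree

theorem ECtx.sub_nonempty {E : ECtx S} {e : Term S} {ρ : ℕ → Set (Ground S)} {g : Ground S}
    (h : tsem True L (E.plug e) ρ g) : ∃ ρ' g', tsem True L e ρ' g' := by
  obtain ⟨a, ha, _⟩ := Tree.exists_tree (L := L) (E.plug e)
  obtain ⟨F, b, hF, rfl, rfl, hb⟩ := a.inv_term ha ⟨_, _, _, h⟩
  rw [← hb] at h
  exact hF.sub_nonempty h

end OML

namespace OML

variable {S : Sig} {L : LabelEnv S}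

/-! ## Unicity conditions -/

theorem Term.finite_fv (e : Term S) : e.fv.Finite := by
  induction e with
  | var x => exact Set.finite_singleton x
  | unit => exact Set.finite_empty
  | lam x e ih => exact ih.sdiff
  | app e₁ e₂ ih₁ ih₂ => exact ih₁.union ih₂
  | letE x e₁ e₂ ih₁ ih₂ => exact ih₁.union ih₂.sdiff
  | tuple es ih => exact Set.finite_iUnion ih
  | record ls es ih => exact Set.finite_iUnion ih
  | recordX T ls es ih => exact Set.finite_iUnion ih
  | hole es ih => exact Set.finite_iUnion ih
  | _ => assumption

/-- The scheme `∀α. α`. -/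
def Scheme.top (S : Sig) : Scheme S := .gen {0} (.var 0)

theorem Scheme.mem_ginst_top (v : ℕ → Ground S) (g : Ground S) : g ∈ (Scheme.top S).ginst v :=
  ginst_gen.2 ⟨Function.update v 0 g, fun a ha => Function.update_of_ne (by simpa using ha) _ _, by
    rw [Ty.ev_var, Function.update_self]⟩

theorem Scheme.fvs_top (a : ℕ) : a ∉ (Scheme.top S).fvs := by
  intro h
  obtain ⟨h1, h2⟩ := mem_fvs_gen.1 h
  rw [Ty.fvs_var] at h1
  simp at h1 h2
  exact h2 h1

/-- An erased term is typable if and only if it has a meaning. -/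
theorem exists_robust_iff {e : Term S} :
    (∃ Γ t, RobustTyping L Γ (e.erase L) (.mono t)) ↔ ∃ ρ h, tsem True L e ρ h := by
  constructor
  · rintro ⟨Γ, t, h⟩
    exact ⟨_, _, tsem_erase.1 (TypingWith.sound h (fun _ => default) _ (Scheme.ginst_mono.2 rfl))⟩
  · rintro ⟨ρ, h, hh⟩
    let l := (e.erase L).finite_fv.toFinset.toList
    have hl : ∀ x ∈ (e.erase L).fv, x ∈ l := by
      intro x hx
      simpa [l] using hx
    -- The sets in `ρ` need not come from a typing context. By monotonicity they may be enlarged to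
    -- all ground types, which is what `∀α. α` denotes.
    let Γ : TyCtx S := l.map fun x => (x, Scheme.top S)
    have hΓ : ∀ p ∈ Γ, p.2 = Scheme.top S := by
      intro p hp
      obtain ⟨x, _, rfl⟩ := List.mem_map.1 hp
      rfl
    have hlook : ∀ x ∈ l, Γ.lookup x = some (Scheme.top S) := by
      show ∀ x ∈ l, (l.map fun x => (x, Scheme.top S)).lookup x = some (Scheme.top S)
      generalize l = l'
      induction l' with
      | nil => simp
      | cons y l' ih =>
        intro x hx
        rw [List.map_cons, List.lookup_cons]
        by_cases hxy : x = y
        · simp [hxy]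
        · have : (x == y) = false := by simpa using hxy
          rw [this]
          exact ih x ((List.mem_cons.1 hx).resolve_left hxy)
    -- One index and no names suffice: the type is ground and the schemes in the context are closed.
    refine ⟨Γ, h.1, (SDTyping.complete (I := Unit) (A := ∅) (v := fun _ _ => default)
      ⟨by simp, by simp⟩ ?_ ?_ fun _ => ?_).typingWith⟩
    · intro p hp a ha
      rw [hΓ p hp] at ha
      exact (Scheme.fvs_top a ha).elim
    · intro a ha
      rw [h.2] at ha
      simp at ha
    · rw [Ty.ev_ground]
      exact tsem_mono (fun x hx g _ => ⟨_, hlook x (hl x hx), Scheme.mem_ginst_top _ _⟩)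
        (tsem_erase.2 hh)

/-- Unicity for implicit constructs, in terms of the meaning of erased terms. -/
def TKnown (L : LabelEnv S) (E : ECtx S) (k : Imp S) (es : Fin k.ar → Term S) (s : Shape S) : Prop :=
  s.Canonical ∧ ∀ (ρ : ℕ → Set (Ground S)) (g h : Ground S),
    tsem True L (E.plug (k.obs g es)) ρ h → s.IsCanonicalOf g.1

/-- Unicity quantifies over all contexts and types, so it depends only on which erased terms are
typable at all, that is, have some meaning. -/
theorem tKnown_iff {E : ECtx S} {k : Imp S} {es : Fin k.ar → Term S} {s : Shape S} :
    TKnown L E k es s ↔ s.Canonical ∧ ∀ (Γ : TyCtx S) (t : Ty S) (g : Ground S),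
      RobustTyping L Γ ((E.plug (k.obs g es)).erase L) (.mono t) → s.IsCanonicalOf g.1 := by
  refine and_congr_right fun _ => ⟨fun h Γ t g ht => ?_, fun h ρ g h' hh => ?_⟩
  · obtain ⟨ρ, h', hh⟩ := exists_robust_iff.1 ⟨Γ, t, ht⟩
    exact h ρ g h' hh
  · obtain ⟨Γ, t, ht⟩ := exists_robust_iff.2 ⟨ρ, h', hh⟩
    exact h Γ t g ht

/-- Elaboration of an implicit construct of a term. -/
inductive TStep (L : LabelEnv S) : Term S → Term S → Prop
  | mk (E : ECtx S) (x : Exp S) (es : Fin x.imp.ar → Term S) :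
      TKnown L E x.imp es x.shape → TStep L (E.plug (x.imp.mk es)) (E.plug (x.mk es))

/-- Elaboration of a suspended constraint of a constraint. -/
inductive CStep (L : LabelEnv S) : Constr S → Constr S → Prop
  | mk (C : CCtx S) (t : Ty S) (s : Shape S) {n : ℕ} (ps : Fin n → Pat) (cs : Fin n → Constr S) :
      Known L C t s → CStep L (C.plug (.mtch t ps cs)) (C.plug (.matched L t s ps cs))

theorem CCtx.csem_mono {m : Prop} {c c' : Constr S} (h : ∀ φ, csem m c φ → csem m c' φ)
    (C : CCtx S) : ∀ {φ}, csem m (C.plug c) φ → csem m (C.plug c') φ := by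
  induction C with
  | hole => exact fun {φ} => h φ
  | andL C d ih => exact fun h => ⟨ih h.1, h.2⟩
  | andR d C ih => exact fun h => ⟨h.1, ih h.2⟩
  | ex C ih => exact fun ⟨g, h⟩ => ⟨g, ih h⟩
  | all C ih => exact fun h g => ih (h g)
  | letL x C d ih => exact fun ⟨G, h1, h2, h3⟩ => ⟨G, fun g hg => ih (h1 g hg), h2, h3⟩
  | letR x d C ih => exact fun ⟨G, h1, h2, h3⟩ => ⟨G, h1, h2, ih h3⟩

theorem CCtx.csem_congr {m : Prop} {c c' : Constr S} (h : ∀ φ, csem m c φ ↔ csem m c' φ)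
    (C : CCtx S) {φ} : csem m (C.plug c) φ ↔ csem m (C.plug c') φ :=
  ⟨C.csem_mono fun φ => (h φ).1, C.csem_mono fun φ => (h φ).2⟩

/-- A solution always reaches the hole: there are ground types for `∀` to range over, and the set
bound by `let` is nonempty. -/
theorem CCtx.sub_nonempty {m : Prop} {c : Constr S} (C : CCtx S) :
    ∀ {φ}, csem m (C.plug c) φ → ∃ φ', csem m c φ' := by
  induction C with
  | hole => exact fun h => ⟨_, h⟩
  | andL C d ih => exact fun h => ih h.1
  | andR d C ih => exact fun h => ih h.2
  | ex C ih => exact fun ⟨g, h⟩ => ih h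
  | all C ih => exact fun h => ih (h default)
  | letL x C d ih => exact fun ⟨G, h1, ⟨g, h2⟩, h3⟩ => ih (h1 g h2)
  | letR x d C ih => exact fun ⟨G, h1, h2, h3⟩ => ih h3

/-- Before the step the suspended constraint counts as true. -/
theorem CStep.csem {c c' : Constr S} (h : CStep L c c') {φ : Env S} (h' : csem True c' φ) :
    OML.csem True c φ := by
  cases h with
  | mk C t s ps cs h => exact C.csem_mono (c' := .mtch t ps cs) (fun _ _ => trivial) h'

theorem CSteps.csem {c c' : Constr S} (h : Relation.ReflTransGen (CStep L) c c') {φ : Env S}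
    (h' : csem True c' φ) : OML.csem True c φ := by
  induction h with
  | refl => exact h'
  | tail _ h ih => exact ih (h.csem h')

/-! ### Elaboration steps of terms and of their constraints -/

namespace Tree

/-- On either side a ground type is observed at the place of the construct, in the same
surroundings; `Imp.sem_obs` equates the two observations. -/
theorem known_iff {F : Tree L → Tree L} {k : Imp S} {as : Fin k.ar → Tree L} {t : Ty S} {α : ℕ}
    {C C₁ : CCtx S} {E : ECtx S} {s : Shape S}
    (h₁ : ∀ b, (F b).con (.var α) = C₁.plug (b.con t))
    (h₂ : ∀ c, C.plug c = C₁.plug (k.mc.fill fun i => i.elim c fun i => (as i).con (.var i)))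
    (h₃ : ∀ b, (F b).term = E.plug b.term) :
    Known L C (k.scrut t) s ↔ TKnown L E k (fun i => (as i).term) s := by
  have key : ∀ (g : Ground S) (φ : Env S), SimpleSat L φ (C.plug (.unif (k.scrut t) g.1)).erase ↔
      tsem True L (E.plug (k.obs g fun i => (as i).term)) φ.tm (φ.ty α) := by
    intro g φ
    obtain ⟨b, hb, _⟩ := exists_tree (L := L) (k.obs g fun i => (as i).term)
    rw [simpleSat_erase_iff, h₂, ← hb, ← h₃]
    refine Iff.trans ?_ (sem (m := True) (F b) (t := .var α))
    rw [h₁]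
    refine C₁.csem_congr fun ψ => ?_
    rw [sem, hb]
    exact Imp.sem_obs (fun i φ => sem (as i)) rfl
  refine and_congr_right fun _ => ⟨fun h ρ g h' hh => ?_, fun h φ g hh => ?_⟩
  · exact h ⟨fun _ => h', ρ⟩ g ((key g _).2 hh)
  · exact h _ g _ ((key g φ).1 hh)

/-- A step of the generated constraint is a step of the term. -/
theorem tStep_of_cStep (a : Tree L) {α : ℕ} {c : Constr S} {φ : Env S}
    (h : CStep L (a.con (.var α)) c) (hφ : csem True c φ) :
    ∃ a' : Tree L, c = a'.con (.var α) ∧ TStep L a.term a'.term := by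
  generalize h₀ : a.con (.var α) = c₀ at h
  cases h with
  | mk C t s ps cs hK =>
    obtain ⟨F, k, hk, as, t', C₁, hF, rfl, h1, h2, h3⟩ := a.inv_con h₀
    obtain ⟨E, hE⟩ := hF.exists_ectx
    injection h2 with h4 h5 h6 h7
    subst h5
    subst h4
    obtain rfl := eq_of_heq h6
    obtain rfl := eq_of_heq h7
    -- Because the result has a solution, the discharged constraint is not `ff`, so the shape
    -- determines an explicit counterpart.
    obtain ⟨φ', hφ'⟩ := C.sub_nonempty hφ
    obtain ⟨x, rfl, rfl⟩ := Imp.exists_exp hφ'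
    refine ⟨F (.node (.exp x) as), ?_, ?_⟩
    · rw [h1, h3]; rfl
    · rw [hE, hE]
      exact .mk E x _ ((known_iff h1 h3 hE).1 hK)

/-- The second alternative makes explicit a construct whose labels already determine the record
name. Its constraint was generated as for the explicit form, and the meaning of the explicit term
forces the same name, so the constraint does not change. -/
theorem inv_imp {b : Tree L} {x : Exp S} {es : Fin x.imp.ar → Term S} (h : b.term = x.imp.mk es)
    {ρ : ℕ → Set (Ground S)} {g : Ground S} (hg : tsem True L (x.mk es) ρ g) :
    (∃ (hk : x.imp.Open L) (as : Fin x.imp.ar → Tree L), b = .node (.imp x.imp hk) as ∧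
      es = fun i => (as i).term) ∨
    ∃ b' : Tree L, b'.term = x.mk es ∧ ∀ t, b'.con t = b.con t := by
  have un : ∀ {es : Fin 1 → Term S} {as : Fin 1 → Tree L}, (as 0).term = es 0 →
      es = fun i => (as i).term := by
    intro es as h; funext i; obtain rfl := Subsingleton.elim i 0; exact h.symm
  obtain ⟨o, as⟩ := b
  cases x with
  | proj n j => cases o with
    | imp k hk => cases k with
      | proj j' => injection h with h1 h2; subst h2; exact .inl ⟨hk, as, rfl, un h1⟩
      | _ => cases h
    | exp x => cases x <;> cases h
    | _ => cases h
  | box a => cases o with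
    | imp k hk => cases k with
      | box => injection h with h1; exact .inl ⟨hk, as, rfl, un h1⟩
      | _ => cases h
    | exp x => cases x <;> cases h
    | _ => cases h
  | unbox a => cases o with
    | imp k hk => cases k with
      | unbox => injection h with h1; exact .inl ⟨hk, as, rfl, un h1⟩
      | _ => cases h
    | exp x => cases x <;> cases h
    | _ => cases h
  | record T n ls => cases o with
    | imp k hk => cases k with
      | record n' ls' =>
        injection h with h1 h2 h3; subst h1; obtain rfl := eq_of_heq h2
        exact .inl ⟨hk, as, rfl, (eq_of_heq h3).symm⟩
      | _ => cases h
    | exp x => cases x <;> cases h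
    | recordC T' n' ls' hT =>
      injection h with h1 h2 h3; subst h1; obtain rfl := eq_of_heq h2; obtain rfl := eq_of_heq h3
      obtain rfl := hT.2 T hg.1
      exact .inr ⟨.node (.recordX T' n' ls') as, rfl, fun t => rfl⟩
    | _ => cases h
  | field T l => cases o with
    | imp k hk => cases k with
      | field l' => injection h with h1 h2; subst h2; exact .inl ⟨hk, as, rfl, un h1⟩
      | _ => cases h
    | exp x => cases x <;> cases h
    | fieldC T' l' hT =>
      injection h with h1 h2; subst h2
      obtain ⟨_, _, t, ht, _⟩ := hg
      obtain rfl := hT.2 T ⟨t, ht⟩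
      exact .inr ⟨.node (.fieldX T' l') as, congrArg (Term.fieldX · T' l') h1, fun t => rfl⟩
    | _ => cases h

/-- A step of the term is a step of the generated constraint, or does not change it. -/
theorem cStep_of_tStep (a : Tree L) {e : Term S} (h : TStep L a.term e)
    {ρ : ℕ → Set (Ground S)} {g : Ground S} (hg : tsem True L e ρ g) :
    ∃ a' : Tree L, a'.term = e ∧
      ∀ α, Relation.ReflTransGen (CStep L) (a.con (.var α)) (a'.con (.var α)) := by
  generalize h₀ : a.term = e₀ at h
  cases h with
  | mk E x es hK =>
    obtain ⟨F, b, hF, rfl, hb, hE⟩ := a.inv_term h₀ ⟨_, _, _, hg⟩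
    obtain ⟨ρ', g', hg'⟩ := E.sub_nonempty hg
    rcases inv_imp hb hg' with ⟨hk, as, rfl, rfl⟩ | ⟨b', hb', hcon⟩
    · refine ⟨F (.node (.exp x) as), hE _, fun α => .single ?_⟩
      obtain ⟨C₁, t, h1⟩ := hF.exists_cctx (.var α)
      obtain ⟨D, hD⟩ := x.imp.exists_cctx fun i => (as i).con (.var i)
      have h2 : ∀ c, (C₁.comp D).plug c =
          C₁.plug (x.imp.mc.fill fun i => i.elim c fun i => (as i).con (.var i)) := fun c => by
        rw [CCtx.plug_comp, hD]
      have h3 := CStep.mk (C₁.comp D) (x.imp.scrut t) x.shape (fun _ : Fin 1 => x.imp.pat)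
        (fun _ => x.imp.branch t) ((known_iff h1 h2 hE).2 hK)
      rw [h2, h2] at h3
      rw [h1, h1]
      exact h3
    · refine ⟨F b', by rw [hE, hb'], fun α => ?_⟩
      obtain ⟨C₁, t, h1⟩ := hF.exists_cctx (.var α)
      rw [h1, h1, hcon]

theorem tSteps_of_cSteps (a : Tree L) {α : ℕ} {c : Constr S} {φ : Env S}
    (h : Relation.ReflTransGen (CStep L) (a.con (.var α)) c) (hφ : csem True c φ) :
    ∃ a' : Tree L, c = a'.con (.var α) ∧ Relation.ReflTransGen (TStep L) a.term a'.term := by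
  induction h with
  | refl => exact ⟨a, rfl, .refl⟩
  | tail _ h ih =>
    obtain ⟨a₁, rfl, h1⟩ := ih (h.csem hφ)
    obtain ⟨a₂, rfl, h2⟩ := a₁.tStep_of_cStep h hφ
    exact ⟨a₂, rfl, h1.tail h2⟩

/-- Obtained from constraints, where a step only replaces something that counts as true. -/
theorem _root_.OML.TStep.tsem {e e' : Term S} (h : TStep L e e') {ρ : ℕ → Set (Ground S)}
    {g : Ground S} (hg : tsem True L e' ρ g) : OML.tsem True L e ρ g := by
  obtain ⟨a, rfl, _⟩ := exists_tree (L := L) e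
  obtain ⟨a', rfl, h1⟩ := a.cStep_of_tStep h hg
  have := CSteps.csem (h1 0) (φ := ⟨fun _ => g, ρ⟩) (a'.sem.2 hg)
  exact a.sem.1 this

theorem cSteps_of_tSteps (a : Tree L) {e : Term S}
    (h : Relation.ReflTransGen (TStep L) a.term e)
    {ρ : ℕ → Set (Ground S)} {g : Ground S} (hg : OML.tsem True L e ρ g) :
    ∃ a' : Tree L, a'.term = e ∧
      ∀ α, Relation.ReflTransGen (CStep L) (a.con (.var α)) (a'.con (.var α)) := by
  induction h with
  | refl => exact ⟨a, rfl, fun α => .refl⟩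
  | tail _ h ih =>
    obtain ⟨a₁, rfl, h1⟩ := ih (h.tsem hg)
    obtain ⟨a₂, h2, h3⟩ := a₁.cStep_of_tStep h hg
    exact ⟨a₂, h2, fun α => (h1 α).trans (h3 α)⟩

end Tree

end OML

namespace OML

variable {S : Sig}

/-! ## Principal shapes -/

namespace PreTy

/-- The subterm at a path. -/
def sub : List ℕ → PreTy S → PreTy S
  | i :: q, .con c ts => if h : i < c.arity then sub q (ts ⟨i, h⟩) else .fvar 0
  | _ :: q, .poly _ b => sub q b
  | _, t => t

theorem sub_nil (t : PreTy S) : sub [] t = t := by cases t <;> rfl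

theorem sub_append (p q : List ℕ) (t : PreTy S) : sub (p ++ q) t = sub q (sub p t) := by
  induction p generalizing t with
  | nil => rw [sub_nil]; rfl
  | cons i p ih =>
    cases t with
    | con c ts =>
      simp only [List.cons_append, sub]
      split
      · exact ih _
      · cases q <;> rfl
    | poly n b => exact ih b
    | _ => cases q <;> rfl

open Classical in
/-- Replace the maximal locally closed subterms by variables that name their paths. -/
def skel : List ℕ → PreTy S → PreTy S
  | p, .fvar _ => .fvar (Encodable.encode p)
  | _, .bvar k i => .bvar k i
  | p, .con c ts => if (PreTy.con c ts).LC 0 then .fvar (Encodable.encode p)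
      else .con c fun i => (ts i).skel (p ++ [(i : ℕ)])
  | p, .poly n b => if (PreTy.poly n b).LC 0 then .fvar (Encodable.encode p)
      else .poly n (b.skel (p ++ [0]))

/-- The same for the arguments of the outermost constructor. -/
def topSkel : PreTy S → PreTy S
  | .con c ts => .con c fun i => (ts i).skel [(i : ℕ)]
  | .poly n b => .poly n (b.skel [0])
  | t => t

theorem skel_of_LC {t : PreTy S} (h : t.LC 0) (p : List ℕ) :
    t.skel p = .fvar (Encodable.encode p) := by
  cases t with
  | fvar a => rfl
  | bvar k i => exact (Nat.not_lt_zero _ h).elim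
  | con c ts => exact if_pos h
  | poly n b => exact if_pos h

theorem LC_subst_iff {θ : ℕ → PreTy S} (hθ : ∀ a, (θ a).LC 0) {t : PreTy S} {d : ℕ} :
    (t.subst θ).LC d ↔ t.LC d := ⟨LC.of_subst hθ, LC.subst hθ⟩

/-- Substituting locally closed types does not change which subterms are locally closed, and the
skeleton only records the paths of the maximal ones. -/
theorem skel_subst {θ : ℕ → PreTy S} (hθ : ∀ a, (θ a).LC 0) (t : PreTy S) (p : List ℕ) :
    (t.subst θ).skel p = t.skel p := by
  induction t generalizing p with
  | fvar a => exact skel_of_LC (hθ a) p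
  | bvar k i => rfl
  | con c ts ih =>
    have := LC_subst_iff hθ (t := .con c ts) (d := 0)
    simp only [subst] at this
    simp only [subst, skel, ih]
    by_cases hc : LC 0 (PreTy.con c ts)
    · rw [if_pos (this.2 hc), if_pos hc]
    · rw [if_neg fun h => hc (this.1 h), if_neg hc]
  | poly n b ih =>
    have := LC_subst_iff hθ (t := .poly n b) (d := 0)
    simp only [subst] at this
    simp only [subst, skel, ih]
    by_cases hc : LC 0 (PreTy.poly n b)
    · rw [if_pos (this.2 hc), if_pos hc]
    · rw [if_neg fun h => hc (this.1 h), if_neg hc]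

open Classical in
/-- The subterm that a variable of the skeleton of `t` stands for. -/
def look (t : PreTy S) (c : ℕ) : PreTy S :=
  if (sub ((Encodable.decode c).getD []) t).LC 0 then sub ((Encodable.decode c).getD []) t else .fvar 0

theorem LC_look (t : PreTy S) (c : ℕ) : (look t c).LC 0 := by
  unfold look; split
  · assumption
  · trivial

theorem look_encode {t t' : PreTy S} {p : List ℕ} (h : sub p t = t') (ht : t'.LC 0) :
    look t (Encodable.encode p) = t' := by
  subst h
  simp [look, ht]

theorem skel_look (r : PreTy S) {t : PreTy S} {p : List ℕ} (h : sub p r = t) :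
    (t.skel p).subst (look r) = t := by
  induction t generalizing p with
  | fvar a => exact look_encode h trivial
  | bvar k i => rfl
  | con c ts ih =>
    by_cases hc : (PreTy.con c ts).LC 0
    · rw [skel_of_LC hc]; exact look_encode h hc
    · simp only [skel, if_neg hc, subst, con.injEq, heq_eq_eq, true_and]
      funext i
      refine ih i ?_
      rw [sub_append, h]
      simp [sub, i.2]
  | poly n b ih =>
    by_cases hc : (PreTy.poly n b).LC 0
    · rw [skel_of_LC hc]; exact look_encode h hc
    · simp only [skel, if_neg hc, subst, poly.injEq, true_and]
      refine ih ?_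
      rw [sub_append, h]
      simp [sub]

theorem topSkel_look {t : PreTy S} (ht : ∀ a, t ≠ .fvar a) : t.topSkel.subst (look t) = t := by
  cases t with
  | fvar a => exact (ht a rfl).elim
  | bvar k i => rfl
  | con c ts =>
    simp only [topSkel, subst, con.injEq, heq_eq_eq, true_and]
    funext i
    exact skel_look _ (by simp [sub, i.2])
  | poly n b =>
    simp only [topSkel, subst, poly.injEq, true_and]
    exact skel_look _ (by simp [sub])

theorem topSkel_subst {θ : ℕ → PreTy S} (hθ : ∀ a, (θ a).LC 0) {t : PreTy S}
    (ht : ∀ a, t ≠ .fvar a) : (t.subst θ).topSkel = t.topSkel := by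
  cases t with
  | fvar a => exact (ht a rfl).elim
  | bvar k i => rfl
  | con c ts => simp only [subst, topSkel, skel_subst hθ]
  | poly n b => simp only [subst, topSkel, skel_subst hθ]

theorem LC_topSkel {t : PreTy S} (ht : t.LC 0) : t.topSkel.LC 0 := by
  by_cases h : ∃ a, t = .fvar a
  · obtain ⟨a, rfl⟩ := h; trivial
  · refine LC.of_subst (LC_look t) ?_
    rw [topSkel_look fun a ha => h ⟨a, ha⟩]
    exact ht

end PreTy

namespace Ty

/-- The most general non-trivial form of a type that is not a variable. -/
def skel (t : Ty S) : Ty S := ⟨t.1.topSkel, PreTy.LC_topSkel t.2⟩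

theorem ne_fvar {t : Ty S} (ht : ∀ a, t ≠ var a) (a : ℕ) : t.1 ≠ .fvar a :=
  fun h => ht a (Ty.ext h)

theorem skel_subst {t : Ty S} (ht : ∀ a, t ≠ var a) (θ : ℕ → Ty S) : (t.subst θ).skel = t.skel :=
  Ty.ext (PreTy.topSkel_subst (fun a => (θ a).2) (ne_fvar ht))

theorem exists_skel_subst {t : Ty S} (ht : ∀ a, t ≠ var a) : ∃ θ, t.skel.subst θ = t :=
  ⟨fun c => ⟨t.1.look c, PreTy.LC_look _ _⟩, Ty.ext (PreTy.topSkel_look (ne_fvar ht))⟩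

theorem skel_ne_var {t : Ty S} (ht : ∀ a, t ≠ var a) (a : ℕ) : t.skel ≠ var a := by
  intro h
  have h' : t.1.topSkel = .fvar a := congrArg Subtype.val h
  have h2 := ne_fvar ht
  generalize t.1 = u at h' h2
  cases u with
  | fvar b => exact h2 b rfl
  | _ => cases h'

end Ty

namespace Shape

/-- Numbering the variables of a type gives a shape. -/
def ofTy (t : Ty S) : Shape S where
  n := t.fvs.toFinset.card
  ty := t.subst fun a => .var (rank t.fvs a)
  closed := by
    intro i
    rw [← (canonicalOcc_rank t.fvs).1 i, Ty.mem_fvs_subst, List.mem_map]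
    simp only [Ty.fvs_var, List.mem_singleton, eq_comm]

/-- Numbering by rank is injective on the variables that occur, so it can be undone. -/
theorem ofTy_subst (t : Ty S) (θ : ℕ → Ty S) : ∃ η, (ofTy t).ty.subst η = t.subst θ := by
  classical
  refine ⟨fun i => if h : ∃ a ∈ t.fvs, rank t.fvs a = i then θ h.choose else .var 0, ?_⟩
  rw [ofTy, Ty.subst_subst]
  refine Ty.subst_congr fun a ha => ?_
  have h : ∃ b ∈ t.fvs, rank t.fvs b = rank t.fvs a := ⟨a, ha, rfl⟩
  rw [Ty.var_subst, dif_pos h, rank_injOn h.choose_spec.1 ha h.choose_spec.2]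

theorem ofTy_nonTrivial {t : Ty S} (ht : ∀ a, t ≠ .var a) : (ofTy t).NonTrivial := by
  intro a h
  obtain ⟨η, h1⟩ := ofTy_subst t Ty.var
  rw [h, Ty.var_subst, Ty.subst_var] at h1
  have h2 : t.1.subst (fun a => (Ty.var (rank t.fvs a) : Ty S).1) = .fvar a := congrArg Subtype.val h
  have h3 := Ty.ne_fvar ht
  generalize t.1 = u at h2 h3
  cases u with
  | fvar b => exact h3 b rfl
  | _ => cases h2

theorem Canonical.nonTrivial {s : Shape S} (h : s.Canonical) : s.NonTrivial := h.choose_spec.1.1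

/-- A canonical shape and the skeleton of its type are equally general. -/
theorem Canonical.le_iff {s : Shape S} (h : s.Canonical) (t : Ty S) :
    (∃ θ, t = s.ty.subst θ) ↔ ∃ θ, t = s.ty.skel.subst θ := by
  obtain ⟨t₀, ⟨h1, ⟨η, rfl⟩, h3⟩, _⟩ := h
  obtain ⟨κ, hκ⟩ := Ty.exists_skel_subst h1
  constructor
  · rintro ⟨θ, rfl⟩
    exact ⟨_, by rw [← Ty.subst_subst, hκ]⟩
  · rintro ⟨θ, rfl⟩
    obtain ⟨ζ, hζ⟩ := ofTy_subst s.ty.skel fun a => (κ a).subst η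
    -- Principality makes `s` more general than the numbered skeleton of its own type.
    obtain ⟨ξ, hξ⟩ := h3 (ofTy s.ty.skel) (ofTy_nonTrivial (Ty.skel_ne_var h1))
      ⟨ζ, by rw [hζ, ← Ty.subst_subst, hκ]⟩
    obtain ⟨ω, hω⟩ := ofTy_subst s.ty.skel θ
    exact ⟨fun a => (ξ a).subst ω, by rw [← hω, hξ, Ty.subst_subst]⟩

theorem Canonical.firstOcc {s : Shape S} (h : s.Canonical) : FirstOcc s.ty.fvs := h.choose_spec.2

/-- With equal skeletons each shape is an instance of the other, so they differ by an injective
renaming. Both number their variables by first occurrence, so the renaming is the identity. -/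
theorem Canonical.eq_of_skel {s s' : Shape S} (h : s.Canonical) (h' : s'.Canonical)
    (he : s.ty.skel = s'.ty.skel) : s = s' := by
  obtain ⟨a, ha⟩ := (h'.le_iff s.ty).2 (he ▸ (h.le_iff s.ty).1 ⟨Ty.var, (Ty.subst_var _).symm⟩)
  obtain ⟨b, hb⟩ := (h.le_iff s'.ty).2 (he ▸ (h'.le_iff s'.ty).1 ⟨Ty.var, (Ty.subst_var _).symm⟩)
  have h1 : ∀ v ∈ s.ty.fvs, (b v).subst a = .var v := by
    refine Ty.subst_inj_on (t := s.ty) (θ := fun v => (b v).subst a) (θ' := Ty.var) ?_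
    rw [← Ty.subst_subst, ← hb, ← ha, Ty.subst_var]
  have h2 : ∀ v ∈ s.ty.fvs, ∃ r, b v = .var r := by
    intro v hv
    have := congrArg Subtype.val (h1 v hv)
    have h3 : (b v).1.subst (fun c => (a c).1) = .fvar v := this
    generalize hu : (b v).1 = u at h3
    cases u with
    | fvar r => exact ⟨r, Ty.ext hu⟩
    | _ => cases h3
  choose! r hr using h2
  have h3 : s'.ty = s.ty.subst fun v => .var (r v) := hb.trans (Ty.subst_congr hr)
  have h4 : ∀ v ∈ s.ty.fvs, ∀ w ∈ s.ty.fvs, r v = r w → v = w := by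
    intro v hv w hw hvw
    have e1 := h1 v hv
    have e2 := h1 w hw
    rw [hr v hv, hvw, ← hr w hw, e2] at e1
    exact (Ty.var_inj e1).symm
  have h5 : s'.ty.fvs = s.ty.fvs.map r := by
    rw [h3, Ty.fvs_subst]
    simp only [Ty.fvs_var]
    exact List.flatMap_pure_eq_map r _
  have h6 : ∀ v ∈ s.ty.fvs, r v = v := by
    intro v hv
    have e1 := h'.firstOcc.rank_eq (a := r v) (by rw [h5]; exact List.mem_map_of_mem hv)
    rw [h5, rank_map hv h4, h.firstOcc.rank_eq hv] at e1
    exact e1.symm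
  have h7 : s.ty = s'.ty := by
    rw [h3]
    conv_lhs => rw [← Ty.subst_var s.ty]
    exact Ty.subst_congr fun v hv => by rw [h6 v hv]
  have h8 : s.n = s'.n := by
    have : ∀ i, i < s.n ↔ i < s'.n := fun i => by rw [← s.closed, ← s'.closed, h7]
    have := this s.n; have := ‹∀ i, i < s.n ↔ i < s'.n› s'.n
    omega
  cases s; cases s'
  simp only at h7 h8
  subst h7; subst h8; rfl

/-- A type that is not a variable has instances of one canonical shape only. -/
theorem Canonical.eq_of_subst {s s' : Shape S} (h : s.Canonical) (h' : s'.Canonical) {t : Ty S}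
    (ht : ∀ a, t ≠ .var a) {θ θ' η η' : ℕ → Ty S} (e : t.subst θ = s.ty.subst η)
    (e' : t.subst θ' = s'.ty.subst η') : s = s' := by
  refine h.eq_of_skel h' ?_
  rw [← Ty.skel_subst h.nonTrivial η, ← e, Ty.skel_subst ht, ← Ty.skel_subst ht θ', e',
    Ty.skel_subst h'.nonTrivial η']

/-- The unit type and an arrow type do not have a shape in common. -/
theorem NonTrivial.not_both {s : Shape S} (h : s.NonTrivial) {η η' : ℕ → Ty S} {a b : Ty S}
    (e : Ty.unit = s.ty.subst η) (e' : Ty.arr a b = s.ty.subst η') : False := by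
  have h1 : (Ty.unit : Ty S).skel = (Ty.arr a b).skel := by
    rw [e, e', Ty.skel_subst h, Ty.skel_subst h]
  have h2 := congrArg Subtype.val h1
  cases h2

end Shape

end OML

namespace OML

variable {S : Sig} {L : LabelEnv S}

/-! ## Homomorphisms from families of ground types -/

/-- Evaluation maps of families of ground types that commute with the type constructors. -/
def Hom {I : Type} (Ψ : (I → Ground S) → Ground S) : Prop :=
  ∀ (t : Ty S) (w : ℕ → I → Ground S),
    Ψ (fun i => t.ev fun a => w a i) = t.ev fun a => Ψ (w a)

/-- The values of irreducible families can be chosen freely. -/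
theorem exists_hom {I : Type} [Nonempty I] (w₀ : (I → Ground S) → Ground S) :
    ∃ Ψ, Hom Ψ ∧ ∀ f, Irred f → Ψ f = w₀ f := by
  have hname : ∀ f : I → Ground S, ∃ (v : I → ℕ → Ground S) (t : Ty S),
      (∀ a ∈ t.fvs, Irred fun i => v i a) ∧ ∀ i, t.ev (v i) = f i := by
    intro f
    obtain ⟨A', v', t, h1, h2, h3⟩ := exists_name f ∅ (fun _ _ => default)
      ⟨by simp, by simp⟩
    exact ⟨v', t, fun a ha => h1.faithful.irred a (h2 a ha), h3⟩
  choose v t h1 h2 using hname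
  -- A family is described over irreducible families, and these are replaced by their prescribed
  -- values. Uniqueness of descriptions makes this commute with type constructors.
  refine ⟨fun f => (t f).ev fun a => w₀ fun i => v f i a, fun u w => ?_, fun f hf => ?_⟩
  · set f : I → Ground S := fun i => u.ev fun a => w a i with hf
    -- The chosen description of `f` is compared with the one assembled from descriptions of the
    -- families `w a`; pairing keeps names from different descriptions apart.
    have key := Ty.subst_eq_of_irred (t := t f)
      (t' := u.subst fun a => (t (w a)).subst fun c => .var (Nat.pair a c))
      (v := v f) (v' := fun i n => v (w n.unpair.1) i n.unpair.2)
      (θ := fun a => (w₀ fun i => v f i a).1)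
      (θ' := fun n => (w₀ fun i => v (w n.unpair.1) i n.unpair.2).1) (h1 f) ?_ ?_ ?_
    · refine Ground.ext (key.trans ?_)
      rw [Ty.subst_subst, Ty.ev_val]
      refine Ty.subst_congr fun a _ => ?_
      rw [Ty.subst_subst]
      refine Ty.subst_congr fun c _ => ?_
      rw [Ty.var_subst, Nat.unpair_pair]; rfl
    · intro n hn
      obtain ⟨a, _, hn⟩ := Ty.mem_fvs_subst.1 hn
      obtain ⟨c, hc, hn⟩ := Ty.mem_fvs_subst.1 hn
      rw [Ty.fvs_var, List.mem_singleton] at hn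
      subst hn
      simp only [Nat.unpair_pair]
      exact h1 _ c hc
    · intro a _ n _ h
      exact congrArg (fun f => (w₀ f).1) (funext h)
    · intro i
      rw [h2, Ty.ev_subst]
      refine Ty.ev_congr fun a _ => ?_
      rw [Ty.ev_subst, ← h2 (w a) i]
      refine Ty.ev_congr fun c _ => ?_
      rw [Ty.ev_var, Nat.unpair_pair]
  · obtain ⟨a, ha⟩ := hf (t f) (v f) (h2 f)
    show (t f).ev _ = _
    rw [ha, Ty.ev_var]
    congr 1
    funext i
    rw [← h2 f i, ha]; rfl

/-- The type is an instance of the shape. -/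
def Shape.Inst (s : Shape S) (g : Ground S) : Prop := ∃ u : ℕ → Ground S, g = s.ty.ev u

/-- A common non-trivial form would have instances of two different canonical shapes. -/
theorem irred_of_inst {s s' : Shape S} (hs : s.Canonical) (hs' : s'.Canonical) (hne : s ≠ s')
    {I : Type} {f : I → Ground S} {i j : I} (hi : s.Inst (f i)) (hj : s'.Inst (f j)) : Irred f := by
  intro t w hw
  by_contra ht
  obtain ⟨u, hu⟩ := hi
  obtain ⟨u', hu'⟩ := hj
  exact hne (hs.eq_of_subst hs' (fun a ha => ht ⟨a, ha⟩)
    (congrArg Subtype.val ((hw i).trans hu)) (congrArg Subtype.val ((hw j).trans hu')))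

/-- No non-trivial shape is shared by `1` and `1 → 1`. -/
theorem Shape.NonTrivial.exists_not_inst {s : Shape S} (h : s.NonTrivial) : ∃ g, ¬ s.Inst g := by
  by_contra hall
  push Not at hall
  obtain ⟨u, hu⟩ := hall Ground.unit
  obtain ⟨u', hu'⟩ := hall ((Ty.arr (Ty.var 0) (Ty.var 0)).ev fun _ => Ground.unit)
  refine h.not_both (congrArg Subtype.val hu) (Eq.trans ?_ (congrArg Subtype.val hu'))
    (a := Ty.unit) (b := Ty.unit)
  rw [Ty.ev_val, Ty.arr_subst]; rfl

/-- An evaluation map that takes the value `g` on the families whose shapes are as specified. -/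
structure Good {I : Type} (s : I → Shape S) (g : Ground S) (Ψ : (I → Ground S) → Ground S) :
    Prop where
  hom : Hom Ψ
  val : ∀ f, (∀ i, (s i).Inst (f i)) → Ψ f = g

/-- Since two of the specified shapes differ, every family that has them is irreducible, and all of
these may be sent to `g`. -/
theorem exists_good {I : Type} [Nonempty I] {s : I → Shape S} (hs : ∀ i, (s i).Canonical)
    {i₀ i₁ : I} (hne : s i₀ ≠ s i₁) (g : Ground S) : ∃ Ψ, Good s g Ψ := by
  obtain ⟨Ψ, h1, h2⟩ := exists_hom (I := I) (S := S) fun _ => g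
  exact ⟨Ψ, h1, fun f hf => h2 f (irred_of_inst (hs _) (hs _) hne (hf i₀) (hf i₁))⟩

/-- A fresh irreducible family can be given any value. -/
theorem Good.extend {I : Type} [Nonempty I] {s : I → Shape S} (hs : ∀ i, (s i).Canonical)
    {i₀ i₁ : I} (hne : s i₀ ≠ s i₁) {g : Ground S} {Ψ : (I → Ground S) → Ground S}
    (hΨ : Good s g Ψ) (h : Ground S) :
    ∃ Ψ' : (I × Ground S → Ground S) → Ground S, Good (fun j => s j.1) g Ψ' ∧
      (∀ f : I → Ground S, Ψ' (fun j => f j.1) = Ψ f) ∧ Ψ' (fun j => j.2) = h := by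
  classical
  -- Among irreducible families, those pulled back from `I` follow `Ψ`, the second projection gets
  -- `h`, and the others get `g`.
  let w₀ : (I × Ground S → Ground S) → Ground S := fun f =>
    if hf : ∃ f₀ : I → Ground S, f = fun j => f₀ j.1 then Ψ hf.choose
    else if f = fun j => j.2 then h else g
  have hw₀ : ∀ f₀ : I → Ground S, w₀ (fun j => f₀ j.1) = Ψ f₀ := by
    intro f₀
    have hex : ∃ f₁ : I → Ground S, (fun j : I × Ground S => f₀ j.1) = fun j => f₁ j.1 := ⟨f₀, rfl⟩
    simp only [w₀]
    rw [dif_pos hex]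
    congr 1
    funext i
    exact (congrFun hex.choose_spec (i, default)).symm
  -- A pulled-back family is constant in the second component, but there is more than one ground
  -- type.
  have hsnd : ¬ ∃ f₀ : I → Ground S, (fun j : I × Ground S => j.2) = fun j => f₀ j.1 := by
    rintro ⟨f₀, hf⟩
    obtain ⟨g', hg'⟩ := (hs i₀).nonTrivial.exists_not_inst
    have e : ∀ g₁ : Ground S, g₁ = f₀ i₀ := fun g₁ => congrFun hf (i₀, g₁)
    exact hg' ⟨fun _ => default, (e g').trans (e _).symm⟩
  obtain ⟨Ψ', h1, h2⟩ := exists_hom w₀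
  have hfst : Function.Surjective (Prod.fst : I × Ground S → I) := fun i => ⟨(i, default), rfl⟩
  have h3 : ∀ f : I → Ground S, Ψ' (fun j => f j.1) = Ψ f := by
    intro f
    obtain ⟨A, v, t, h4, h5, h6⟩ := exists_name f ∅ (fun _ _ => default) ⟨by simp, by simp⟩
    have e : f = fun i => t.ev fun a => v i a := funext fun i => (h6 i).symm
    rw [e, hΨ.hom t fun a i => v i a]
    refine (h1 t fun a j => v j.1 a).trans (Ty.ev_congr fun a ha => ?_)
    exact (h2 _ ((h4.faithful.irred a (h5 a ha)).comp hfst)).trans (hw₀ fun i => v i a)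
  refine ⟨Ψ', ⟨h1, fun f hf => ?_⟩, h3, ?_⟩
  · by_cases hf₀ : ∃ f₀ : I → Ground S, f = fun j => f₀ j.1
    · obtain ⟨f₀, rfl⟩ := hf₀
      rw [h3]
      exact hΨ.val f₀ fun i => hf (i, default)
    · rw [h2 f (irred_of_inst (hs _) (hs _) hne (hf (i₀, default)) (hf (i₁, default)))]
      simp only [w₀]
      rw [dif_neg hf₀, if_neg]
      rintro rfl
      -- The second projection also takes values outside the shape `s i₀`, so it is not among the
      -- families whose value must be `g`.
      obtain ⟨g', hg'⟩ := (hs i₀).nonTrivial.exists_not_inst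
      exact hg' (hf (i₀, g'))
  · rw [h2 _ (irred_of_surjective fun g' => ⟨(Classical.arbitrary I, g'), rfl⟩)]
    simp only [w₀]
    rw [dif_neg hsnd]; exact if_pos trivial

/-! ## Uniqueness of shapes -/

/-- Three constraints that only differ in one place, where the type `t` has the shape `s₁`, the
shape `s₂`, and the value `g`, respectively. -/
inductive Tri (t : Ty S) (s₁ s₂ : Shape S) (g : Ground S) :
    Constr S → Constr S → Constr S → Prop
  | hole : Tri t s₁ s₂ g (.exN s₁.n (.unif (t.shift s₁.n) s₁.ty))
      (.exN s₂.n (.unif (t.shift s₂.n) s₂.ty)) (.unif t g.1)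
  | tt : Tri t s₁ s₂ g .tt .tt .tt
  | unif (a b) : Tri t s₁ s₂ g (.unif a b) (.unif a b) (.unif a b)
  | app (x a) : Tri t s₁ s₂ g (.app x a) (.app x a) (.app x a)
  | mtch (a) {n : ℕ} (ps : Fin n → Pat) (cs) :
      Tri t s₁ s₂ g (.mtch a ps cs) (.mtch a ps cs) (.mtch a ps cs)
  -- For `ff` and unresolved variables; insolubility of the first constraint is enough, since some
  -- index always selects it.
  | absurd {c₁ c₂ c₃} : (∀ φ, ¬ csem True c₁ φ) → Tri t s₁ s₂ g c₁ c₂ c₃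
  | conj {c₁ c₂ c₃ d₁ d₂ d₃} : Tri t s₁ s₂ g c₁ c₂ c₃ → Tri t s₁ s₂ g d₁ d₂ d₃ →
      Tri t s₁ s₂ g (.conj c₁ d₁) (.conj c₂ d₂) (.conj c₃ d₃)
  | ex {c₁ c₂ c₃} : Tri t s₁ s₂ g c₁ c₂ c₃ → Tri t s₁ s₂ g (.ex c₁) (.ex c₂) (.ex c₃)
  | all {c₁ c₂ c₃} : Tri t s₁ s₂ g c₁ c₂ c₃ → Tri t s₁ s₂ g (.all c₁) (.all c₂) (.all c₃)
  | letC (x) {c₁ c₂ c₃ d₁ d₂ d₃} : Tri t s₁ s₂ g c₁ c₂ c₃ → Tri t s₁ s₂ g d₁ d₂ d₃ →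
      Tri t s₁ s₂ g (.letC x c₁ d₁) (.letC x c₂ d₂) (.letC x c₃ d₃)

theorem Tri.refl {t : Ty S} {s₁ s₂ : Shape S} {g : Ground S} (c : Constr S) :
    Tri t s₁ s₂ g c c c := by
  induction c with
  | tt => exact .tt
  | conj _ _ ih₁ ih₂ => exact .conj ih₁ ih₂
  | unif a b => exact .unif a b
  | ex _ ih => exact .ex ih
  | all _ ih => exact .all ih
  | letC x _ _ ih₁ ih₂ => exact .letC x ih₁ ih₂
  | app x a => exact .app x a
  | mtch a ps cs => exact .mtch a ps cs
  | _ => exact .absurd fun _ h => h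

theorem Tri.plug {t : Ty S} {s₁ s₂ : Shape S} {g : Ground S} (C : CCtx S) :
    Tri t s₁ s₂ g (C.plug (.exN s₁.n (.unif (t.shift s₁.n) s₁.ty)))
      (C.plug (.exN s₂.n (.unif (t.shift s₂.n) s₂.ty))) (C.plug (.unif t g.1)) := by
  induction C with
  | hole => exact .hole
  | andL C c ih => exact .conj ih (.refl c)
  | andR c C ih => exact .conj (.refl c) ih
  | ex C ih => exact .ex ih
  | all C ih => exact .all ih
  | letL x C c ih => exact .letC x ih (.refl c)
  | letR x c C ih => exact .letC x (.refl c) ih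

theorem csem_hasShape {m : Prop} {s : Shape S} {t : Ty S} {φ : Env S} :
    csem m (.exN s.n (.unif (t.shift s.n) s.ty)) φ ↔ s.Inst (t.ev φ.ty) := by
  rw [csem_exN]
  refine exists_congr fun u => ?_
  simp only [csem, ev_shift_pushN, ev_pushN_closed φ u fun i hi => (s.closed i).1 hi]

/-- The set `G` contains the values of all families in `X`, also of those over a larger index. -/
def RelSet {I : Type} (s : I → Shape S) (g : Ground S) (Ψ : (I → Ground S) → Ground S)
    (X : I → Set (Ground S)) (G : Set (Ground S)) : Prop :=
  ∀ (J : Type) (r : J → I) (Ψ' : (J → Ground S) → Ground S), Function.Surjective r →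
    Good (fun j => s (r j)) g Ψ' → (∀ f : I → Ground S, Ψ' (fun j => f (r j)) = Ψ f) →
    ∀ τ : J → Ground S, (∀ j, τ j ∈ X (r j)) → Ψ' τ ∈ G

/-- An enlargement of `J` is also an enlargement of `I`. -/
theorem RelSet.comp {I : Type} {s : I → Shape S} {g : Ground S} {Ψ : (I → Ground S) → Ground S}
    {X : I → Set (Ground S)} {G : Set (Ground S)} (h : RelSet s g Ψ X G) {J : Type} {r : J → I}
    {Ψ' : (J → Ground S) → Ground S} (hr : Function.Surjective r)
    (hΨ : ∀ f : I → Ground S, Ψ' (fun j => f (r j)) = Ψ f) :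
    RelSet (fun j => s (r j)) g Ψ' (fun j => X (r j)) G :=
  fun K q Ψ'' hq hg he τ hτ => h K (r ∘ q) Ψ'' (hr.comp hq) hg
    (fun f => (he fun j => f (r j)).trans (hΨ f)) τ hτ

/-- A family of solutions, each of the first or of the second constraint, is merged by `Ψ` into a
solution of the third. Equations survive because `Ψ` commutes with type constructors. In the
distinguished place the values of `t` have the shapes that `Ψ` sends to `g`. Binders are followed by
enlarging the index set. -/
theorem Tri.transfer {t : Ty S} {s₁ s₂ : Shape S} {g : Ground S} {c₁ c₂ c₃ : Constr S}
    (h : Tri t s₁ s₂ g c₁ c₂ c₃) (hs₁ : s₁.Canonical) (hs₂ : s₂.Canonical) (hne : s₁ ≠ s₂) :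
    ∀ {I : Type} {b : I → Bool}, Function.Surjective b → ∀ {Φ : I → Env S} {ψ : Env S}
      {Ψ : (I → Ground S) → Ground S},
      (∀ i, csem True (bif b i then c₁ else c₂) (Φ i)) →
      Good (fun i => bif b i then s₁ else s₂) g Ψ → (∀ a, ψ.ty a = Ψ fun i => (Φ i).ty a) →
      (∀ x, RelSet (fun i => bif b i then s₁ else s₂) g Ψ (fun i => (Φ i).tm x) (ψ.tm x)) →
      csem True c₃ ψ := by
  have hev : ∀ {I : Type} {Φ : I → Env S} {ψ : Env S} {Ψ : (I → Ground S) → Ground S}, Hom Ψ →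
      (∀ a, ψ.ty a = Ψ fun i => (Φ i).ty a) → ∀ a : Ty S, a.ev ψ.ty = Ψ fun i => a.ev (Φ i).ty := by
    intro I Φ ψ Ψ hΨ hψ a
    exact (Ty.ev_congr fun x _ => hψ x).trans (hΨ a fun x i => (Φ i).ty x).symm
  have hcan : ∀ {I : Type} (b : I → Bool) (i : I), (bif b i then s₁ else s₂).Canonical := by
    intro I b i; cases b i <;> assumption
  induction h with
  | hole =>
    intro I b _ Φ ψ Ψ hc hg hψ _
    show t.ev _ = g.1.ev _
    rw [Ty.ev_ground, hev hg.hom hψ]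
    refine hg.val _ fun i => ?_
    have := hc i
    cases hb : b i <;> rw [hb] at this
    · exact csem_hasShape.1 this
    · exact csem_hasShape.1 this
  | tt => intros; trivial
  | mtch => intros; trivial
  | unif a a' =>
    intro I b _ Φ ψ Ψ hc hg hψ _
    show a.ev _ = a'.ev _
    rw [hev hg.hom hψ, hev hg.hom hψ]
    congr 1
    funext i
    have := hc i
    rwa [Bool.cond_self] at this
  | app x a =>
    intro I b _ Φ ψ Ψ hc hg hψ hX
    show a.ev _ ∈ ψ.tm x
    rw [hev hg.hom hψ]
    refine hX x I id Ψ Function.surjective_id hg (fun f => rfl) _ fun i => ?_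
    have := hc i
    rwa [Bool.cond_self] at this
  | absurd hn =>
    intro I b hb Φ ψ Ψ hc
    obtain ⟨i, hi⟩ := hb true
    have := hc i
    rw [hi] at this
    exact (hn _ this).elim
  | conj _ _ ih₁ ih₂ =>
    intro I b hb Φ ψ Ψ hc hg hψ hX
    refine ⟨ih₁ hb (fun i => ?_) hg hψ hX, ih₂ hb (fun i => ?_) hg hψ hX⟩
    · have := hc i; cases hi : b i <;> rw [hi] at this <;> exact this.1
    · have := hc i; cases hi : b i <;> rw [hi] at this <;> exact this.2
  | @ex d₁ d₂ d₃ _ ih =>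
    intro I b hb Φ ψ Ψ hc hg hψ hX
    have hc' : ∀ i, ∃ g', csem True (bif b i then d₁ else d₂) ((Φ i).pushTy g') := by
      intro i; have := hc i; cases hi : b i <;> rw [hi] at this <;> exact this
    choose f hf using hc'
    refine ⟨Ψ f, ih hb hf hg (fun a => ?_) hX⟩
    cases a with
    | zero => rfl
    | succ a => exact hψ a
  | @all d₁ d₂ d₃ _ ih =>
    intro I b hb Φ ψ Ψ hc hg hψ hX h
    obtain ⟨i₀, hi₀⟩ := hb true
    obtain ⟨i₁, hi₁⟩ := hb false
    have : Nonempty I := ⟨i₀⟩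
    -- For an arbitrary value `h` of the bound variable, the index set is multiplied by all ground
    -- types. The bound variable becomes the second projection, to which `Ψ'` gives the value `h`.
    obtain ⟨Ψ', h1, h2, h3⟩ := hg.extend (hcan b) (i₀ := i₀) (i₁ := i₁)
      (by rw [hi₀, hi₁]; exact hne) h
    have hfst : Function.Surjective (Prod.fst : I × Ground S → I) := fun i => ⟨(i, default), rfl⟩
    refine ih (b := fun j : I × Ground S => b j.1) (Φ := fun j => (Φ j.1).pushTy j.2)
      (hb.comp hfst) (fun j => ?_) h1 (fun a => ?_) fun x => (hX x).comp hfst h2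
    · have := hc j.1
      cases hi : b j.1 <;> rw [hi] at this <;> exact this j.2
    · cases a with
      | zero => exact h3.symm
      | succ a => exact (hψ a).trans (h2 _).symm
  | @letC x d₁ d₂ d₃ k₁ k₂ k₃ _ _ ih₁ ih₂ =>
    intro I b hb Φ ψ Ψ hc hg hψ hX
    have hc' : ∀ i, ∃ G : Set (Ground S),
        (∀ g ∈ G, csem True (bif b i then d₁ else d₂) ((Φ i).pushTy g)) ∧ G.Nonempty ∧
        csem True (bif b i then k₁ else k₂) ((Φ i).setTm x G) := by
      intro i; have := hc i; cases hi : b i <;> rw [hi] at this <;> exact this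
    choose G h1 h2 h3 using hc'
    -- The set bound in the merged solution collects merged values over all enlargements of the
    -- index set, since uses of `x` below later binders live over larger index sets.
    let G' : Set (Ground S) := fun h => ∃ (J : Type) (r : J → I) (Ψ' : (J → Ground S) → Ground S)
      (τ : J → Ground S), Function.Surjective r ∧
      Good (fun j => bif b (r j) then s₁ else s₂) g Ψ' ∧
      (∀ f : I → Ground S, Ψ' (fun j => f (r j)) = Ψ f) ∧ (∀ j, τ j ∈ G (r j)) ∧ Ψ' τ = h
    refine ⟨G', ?_, ?_, ih₂ (Φ := fun i => (Φ i).setTm x (G i)) hb h3 hg hψ fun y => ?_⟩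
    · rintro _ ⟨J, r, Ψ', τ, hr, hg', he, hτ, rfl⟩
      refine ih₁ (b := fun j => b (r j)) (Φ := fun j => (Φ (r j)).pushTy (τ j)) (hb.comp hr)
        (fun j => h1 _ _ (hτ j)) hg' (fun a => ?_) fun y => (hX y).comp hr he
      cases a with
      | zero => rfl
      | succ a => exact (hψ a).trans (he _).symm
    · choose τ hτ using h2
      exact ⟨Ψ τ, I, id, Ψ, τ, Function.surjective_id, hg, fun f => rfl, hτ, rfl⟩
    · by_cases hy : y = x
      · subst hy
        simp only [Env.setTm, Function.update_self]
        intro J r Ψ' hr hg' he τ hτ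
        exact ⟨J, r, Ψ', τ, hr, hg', he, hτ, rfl⟩
      · simp only [Env.setTm, Function.update_of_ne hy]
        exact hX y

/-- A known shape is the only one that the type can have. -/
theorem Known.eq {C : CCtx S} {t : Ty S} {s s' : Shape S} (h : Known L C t s)
    (hs' : s'.Canonical) {φ φ' : Env S}
    (hφ : csem True (C.plug (.exN s.n (.unif (t.shift s.n) s.ty))) φ)
    (hφ' : csem True (C.plug (.exN s'.n (.unif (t.shift s'.n) s'.ty))) φ') : s = s' := by
  by_contra hne
  have key : ∀ g : Ground S, ∃ θ, g.1 = s.ty.subst θ := by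
    intro g
    -- Two indices, one for each of the two solutions. Merging yields a solution in which the
    -- matched type equals an arbitrary `g`, so unicity would give every ground type the shape `s`.
    obtain ⟨Ψ, hΨ⟩ := exists_good (I := Bool) (s := fun i => bif i then s else s')
      (by rintro (_ | _); exacts [hs', h.1]) (i₀ := true) (i₁ := false) hne g
    have := Tri.transfer (Tri.plug (g := g) (t := t) C) h.1 hs' hne (b := id)
      Function.surjective_id (Φ := fun i => bif i then φ else φ')
      -- Free term variables may denote everything, since unicity quantifies over all environments.
      (ψ := ⟨fun a => Ψ fun i => (bif i then φ else φ').ty a, fun _ => Set.univ⟩)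
      (by rintro (_ | _); exacts [hφ', hφ]) hΨ (fun _ => rfl) fun x _ _ _ _ _ _ _ _ => trivial
    exact (h.2 _ g (simpleSat_erase_iff.2 this)).1.2.1
  obtain ⟨g, hg⟩ := h.1.nonTrivial.exists_not_inst
  obtain ⟨θ, hθ⟩ := key g
  refine hg ⟨fun a => (θ a).ev fun _ => default, ?_⟩
  rw [← Ty.ev_subst, ← hθ, Ty.ev_ground]

end OML

namespace OML

variable {S : Sig} {L : LabelEnv S}

/-! ## Full elaborations of constraints -/

/-- `c'` arises from `c` by discharging every suspended constraint with some shape. -/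
inductive CElab (L : LabelEnv S) : Constr S → Constr S → Prop
  | tt : CElab L .tt .tt
  | unif (a b : Ty S) : CElab L (.unif a b) (.unif a b)
  | app (x : ℕ) (a : Ty S) : CElab L (.app x a) (.app x a)
  | conj {c c' d d'} : CElab L c c' → CElab L d d' → CElab L (.conj c d) (.conj c' d')
  | ex {c c'} : CElab L c c' → CElab L (.ex c) (.ex c')
  | all {c c'} : CElab L c c' → CElab L (.all c) (.all c')
  | letC (x : ℕ) {c c' d d'} : CElab L c c' → CElab L d d' → CElab L (.letC x c d) (.letC x c' d')
  | mtch {t n} {ps : Fin n → Pat} {cs : Fin n → Constr S} {c'} (s : Shape S) : s.Canonical →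
      CElab L (.matched L t s ps cs) c' → CElab L (.mtch t ps cs) c'

theorem CElab.of_csem {c : Constr S} : ∀ {φ : Env S}, csem False c φ → CElab L c c := by
  induction c with
  | tt => exact fun _ => .tt
  | conj c₁ c₂ ih₁ ih₂ => exact fun h => .conj (ih₁ h.1) (ih₂ h.2)
  | unif a b => exact fun _ => .unif a b
  | ex c ih => exact fun ⟨g, h⟩ => .ex (ih h)
  | all c ih => exact fun h => .all (ih (h default))
  | letC x c₁ c₂ ih₁ ih₂ => exact fun ⟨G, h1, ⟨g, h2⟩, h3⟩ => .letC x (ih₁ (h1 g h2)) (ih₂ h3)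
  | app x t => exact fun _ => .app x t
  | _ => exact fun h => h.elim

/-- A constraint with a solution in the simple semantics has nothing left to discharge. -/
theorem CElab.eq {c c' : Constr S} (h : CElab L c c') : ∀ {φ : Env S}, csem False c φ → c = c' := by
  induction h with
  | conj _ _ ih₁ ih₂ => exact fun h => by rw [ih₁ h.1, ih₂ h.2]
  | ex _ ih => exact fun ⟨g, h⟩ => by rw [ih h]
  | all _ ih => exact fun h => by rw [ih (h default)]
  | letC x _ _ ih₁ ih₂ => exact fun ⟨G, h1, ⟨g, h2⟩, h3⟩ => by rw [ih₁ (h1 g h2), ih₂ h3]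
  | mtch => exact fun h => h.elim
  | _ => exact fun _ => rfl

theorem CElab.csem {c c' : Constr S} (h : CElab L c c') :
    ∀ {φ : Env S}, csem True c' φ → OML.csem True c φ := by
  induction h with
  | conj _ _ ih₁ ih₂ => exact fun h => ⟨ih₁ h.1, ih₂ h.2⟩
  | ex _ ih => exact fun ⟨g, h⟩ => ⟨g, ih h⟩
  | all _ ih => exact fun h g => ih (h g)
  | letC x _ _ ih₁ ih₂ => exact fun ⟨G, h1, h2, h3⟩ => ⟨G, fun g hg => ih₁ (h1 g hg), h2, ih₂ h3⟩
  | mtch => exact fun _ => trivial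
  | _ => exact fun h => h

/-- Elaborating one suspended constraint first. -/
theorem CElab.plug_iff {t : Ty S} {n : ℕ} {ps : Fin n → Pat} {cs : Fin n → Constr S}
    {C : CCtx S} : ∀ {c' : Constr S}, CElab L (C.plug (.mtch t ps cs)) c' ↔
      ∃ s : Shape S, s.Canonical ∧ CElab L (C.plug (.matched L t s ps cs)) c' := by
  induction C with
  | hole =>
    refine fun {c'} => ⟨fun h => ?_, fun ⟨s, h1, h2⟩ => .mtch s h1 h2⟩
    cases h with
    | mtch s h1 h2 => exact ⟨s, h1, h2⟩
  | andL C d ih =>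
    refine fun {c'} => ⟨fun h => ?_, fun ⟨s, h1, h2⟩ => ?_⟩
    · cases h with
      | conj h h' => obtain ⟨s, h1, h2⟩ := ih.1 h; exact ⟨s, h1, .conj h2 h'⟩
    · cases h2 with
      | conj h h' => exact .conj (ih.2 ⟨s, h1, h⟩) h'
  | andR d C ih =>
    refine fun {c'} => ⟨fun h => ?_, fun ⟨s, h1, h2⟩ => ?_⟩
    · cases h with
      | conj h' h => obtain ⟨s, h1, h2⟩ := ih.1 h; exact ⟨s, h1, .conj h' h2⟩
    · cases h2 with
      | conj h' h => exact .conj h' (ih.2 ⟨s, h1, h⟩)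
  | ex C ih =>
    refine fun {c'} => ⟨fun h => ?_, fun ⟨s, h1, h2⟩ => ?_⟩
    · cases h with
      | ex h => obtain ⟨s, h1, h2⟩ := ih.1 h; exact ⟨s, h1, .ex h2⟩
    · cases h2 with
      | ex h => exact .ex (ih.2 ⟨s, h1, h⟩)
  | all C ih =>
    refine fun {c'} => ⟨fun h => ?_, fun ⟨s, h1, h2⟩ => ?_⟩
    · cases h with
      | all h => obtain ⟨s, h1, h2⟩ := ih.1 h; exact ⟨s, h1, .all h2⟩
    · cases h2 with
      | all h => exact .all (ih.2 ⟨s, h1, h⟩)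
  | letL x C d ih =>
    refine fun {c'} => ⟨fun h => ?_, fun ⟨s, h1, h2⟩ => ?_⟩
    · cases h with
      | letC _ h h' => obtain ⟨s, h1, h2⟩ := ih.1 h; exact ⟨s, h1, .letC x h2 h'⟩
    · cases h2 with
      | letC _ h h' => exact .letC x (ih.2 ⟨s, h1, h⟩) h'
  | letR x d C ih =>
    refine fun {c'} => ⟨fun h => ?_, fun ⟨s, h1, h2⟩ => ?_⟩
    · cases h with
      | letC _ h' h => obtain ⟨s, h1, h2⟩ := ih.1 h; exact ⟨s, h1, .letC x h' h2⟩
    · cases h2 with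
      | letC _ h' h => exact .letC x h' (ih.2 ⟨s, h1, h⟩)

/-- The order of the steps and their unicity conditions are forgotten, so that different sequences
of steps can be compared. -/
theorem CSteps.cElab {c c' : Constr S} (h : Relation.ReflTransGen (CStep L) c c') {φ : Env S}
    (hφ : OML.csem False c' φ) : CElab L c c' := by
  induction h using Relation.ReflTransGen.head_induction_on with
  | refl => exact .of_csem hφ
  | head h _ ih =>
    cases h with
    | mk C t s ps cs h => exact CElab.plug_iff.2 ⟨s, h.1, ih⟩

theorem csem_hasShape_of_matched {t : Ty S} {s : Shape S} {n : ℕ} {ps : Fin n → Pat}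
    {cs : Fin n → Constr S} {m : Prop} {φ : Env S} (h : csem m (.matched L t s ps cs) φ) :
    csem m (.exN s.n (.unif (t.shift s.n) s.ty)) φ := by
  unfold Constr.matched at h
  split at h
  · rw [csem_exN] at h ⊢
    obtain ⟨u, h, _⟩ := h
    exact ⟨u, h⟩
  · exact h.elim

/-- Elaboration steps that lead to a solvable constraint are the only way to elaborate. -/
theorem CSteps.eq {c c₁ c₂ : Constr S} (h : Relation.ReflTransGen (CStep L) c c₁) {φ₁ φ₂ : Env S}
    (h₁ : OML.csem False c₁ φ₁) (h' : CElab L c c₂) (h₂ : OML.csem True c₂ φ₂) : c₁ = c₂ := by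
  induction h using Relation.ReflTransGen.head_induction_on with
  | refl => exact h'.eq h₁
  | head h hs ih =>
    have hm := CSteps.csem hs (csem_weaken h₁)
    cases h with
    | mk C t s ps cs h =>
      obtain ⟨s', hs', he⟩ := CElab.plug_iff.1 h'
      -- Both shapes lead to solutions, and the one chosen by the step is known, so they are equal.
      obtain rfl := h.eq hs' (C.csem_mono (fun _ => csem_hasShape_of_matched) hm)
        (C.csem_mono (fun _ => csem_hasShape_of_matched) (he.csem h₂))
      exact ih he

theorem CSteps.unique {c c₁ c₂ : Constr S} (h : Relation.ReflTransGen (CStep L) c c₁)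
    {φ₁ φ₂ : Env S} (h₁ : OML.csem False c₁ φ₁) (h' : Relation.ReflTransGen (CStep L) c c₂)
    (h₂ : OML.csem False c₂ φ₂) : c₁ = c₂ :=
  CSteps.eq h h₁ (CSteps.cElab h' h₂) (csem_weaken h₂)

/-- Unicity persists in larger contexts, since every solution there restricts to one of the smaller
context. -/
theorem CStep.frame (F : CCtx S) {c c' : Constr S} (h : CStep L c c') :
    CStep L (F.plug c) (F.plug c') := by
  cases h with
  | mk C t s ps cs h =>
    rw [← CCtx.plug_comp, ← CCtx.plug_comp]
    refine .mk _ t s ps cs ⟨h.1, fun φ g hg => ?_⟩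
    rw [simpleSat_erase_iff, CCtx.plug_comp] at hg
    obtain ⟨φ', hφ'⟩ := F.sub_nonempty hg
    exact h.2 φ' g (simpleSat_erase_iff.2 hφ')

theorem CSteps.frame (F : CCtx S) {c c' : Constr S} (h : Relation.ReflTransGen (CStep L) c c') :
    Relation.ReflTransGen (CStep L) (F.plug c) (F.plug c') :=
  Relation.ReflTransGen.lift F.plug (fun _ _ => CStep.frame F) _ _ h

/-- All uses of the contextual rule are moved to the front. Below `∀` and `let` the derivations for
different ground types come with elaborations of their own, and uniqueness makes these the same. -/
theorem sat_iff {c : Constr S} {φ : Env S} :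
    Sat L φ c ↔ ∃ c', Relation.ReflTransGen (CStep L) c c' ∧ csem False c' φ := by
  constructor
  · intro h
    unfold Sat at h
    induction h with
    | tt => exact ⟨_, .refl, trivial⟩
    | @conj φ c₁ c₂ _ _ ih₁ ih₂ =>
      obtain ⟨d₁, h1, h2⟩ := ih₁
      obtain ⟨d₂, h3, h4⟩ := ih₂
      exact ⟨.conj d₁ d₂, (CSteps.frame (.andL .hole c₂) h1).trans (CSteps.frame (.andR d₁ .hole) h3),
        h2, h4⟩
    | unif h => exact ⟨_, .refl, h⟩
    | ex g _ ih =>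
      obtain ⟨d, h1, h2⟩ := ih
      exact ⟨.ex d, CSteps.frame (.ex .hole) h1, g, h2⟩
    | all _ ih =>
      choose d h1 h2 using ih
      exact ⟨.all (d default), CSteps.frame (.all .hole) (h1 default), fun g => by
        rw [CSteps.unique (h1 default) (h2 default) (h1 g) (h2 g)]; exact h2 g⟩
    | @letC φ x c₁ c₂ G _ hG _ ih₁ ih₂ =>
      choose d h1 h2 using ih₁
      obtain ⟨g₀, hg₀⟩ := hG
      obtain ⟨d₂, h3, h4⟩ := ih₂
      refine ⟨.letC x (d g₀ hg₀) d₂, (CSteps.frame (.letL x .hole c₂) (h1 g₀ hg₀)).trans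
        (CSteps.frame (.letR x _ .hole) h3), G, fun g hg => ?_, ⟨g₀, hg₀⟩, h4⟩
      rw [CSteps.unique (h1 g₀ hg₀) (h2 g₀ hg₀) (h1 g hg) (h2 g hg)]
      exact h2 g hg
    | app h => exact ⟨_, .refl, h⟩
    | matchCtx C s h _ ih =>
      obtain ⟨d, h1, h2⟩ := ih
      exact ⟨d, h1.head (.mk C _ s _ _ h), h2⟩
  · rintro ⟨c', h, hc⟩
    induction h using Relation.ReflTransGen.head_induction_on with
    | refl => exact SatWith.of_csem hc
    | head h _ ih =>
      cases h with
      | mk C t s ps cs h => exact SatWith.matchCtx C s h ih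

end OML

namespace OML

variable {S : Sig} {L : LabelEnv S}

/-! ## Elaboration of terms -/

theorem Exp.fv_mk (x : Exp S) (es : Fin x.imp.ar → Term S) : (x.imp.mk es).fv = (x.mk es).fv := by
  cases x <;> rfl

theorem TStep.fv_eq {e e' : Term S} (h : TStep L e e') : e.fv = e'.fv := by
  cases h with
  | mk E x es h => exact E.fv_plug (x.fv_mk es)

theorem TSteps.fv_eq {e e' : Term S} (h : Relation.ReflTransGen (TStep L) e e') : e.fv = e'.fv := by
  induction h with
  | refl => rfl
  | tail _ h ih => exact ih.trans h.fv_eq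

theorem TStep.frame (F : ECtx S) {e e' : Term S} (h : TStep L e e') :
    TStep L (F.plug e) (F.plug e') := by
  cases h with
  | mk E x es h =>
    rw [← ECtx.plug_comp, ← ECtx.plug_comp]
    refine .mk _ x es ⟨h.1, fun ρ g t ht => ?_⟩
    rw [ECtx.plug_comp] at ht
    obtain ⟨ρ', t', h'⟩ := ECtx.sub_nonempty ht
    exact h.2 ρ' g t' h'

theorem TSteps.frame (F : ECtx S) {e e' : Term S} (h : Relation.ReflTransGen (TStep L) e e') :
    Relation.ReflTransGen (TStep L) (F.plug e) (F.plug e') :=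
  Relation.ReflTransGen.lift (fun e => F.plug e) (fun _ _ => TStep.frame F) _ _ h

/-- The components are elaborated one at a time; the finite set `s` consists of those already done.
-/
theorem TSteps.frame_pi {n : ℕ} {F : (Fin n → Term S) → Term S} {es es' : Fin n → Term S}
    (hF : ∀ (fs : Fin n → Term S) (j : Fin n), ∃ E : ECtx S, ∀ e, E.plug e = F (Function.update fs j e))
    (h : ∀ i, Relation.ReflTransGen (TStep L) (es i) (es' i)) :
    Relation.ReflTransGen (TStep L) (F es) (F es') := by
  have key : ∀ s : Finset (Fin n), Relation.ReflTransGen (TStep L) (F es) (F (s.piecewise es' es)) := by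
    intro s
    induction s using Finset.induction_on with
    | empty => rw [Finset.piecewise_empty]
    | insert j s hj ih =>
      obtain ⟨E, hE⟩ := hF (s.piecewise es' es) j
      have h1 := TSteps.frame E (h j)
      rw [hE, hE, ← Finset.piecewise_insert] at h1
      rw [show Function.update (s.piecewise es' es) j (es j) = s.piecewise es' es by
        rw [← Finset.piecewise_eq_of_notMem s es' es hj, Function.update_eq_self]] at h1
      exact ih.trans h1
  have := key Finset.univ
  rwa [Finset.piecewise_univ] at this

/-- The rule for determined labels has the explicit literal as its premise. Steps inside that
literal must be redone inside the implicit one, which has the same meaning because the record name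
is determined. -/
theorem TStep.recordX_inv {T : S.Rec} {n : ℕ} {ls : Fin (n + 1) → S.Lab}
    {es : Fin (n + 1) → Term S} {e : Term S} (h : TStep L (.recordX T ls es) e) :
    ∃ es', e = .recordX T ls es' ∧
      (L.LabsUni (Set.range ls) T → TStep L (.record ls es) (.record ls es')) := by
  generalize h₀ : Term.recordX T ls es = e₀ at h
  cases h with
  | mk E x fs h =>
    cases E with
    | recordX T' ls' j E ds =>
      injection h₀ with h1 h2 h3 h4
      subst h1; subst h2; obtain rfl := eq_of_heq h3; obtain rfl := eq_of_heq h4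
      refine ⟨_, rfl, fun hT => .mk (.record ls j E ds) x fs ⟨h.1, fun ρ g t ht => ?_⟩⟩
      rcases ht with ⟨T', h1, h2, h3⟩ | ⟨hn, _⟩
      · obtain rfl := hT.2 T' h1.1
        exact h.2 ρ g t ⟨h2, h3⟩
      · exact (hn ⟨T, hT⟩).elim
    | hole => cases x <;> cases h₀
    | _ => cases h₀

theorem TSteps.recordX_inv {T : S.Rec} {n : ℕ} {ls : Fin (n + 1) → S.Lab}
    (hT : L.LabsUni (Set.range ls) T) {es : Fin (n + 1) → Term S} {e : Term S}
    (h : Relation.ReflTransGen (TStep L) (.recordX T ls es) e) :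
    ∃ es', e = .recordX T ls es' ∧
      Relation.ReflTransGen (TStep L) (.record ls es) (.record ls es') := by
  induction h with
  | refl => exact ⟨es, rfl, .refl⟩
  | tail _ h ih =>
    obtain ⟨fs, rfl, h1⟩ := ih
    obtain ⟨es', rfl, h2⟩ := h.recordX_inv
    exact ⟨es', rfl, h1.tail (h2 hT)⟩

theorem TStep.fieldX_inv {T : S.Rec} {l : S.Lab} {e e' : Term S} (h : TStep L (.fieldX e T l) e') :
    ∃ d, e' = .fieldX d T l ∧ (L.LabUni l T → TStep L (.field e l) (.field d l)) := by
  generalize h₀ : Term.fieldX e T l = e₀ at h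
  cases h with
  | mk E x fs h =>
    cases E with
    | fieldX E T' l' =>
      injection h₀ with h1 h2 h3
      subst h1; subst h2; subst h3
      refine ⟨_, rfl, fun hT => .mk (.field E l) x fs ⟨h.1, fun ρ g t ht => ?_⟩⟩
      rcases ht with ⟨T', h1, h2⟩ | ⟨hn, _⟩
      · obtain rfl := hT.2 T' h1.1
        exact h.2 ρ g t h2
      · exact (hn ⟨T, hT⟩).elim
    | hole => cases x <;> cases h₀
    | _ => cases h₀

theorem TSteps.fieldX_inv {T : S.Rec} {l : S.Lab} (hT : L.LabUni l T) {e e' : Term S}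
    (h : Relation.ReflTransGen (TStep L) (.fieldX e T l) e') :
    ∃ d, e' = .fieldX d T l ∧ Relation.ReflTransGen (TStep L) (.field e l) (.field d l) := by
  induction h with
  | refl => exact ⟨e, rfl, .refl⟩
  | tail _ h ih =>
    obtain ⟨d, rfl, h1⟩ := ih
    obtain ⟨d', rfl, h2⟩ := h.fieldX_inv
    exact ⟨d', rfl, h1.tail (h2 hT)⟩

theorem TStep.projI {E : ECtx S} {e : Term S} {n : ℕ} (h : KnownElim L E e (.prod S n)) (j : ℕ) :
    TStep L (E.plug (.proj e j)) (E.plug (.projX e n j)) :=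
  .mk E (.proj n j) (fun _ => e) (tKnown_iff.2 h)

theorem TStep.boxI {E : ECtx S} {e : Term S} {a : SchAnn S} (h : KnownIntro L E 1 ![e] (.poly a)) :
    TStep L (E.plug (.box e)) (E.plug (.boxX e a)) :=
  .mk E (.box a) (fun _ => e) (tKnown_iff.2 h)

theorem TStep.unboxI {E : ECtx S} {e : Term S} {a : SchAnn S} (h : KnownElim L E e (.poly a)) :
    TStep L (E.plug (.unbox e)) (E.plug (.unboxX e a)) :=
  .mk E (.unbox a) (fun _ => e) (tKnown_iff.2 h)

theorem TStep.recordI {E : ECtx S} {n : ℕ} {es : Fin (n + 1) → Term S} {T : S.Rec}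
    (h : KnownIntro L E (n + 1) es (.rcd T)) (ls : Fin (n + 1) → S.Lab) :
    TStep L (E.plug (.record ls es)) (E.plug (.recordX T ls es)) :=
  .mk E (.record T n ls) es (tKnown_iff.2 h)

theorem TStep.fieldI {E : ECtx S} {e : Term S} {T : S.Rec} (h : KnownElim L E e (.rcd T))
    (l : S.Lab) : TStep L (E.plug (.field e l)) (E.plug (.fieldX e T l)) :=
  .mk E (.field T l) (fun _ => e) (tKnown_iff.2 h)

/-- Induction over the implicit construct of a step. -/
theorem TStep.elim {P : Term S → Term S → Prop} {e e' : Term S} (h : TStep L e e')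
    (projI : ∀ (E : ECtx S) (e : Term S) (n j : ℕ), KnownElim L E e (.prod S n) →
      P (E.plug (.proj e j)) (E.plug (.projX e n j)))
    (boxI : ∀ (E : ECtx S) (e : Term S) (a : SchAnn S), KnownIntro L E 1 ![e] (.poly a) →
      P (E.plug (.box e)) (E.plug (.boxX e a)))
    (unboxI : ∀ (E : ECtx S) (e : Term S) (a : SchAnn S), KnownElim L E e (.poly a) →
      P (E.plug (.unbox e)) (E.plug (.unboxX e a)))
    (recordI : ∀ (E : ECtx S) (n : ℕ) (ls : Fin (n + 1) → S.Lab) (es : Fin (n + 1) → Term S)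
      (T : S.Rec), KnownIntro L E (n + 1) es (.rcd T) →
      P (E.plug (.record ls es)) (E.plug (.recordX T ls es)))
    (fieldI : ∀ (E : ECtx S) (e : Term S) (T : S.Rec) (l : S.Lab), KnownElim L E e (.rcd T) →
      P (E.plug (.field e l)) (E.plug (.fieldX e T l))) : P e e' := by
  cases h with
  | mk E x es h =>
    replace h := tKnown_iff.1 h
    cases x with
    | proj n j => exact projI E _ n j h
    | box a => exact boxI E _ a h
    | unbox a => exact unboxI E _ a h
    | record T n ls => exact recordI E n ls es T h
    | field T l => exact fieldI E _ T l h

/-! ## Typing by elaboration -/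

theorem TypingWith.imp {KE KE' : ECtx S → Term S → Shape S → Prop}
    {KI KI' : ECtx S → (n : ℕ) → (Fin n → Term S) → Shape S → Prop}
    (hE : ∀ E e s, KE E e s → KE' E e s) (hI : ∀ E n es s, KI E n es s → KI' E n es s)
    {Γ : TyCtx S} {e : Term S} {σ : Scheme S} (h : TypingWith L KE KI Γ e σ) :
    TypingWith L KE' KI' Γ e σ := by
  induction h with
  | var h => exact .var h
  | lam _ ih => exact .lam ih
  | app _ _ ih₁ ih₂ => exact .app ih₁ ih₂
  | unit => exact .unit
  | gen α _ h ih => exact .gen α ih h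
  | inst α t _ ih => exact .inst α t ih
  | letE _ _ ih₁ ih₂ => exact .letE ih₁ ih₂
  | annot θ _ ih => exact .annot θ ih
  | tuple _ ih => exact .tuple ih
  | projX j _ ih => exact .projX j ih
  | boxX θ _ ih => exact .boxX θ ih
  | unboxX θ _ ih => exact .unboxX θ ih
  | recordX h1 h2 _ ih => exact .recordX h1 h2 ih
  | recordClosed h _ ih => exact .recordClosed h ih
  | fieldX h _ ih => exact .fieldX h ih
  | fieldClosed h _ ih => exact .fieldClosed h ih
  | hole t _ ih => exact .hole t ih
  | projI E n h _ ih => exact .projI E n (hE _ _ _ h) ih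
  | boxI E a h _ ih => exact .boxI E a (hI _ _ _ _ h) ih
  | unboxI E a h _ ih => exact .unboxI E a (hE _ _ _ h) ih
  | recordI E T h _ ih => exact .recordI E T (hI _ _ _ _ h) ih
  | fieldI E T h _ ih => exact .fieldI E T (hE _ _ _ h) ih

/-- Contextual rules used anywhere in the derivation are moved to the front, since steps are stable
under contexts. The term constructs have finitely many subderivations, so no uniqueness is needed
here. -/
theorem Typing.exists_steps {Γ : TyCtx S} {e : Term S} {σ : Scheme S} (h : Typing L Γ e σ) :
    ∃ e', Relation.ReflTransGen (TStep L) e e' ∧ RobustTyping L Γ e' σ := by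
  unfold Typing at h
  induction h with
  | var h => exact ⟨_, .refl, .var h⟩
  | @lam Γ x _ _ _ _ ih =>
    obtain ⟨d, h1, h2⟩ := ih
    exact ⟨.lam x d, TSteps.frame (.lam x .hole) h1, .lam h2⟩
  | @app Γ e₁ e₂ _ _ _ _ ih₁ ih₂ =>
    obtain ⟨d₁, h1, h2⟩ := ih₁
    obtain ⟨d₂, h3, h4⟩ := ih₂
    exact ⟨.app d₁ d₂, (TSteps.frame (.appL .hole e₂) h1).trans (TSteps.frame (.appR d₁ .hole) h3),
      .app h2 h4⟩
  | unit => exact ⟨_, .refl, .unit⟩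
  | gen α _ h ih => obtain ⟨d, h1, h2⟩ := ih; exact ⟨d, h1, .gen α h2 h⟩
  | inst α t _ ih => obtain ⟨d, h1, h2⟩ := ih; exact ⟨d, h1, .inst α t h2⟩
  | @letE Γ x e₁ e₂ _ _ _ _ ih₁ ih₂ =>
    obtain ⟨d₁, h1, h2⟩ := ih₁
    obtain ⟨d₂, h3, h4⟩ := ih₂
    exact ⟨.letE x d₁ d₂, (TSteps.frame (.letL x .hole e₂) h1).trans
      (TSteps.frame (.letR x d₁ .hole) h3), .letE h2 h4⟩
  | @annot Γ e a θ _ ih =>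
    obtain ⟨d, h1, h2⟩ := ih
    exact ⟨.annot d a, TSteps.frame (.annot .hole a) h1, .annot θ h2⟩
  | tuple _ ih =>
    choose d h1 h2 using ih
    exact ⟨.tuple d, TSteps.frame_pi (F := .tuple) (fun fs j => ⟨.tuple j .hole fs, fun _ => rfl⟩) h1,
      .tuple h2⟩
  | @projX Γ e n _ j _ ih =>
    obtain ⟨d, h1, h2⟩ := ih
    exact ⟨.projX d n j, TSteps.frame (.projX .hole n j) h1, .projX j h2⟩
  | @boxX Γ e a θ _ ih =>
    obtain ⟨d, h1, h2⟩ := ih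
    exact ⟨.boxX d a, TSteps.frame (.boxX .hole a) h1, .boxX θ h2⟩
  | @unboxX Γ e a θ _ ih =>
    obtain ⟨d, h1, h2⟩ := ih
    exact ⟨.unboxX d a, TSteps.frame (.unboxX .hole a) h1, .unboxX θ h2⟩
  | @recordX Γ T n ls es t ts h h' _ ih =>
    choose d h1 h2 using ih
    exact ⟨.recordX T ls d,
      TSteps.frame_pi (F := .recordX T ls) (fun fs j => ⟨.recordX T ls j .hole fs, fun _ => rfl⟩) h1,
      .recordX h h' h2⟩
  | recordClosed h _ ih =>
    obtain ⟨d, h1, h2⟩ := ih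
    obtain ⟨es', rfl, h3⟩ := TSteps.recordX_inv h h1
    exact ⟨_, h3, .recordClosed h h2⟩
  | @fieldX Γ e T l _ _ h _ ih =>
    obtain ⟨d, h1, h2⟩ := ih
    exact ⟨.fieldX d T l, TSteps.frame (.fieldX .hole T l) h1, .fieldX h h2⟩
  | fieldClosed h _ ih =>
    obtain ⟨d, h1, h2⟩ := ih
    obtain ⟨d', rfl, h3⟩ := TSteps.fieldX_inv h h1
    exact ⟨_, h3, .fieldClosed h h2⟩
  | hole t _ ih =>
    choose d h1 h2 using ih
    exact ⟨.hole d, TSteps.frame_pi (F := .hole)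
      (fun fs j => ⟨.typedHole j .hole fs, fun _ => rfl⟩) h1, .hole t h2⟩
  | projI E n h _ ih => obtain ⟨d, h1, h2⟩ := ih; exact ⟨d, h1.head (.projI h _), h2⟩
  | boxI E a h _ ih => obtain ⟨d, h1, h2⟩ := ih; exact ⟨d, h1.head (.boxI h), h2⟩
  | unboxI E a h _ ih => obtain ⟨d, h1, h2⟩ := ih; exact ⟨d, h1.head (.unboxI h), h2⟩
  | recordI E T h _ ih => obtain ⟨d, h1, h2⟩ := ih; exact ⟨d, h1.head (.recordI h _), h2⟩
  | fieldI E T h _ ih => obtain ⟨d, h1, h2⟩ := ih; exact ⟨d, h1.head (.fieldI h _), h2⟩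

theorem Typing.of_steps {Γ : TyCtx S} {e e' : Term S} {t : Ty S}
    (h : Relation.ReflTransGen (TStep L) e e') (h' : RobustTyping L Γ e' (.mono t)) :
    Typing L Γ e (.mono t) := by
  induction h using Relation.ReflTransGen.head_induction_on with
  | refl => exact TypingWith.imp (fun _ _ _ h => h.elim) (fun _ _ _ _ h => h.elim) h'
  | head h _ ih =>
    refine h.elim (P := fun d d' => Typing L Γ d' (.mono t) → Typing L Γ d (.mono t))
      ?_ ?_ ?_ ?_ ?_ ih
    · exact fun E e n j h => .projI E n h
    · exact fun E e a h => .boxI E a h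
    · exact fun E e a h => .unboxI E a h
    · exact fun E n ls es T h => .recordI E T h
    · exact fun E e T l h => .fieldI E T h

/-- The contextual rules conclude with monotypes, so a scheme is first instantiated. -/
theorem typable_iff {e : Term S} : Typable L e ↔
    ∃ e' t, Relation.ReflTransGen (TStep L) e e' ∧ RobustTyping L [] e' (.mono t) :=
  ⟨fun ⟨_, h⟩ => let ⟨e', h1, h2⟩ := h.exists_steps; ⟨e', _, h1, h2.inst_mono Ty.var⟩,
    fun ⟨_, t, h1, h2⟩ => ⟨.mono t, .of_steps h1 h2⟩⟩

theorem canTyping_iff {e : Term S} {t : Ty S} : CanTyping L e t ↔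
    ∃ e', Relation.ReflTransGen (TStep L) e e' ∧ SDTyping L [] e' t := by
  constructor
  · intro h
    induction h with
    | base h => exact ⟨_, .refl, h⟩
    | projI E n h _ ih => obtain ⟨d, h1, h2⟩ := ih; exact ⟨d, h1.head (.projI h _), h2⟩
    | boxI E a h _ ih => obtain ⟨d, h1, h2⟩ := ih; exact ⟨d, h1.head (.boxI h), h2⟩
    | unboxI E a h _ ih => obtain ⟨d, h1, h2⟩ := ih; exact ⟨d, h1.head (.unboxI h), h2⟩
    | recordI E T h _ ih => obtain ⟨d, h1, h2⟩ := ih; exact ⟨d, h1.head (.recordI h _), h2⟩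
    | fieldI E T h _ ih => obtain ⟨d, h1, h2⟩ := ih; exact ⟨d, h1.head (.fieldI h _), h2⟩
  · rintro ⟨e', h, h'⟩
    induction h using Relation.ReflTransGen.head_induction_on with
    | refl => exact .base h'
    | head h _ ih =>
      refine h.elim (P := fun d d' => CanTyping L d' t → CanTyping L d t) ?_ ?_ ?_ ?_ ?_ ih
      · exact fun E e n j h => .projI E n h
      · exact fun E e a h => .boxI E a h
      · exact fun E e a h => .unboxI E a h
      · exact fun E n ls es T h => .recordI E T h
      · exact fun E e T l h => .fieldI E T h

/-! ## Substitutions as constraints -/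

theorem CStep.not_noMatch {c c' : Constr S} (h : CStep L c c') : ¬ NoMatch c := by
  cases h with
  | mk => exact NoMatch.plug_ne

theorem CSteps.eq_of_noMatch {c c' : Constr S} (hc : NoMatch c)
    (h : Relation.ReflTransGen (CStep L) c c') : c' = c := by
  cases h.cases_head with
  | inl h => exact h.symm
  | inr h => obtain ⟨d, h, _⟩ := h; exact (h.not_noMatch hc).elim

theorem sat_iff_of_noMatch {c : Constr S} (hc : NoMatch c) {φ : Env S} :
    Sat L φ c ↔ csem False c φ := by
  refine sat_iff.trans ⟨fun ⟨c', h1, h2⟩ => ?_, fun h => ⟨c, .refl, h⟩⟩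
  rwa [CSteps.eq_of_noMatch hc h1] at h2

/-- A variable of the range is bound under its position in `rng`, so valuations of names and of de
Bruijn indices translate into each other. The default of `getD` is never reached. -/
theorem Substitution.sat_toConstr {θ : Substitution S} {φ : Env S} :
    Sat L φ θ.toConstr ↔ ∃ w : ℕ → Ground S, ∀ a, θ.toFun a ≠ .var a →
      φ.ty a = (θ.toFun a).ev w := by
  have hdom : ∀ a, a ∈ θ.dom ↔ θ.toFun a ≠ .var a := fun a => by simp [dom]
  have hrng : ∀ a ∈ θ.dom, ∀ b ∈ (θ.toFun a).fvs, b ∈ θ.rng := fun a ha b hb =>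
    List.mem_dedup.2 (List.mem_flatMap.2 ⟨a, ha, hb⟩)
  have hev : ∀ (u : ℕ → Ground S) (a), a ∈ θ.dom →
      ((θ.toFun a).subst fun b => .var (θ.rng.idxOf b)).ev (φ.pushN θ.rng.length u).ty =
      (θ.toFun a).ev fun b => u (θ.rng.idxOf b) := by
    intro u a ha
    rw [Ty.ev_subst]
    exact Ty.ev_congr fun b hb => pushN_lt φ u (List.idxOf_lt_length_of_mem (hrng a ha b hb))
  have hvar : ∀ (u : ℕ → Ground S) (a : ℕ),
      (Ty.var (a + θ.rng.length)).ev (φ.pushN θ.rng.length u).ty = φ.ty a := by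
    intro u a
    rw [Ty.ev_var]; simp [Env.pushN]
  rw [toConstr, sat_iff_of_noMatch (NoMatch.exN (NoMatch.conjList fun c hc => by
    obtain ⟨a, _, rfl⟩ := List.mem_map.1 hc; trivial)), csem_exN]
  simp only [csem_conjList, List.forall_mem_map, csem, hvar]
  constructor
  · rintro ⟨u, h⟩
    refine ⟨fun b => u (θ.rng.idxOf b), fun a ha => ?_⟩
    rw [h a ((hdom a).2 ha), hev u a ((hdom a).2 ha)]
  · rintro ⟨w, h⟩
    refine ⟨fun i => w (θ.rng.getD i 0), fun a ha => ?_⟩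
    rw [h a ((hdom a).1 ha), hev _ a ha]
    refine Ty.ev_congr fun b hb => ?_
    have hb' := List.idxOf_lt_length_of_mem (hrng a ha b hb)
    show w b = w (θ.rng.getD (θ.rng.idxOf b) 0)
    rw [List.getD_eq_getElem _ _ hb', List.getElem_idxOf]

/-! ## Soundness and completeness of constraint generation -/

/-- Unicity quantifies over all environments, so it is indifferent to whether a type variable is
free or existentially bound at the root. -/
theorem CStep.ex_inv {c d : Constr S} (h : CStep L (.ex c) d) : ∃ c', d = .ex c' ∧ CStep L c c' := by
  generalize h₀ : Constr.ex c = c₀ at h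
  cases h with
  | mk C t s ps cs h =>
    cases C with
    | ex C =>
      injection h₀ with h₀
      subst h₀
      refine ⟨_, rfl, .mk C t s ps cs ⟨h.1, fun φ g hg => ?_⟩⟩
      refine h.2 ⟨fun a => φ.ty (a + 1), φ.tm⟩ g ?_
      rw [simpleSat_erase_iff] at hg ⊢
      refine ⟨φ.ty 0, ?_⟩
      have : (Env.mk (fun a => φ.ty (a + 1)) φ.tm).pushTy (φ.ty 0) = φ := by
        obtain ⟨f, tm⟩ := φ
        simp only [Env.pushTy, Env.mk.injEq, and_true]
        funext i
        cases i <;> rfl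
      rw [this]
      exact hg
    | _ => cases h₀

theorem CSteps.ex_inv {c d : Constr S} (h : Relation.ReflTransGen (CStep L) (.ex c) d) :
    ∃ c', d = .ex c' ∧ Relation.ReflTransGen (CStep L) c c' := by
  induction h with
  | refl => exact ⟨c, rfl, .refl⟩
  | tail _ h ih =>
    obtain ⟨c₁, rfl, h1⟩ := ih
    obtain ⟨c₂, rfl, h2⟩ := h.ex_inv
    exact ⟨c₂, rfl, h1.tail h2⟩

/-- Inversion is not immediate, since the contextual rule may have been used outside the quantifier;
after passing to steps it is. -/
theorem sat_ex_iff {c : Constr S} {φ : Env S} : Sat L φ (.ex c) ↔ ∃ g, Sat L (φ.pushTy g) c := by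
  refine ⟨fun h => ?_, fun ⟨g, h⟩ => SatWith.ex g h⟩
  obtain ⟨d, h1, h2⟩ := sat_iff.1 h
  obtain ⟨c', rfl, h3⟩ := CSteps.ex_inv h1
  obtain ⟨g, h4⟩ := h2
  exact ⟨g, sat_iff.2 ⟨c', h3, h4⟩⟩

/-- The generated constraint in terms of the elaborations of a closed term. -/
theorem sat_gen_iff {e : Term S} (he : e.Closed) {α : ℕ} {φ : Env S} :
    Sat L φ (gen L e (.var α)) ↔ ∃ a : Tree L, Relation.ReflTransGen (TStep L) e a.term ∧
      Relation.ReflTransGen (CStep L) (gen L e (.var α)) (a.con (.var α)) ∧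
      tsem False L a.term (ctxSem [] fun _ => default) (φ.ty α) := by
  obtain ⟨a, rfl, ha⟩ := Tree.exists_tree (L := L) e
  rw [sat_iff, ← ha]
  constructor
  · rintro ⟨c, h1, h2⟩
    obtain ⟨a', rfl, h3⟩ := a.tSteps_of_cSteps h1 (csem_weaken h2)
    refine ⟨a', h3, h1, tsem_closed ?_ _ _ (a'.sem.1 h2)⟩
    rw [Term.Closed, ← TSteps.fv_eq h3]; exact he
  · rintro ⟨a', h1, h2, h3⟩
    refine ⟨_, h2, a'.sem.2 (tsem_closed ?_ _ _ h3)⟩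
    rw [Term.Closed, ← TSteps.fv_eq h1]; exact he

theorem sat_gen_of_steps {e e' : Term S} (he : e.Closed)
    (h : Relation.ReflTransGen (TStep L) e e') {ρ : ℕ → Set (Ground S)} {α : ℕ} {φ : Env S}
    (h' : tsem False L e' ρ (φ.ty α)) : Sat L φ (gen L e (.var α)) := by
  obtain ⟨a, rfl, ha⟩ := Tree.exists_tree (L := L) e
  obtain ⟨a', rfl, h1⟩ := a.cSteps_of_tSteps h (tsem_weaken h')
  refine (sat_gen_iff he).2 ⟨a', h, ?_, tsem_closed ?_ _ _ h'⟩
  · rw [← ha]; exact h1 α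
  · rw [Term.Closed, ← TSteps.fv_eq h]; exact he

theorem typable_iff_satisfiable {e : Term S} (he : e.Closed) :
    Typable L e ↔ Satisfiable L (.ex (gen L e (.var 0))) := by
  rw [typable_iff]
  constructor
  · rintro ⟨e', t, h1, h2⟩
    refine ⟨⟨fun _ => default, fun _ => ∅⟩, sat_ex_iff.2 ⟨t.ev fun _ => default, ?_⟩⟩
    exact sat_gen_of_steps he h1 (TypingWith.sound h2 _ _ (Scheme.ginst_mono.2 rfl))
  · rintro ⟨φ, h⟩
    obtain ⟨g, h⟩ := sat_ex_iff.1 h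
    obtain ⟨a, h1, _, h2⟩ := (sat_gen_iff he).1 h
    -- The type and the empty context have no variables to name, so a one-point family suffices.
    refine ⟨a.term, g.1, h1, (SDTyping.complete (I := Unit) (A := ∅) (v := fun _ _ => default)
      ⟨by simp, by simp⟩ (by simp) (by rw [g.2]; simp) fun _ => ?_).typingWith⟩
    rw [Ty.ev_ground]
    exact h2

theorem canTyping_iff_isUnifier {e : Term S} (he : e.Closed) (θ : Substitution S) (α : ℕ) :
    CanTyping L e (θ.toFun α) ↔ IsUnifier L θ (gen L e (.var α)) := by
  rw [canTyping_iff]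
  constructor
  · rintro ⟨e', h1, h2⟩ φ hφ
    obtain ⟨w, hw⟩ : ∃ w : ℕ → Ground S, φ.ty α = (θ.toFun α).ev w := by
      -- Outside the domain `∃θ` says nothing about `α`, and its own value serves.
      by_cases hα : θ.toFun α = .var α
      · exact ⟨φ.ty, by rw [hα]; rfl⟩
      · obtain ⟨w, hw⟩ := Substitution.sat_toConstr.1 hφ
        exact ⟨w, hw α hα⟩
    refine sat_gen_of_steps he h1 (ρ := ctxSem [] w) ?_
    rw [hw]
    exact TypingWith.sound h2.typingWith w _ (Scheme.ginst_mono.2 rfl)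
  · intro h
    -- Each ground valuation of the range variables gives a solution of `∃θ`, hence an elaboration,
    -- which may so far depend on the valuation.
    have key : ∀ w : ℕ → Ground S, ∃ a : Tree L, Relation.ReflTransGen (TStep L) e a.term ∧
        Relation.ReflTransGen (CStep L) (gen L e (.var α)) (a.con (.var α)) ∧
        tsem False L a.term (ctxSem [] fun _ => default) ((θ.toFun α).ev w) := fun w =>
      (sat_gen_iff he (φ := ⟨fun a => (θ.toFun a).ev w, fun _ => ∅⟩)).1
        (h _ (Substitution.sat_toConstr.2 ⟨w, fun a _ => rfl⟩))
    choose a h1 h2 h3 using key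
    let w₀ : ℕ → Ground S := fun _ => default
    have csem_of : ∀ w, csem False ((a w).con (.var α)) ⟨fun _ => (θ.toFun α).ev w, ctxSem [] w₀⟩ :=
      fun w => (a w).sem.2 (h3 w)
    -- The index set consists of all valuations, so that each variable names the family of its own
    -- values.
    refine ⟨(a w₀).term, h1 w₀, SDTyping.complete (I := ℕ → Ground S) (v := fun w => w)
      (A := (θ.toFun α).fvs.toFinset) ⟨fun b _ => ?_, fun b _ c _ hbc => ?_⟩ (by simp) (by simp)
      fun w => ?_⟩
    · exact irred_of_surjective fun g => ⟨fun _ => g, rfl⟩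
    · by_contra hne
      have := hbc (Function.update (fun _ => Ground.unit) b
        ((Ty.arr (Ty.var 0) (Ty.var 0)).ev fun _ => Ground.unit))
      rw [Function.update_self, Function.update_of_ne (Ne.symm hne)] at this
      have h4 : PreTy.con .arr _ = PreTy.con .unit _ := congrArg (fun g : Ground S => g.1.1) this
      injection h4 with h4
      cases h4
    -- The elaborated constraint is the same for all valuations. The terms need not be, but `a w₀`
    -- has the meaning of this constraint, hence all the required values.
    · have e := CSteps.unique (h2 w) (csem_of w) (h2 w₀) (csem_of w₀)
      have := csem_of w
      rw [e] at this
      exact tsem_closed (by rw [Term.Closed, ← TSteps.fv_eq (h1 w₀)]; exact he) _ _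
        ((a w₀).sem.1 this)

end OML

theorem mainTheorem2 {S : OML.Sig} (L : OML.LabelEnv S) (e : OML.Term S) (he : e.Closed) :
    (OML.Typable L e ↔ OML.Satisfiable L (.ex (OML.gen L e (.var 0)))) ∧
    ∀ (θ : OML.Substitution S) (α : ℕ),
      OML.CanTyping L e (θ.toFun α) ↔ OML.IsUnifier L θ (OML.gen L e (.var α)) :=
  ⟨OML.typable_iff_satisfiable he, OML.canTyping_iff_isUnifier he⟩

end
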